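/- Let $(M,g)$ be an $n$-dimensional smooth semi-Riemannian manifold with Levi-Civita connection $\nabla$ and curvature $R(X,Y)=[\nabla_X,\nabla_Y]-\nabla_{[X,Y]}$. Let $\gamma:\mathbb R\to M$ be a closed geodesic of period $1$ that admits a smooth $1$-periodic orthonormal frame $\mathbf T=(T_t)_{t\in\mathbb R}$, that is, isomorphisms $T_t:\mathbb R^n\to T_{\gamma(t)}M$, smooth and $1$-periodic in $t$, with $g(T_te_i,T_te_j)=\epsilon_i\delta_{ij}$ and $\epsilon_i\in\{-1,1\}$ independent of $t$ (this is the sense in which $\gamma$ is "orientation preserving"). For $\mathbb K\in\{\mathbb R,\mathbb C\}$ let $G(v,w)=\sum_i\epsilon_iv_i\overline{w_i}$ on $\mathbb K^n$. Let $\Gamma_t$ be the matrix with $\Gamma_te_j=T_t^{-1}\frac{\mathrm D}{\mathrm dt}(T_te_j)$ and let $\overline R_t=T_t^{-1}\circ R(\dot\gamma,\cdot)\dot\gamma\circ T_t$. On the Hilbert space $H^1([0,1],\mathbb K^n)$ with inner product $\langle V,W\rangle=V(0)\cdot W(0)+\int_0^1V'\cdot W'\,dr$, put for $t\in[0,1]$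 $$B_t(V,W)=\int_0^1\Big[G(V',W')+tG(\Gamma_{tr}V,W')+tG(V',\Gamma_{tr}W)+t^2G(\Gamma_{tr}V,\Gamma_{tr}W)+t^2G(\overline R_{tr}V,W)\Big]dr .$$ The spectral flow of a path of Hermitian (or real symmetric) forms represented by a continuous path $(A_t)_{t\in[0,1]}$ of bounded self-adjoint Fredholm operators is understood in the sense of Phillips: it is $\sum_i\big(\operatorname{rank}\chi_{[0,a_i]}(A_{s_{i+1}})-\operatorname{rank}\chi_{[0,a_i]}(A_{s_i})\big)$ for any sufficiently fine subdivision $0=s_0\le\dots\le s_k=1$ and cut-offs $a_i>0$ such that, for all $t\in[s_i,s_{i+1}]$, $\pm a_i$ is not in the spectrum of $A_t$ and $[-a_i,a_i]$ does not meet the essential spectrum of $A_t$. For $z\in\mathbb S^1$ let $\lambda_\gamma(z)$ be the spectral flow of $t\mapsto B_t$ on $\mathcal H_z=\{V\in H^1([0,1],\mathbb C^n):V(1)=zV(0)\}$. The spectral flow $\mathfrak{sf}(\gamma)$ of a closed geodesic is the spectral flow of $t\mapsto B_t$ on the real space $\{V\in H^1([0,1],\mathbb R^n):V(1)=V(0)\}$,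 where $B_t$ is computed in a smooth periodic orthonormal frame along that geodesic. Let $N\ge1$, $\omega=e^{2\pi i/N}$, and let $\gamma^{(N)}(t)=\gamma(Nt)$ be the $N$-th iterate of $\gamma$. Then the spectral flows $\lambda_\gamma(z)$, $z\in\mathbb S^1$, and $\mathfrak{sf}(\gamma^{(N)})$ are well defined integers and $$\mathfrak{sf}\big(\gamma^{(N)}\big)=\sum_{k=0}^{N-1}\lambda_\gamma(\omega^k),$$ whichever smooth periodic orthonormal frames along $\gamma$ and along $\gamma^{(N)}$ are used to compute the right-hand and the left-hand side. -/

import Mathlib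

open scoped Manifold ContDiff
open MeasureTheory

noncomputable section

/-! ### Spectral flow of a path of self-adjoint Fredholm operators / Hermitian forms -/

section SpectralFlow

variable {𝕜 : Type*} [RCLike 𝕜] {H : Type*} [NormedAddCommGroup H] [InnerProductSpace 𝕜 H]

/-- The number of eigenvalues of `A` in `[0, a]`, counted with multiplicity. If `[-a, a]` meets the
spectrum of the self-adjoint operator `A` only in eigenvalues of finite multiplicity,
this is the rank of the spectral projection `χ_[0,a](A)`. -/
def eigenvalueCount (A : H →L[𝕜] H) (a : ℝ) : ℕ :=
  Module.finrank 𝕜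
    (⨆ μ : Set.Icc (0 : ℝ) a, Module.End.eigenspace (A : H →ₗ[𝕜] H) (((μ : ℝ) : 𝕜)) :
      Submodule 𝕜 H)

/-- The interval `[-a, a]` does not meet the essential spectrum of `A`, and its endpoints are not in
the spectrum of `A`. For self-adjoint `A` this says that `χ_[-a,a](A)` has finite rank and
that `χ_[-a,a]` is norm continuous near `A`. -/
def IsSpectralGap (A : H →L[𝕜] H) (a : ℝ) : Prop :=
  IsUnit (A - (a : 𝕜) • ContinuousLinearMap.id 𝕜 H) ∧
  IsUnit (A + (a : 𝕜) • ContinuousLinearMap.id 𝕜 H) ∧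
  ∀ μ ∈ Set.Icc (-a) a, (A - (μ : 𝕜) • ContinuousLinearMap.id 𝕜 H).IsFredholm

/-- `m` is the spectral flow of the operator path `A t`, `t ∈ [0, 1]`, in the sense of Phillips: for
some subdivision `0 = s 0 ≤ ⋯ ≤ s k = 1` and some cut-offs `a i > 0` that are admissible for
`A t` whenever `t ∈ [s i, s (i + 1)]`, one has
`m = ∑ i, (rank χ_[0, a i](A (s (i + 1))) - rank χ_[0, a i](A (s i)))`. -/
def HasOperatorSpectralFlow (A : ℝ → H →L[𝕜] H) (m : ℤ) : Prop :=
  ∃ (k : ℕ) (s : ℕ → ℝ) (a : ℕ → ℝ),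
    s 0 = 0 ∧ s k = 1 ∧
    (∀ i < k, s i ≤ s (i + 1) ∧ 0 < a i ∧
      ∀ t ∈ Set.Icc (s i) (s (i + 1)), IsSpectralGap (A t) (a i)) ∧
    m = ∑ i ∈ Finset.range k,
      ((eigenvalueCount (A (s (i + 1))) (a i) : ℤ) - (eigenvalueCount (A (s i)) (a i) : ℤ))

/-- `m` is the spectral flow of the path of forms `B t`, `t ∈ [0, 1]`, on `H` (linear in the first
argument, conjugate linear in the second one): the forms `B t` are represented, with respect to
the inner product of `H`, by a norm continuous path of bounded self-adjoint Fredholm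
operators with spectral flow `m`. In Mathlib `inner 𝕜 x y` is linear in `y`. -/
def HasSpectralFlow (B : ℝ → H → H → 𝕜) (m : ℤ) : Prop :=
  ∃ A : ℝ → H →L[𝕜] H,
    ContinuousOn A (Set.Icc 0 1) ∧
    (∀ t ∈ Set.Icc (0 : ℝ) 1,
      (∀ V W : H, inner 𝕜 W (A t V) = B t V W) ∧
      (A t : H →ₗ[𝕜] H).IsSymmetric ∧ (A t).IsFredholm) ∧
    HasOperatorSpectralFlow A m

open Classical in
/-- The spectral flow of a path of forms (with the dummy value `0` if there is none). -/
def spectralFlow (B : ℝ → H → H → 𝕜) : ℤ :=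
  if h : ∃ m, HasSpectralFlow B m then h.choose else 0

end SpectralFlow

/-! ### The Sobolev space `H¹([0, 1], 𝕜ⁿ)` -/

section Sobolev

variable (𝕜 : Type*) [RCLike 𝕜] (n : ℕ)

/-- Lebesgue measure on `[0, 1]`. -/
abbrev unitMeasure : Measure ℝ := volume.restrict (Set.Icc 0 1)

/-- The Hilbert space `H¹([0, 1], 𝕜ⁿ)` with the inner product
`⟨V, W⟩ = V(0) · W(0) + ∫₀¹ V'(r) · W'(r) dr`. An `H¹` map is `V(r) = c + ∫₀ʳ f` for a unique pair
`c = V(0) ∈ 𝕜ⁿ`, `f = V' ∈ L²([0, 1], 𝕜ⁿ)`; it is recorded as this pair, and the `L²` direct sum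
of Hilbert spaces carries precisely the above inner product. -/
abbrev SobolevH1 : Type _ :=
  WithLp 2 (EuclideanSpace 𝕜 (Fin n) × Lp (EuclideanSpace 𝕜 (Fin n)) 2 unitMeasure)

variable {𝕜 n}

/-- The (weak) derivative `V'`, an `L²` map on `[0, 1]`. -/
def SobolevH1.deriv (V : SobolevH1 𝕜 n) : Lp (EuclideanSpace 𝕜 (Fin n)) 2 unitMeasure := V.snd

/-- The value `V(r) = V(0) + ∫₀ʳ V'` of the continuous representative at `r ∈ [0, 1]`. -/
def SobolevH1.eval (V : SobolevH1 𝕜 n) (r : ℝ) : EuclideanSpace 𝕜 (Fin n) :=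
  V.fst + ∫ s in (0 : ℝ)..r, V.deriv s ∂unitMeasure

theorem SobolevH1.intervalIntegrable_deriv (V : SobolevH1 𝕜 n) (r : ℝ) :
    IntervalIntegrable V.deriv unitMeasure 0 r :=
  ((Lp.memLp V.deriv).integrable (by norm_num)).intervalIntegrable

theorem SobolevH1.eval_add (V W : SobolevH1 𝕜 n) (r : ℝ) :
    (V + W).eval r = V.eval r + W.eval r := by
  have h : ∫ s in (0 : ℝ)..r, (V + W).deriv s ∂unitMeasure
      = ∫ s in (0 : ℝ)..r, (V.deriv s + W.deriv s) ∂unitMeasure := by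
    refine intervalIntegral.integral_congr_ae ?_
    filter_upwards [Lp.coeFn_add V.deriv W.deriv] with s hs _
    exact hs
  rw [SobolevH1.eval, h, intervalIntegral.integral_add (V.intervalIntegrable_deriv r)
    (W.intervalIntegrable_deriv r)]
  simp only [SobolevH1.eval, WithLp.add_fst]
  abel

theorem SobolevH1.eval_smul (a : 𝕜) (V : SobolevH1 𝕜 n) (r : ℝ) :
    (a • V).eval r = a • V.eval r := by
  have h : ∫ s in (0 : ℝ)..r, (a • V).deriv s ∂unitMeasure
      = ∫ s in (0 : ℝ)..r, a • V.deriv s ∂unitMeasure := by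
    refine intervalIntegral.integral_congr_ae ?_
    filter_upwards [Lp.coeFn_smul a V.deriv] with s hs _
    exact hs
  rw [SobolevH1.eval, h, intervalIntegral.integral_smul]
  simp only [SobolevH1.eval, WithLp.smul_fst, smul_add]

/-- The closed subspace `{V ∈ H¹([0, 1], 𝕜ⁿ) : V(1) = z V(0)}`. -/
def twistedH1 (𝕜 : Type*) [RCLike 𝕜] (n : ℕ) (z : 𝕜) : Submodule 𝕜 (SobolevH1 𝕜 n) where
  carrier := {V | V.eval 1 = z • V.eval 0}
  add_mem' {V W} hV hW := by
    simp only [Set.mem_ofPred_eq] at hV hW ⊢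
    rw [SobolevH1.eval_add, SobolevH1.eval_add, hV, hW, smul_add]
  zero_mem' := by
    have h : ∀ r, (0 : SobolevH1 𝕜 n).eval r = 0 := fun r => by
      have := SobolevH1.eval_smul (0 : 𝕜) (0 : SobolevH1 𝕜 n) r
      rwa [zero_smul, zero_smul] at this
    simp only [Set.mem_ofPred_eq, h, smul_zero]
  smul_mem' a V hV := by
    simp only [Set.mem_ofPred_eq] at hV ⊢
    rw [SobolevH1.eval_smul, SobolevH1.eval_smul, hV, smul_comm]

end Sobolev

/-! ### The path of index forms attached to frame data -/

section IndexForm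

variable {𝕜 : Type*} [RCLike 𝕜] {n : ℕ}

/-- The sesquilinear extension `∑ᵢ εᵢ vᵢ w̄ᵢ` to `𝕜ⁿ` of the form `G = diag(ε)` on `ℝⁿ`. -/
def signForm (ε : Fin n → ℝ) (v w : EuclideanSpace 𝕜 (Fin n)) : 𝕜 :=
  ∑ i, (ε i : 𝕜) * v i * star (w i)

/-- The action of a real matrix on `𝕜ⁿ`. -/
def realMatrixApply (A : Matrix (Fin n) (Fin n) ℝ) (v : EuclideanSpace 𝕜 (Fin n)) :
    EuclideanSpace 𝕜 (Fin n) :=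
  WithLp.toLp 2 (fun i => ∑ j, (A i j : 𝕜) * v j)

/-- The form `B_t(V, W) = ∫₀¹ G(V', W') + t G(Γ_{tr} V, W') + t G(V', Γ_{tr} W)
+ t² G(Γ_{tr} V, Γ_{tr} W) + t² G(R_{tr} V, W) dr` on `H¹([0, 1], 𝕜ⁿ)`. -/
def pathForm (ε : Fin n → ℝ) (Γ R : ℝ → Matrix (Fin n) (Fin n) ℝ) (t : ℝ)
    (V W : SobolevH1 𝕜 n) : 𝕜 :=
  ∫ r in (0 : ℝ)..1,
    (signForm ε (V.deriv r) (W.deriv r)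
      + (t : 𝕜) * signForm ε (realMatrixApply (Γ (t * r)) (V.eval r)) (W.deriv r)
      + (t : 𝕜) * signForm ε (V.deriv r) (realMatrixApply (Γ (t * r)) (W.eval r))
      + (t : 𝕜) ^ 2 * signForm ε (realMatrixApply (Γ (t * r)) (V.eval r))
          (realMatrixApply (Γ (t * r)) (W.eval r))
      + (t : 𝕜) ^ 2 * signForm ε (realMatrixApply (R (t * r)) (V.eval r)) (W.eval r))

end IndexForm

/-! ### Semi-Riemannian geometry -/

section Geometry

/-- A smooth semi-Riemannian metric: a smooth field of nondegenerate symmetric bilinear forms on the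
tangent spaces of the `n`-dimensional manifold `M`. -/
structure SemiRiemannianMetric (n : ℕ) (M : Type*) [TopologicalSpace M]
    [ChartedSpace (EuclideanSpace ℝ (Fin n)) M] [IsManifold (𝓡 n) ∞ M] where
  /-- the bilinear form on the tangent space at `x` -/
  form (x : M) : TangentSpace (𝓡 n) x →L[ℝ] TangentSpace (𝓡 n) x →L[ℝ] ℝ
  symm (x : M) (v w : TangentSpace (𝓡 n) x) : form x v w = form x w v
  nondegenerate (x : M) (v : TangentSpace (𝓡 n) x) : (∀ w, form x v w = 0) → v = 0
  contMDiff : ContMDiff (𝓡 n)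
    ((𝓡 n).prod 𝓘(ℝ, EuclideanSpace ℝ (Fin n) →L[ℝ] EuclideanSpace ℝ (Fin n) →L[ℝ] ℝ)) ∞
    (fun x => Bundle.TotalSpace.mk'
      (EuclideanSpace ℝ (Fin n) →L[ℝ] EuclideanSpace ℝ (Fin n) →L[ℝ] ℝ)
      (E := fun x : M => TangentSpace (𝓡 n) x →L[ℝ] TangentSpace (𝓡 n) x →L[ℝ] ℝ) x (form x))

variable {n : ℕ} {M : Type*} [TopologicalSpace M] [ChartedSpace (EuclideanSpace ℝ (Fin n)) M]
  [IsManifold (𝓡 n) ∞ M]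

/-- The differential at `x` of the preferred chart around `p`. -/
def chartDiff (p x : M) : TangentSpace (𝓡 n) x →L[ℝ] EuclideanSpace ℝ (Fin n) :=
  mfderiv (𝓡 n) 𝓘(ℝ, EuclideanSpace ℝ (Fin n)) (extChartAt (𝓡 n) p) x

/-- The differential at `y` of the inverse of the preferred chart around `p`. -/
def chartSymmDiff (p : M) (y : EuclideanSpace ℝ (Fin n)) :
    EuclideanSpace ℝ (Fin n) →L[ℝ] TangentSpace (𝓡 n) ((extChartAt (𝓡 n) p).symm y) :=
  mfderiv 𝓘(ℝ, EuclideanSpace ℝ (Fin n)) (𝓡 n) (extChartAt (𝓡 n) p).symm y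

namespace SemiRiemannianMetric

variable (g : SemiRiemannianMetric n M)

/-- The metric in the preferred chart around `p`, as a field of bilinear forms on `ℝⁿ`. -/
def inChart (p : M) (y : EuclideanSpace ℝ (Fin n)) :
    EuclideanSpace ℝ (Fin n) →L[ℝ] EuclideanSpace ℝ (Fin n) →L[ℝ] ℝ :=
  (ContinuousLinearMap.precomp ℝ (chartSymmDiff p y)).comp
    ((g.form ((extChartAt (𝓡 n) p).symm y)).comp (chartSymmDiff p y))

/-- The Koszul expression in the chart around `p`, for constant coordinate fields `u, v, w`:
`½ (∂_u g(v, w) + ∂_v g(u, w) - ∂_w g(u, v))`, as a linear form in `w`. -/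
def koszul (p : M) (y u v : EuclideanSpace ℝ (Fin n)) : EuclideanSpace ℝ (Fin n) →L[ℝ] ℝ :=
  (1 / 2 : ℝ) • (fderiv ℝ (g.inChart p) y u v + fderiv ℝ (g.inChart p) y v u
    - ((fderiv ℝ (g.inChart p) y).flip u).flip v)

/-- The Christoffel symbols of the Levi-Civita connection in the chart around `p`:
`christoffel p y u v = ∇_u v` for constant coordinate fields, i.e. the vector with
`g (∇_u v, w) = koszul p y u v w`. -/
def christoffel (p : M) (y u v : EuclideanSpace ℝ (Fin n)) : EuclideanSpace ℝ (Fin n) :=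
  (g.inChart p y).inverse (g.koszul p y u v)

/-- The curvature `R(u, v) w = ∇_u ∇_v w - ∇_v ∇_u w` of constant coordinate fields in the chart
around `p`. -/
def chartCurvature (p : M) (y u v w : EuclideanSpace ℝ (Fin n)) : EuclideanSpace ℝ (Fin n) :=
  fderiv ℝ (fun y' => g.christoffel p y' v w) y u
    - fderiv ℝ (fun y' => g.christoffel p y' u w) y v
    + g.christoffel p y u (g.christoffel p y v w)
    - g.christoffel p y v (g.christoffel p y u w)

/-- The curvature tensor `R(X, Y) = [∇_X, ∇_Y] - ∇_{[X, Y]}` at the point `p`. -/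
def curvature (p : M) (u v w : TangentSpace (𝓡 n) p) : TangentSpace (𝓡 n) p :=
  (chartDiff p p).inverse (g.chartCurvature p (extChartAt (𝓡 n) p p)
    (chartDiff p p u) (chartDiff p p v) (chartDiff p p w))

/-- The velocity of a curve. -/
def _root_.curveVelocity (γ : ℝ → M) (t : ℝ) : TangentSpace (𝓡 n) (γ t) :=
  mfderiv 𝓘(ℝ, ℝ) (𝓡 n) γ t (1 : ℝ)

/-- The covariant derivative `D V / dt` of a vector field along `γ` at time `t`: in the chart around
`γ t`, the field with coordinates `v` along the curve with coordinates `c` has covariant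
derivative `v' + Γ_c(c', v)`. -/
def covDerivAlong (γ : ℝ → M) (V : ∀ t, TangentSpace (𝓡 n) (γ t)) (t : ℝ) :
    TangentSpace (𝓡 n) (γ t) :=
  (chartDiff (γ t) (γ t)).inverse
    (deriv (fun s => chartDiff (γ t) (γ s) (V s)) t
      + g.christoffel (γ t) (extChartAt (𝓡 n) (γ t) (γ t))
          (deriv (fun s => extChartAt (𝓡 n) (γ t) (γ s)) t)
          (chartDiff (γ t) (γ t) (V t)))

/-- `γ` is a closed geodesic of period `1`, extended periodically to the real line. -/
structure IsClosedGeodesic (γ : ℝ → M) : Prop where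
  contMDiff : ContMDiff 𝓘(ℝ, ℝ) (𝓡 n) ∞ γ
  periodic : ∀ t, γ (t + 1) = γ t
  geodesic : ∀ t, g.covDerivAlong γ (curveVelocity γ) t = 0

/-- The `N`-th iterate `t ↦ γ(N t)`. -/
def _root_.iterateCurve (γ : ℝ → M) (N : ℕ) (t : ℝ) : M := γ (N * t)

/-- A smooth periodic orthonormal frame along the closed curve `γ`. -/
structure PeriodicFrame (γ : ℝ → M) where
  /-- the `i`-th vector `T_t e_i` of the frame at time `t` -/
  vec (i : Fin n) (t : ℝ) : TangentSpace (𝓡 n) (γ t)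
  /-- the signs `g(T_t e_i, T_t e_i)` -/
  sign : Fin n → ℝ
  sign_eq : ∀ i, sign i = 1 ∨ sign i = -1
  contMDiff : ∀ i, ContMDiff 𝓘(ℝ, ℝ) (𝓡 n).tangent ∞
    (fun t => (⟨γ t, vec i t⟩ : TangentBundle (𝓡 n) M))
  periodic : ∀ i t, (⟨γ (t + 1), vec i (t + 1)⟩ : TangentBundle (𝓡 n) M) = ⟨γ t, vec i t⟩
  orthonormal : ∀ t i j, g.form (γ t) (vec i t) (vec j t) = if i = j then sign i else 0

namespace PeriodicFrame

variable {g} {γ : ℝ → M} (T : g.PeriodicFrame γ)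

/-- The coordinates `T_t⁻¹ w` of a tangent vector in the orthonormal frame. -/
def coord (t : ℝ) (w : TangentSpace (𝓡 n) (γ t)) (i : Fin n) : ℝ :=
  T.sign i * g.form (γ t) w (T.vec i t)

/-- The matrix of the Christoffel symbol `Γ_t` of the frame: `Γ_t e_j = T_t⁻¹ (D (T e_j) / dt)`. -/
def christoffelMatrix (t : ℝ) : Matrix (Fin n) (Fin n) ℝ :=
  Matrix.of fun i j => T.coord t (g.covDerivAlong γ (T.vec j) t) i

/-- The matrix of `T_t⁻¹ ∘ R(γ', ·)γ' ∘ T_t`. -/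
def curvatureMatrix (t : ℝ) : Matrix (Fin n) (Fin n) ℝ :=
  Matrix.of fun i j =>
    T.coord t (g.curvature (γ t) (curveVelocity γ t) (T.vec j t) (curveVelocity γ t)) i

/-- The path of index forms `B_t` in the frame `T`, restricted to `{V : V(1) = z V(0)}`. -/
def indexForm {𝕜 : Type*} [RCLike 𝕜] (z : 𝕜) (t : ℝ) (V W : twistedH1 𝕜 n z) : 𝕜 :=
  pathForm T.sign T.christoffelMatrix T.curvatureMatrix t (V : SobolevH1 𝕜 n) (W : SobolevH1 𝕜 n)

/-- The spectral flow of the closed geodesic `γ`, computed in the frame `T`: the spectral flow of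
`t ↦ B_t` on the real Hilbert space of periodic maps in `H¹([0, 1], ℝⁿ)`. -/
def geodesicSpectralFlow : ℤ := spectralFlow (T.indexForm (1 : ℝ))

/-- The spectral flow function `λ_γ` on the unit circle, computed in the frame `T`: the spectral
flow of `t ↦ B_t` on `{V ∈ H¹([0, 1], ℂⁿ) : V(1) = z V(0)}`. -/
def spectralFlowFunction (z : Circle) : ℤ := spectralFlow (T.indexForm (z : ℂ))

end PeriodicFrame

end SemiRiemannianMetric

end Geometry

end

/-! The plan is to replace spectral flow by an integer that depends only on the quadratic forms at
the two ends of the path. That integer is additive over direct sums and can be transported by linear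
isomorphisms.

Let `J` be pointwise multiplication by `diag(ε)` on `{V : V(1) = z V(0)}`, with eigenspaces `P`
(eigenvalue 1) and `N` (eigenvalue -1). On maps vanishing on a fine grid, `V` is small compared with
`V'`. The operator of `B_t` is therefore `J` up to a form that is arbitrarily small on suitable
subspaces of finite codimension (`isReflectionModSmall_indexOp`). For such an operator there is a
relative index: the `r` such that the form is nonnegative on a space of relative dimension `r` over
`P` and negative on a space of relative dimension `-r` over `N`. It is unique by a dimension count
(`HasIndex.unique`) and exists by a splitting of the space (`IsDefiniteModFinite.exists_splitting`).
If `a` is an admissible cut-off, the index of `A` exceeds that of `A - a` by the number of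
eigenvalues in `[0, a]`, and the index of `A t - a` is constant on a piece of the subdivision.
Phillips' sum thus telescopes to the index at `t = 1` minus the index at `t = 0`
(`HasOperatorSpectralFlow.eq_index_sub`), which also shows that it does not depend on the choices.

The iteration formula for the index is discrete Fourier analysis. Cutting a periodic map into `N`
pieces and writing `V((s + j) / N) = ∑ₖ ω^{jk} U_k(s)` identifies the complex periodic maps with the
sum of the spaces `{U : U(1) = ω^k U(0)}`. This respects the reflections, and the form of the
`N`-fold data becomes `N²` times the sum of the forms of the `U_k` (`loopIndex_rescale`). The
formula holds for the data of `γ` and also for zero data, which is the end `t = 0`. Real and complex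
periodic maps have the same index, because a complex map is a pair of real ones and real dimensions
are twice complex dimensions (`loopIndex_complexify`).

Frames along `γ` and along its iterate differ by a loop `a` of matrices, which acts by `V ↦ a V`.
This preserves the form but in general moves `P` and `N` to splittings that are not commensurable
with the old ones. The remedy in `IsGaugeLoop.loopIndex_eq` is that the difference of the indices
relative to two splittings is constant along a path. Adding a large multiple of `G(V, W)` to the
form makes both indices zero, so they agree at the start as well.

The geometric input is that the curvature matrix is symmetric for `G`, that the coefficient matrices
are continuous and periodic, and that they obey the transformation law of a gauge change. These
facts are computed in charts, after showing that the chart expressions for curvature and covariant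
derivative do not depend on the chart. -/

open scoped Manifold ContDiff
open MeasureTheory

noncomputable section

/-! ### Relative dimension of subspaces and the relative index of a quadratic function -/

section RelativeIndex

open Module

variable {K V V' : Type*} [Field K] [AddCommGroup V] [Module K V] [AddCommGroup V'] [Module K V']

/-- `E` and `P` agree up to finite dimensional subspaces, and `r = dim E - dim P`. -/
def RelDim (E P : Submodule K V) (r : ℤ) : Prop :=
  ∃ U S T : Submodule K V, FiniteDimensional K S ∧ FiniteDimensional K T ∧
    Disjoint U S ∧ Disjoint U T ∧ U ⊔ S = E ∧ U ⊔ T = P ∧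
    (finrank K S : ℤ) - finrank K T = r

theorem Submodule.finrank_sup_of_disjoint {S T : Submodule K V} [FiniteDimensional K S]
    [FiniteDimensional K T] (h : Disjoint S T) :
    finrank K (S ⊔ T : Submodule K V) = finrank K S + finrank K T := by
  have := Submodule.finrank_sup_add_finrank_inf_eq S T
  rwa [h.eq_bot, finrank_bot, add_zero] at this

theorem RelDim.refl (P : Submodule K V) : RelDim P P 0 :=
  ⟨P, ⊥, ⊥, inferInstance, inferInstance, disjoint_bot_right, disjoint_bot_right,
    sup_bot_eq _, sup_bot_eq _, sub_self _⟩

theorem RelDim.symm {E P : Submodule K V} {r : ℤ} (h : RelDim E P r) : RelDim P E (-r) := by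
  obtain ⟨U, S, T, hS, hT, h1, h2, h3, h4, h5⟩ := h
  exact ⟨U, T, S, hT, hS, h2, h1, h4, h3, by omega⟩

/-- `S ⊕ S'` embeds in the quotient by `U ⊔ W` because `E` and `F` are disjoint, while `T ⊔ T'` maps
onto that quotient because `P ⊔ N = ⊤`. Comparing dimensions gives the inequality. -/
theorem RelDim.add_nonpos {E P F N : Submodule K V} {r s : ℤ} (hE : RelDim E P r)
    (hF : RelDim F N s) (hd : Disjoint E F) (ht : P ⊔ N = ⊤) : r + s ≤ 0 := by
  obtain ⟨U, S, T, hS, hT, h1, h2, rfl, rfl, h5⟩ := hE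
  obtain ⟨W, S', T', hS', hT', k1, k2, rfl, rfl, k5⟩ := hF
  have hSS : Disjoint S S' := hd.mono le_sup_right le_sup_right
  have hdisj : Disjoint (S ⊔ S') (U ⊔ W) := by
    rw [Submodule.disjoint_def]
    intro x hx hx'
    obtain ⟨s, hs, s', hs', rfl⟩ := Submodule.mem_sup.1 hx
    obtain ⟨u, hu, w, hw, huw⟩ := Submodule.mem_sup.1 hx'
    have h0 : s - u = 0 := by
      refine Submodule.disjoint_def.1 hd _ ?_ ?_
      · exact sub_mem (Submodule.mem_sup_right hs) (Submodule.mem_sup_left hu)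
      · have : s - u = w - s' := by
          rw [sub_eq_sub_iff_add_eq_add, ← huw]; abel
        rw [this]
        exact sub_mem (Submodule.mem_sup_left hw) (Submodule.mem_sup_right hs')
    have hs0 : s = 0 := Submodule.disjoint_def.1 h1 s (by rwa [sub_eq_zero.1 h0]) hs
    have hu0 : u = 0 := by rw [← sub_eq_zero.1 h0, hs0]
    have hs'0 : s' = 0 :=
      Submodule.disjoint_def.1 k1 s' (by
        rw [hs0, hu0, zero_add, zero_add] at huw
        exact huw ▸ hw) hs'
    rw [hs0, hs'0, add_zero]
  have hinj : Function.Injective ((U ⊔ W).mkQ.domRestrict (S ⊔ S')) := by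
    rw [← LinearMap.ker_eq_bot, LinearMap.ker_eq_bot']
    rintro ⟨x, hx⟩ h
    have : x ∈ U ⊔ W := by simpa using h
    exact Subtype.ext (Submodule.disjoint_def.1 hdisj x hx this)
  have hsurj : Function.Surjective ((U ⊔ W).mkQ.domRestrict (T ⊔ T')) := by
    intro y
    obtain ⟨y, rfl⟩ := Submodule.mkQ_surjective _ y
    have hy : y ∈ (U ⊔ W) ⊔ (T ⊔ T') := by
      rw [sup_sup_sup_comm, ht]; trivial
    obtain ⟨a, ha, b, hb, rfl⟩ := Submodule.mem_sup.1 hy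
    refine ⟨⟨b, hb⟩, ?_⟩
    simpa [Submodule.Quotient.eq] using ha
  have : FiniteDimensional K (V ⧸ (U ⊔ W)) := FiniteDimensional.of_surjective _ hsurj
  have e1 := LinearMap.finrank_le_finrank_of_injective hinj
  have e2 := LinearMap.finrank_le_finrank_of_surjective hsurj
  have e3 := Submodule.finrank_sup_of_disjoint hSS
  have e4 := Submodule.finrank_add_le_finrank_add_finrank T T'
  omega

theorem RelDim.add_eq_zero {E P F N : Submodule K V} {r s : ℤ} (hE : RelDim E P r)
    (hF : RelDim F N s) (h : IsCompl E F) (ht : IsCompl P N) : r + s = 0 := by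
  have h1 := hE.add_nonpos hF h.disjoint ht.sup_eq_top
  have h2 := hE.symm.add_nonpos hF.symm ht.disjoint h.sup_eq_top
  omega

theorem RelDim.sup {E P S : Submodule K V} {r : ℤ} (hE : RelDim E P r)
    [FiniteDimensional K S] (h : Disjoint E S) : RelDim (E ⊔ S) P (r + finrank K S) := by
  obtain ⟨U, S', T, hS, hT, h1, h2, rfl, h4, h5⟩ := hE
  refine ⟨U, S' ⊔ S, T, inferInstance, hT, ?_, h2, (sup_assoc ..).symm, h4, ?_⟩
  · exact h1.disjoint_sup_right_of_disjoint_sup_left h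
  · rw [Submodule.finrank_sup_of_disjoint (h.mono_left le_sup_right)]
    push_cast; omega

theorem RelDim.map {E P : Submodule K V} {r : ℤ} (hE : RelDim E P r) (e : V ≃ₗ[K] V') :
    RelDim (E.map (e : V →ₗ[K] V')) (P.map (e : V →ₗ[K] V')) r := by
  obtain ⟨U, S, T, hS, hT, h1, h2, rfl, rfl, h5⟩ := hE
  refine ⟨U.map (e : V →ₗ[K] V'), S.map (e : V →ₗ[K] V'), T.map (e : V →ₗ[K] V'), inferInstance,
    inferInstance, ?_, ?_, (Submodule.map_sup ..).symm, (Submodule.map_sup ..).symm, ?_⟩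
  · exact (Submodule.disjoint_map e.injective h1)
  · exact (Submodule.disjoint_map e.injective h2)
  · rw [LinearEquiv.finrank_map_eq, LinearEquiv.finrank_map_eq, h5]

/-- Any subspace cut out of `P` by finitely many linear conditions has finite codimension. -/
theorem exists_relDim_inf_ker {F : Type*} [AddCommGroup F] [Module K F] [FiniteDimensional K F]
    (P : Submodule K V) (f : V →ₗ[K] F) : ∃ r, RelDim (P ⊓ LinearMap.ker f) P r := by
  obtain ⟨T, hT⟩ := Submodule.exists_isCompl ((P ⊓ LinearMap.ker f))
  have hfin : FiniteDimensional K (P ⊓ T : Submodule K V) := by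
    refine FiniteDimensional.of_injective (f.domRestrict (P ⊓ T : Submodule K V)) ?_
    rw [← LinearMap.ker_eq_bot, LinearMap.ker_eq_bot']
    rintro ⟨x, hx⟩ h
    exact Subtype.ext (Submodule.disjoint_def.1 hT.disjoint x ⟨hx.1, h⟩ hx.2)
  refine ⟨_, P ⊓ LinearMap.ker f, ⊥, P ⊓ T, inferInstance, hfin, disjoint_bot_right,
    hT.disjoint.mono_right inf_le_right, sup_bot_eq _, ?_, rfl⟩
  rw [inf_comm P T, ← sup_inf_assoc_of_le T (inf_le_left : P ⊓ LinearMap.ker f ≤ P),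
    hT.sup_eq_top, top_inf_eq]

/-- The quadratic function `q` is nonnegative on a subspace of relative dimension `r` over `P`, and
negative on a subspace of relative dimension `-r` over `N`. -/
def HasIndex (P N : Submodule K V) (q : V → ℝ) (r : ℤ) : Prop :=
  (∃ E, RelDim E P r ∧ ∀ x ∈ E, 0 ≤ q x) ∧ (∃ F, RelDim F N (-r) ∧ ∀ x ∈ F, x ≠ 0 → q x < 0)

/-- A subspace where `q` is nonnegative meets one where `q` is negative only in `0`. Pairing the
nonnegative space of one index with the negative space of the other gives both inequalities. -/
theorem HasIndex.unique {P N : Submodule K V} {q : V → ℝ} {r s : ℤ} (ht : P ⊔ N = ⊤)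
    (hr : HasIndex P N q r) (hs : HasIndex P N q s) : r = s := by
  have key : ∀ {r s : ℤ}, HasIndex P N q r → HasIndex P N q s → r ≤ s := by
    rintro r s ⟨⟨E, hE, hE'⟩, -⟩ ⟨-, F, hF, hF'⟩
    have hd : Disjoint E F := by
      rw [Submodule.disjoint_def]
      intro x hx hx'
      by_contra h0
      exact absurd (hE' x hx) (not_le.2 (hF' x hx' h0))
    have := hE.add_nonpos hF hd ht
    omega
  exact le_antisymm (key hr hs) (key hs hr)

/-- For complementary `E` and `F` the two relative dimensions cancel, so that of `F` need not be
computed. -/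
theorem HasIndex.of_isCompl {P N E F : Submodule K V} {q : V → ℝ} {r s : ℤ} (ht : IsCompl P N)
    (h : IsCompl E F) (hE : RelDim E P r) (hF : RelDim F N s)
    (hE' : ∀ x ∈ E, 0 ≤ q x) (hF' : ∀ x ∈ F, x ≠ 0 → q x < 0) : HasIndex P N q r := by
  have : s = -r := by have := hE.add_eq_zero hF h ht; omega
  exact ⟨⟨E, hE, hE'⟩, ⟨F, this ▸ hF, hF'⟩⟩

theorem HasIndex.congr {P N : Submodule K V} {q q' : V → ℝ} {r : ℤ} (h : HasIndex P N q r)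
    {c : ℝ} (hc : 0 < c) (hq : ∀ x, q' x = c * q x) : HasIndex P N q' r := by
  obtain ⟨⟨E, hE, hE'⟩, ⟨F, hF, hF'⟩⟩ := h
  refine ⟨⟨E, hE, fun x hx => ?_⟩, ⟨F, hF, fun x hx h0 => ?_⟩⟩
  · rw [hq]; exact mul_nonneg hc.le (hE' x hx)
  · rw [hq]; exact mul_neg_of_pos_of_neg hc (hF' x hx h0)

theorem HasIndex.map {P N : Submodule K V} {q : V → ℝ} {q' : V' → ℝ} {r : ℤ}
    (h : HasIndex P N q r) (e : V ≃ₗ[K] V') (hq : ∀ x, q' (e x) = q x) :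
    HasIndex (P.map (e : V →ₗ[K] V')) (N.map (e : V →ₗ[K] V')) q' r := by
  obtain ⟨⟨E, hE, hE'⟩, ⟨F, hF, hF'⟩⟩ := h
  refine ⟨⟨_, hE.map e, ?_⟩, ⟨_, hF.map e, ?_⟩⟩
  · rintro _ ⟨x, hx, rfl⟩
    exact (hq x).symm ▸ hE' x hx
  · rintro _ ⟨x, hx, rfl⟩ h0
    refine (hq x).symm ▸ hF' x hx ?_
    rintro rfl
    exact h0 (map_zero _)

section Pi

variable {ι : Type*} [Fintype ι] {W : ι → Type*} [∀ i, AddCommGroup (W i)] [∀ i, Module K (W i)]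

theorem Submodule.finrank_pi_univ (S : ∀ i, Submodule K (W i)) [∀ i, FiniteDimensional K (S i)] :
    FiniteDimensional K (Submodule.pi Set.univ S) ∧
      finrank K (Submodule.pi Set.univ S) = ∑ i, finrank K (S i) := by
  let e : (Submodule.pi Set.univ S) ≃ₗ[K] (∀ i, S i) :=
    { toFun := fun x i => ⟨x.1 i, x.2 i trivial⟩
      invFun := fun x => ⟨fun i => (x i).1, fun i _ => (x i).2⟩
      map_add' := fun _ _ => rfl
      map_smul' := fun _ _ => rfl
      left_inv := fun _ => rfl
      right_inv := fun _ => rfl }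
  exact ⟨e.symm.finiteDimensional, by rw [e.finrank_eq, finrank_pi_fintype]⟩

theorem RelDim.pi {E P : ∀ i, Submodule K (W i)} {r : ι → ℤ} (h : ∀ i, RelDim (E i) (P i) (r i)) :
    RelDim (Submodule.pi Set.univ E) (Submodule.pi Set.univ P) (∑ i, r i) := by
  choose U S T hS hT h1 h2 h3 h4 h5 using h
  have hsup : ∀ A B : ∀ i, Submodule K (W i), Submodule.pi Set.univ A ⊔ Submodule.pi Set.univ B
      = Submodule.pi Set.univ fun i => A i ⊔ B i := by
    intro A B
    refine le_antisymm (sup_le ?_ ?_) ?_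
    · exact fun x hx i hi => Submodule.mem_sup_left (hx i hi)
    · exact fun x hx i hi => Submodule.mem_sup_right (hx i hi)
    · intro x hx
      choose a ha b hb hab using fun i => Submodule.mem_sup.1 (hx i trivial)
      exact Submodule.mem_sup.2 ⟨a, fun i _ => ha i, b, fun i _ => hb i, funext hab⟩
  have hdis : ∀ A B : ∀ i, Submodule K (W i), (∀ i, Disjoint (A i) (B i)) →
      Disjoint (Submodule.pi Set.univ A) (Submodule.pi Set.univ B) := by
    intro A B h
    rw [Submodule.disjoint_def]
    exact fun x hx hx' => funext fun i =>
      Submodule.disjoint_def.1 (h i) _ (hx i trivial) (hx' i trivial)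
  refine ⟨Submodule.pi Set.univ U, Submodule.pi Set.univ S, Submodule.pi Set.univ T,
    (Submodule.finrank_pi_univ S).1, (Submodule.finrank_pi_univ T).1, hdis _ _ h1, hdis _ _ h2,
    ?_, ?_, ?_⟩
  · rw [hsup]; congr 1; exact funext h3
  · rw [hsup]; congr 1; exact funext h4
  · rw [(Submodule.finrank_pi_univ S).2, (Submodule.finrank_pi_univ T).2]
    push_cast
    rw [← Finset.sum_sub_distrib]
    exact Finset.sum_congr rfl fun i _ => h5 i

theorem HasIndex.pi {P N : ∀ i, Submodule K (W i)} {q : ∀ i, W i → ℝ} {r : ι → ℤ}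
    (h : ∀ i, HasIndex (P i) (N i) (q i) (r i)) (h0 : ∀ i, q i 0 = 0) :
    HasIndex (Submodule.pi Set.univ P) (Submodule.pi Set.univ N) (fun x => ∑ i, q i (x i))
      (∑ i, r i) := by
  choose hE hF using h
  choose E hE hE' using hE
  choose F hF hF' using hF
  refine ⟨⟨_, RelDim.pi hE, fun x hx => Finset.sum_nonneg fun i _ => hE' i _ (hx i trivial)⟩,
    ⟨_, by simpa using RelDim.pi hF, fun x hx hx0 => ?_⟩⟩
  -- One nonzero component makes the sum strictly negative. The zero components contribute `0` by
  -- `h0`, as `q i` is an arbitrary function here.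
  obtain ⟨i, hi⟩ := Function.ne_iff.1 hx0
  refine Finset.sum_neg' (fun j _ => ?_) ⟨i, Finset.mem_univ i, hF' i _ (hx i trivial) hi⟩
  by_cases hj : x j = 0
  · rw [hj, h0]
  · exact (hF' j _ (hx j trivial) hj).le

end Pi

theorem RelDim.restrictScalars {V : Type*} [AddCommGroup V] [Module ℂ V] [Module ℝ V]
    [IsScalarTower ℝ ℂ V] {E P : Submodule ℂ V}
    {r : ℤ} (h : RelDim E P r) :
    RelDim (E.restrictScalars ℝ) (P.restrictScalars ℝ) (2 * r) := by
  obtain ⟨U, S, T, hS, hT, h1, h2, rfl, rfl, h5⟩ := h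
  have hf : ∀ S : Submodule ℂ V, finrank ℝ (S.restrictScalars ℝ) = 2 * finrank ℂ S := fun S => by
    have := Module.finrank_mul_finrank ℝ ℂ (S.restrictScalars ℝ)
    rw [Complex.finrank_real_complex] at this
    exact this.symm
  have hfd : ∀ S : Submodule ℂ V, FiniteDimensional ℂ S →
      FiniteDimensional ℝ (S.restrictScalars ℝ) := fun S hS =>
    by
    have : FiniteDimensional ℂ (S.restrictScalars ℝ) := hS
    exact Module.Finite.trans ℂ (S.restrictScalars ℝ)
  refine ⟨U.restrictScalars ℝ, S.restrictScalars ℝ, T.restrictScalars ℝ, hfd S hS, hfd T hT, ?_,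
    ?_, (Submodule.restrictScalars_sup ..).symm, (Submodule.restrictScalars_sup ..).symm, ?_⟩
  · rw [Submodule.disjoint_def] at h1 ⊢; exact h1
  · rw [Submodule.disjoint_def] at h2 ⊢; exact h2
  · rw [hf, hf]; push_cast; omega

/-- Real dimensions of complex spaces are doubled. This is one half of the comparison of real with
complex periodic maps. -/
theorem HasIndex.restrictScalars {V : Type*} [AddCommGroup V] [Module ℂ V] [Module ℝ V]
    [IsScalarTower ℝ ℂ V] {P N : Submodule ℂ V}
    {q : V → ℝ} {r : ℤ} (h : HasIndex P N q r) :
    HasIndex (P.restrictScalars ℝ) (N.restrictScalars ℝ) q (2 * r) := by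
  obtain ⟨⟨E, hE, hE'⟩, ⟨F, hF, hF'⟩⟩ := h
  exact ⟨⟨_, hE.restrictScalars, hE'⟩, ⟨_, by simpa using hF.restrictScalars, hF'⟩⟩

open Classical in
/-- The index of `q` relative to `P` and `N` (with the dummy value `0` if there is none). -/
def formIndex (P N : Submodule K V) (q : V → ℝ) : ℤ :=
  if h : ∃ r, HasIndex P N q r then h.choose else 0

theorem HasIndex.formIndex_eq {P N : Submodule K V} {q : V → ℝ} {r : ℤ} (h : HasIndex P N q r)
    (ht : P ⊔ N = ⊤) : formIndex P N q = r := by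
  have hex : ∃ r, HasIndex P N q r := ⟨r, h⟩
  rw [formIndex, dif_pos hex]
  exact hex.choose_spec.unique ht h

end RelativeIndex

end

open scoped Manifold ContDiff
open MeasureTheory

noncomputable section

/-! ### Self-adjoint operators that are definite up to finite dimension -/

section Operators

open Module

variable {𝕜 : Type*} [RCLike 𝕜] {H : Type*} [NormedAddCommGroup H] [InnerProductSpace 𝕜 H]

local notation "⟪" x ", " y "⟫" => inner 𝕜 x y

/-- The quadratic form `x ↦ Re ⟪A x, x⟫`. -/
def opForm (A : H →L[𝕜] H) (x : H) : ℝ := RCLike.re ⟪A x, x⟫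

theorem opForm_sub_smul (A : H →L[𝕜] H) (μ : ℝ) (x : H) :
    opForm (A - (μ : 𝕜) • ContinuousLinearMap.id 𝕜 H) x = opForm A x - μ * ‖x‖ ^ 2 := by
  rw [opForm, opForm, sub_apply, inner_sub_left, smul_apply,
    inner_smul_left, RCLike.conj_ofReal, map_sub, RCLike.re_ofReal_mul,
    ContinuousLinearMap.id_apply, inner_self_eq_norm_sq]

theorem opForm_add_smul (A : H →L[𝕜] H) (μ : ℝ) (x : H) :
    opForm (A + (μ : 𝕜) • ContinuousLinearMap.id 𝕜 H) x = opForm A x + μ * ‖x‖ ^ 2 := by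
  rw [opForm, opForm, add_apply, inner_add_left, smul_apply,
    inner_smul_left, RCLike.conj_ofReal, map_add, RCLike.re_ofReal_mul,
    ContinuousLinearMap.id_apply, inner_self_eq_norm_sq]

theorem isSymmetric_sub_smul {A : H →L[𝕜] H} (hA : (A : H →ₗ[𝕜] H).IsSymmetric) (μ : ℝ) :
    ((A - (μ : 𝕜) • ContinuousLinearMap.id 𝕜 H : H →L[𝕜] H) : H →ₗ[𝕜] H).IsSymmetric := by
  intro x y
  have := hA x y
  simp only [ContinuousLinearMap.coe_coe] at this
  simp [inner_sub_left, inner_sub_right, inner_smul_left, inner_smul_right, this]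

theorem add_smul_eq_sub_neg_smul (A : H →L[𝕜] H) (μ : ℝ) :
    A + (μ : 𝕜) • ContinuousLinearMap.id 𝕜 H
      = A - ((-μ : ℝ) : 𝕜) • ContinuousLinearMap.id 𝕜 H := by
  simp

theorem abs_opForm_sub_le (A B : H →L[𝕜] H) (x : H) :
    |opForm A x - opForm B x| ≤ ‖A - B‖ * ‖x‖ ^ 2 := by
  have h : opForm A x - opForm B x = RCLike.re ⟪(A - B) x, x⟫ := by
    simp [opForm, inner_sub_left]
  rw [h]
  refine (RCLike.abs_re_le_norm _).trans ((norm_inner_le_norm _ _).trans ?_)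
  calc ‖(A - B) x‖ * ‖x‖ ≤ (‖A - B‖ * ‖x‖) * ‖x‖ := by gcongr; exact (A - B).le_opNorm x
    _ = _ := by ring

/-- A cross-term identity: `Re ⟪A (u + w), u - w⟫ = q(u) - q(w)` for symmetric `A`. -/
theorem re_inner_map_add_sub {A : H →L[𝕜] H} (hA : (A : H →ₗ[𝕜] H).IsSymmetric) (u w : H) :
    RCLike.re ⟪A (u + w), u - w⟫ = opForm A u - opForm A w := by
  have h : RCLike.re ⟪A w, u⟫ = RCLike.re ⟪A u, w⟫ := by
    have := hA w u
    simp only [ContinuousLinearMap.coe_coe] at this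
    rw [this, ← inner_conj_symm, RCLike.conj_re]
  simp only [opForm, map_add, inner_add_left, inner_sub_right, map_sub]
  rw [h]; ring

theorem disjoint_of_definite {A : H →L[𝕜] H} {c : ℝ} (hc : 0 < c) {E F : Submodule 𝕜 H}
    (hE : ∀ x ∈ E, c * ‖x‖ ^ 2 ≤ opForm A x) (hF : ∀ x ∈ F, opForm A x ≤ -(c * ‖x‖ ^ 2)) :
    Disjoint E F := by
  rw [Submodule.disjoint_def]
  intro x hx hx'
  have h : c * ‖x‖ ^ 2 ≤ 0 := by linarith [hE x hx, hF x hx']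
  have h2 : ‖x‖ ^ 2 ≤ 0 := by
    by_contra h3
    push Not at h3
    exact absurd h (not_le.2 (mul_pos hc h3))
  simpa using le_antisymm h2 (by positivity)

/-- Test `A (u + w)` against `u - w`: the cross terms cancel and both definite parts enter with a
positive sign. -/
theorem norm_le_of_definite {A : H →L[𝕜] H} (hA : (A : H →ₗ[𝕜] H).IsSymmetric) {c : ℝ}
    {u w : H} (hu : c * ‖u‖ ^ 2 ≤ opForm A u)
    (hw : opForm A w ≤ -(c * ‖w‖ ^ 2)) (hc : 0 < c) : c / 2 * ‖u + w‖ ≤ ‖A (u + w)‖ := by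
  have h1 : c * (‖u‖ ^ 2 + ‖w‖ ^ 2) ≤ ‖A (u + w)‖ * (‖u‖ + ‖w‖) := by
    calc c * (‖u‖ ^ 2 + ‖w‖ ^ 2) ≤ RCLike.re ⟪A (u + w), u - w⟫ := by
          rw [re_inner_map_add_sub hA]; linarith
      _ ≤ ‖A (u + w)‖ * ‖u - w‖ := (RCLike.re_le_norm _).trans (norm_inner_le_norm _ _)
      _ ≤ _ := by gcongr; exact norm_sub_le _ _
  have h2 : (‖u‖ + ‖w‖) * (c / 2 * (‖u‖ + ‖w‖)) ≤ (‖u‖ + ‖w‖) * ‖A (u + w)‖ := by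
    nlinarith [mul_nonneg hc.le (sq_nonneg (‖u‖ - ‖w‖))]
  have h3 := norm_add_le u w
  by_cases h0 : ‖u‖ + ‖w‖ = 0
  · have : ‖u + w‖ = 0 := le_antisymm (h3.trans h0.le) (norm_nonneg _)
    rw [this, mul_zero]; exact norm_nonneg _
  · have hpos : 0 < ‖u‖ + ‖w‖ := lt_of_le_of_ne (by positivity) (Ne.symm h0)
    have := le_of_mul_le_mul_left h2 hpos
    exact le_trans (by gcongr) this

theorem finiteDimensional_of_disjoint {K Q T : Submodule 𝕜 H} (h : Disjoint K Q)
    (ht : Q ⊔ T = ⊤) [FiniteDimensional 𝕜 T] : FiniteDimensional 𝕜 K := by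
  have hsurj : Function.Surjective (Q.mkQ.domRestrict T) := by
    intro y
    obtain ⟨y, rfl⟩ := Submodule.mkQ_surjective _ y
    have hy : y ∈ Q ⊔ T := by rw [ht]; trivial
    obtain ⟨a, ha, b, hb, rfl⟩ := Submodule.mem_sup.1 hy
    exact ⟨⟨b, hb⟩, by simpa [Submodule.Quotient.eq] using ha⟩
  have : FiniteDimensional 𝕜 (H ⧸ Q) := FiniteDimensional.of_surjective _ hsurj
  refine FiniteDimensional.of_injective (Q.mkQ.domRestrict K) ?_
  rw [← LinearMap.ker_eq_bot, LinearMap.ker_eq_bot']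
  rintro ⟨x, hx⟩ h'
  exact Subtype.ext (Submodule.disjoint_def.1 h x hx (by simpa using h'))

/-- The part of `P` in a complement of `U` embeds in the image of `T` modulo `U`, hence is finite
dimensional. -/
theorem exists_relDim_of_le_sup {U P T : Submodule 𝕜 H} (hU : U ≤ P) [FiniteDimensional 𝕜 T]
    (hP : P ≤ U ⊔ T) : ∃ r, RelDim U P r := by
  obtain ⟨C, hC⟩ := Submodule.exists_isCompl U
  have hsup : U ⊔ (C ⊓ P) = P := by
    rw [← sup_inf_assoc_of_le C hU, hC.sup_eq_top, top_inf_eq]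
  have hfd : FiniteDimensional 𝕜 (C ⊓ P : Submodule 𝕜 H) := by
    have hle : C ⊓ P ≤ U ⊔ T := inf_le_right.trans hP
    have hfr : FiniteDimensional 𝕜 (T.map U.mkQ) := inferInstance
    refine FiniteDimensional.of_injective
      ((U.mkQ.domRestrict (C ⊓ P)).codRestrict (T.map U.mkQ) ?_) ?_
    · rintro ⟨x, hx⟩
      obtain ⟨a, ha, b, hb, hab⟩ := Submodule.mem_sup.1 (hle hx)
      refine ⟨b, hb, ?_⟩
      simp only [LinearMap.domRestrict_apply]
      rw [← hab, map_add, (Submodule.Quotient.mk_eq_zero U).2 ha |> fun h => (h : U.mkQ a = 0),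
        zero_add]
    · rw [← LinearMap.ker_eq_bot, LinearMap.ker_eq_bot']
      rintro ⟨x, hx⟩ h'
      have : U.mkQ x = 0 := congrArg Subtype.val h'
      refine Subtype.ext (Submodule.disjoint_def.1 hC.disjoint x ?_ hx.1)
      simpa using this
  exact ⟨_, U, ⊥, C ⊓ P, inferInstance, hfd, disjoint_bot_right,
    hC.disjoint.mono_right inf_le_left, sup_bot_eq _, hsup, rfl⟩

theorem exists_le_inf_ker_sup {F : Type*} [AddCommGroup F] [Module 𝕜 F] [FiniteDimensional 𝕜 F]
    (P : Submodule 𝕜 H) (f : H →ₗ[𝕜] F) :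
    ∃ T : Submodule 𝕜 H, FiniteDimensional 𝕜 T ∧ P ≤ (P ⊓ LinearMap.ker f) ⊔ T := by
  obtain ⟨r, U, S, T, hS, hT, -, -, h3, h4, -⟩ := exists_relDim_inf_ker P f
  refine ⟨T, hT, ?_⟩
  rw [← h3]
  conv_lhs => rw [← h4]
  exact sup_le_sup_right le_sup_left _

/-- A symmetric operator on a finite dimensional space splits it into a positive and a negative
part and the kernel. -/
theorem LinearMap.IsSymmetric.exists_sign_decomposition {S : Type*} [NormedAddCommGroup S]
    [InnerProductSpace 𝕜 S] [FiniteDimensional 𝕜 S] {T : S →ₗ[𝕜] S} (hT : T.IsSymmetric) :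
    ∃ c > 0, ∃ Sp Sm : Submodule 𝕜 S, (∀ x ∈ Sp, c * ‖x‖ ^ 2 ≤ RCLike.re ⟪T x, x⟫) ∧
      (∀ x ∈ Sm, RCLike.re ⟪T x, x⟫ ≤ -(c * ‖x‖ ^ 2)) ∧
      (∀ x ∈ Sp, ∀ y, T y = 0 → ⟪x, y⟫ = 0) ∧ (∀ x ∈ Sm, ∀ y, T y = 0 → ⟪x, y⟫ = 0) ∧
      Sp ⊔ Sm ⊔ LinearMap.ker T = ⊤ := by
  set b := hT.eigenvectorBasis (rfl : finrank 𝕜 S = finrank 𝕜 S) with hb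
  set l := hT.eigenvalues (rfl : finrank 𝕜 S = finrank 𝕜 S) with hl
  have hTb : ∀ x i, b.repr (T x) i = l i * b.repr x i := fun x i =>
    hT.eigenvectorBasis_apply_self_apply _ x i
  have hq : ∀ x, RCLike.re ⟪T x, x⟫ = ∑ i, l i * ‖b.repr x i‖ ^ 2 := by
    intro x
    rw [← b.repr.inner_map_map, PiLp.inner_apply, map_sum]
    refine Finset.sum_congr rfl fun i _ => ?_
    rw [hTb, ← smul_eq_mul, inner_smul_left, RCLike.conj_ofReal, RCLike.re_ofReal_mul,
      inner_self_eq_norm_sq]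
  have hn : ∀ x, ‖x‖ ^ 2 = ∑ i, ‖b.repr x i‖ ^ 2 := by
    intro x
    rw [← b.repr.norm_map, EuclideanSpace.norm_sq_eq]
  obtain ⟨c, hc, hcl⟩ : ∃ c > 0, ∀ i, l i ≠ 0 → c ≤ |l i| := by
    by_cases hne : (Finset.univ.filter fun i => l i ≠ 0).Nonempty
    · obtain ⟨i, hi, hmin⟩ := Finset.exists_min_image _ (fun i => |l i|) hne
      exact ⟨|l i|, abs_pos.2 (Finset.mem_filter.1 hi).2, fun j hj =>
        hmin j (Finset.mem_filter.2 ⟨Finset.mem_univ _, hj⟩)⟩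
    · refine ⟨1, one_pos, fun i hi => absurd ⟨i, ?_⟩ hne⟩
      exact Finset.mem_filter.2 ⟨Finset.mem_univ _, hi⟩
  have hker : ∀ y, T y = 0 → ∀ i, l i ≠ 0 → b.repr y i = 0 := by
    intro y hy i hi
    have := hTb y i
    rw [hy, map_zero] at this
    exact (mul_eq_zero.1 this.symm).resolve_left (by exact_mod_cast hi)
  let sub : (Fin (finrank 𝕜 S) → Prop) → Submodule 𝕜 S := fun p =>
    { carrier := {x | ∀ i, ¬ p i → b.repr x i = 0}
      add_mem' := fun {x y} hx hy i hi => by simp [hx i hi, hy i hi]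
      zero_mem' := fun i _ => by simp
      smul_mem' := fun a x hx i hi => by simp [hx i hi] }
  have horth : ∀ p : Fin (finrank 𝕜 S) → Prop, (∀ i, p i → l i ≠ 0) → ∀ x ∈ sub p,
      ∀ y, T y = 0 → ⟪x, y⟫ = 0 := by
    intro p hp x hx y hy
    rw [← b.repr.inner_map_map, PiLp.inner_apply]
    refine Finset.sum_eq_zero fun i _ => ?_
    by_cases hi : p i
    · rw [hker y hy i (hp i hi), inner_zero_right]
    · rw [hx i hi, inner_zero_left]
  refine ⟨c, hc, sub fun i => 0 < l i, sub fun i => l i < 0, ?_, ?_,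
    horth _ fun i hi => hi.ne', horth _ fun i hi => hi.ne, ?_⟩
  · intro x hx
    rw [hq, hn, Finset.mul_sum]
    refine Finset.sum_le_sum fun i _ => ?_
    by_cases hi : 0 < l i
    · gcongr; rw [← abs_of_pos hi]; exact hcl i hi.ne'
    · rw [hx i hi]; simp
  · intro x hx
    rw [hq, hn, Finset.mul_sum, ← Finset.sum_neg_distrib]
    refine Finset.sum_le_sum fun i _ => ?_
    by_cases hi : l i < 0
    · rw [← neg_mul]; gcongr; have := hcl i hi.ne; rw [abs_of_neg hi] at this; linarith
    · rw [hx i hi]; simp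
  · classical
    rw [eq_top_iff]
    intro x _
    let part : (Fin (finrank 𝕜 S) → Prop) → S := fun p =>
      b.repr.symm (WithLp.toLp 2 fun i => if p i then b.repr x i else 0)
    have hpart : ∀ p i, b.repr (part p) i = if p i then b.repr x i else 0 := by
      intro p i; simp [part]
    have hx : part (fun i => 0 < l i) + part (fun i => l i < 0) + part (fun i => l i = 0) = x := by
      apply b.repr.injective
      ext i
      simp only [map_add, PiLp.add_apply, hpart]
      rcases lt_trichotomy (l i) 0 with h | h | h
      · simp [h, h.ne, h.le.not_gt]
      · simp [h]
      · simp [h, h.ne', h.le.not_gt]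
    rw [← hx]
    refine add_mem (Submodule.mem_sup_left (add_mem (Submodule.mem_sup_left ?_)
      (Submodule.mem_sup_right ?_))) (Submodule.mem_sup_right ?_)
    · intro i hi; rw [hpart, if_neg hi]
    · intro i hi; rw [hpart, if_neg hi]
    · rw [LinearMap.mem_ker]
      apply b.repr.injective
      ext i
      rw [hTb, hpart, map_zero]
      split_ifs with h <;> simp [h]

variable [CompleteSpace H]

/-- `A` is bounded below by `norm_le_of_definite`. Since `⟪A² x, x⟫ = ‖A x‖²`, the square `A²` is
coercive, hence invertible, and so is `A`. -/
theorem isUnit_of_definite {A : H →L[𝕜] H} (hA : (A : H →ₗ[𝕜] H).IsSymmetric) {c : ℝ}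
    (hc : 0 < c) {E F : Submodule 𝕜 H} (hE : ∀ x ∈ E, c * ‖x‖ ^ 2 ≤ opForm A x)
    (hF : ∀ x ∈ F, opForm A x ≤ -(c * ‖x‖ ^ 2)) (ht : E ⊔ F = ⊤) : IsUnit A := by
  have hbd : ∀ x, c / 2 * ‖x‖ ≤ ‖A x‖ := by
    intro x
    have hx : x ∈ E ⊔ F := by rw [ht]; trivial
    obtain ⟨u, hu, w, hw, rfl⟩ := Submodule.mem_sup.1 hx
    exact norm_le_of_definite hA (hE u hu) (hF w hw) hc
  have h2 : IsUnit (A * A) := by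
    refine ContinuousLinearMap.isUnit_of_forall_le_norm_inner_map (𝕜 := 𝕜) (A * A)
      (c := ⟨(c / 2) ^ 2, by positivity⟩) (by exact pow_pos (half_pos hc) 2) fun x => ?_
    have h3 : ⟪(A * A) x, x⟫ = ⟪A x, A x⟫ := hA (A x) x
    rw [h3, inner_self_eq_norm_sq_to_K, norm_pow, RCLike.norm_ofReal, abs_norm]
    have : (c / 2 * ‖x‖) ^ 2 ≤ ‖A x‖ ^ 2 := pow_le_pow_left₀ (by positivity) (hbd x) 2
    calc ‖x‖ ^ 2 * (c / 2) ^ 2 = (c / 2 * ‖x‖) ^ 2 := by ring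
      _ ≤ _ := this
  rw [← pow_two] at h2
  exact (isUnit_pow_iff two_ne_zero).1 h2

/-- If `A` is definite of opposite signs on the closed subspaces `U` and `W`, then every vector has
a component in `U + W` along the `A`-orthogonal complement of `U + W`. -/
theorem exists_sub_orthogonal {A : H →L[𝕜] H} (hA : (A : H →ₗ[𝕜] H).IsSymmetric) {c : ℝ}
    (hc : 0 < c) {U W : Submodule 𝕜 H} (hUc : IsClosed (U : Set H)) (hWc : IsClosed (W : Set H))
    (hU : ∀ x ∈ U, c * ‖x‖ ^ 2 ≤ opForm A x) (hW : ∀ x ∈ W, opForm A x ≤ -(c * ‖x‖ ^ 2)) (x : H) :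
    ∃ u ∈ U, ∃ w ∈ W, A (x - (u + w)) ∈ (U ⊔ W)ᗮ := by
  have : CompleteSpace U := hUc.completeSpace_coe
  have : CompleteSpace W := hWc.completeSpace_coe
  let e := WithLp.prodContinuousLinearEquiv 2 𝕜 U W
  let i : WithLp 2 (U × W) →L[𝕜] H :=
    (U.subtypeL.coprod W.subtypeL) ∘L (e : WithLp 2 (U × W) →L[𝕜] U × W)
  let j : WithLp 2 (U × W) →L[𝕜] H :=
    (U.subtypeL.coprod (-W.subtypeL)) ∘L (e : WithLp 2 (U × W) →L[𝕜] U × W)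
  have hi : ∀ p, i p = (p.fst : H) + p.snd := fun p => rfl
  have hj : ∀ p, j p = (p.fst : H) - p.snd := fun p => by
    rw [sub_eq_add_neg]; rfl
  -- Although `A` is indefinite on `U + W`, the twisted form `⟪A (u + w), u' - w'⟫` is coercive on
  -- `U × W`, so every functional of the form `⟪A x, u' - w'⟫` is represented by some `u + w`.
  have hunit : IsUnit ((ContinuousLinearMap.adjoint j) ∘L A ∘L i) := by
    refine ContinuousLinearMap.isUnit_of_forall_le_norm_inner_map (𝕜 := 𝕜) _
      (c := ⟨c, hc.le⟩) hc fun p => ?_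
    have h1 : inner 𝕜 (((ContinuousLinearMap.adjoint j) ∘L A ∘L i) p) p = ⟪A (i p), j p⟫ := by
      simp [ContinuousLinearMap.adjoint_inner_left]
    rw [h1]
    refine le_trans ?_ (RCLike.re_le_norm _)
    rw [hi, hj, re_inner_map_add_sub hA, WithLp.prod_norm_sq_eq_of_L2]
    have := hU p.fst p.fst.2
    have := hW p.snd p.snd.2
    change (‖(p.fst : H)‖ ^ 2 + ‖(p.snd : H)‖ ^ 2) * c ≤ _
    linarith
  obtain ⟨p, hp⟩ := (ContinuousLinearMap.isUnit_iff_bijective.1 hunit).2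
    ((ContinuousLinearMap.adjoint j) (A x))
  refine ⟨p.fst, p.fst.2, p.snd, p.snd.2, ?_⟩
  have h0 : ∀ p', ⟪j p', A (x - i p)⟫ = 0 := by
    intro p'
    rw [← ContinuousLinearMap.adjoint_inner_right, map_sub, map_sub, ← hp]
    simp
  rw [Submodule.mem_orthogonal]
  intro y hy
  obtain ⟨u, hu, w, hw, rfl⟩ := Submodule.mem_sup.1 hy
  -- The sign in the second entry turns the test vector `u - w` into `u + w`.
  have := h0 (WithLp.toLp 2 (⟨u, hu⟩, -⟨w, hw⟩))
  rw [hj] at this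
  simpa [hi] using this

/-- `A` is symmetric, and definite up to finite codimension: positive on `P`, negative on `N`. -/
structure IsDefiniteModFinite (P N : Submodule 𝕜 H) (A : H →L[𝕜] H) : Prop where
  symm : (A : H →ₗ[𝕜] H).IsSymmetric
  exists_definite : ∃ c > 0, ∃ U W : Submodule 𝕜 H, IsClosed (U : Set H) ∧ IsClosed (W : Set H) ∧
    U ≤ P ∧ W ≤ N ∧ (∃ T : Submodule 𝕜 H, FiniteDimensional 𝕜 T ∧ P ≤ U ⊔ T) ∧
    (∃ T : Submodule 𝕜 H, FiniteDimensional 𝕜 T ∧ N ≤ W ⊔ T) ∧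
    (∀ x ∈ U, c * ‖x‖ ^ 2 ≤ opForm A x) ∧ (∀ x ∈ W, opForm A x ≤ -(c * ‖x‖ ^ 2))

variable {P N : Submodule 𝕜 H}

/-- The decomposition behind all index computations. Shrink `U` and `W` to be orthogonal to the
kernel. The `A`-orthogonal complement `S` of their sum is then finite dimensional and complementary
to it. Diagonalizing the compression of `A` to `S` distributes `S` into a positive part, a negative
part and `ker A`; the first two are added to the shrunken spaces, which changes them only by finite
dimensions. -/
theorem IsDefiniteModFinite.exists_splitting {A : H →L[𝕜] H} (hA : IsDefiniteModFinite P N A)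
    (hPN : IsCompl P N) :
    FiniteDimensional 𝕜 (LinearMap.ker (A : H →ₗ[𝕜] H)) ∧
    ∃ c > 0, ∃ E F : Submodule 𝕜 H, (∃ r, RelDim E P r) ∧ (∃ s, RelDim F N s) ∧
      (∀ x ∈ E, c * ‖x‖ ^ 2 ≤ opForm A x) ∧ (∀ x ∈ F, opForm A x ≤ -(c * ‖x‖ ^ 2)) ∧
      (∀ x ∈ E, ∀ y, A y = 0 → ⟪x, y⟫ = 0) ∧ (∀ x ∈ F, ∀ y, A y = 0 → ⟪x, y⟫ = 0) ∧
      E ⊔ F ⊔ LinearMap.ker (A : H →ₗ[𝕜] H) = ⊤ := by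
  obtain ⟨hs, c, hc, U, W, hUc, hWc, hUP, hWN, ⟨T, hT, hPT⟩, ⟨T', hT', hNT⟩, hU, hW⟩ := hA
  set K := LinearMap.ker (A : H →ₗ[𝕜] H) with hK
  have htop : ∀ {U W T T' : Submodule 𝕜 H}, P ≤ U ⊔ T → N ≤ W ⊔ T' → (U ⊔ W) ⊔ (T ⊔ T') = ⊤ := by
    intro U W T T' h1 h2
    rw [eq_top_iff, ← hPN.sup_eq_top, sup_sup_sup_comm]
    exact sup_le_sup h1 h2
  -- If `A (u + w)` is orthogonal to `U ⊔ W`, pairing it with `u - w` gives `opForm A u = opForm A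
  -- w`. The left side is at least `c ‖u‖²` and the right side at most `-c ‖w‖²`, so both vectors
  -- vanish.
  have hdisj : ∀ {U W S : Submodule 𝕜 H}, (∀ x ∈ U, c * ‖x‖ ^ 2 ≤ opForm A x) →
      (∀ x ∈ W, opForm A x ≤ -(c * ‖x‖ ^ 2)) → (∀ x ∈ S, A x ∈ (U ⊔ W)ᗮ) →
      Disjoint S (U ⊔ W) := by
    intro U W S hU hW hS
    rw [Submodule.disjoint_def]
    intro x hx hx'
    obtain ⟨u, hu, w, hw, rfl⟩ := Submodule.mem_sup.1 hx'
    have h0 : ⟪A (u + w), u - w⟫ = 0 := (Submodule.mem_orthogonal' _ _).1 (hS _ hx) _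
      (sub_mem (Submodule.mem_sup_left hu) (Submodule.mem_sup_right hw))
    have h1 := re_inner_map_add_sub hs u w
    rw [h0, map_zero] at h1
    have h2 := hU u hu
    have h3 := hW w hw
    have hn : ∀ v : H, c * ‖v‖ ^ 2 ≤ 0 → v = 0 := by
      intro v hv
      have : ‖v‖ ^ 2 ≤ 0 := by
        by_contra h
        push Not at h
        exact absurd hv (not_le.2 (mul_pos hc h))
      simpa using le_antisymm this (by positivity)
    have hp1 : 0 ≤ c * ‖u‖ ^ 2 := by positivity
    have hp2 : 0 ≤ c * ‖w‖ ^ 2 := by positivity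
    rw [hn u (by linarith), hn w (by linarith), add_zero]
  have hKd : Disjoint K (U ⊔ W) := hdisj hU hW fun x hx => by
    have : A x = 0 := hx
    rw [this]; exact zero_mem _
  have hKfd : FiniteDimensional 𝕜 K := finiteDimensional_of_disjoint hKd (htop hPT hNT)
  refine ⟨hKfd, ?_⟩
  -- The kernel is now known to be finite dimensional, so passing to its orthogonal complement costs
  -- only finite codimension in `U` and `W`.
  obtain ⟨T₁, hT₁, hUT⟩ := exists_le_inf_ker_sup U (K.orthogonalProjectionOnto : H →ₗ[𝕜] K)
  obtain ⟨T₂, hT₂, hWT⟩ := exists_le_inf_ker_sup W (K.orthogonalProjectionOnto : H →ₗ[𝕜] K)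
  have hkerK : ∀ x, x ∈ LinearMap.ker (K.orthogonalProjectionOnto : H →ₗ[𝕜] K) ↔ x ∈ Kᗮ := fun x =>
    K.orthogonalProjectionOnto_eq_zero_iff
  have hkc : IsClosed (LinearMap.ker (K.orthogonalProjectionOnto : H →ₗ[𝕜] K) : Set H) :=
    K.orthogonalProjectionOnto.isClosed_ker
  set U₁ := U ⊓ LinearMap.ker (K.orthogonalProjectionOnto : H →ₗ[𝕜] K) with hU₁
  set W₁ := W ⊓ LinearMap.ker (K.orthogonalProjectionOnto : H →ₗ[𝕜] K) with hW₁
  have hPT₁ : P ≤ U₁ ⊔ (T₁ ⊔ T) := hPT.trans (by rw [← sup_assoc]; exact sup_le_sup_right hUT _)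
  have hNT₁ : N ≤ W₁ ⊔ (T₂ ⊔ T') := hNT.trans (by rw [← sup_assoc]; exact sup_le_sup_right hWT _)
  have hU' : ∀ x ∈ U₁, c * ‖x‖ ^ 2 ≤ opForm A x := fun x hx => hU x hx.1
  have hW' : ∀ x ∈ W₁, opForm A x ≤ -(c * ‖x‖ ^ 2) := fun x hx => hW x hx.1
  have hU₁K : ∀ x ∈ U₁, ∀ y, A y = 0 → ⟪x, y⟫ = 0 := fun x hx y hy =>
    (Submodule.mem_orthogonal' _ _).1 ((hkerK x).1 hx.2) y hy
  have hW₁K : ∀ x ∈ W₁, ∀ y, A y = 0 → ⟪x, y⟫ = 0 := fun x hx y hy =>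
    (Submodule.mem_orthogonal' _ _).1 ((hkerK x).1 hx.2) y hy
  let S : Submodule 𝕜 H := ((U₁ ⊔ W₁)ᗮ).comap (A : H →ₗ[𝕜] H)
  have hS : ∀ x ∈ S, A x ∈ (U₁ ⊔ W₁)ᗮ := fun x hx => hx
  have hSd : Disjoint S (U₁ ⊔ W₁) := hdisj hU' hW' hS
  have hSfd : FiniteDimensional 𝕜 S := finiteDimensional_of_disjoint hSd (htop hPT₁ hNT₁)
  have hStop : ∀ x, ∃ u ∈ U₁, ∃ w ∈ W₁, ∃ s ∈ S, u + w + s = x := by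
    intro x
    obtain ⟨u, hu, w, hw, h⟩ := exists_sub_orthogonal hs hc (hUc.inter hkc) (hWc.inter hkc) hU' hW' x
    exact ⟨u, hu, w, hw, _, h, by abel⟩
  let AS : S →ₗ[𝕜] S := (S.orthogonalProjectionOnto : H →ₗ[𝕜] S) ∘ₗ (A : H →ₗ[𝕜] H) ∘ₗ S.subtype
  have hAS : ∀ x y : S, inner 𝕜 (AS x) y = ⟪A x, (y : H)⟫ := fun x y =>
    S.inner_orthogonalProjectionOnto_eq_of_mem_right y (A x)
  have hAS' : AS.IsSymmetric := by
    intro x y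
    rw [hAS, ← inner_conj_symm x (AS y), hAS, inner_conj_symm]
    exact hs x y
  obtain ⟨c', hc', Sp, Sm, hp, hm, hpk, hmk, hsup⟩ := hAS'.exists_sign_decomposition
  -- The kernel of the compression is no larger than that of `A`: a vector `A x` orthogonal to `S`
  -- is also orthogonal to `U₁ ⊔ W₁`, and together these span the space.
  have hASker : ∀ x : S, AS x = 0 ↔ A x = 0 := by
    intro x
    constructor
    · intro h
      have h1 : A (x : H) ∈ Sᗮ := S.orthogonalProjectionOnto_eq_zero_iff.1 h
      have h2 := hS x x.2
      rw [← inner_self_eq_zero (𝕜 := 𝕜)]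
      obtain ⟨u, hu, w, hw, s, hs, h3⟩ := hStop (A (x : H))
      conv_lhs => arg 2; rw [← h3]
      rw [inner_add_left, (Submodule.mem_orthogonal _ _).1 h1 s hs,
        (Submodule.mem_orthogonal _ _).1 h2 (u + w)
          (add_mem (Submodule.mem_sup_left hu) (Submodule.mem_sup_right hw)), add_zero]
    · intro h
      change S.orthogonalProjectionOnto (A (x : H)) = 0
      rw [h, map_zero]
  have hq : ∀ x : S, opForm A x = RCLike.re (inner 𝕜 (AS x) x) := fun x => by
    rw [hAS, opForm]
  have hcross : ∀ s ∈ S, ∀ y ∈ U₁ ⊔ W₁, opForm A (y + s) = opForm A y + opForm A s := by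
    intro s hs' y hy
    have h1 : ⟪A s, y⟫ = 0 := (Submodule.mem_orthogonal' _ _).1 (hS s hs') y hy
    have h2 : ⟪A y, s⟫ = 0 := by
      have : ⟪A y, s⟫ = ⟪y, A s⟫ := hs y s
      rw [this, ← inner_conj_symm, h1, map_zero]
    simp [opForm, inner_add_left, inner_add_right, h1, h2]
  have hmin : 0 < min c c' / 2 := half_pos (lt_min hc hc')
  -- The factor `1 / 2` in the constant compensates `‖u + s‖² ≤ 2 (‖u‖² + ‖s‖²)`, as `u` and `s`
  -- need not be orthogonal for the inner product.
  have hnorm : ∀ u s : H, min c c' / 2 * ‖u + s‖ ^ 2 ≤ c * ‖u‖ ^ 2 + c' * ‖s‖ ^ 2 := by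
    intro u s
    have h1 : ‖u + s‖ ^ 2 ≤ 2 * (‖u‖ ^ 2 + ‖s‖ ^ 2) := by
      have h2 : ‖u + s‖ ^ 2 ≤ (‖u‖ + ‖s‖) ^ 2 := by gcongr; exact norm_add_le _ _
      nlinarith [sq_nonneg (‖u‖ - ‖s‖)]
    calc min c c' / 2 * ‖u + s‖ ^ 2 ≤ min c c' / 2 * (2 * (‖u‖ ^ 2 + ‖s‖ ^ 2)) := by gcongr
      _ = min c c' * ‖u‖ ^ 2 + min c c' * ‖s‖ ^ 2 := by ring
      _ ≤ _ := by gcongr; exacts [min_le_left _ _, min_le_right _ _]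
  have hmapS : ∀ S' : Submodule 𝕜 S, S'.map S.subtype ≤ S := fun S' => Submodule.map_subtype_le _ _
  obtain ⟨r, hr⟩ := exists_relDim_of_le_sup (inf_le_left.trans hUP) hPT₁
  obtain ⟨r', hr'⟩ := exists_relDim_of_le_sup (inf_le_left.trans hWN) hNT₁
  refine ⟨min c c' / 2, hmin, U₁ ⊔ Sp.map S.subtype, W₁ ⊔ Sm.map S.subtype,
    ⟨_, hr.sup (hSd.symm.mono le_sup_left (hmapS _))⟩,
    ⟨_, hr'.sup (hSd.symm.mono le_sup_right (hmapS _))⟩, ?_, ?_, ?_, ?_, ?_⟩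
  · intro x hx
    obtain ⟨u, hu, _, ⟨s, hs', rfl⟩, rfl⟩ := Submodule.mem_sup.1 hx
    rw [Submodule.subtype_apply, hcross s s.2 u (Submodule.mem_sup_left hu)]
    refine (hnorm u s).trans (add_le_add (hU' u hu) ?_)
    rw [hq]; exact hp s hs'
  · intro x hx
    obtain ⟨u, hu, _, ⟨s, hs', rfl⟩, rfl⟩ := Submodule.mem_sup.1 hx
    rw [Submodule.subtype_apply, hcross s s.2 u (Submodule.mem_sup_right hu)]
    have h1 := hm s hs'
    rw [← hq] at h1
    have h2 := hW' u hu
    have h3 := hnorm u s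
    have h4 : ‖s‖ = ‖(s : H)‖ := rfl
    rw [h4] at h1
    linarith
  · intro x hx y hy
    obtain ⟨u, hu, _, ⟨s, hs', rfl⟩, rfl⟩ := Submodule.mem_sup.1 hx
    have hyS : y ∈ S := by change A y ∈ (U₁ ⊔ W₁)ᗮ; rw [hy]; exact zero_mem _
    have h1 := hpk s hs' ⟨y, hyS⟩ ((hASker _).2 hy)
    rw [inner_add_left, hU₁K u hu y hy, zero_add]
    exact h1
  · intro x hx y hy
    obtain ⟨u, hu, _, ⟨s, hs', rfl⟩, rfl⟩ := Submodule.mem_sup.1 hx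
    have hyS : y ∈ S := by change A y ∈ (U₁ ⊔ W₁)ᗮ; rw [hy]; exact zero_mem _
    have h1 := hmk s hs' ⟨y, hyS⟩ ((hASker _).2 hy)
    rw [inner_add_left, hW₁K u hu y hy, zero_add]
    exact h1
  · rw [eq_top_iff]
    intro x _
    obtain ⟨u, hu, w, hw, s, hs', rfl⟩ := hStop x
    have : (⟨s, hs'⟩ : S) ∈ Sp ⊔ Sm ⊔ LinearMap.ker AS := by rw [hsup]; trivial
    obtain ⟨y, hy, k, hk, hyk⟩ := Submodule.mem_sup.1 this
    obtain ⟨a, ha, b, hb, rfl⟩ := Submodule.mem_sup.1 hy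
    have hsum : s = (a : H) + b + k := (congrArg Subtype.val hyk).symm
    have hxe : u + w + s = (u + a) + (w + b) + k := by rw [hsum]; abel
    rw [hxe]
    refine add_mem (Submodule.mem_sup_left (add_mem (Submodule.mem_sup_left
      (add_mem (Submodule.mem_sup_left hu) (Submodule.mem_sup_right ⟨a, ha, rfl⟩)))
      (Submodule.mem_sup_right
      (add_mem (Submodule.mem_sup_left hw) (Submodule.mem_sup_right ⟨b, hb, rfl⟩)))))
      (Submodule.mem_sup_right ?_)
    exact (hASker k).1 hk

end Operators

end

open scoped Manifold ContDiff
open MeasureTheory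

noncomputable section

/-! ### Stability of the index under perturbations and shifts; the Fredholm property -/

section Operators

open Module

variable {𝕜 : Type*} [RCLike 𝕜] {H : Type*} [NormedAddCommGroup H] [InnerProductSpace 𝕜 H]
  [CompleteSpace H] {P N : Submodule 𝕜 H}

local notation "⟪" x ", " y "⟫" => inner 𝕜 x y

/-- The two forms differ by at most `‖B - A‖ ‖x‖²`, so the subspaces that work for `A` work for `B`
with half the constant. -/
theorem IsDefiniteModFinite.exists_forall_norm_sub_lt {A : H →L[𝕜] H}
    (hA : IsDefiniteModFinite P N A) :
    ∃ δ > 0, ∀ B : H →L[𝕜] H, (B : H →ₗ[𝕜] H).IsSymmetric → ‖B - A‖ < δ →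
      IsDefiniteModFinite P N B := by
  obtain ⟨-, c, hc, U, W, hUc, hWc, hUP, hWN, hT, hT', hU, hW⟩ := hA
  refine ⟨c / 2, half_pos hc, fun B hB hBA =>
    ⟨hB, c / 2, half_pos hc, U, W, hUc, hWc, hUP, hWN, hT, hT', fun x hx => ?_, fun x hx => ?_⟩⟩
  all_goals
    have h1 := abs_le.1 (abs_opForm_sub_le B A x)
    have h2 : ‖B - A‖ * ‖x‖ ^ 2 ≤ c / 2 * ‖x‖ ^ 2 := by gcongr
  · linarith [hU x hx]
  · linarith [hW x hx]

theorem sq_norm_pos_of_ne_zero {x : H} (hx : x ≠ 0) : 0 < ‖x‖ ^ 2 := by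
  have := norm_pos_iff.2 hx
  positivity

/-- The index is locally constant near an injective operator. -/
theorem IsDefiniteModFinite.exists_hasIndex_near {A : H →L[𝕜] H} (hA : IsDefiniteModFinite P N A)
    (hPN : IsCompl P N) (hk : ∀ x, A x = 0 → x = 0) :
    ∃ r, ∃ δ > 0, ∀ B : H →L[𝕜] H, ‖B - A‖ < δ → HasIndex P N (opForm B) r := by
  obtain ⟨-, c, hc, E, F, ⟨r, hr⟩, ⟨s, hs⟩, hE, hF, -, -, ht⟩ := hA.exists_splitting hPN
  have hker : LinearMap.ker (A : H →ₗ[𝕜] H) = ⊥ := LinearMap.ker_eq_bot'.2 hk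
  rw [hker, sup_bot_eq] at ht
  refine ⟨r, c / 2, half_pos hc, fun B hB => HasIndex.of_isCompl hPN
    ⟨disjoint_of_definite hc hE hF, codisjoint_iff.2 ht⟩ hr hs (fun x hx => ?_)
    fun x hx h0 => ?_⟩
  all_goals
    have h1 := abs_le.1 (abs_opForm_sub_le B A x)
    have h2 : ‖B - A‖ * ‖x‖ ^ 2 ≤ c / 2 * ‖x‖ ^ 2 := by gcongr
  · have : 0 ≤ c / 2 * ‖x‖ ^ 2 := by positivity
    linarith [hE x hx]
  · have : 0 < c / 2 * ‖x‖ ^ 2 := mul_pos (half_pos hc) (sq_norm_pos_of_ne_zero h0)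
    linarith [hF x hx]

/-- Small shifts of a symmetric operator: the kernel becomes positive or negative. -/
theorem IsDefiniteModFinite.exists_hasIndex_shift {A : H →L[𝕜] H}
    (hA : IsDefiniteModFinite P N A) (hPN : IsCompl P N) :
    ∃ r, ∃ δ > 0, HasIndex P N (opForm A) (r + finrank 𝕜 (LinearMap.ker (A : H →ₗ[𝕜] H))) ∧
      ∀ ε : ℝ, 0 < ε → ε < δ →
        HasIndex P N (opForm (A - (ε : 𝕜) • ContinuousLinearMap.id 𝕜 H)) r ∧
        HasIndex P N (opForm (A + (ε : 𝕜) • ContinuousLinearMap.id 𝕜 H))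
          (r + finrank 𝕜 (LinearMap.ker (A : H →ₗ[𝕜] H))) ∧
        IsUnit (A - (ε : 𝕜) • ContinuousLinearMap.id 𝕜 H) ∧
        IsUnit (A + (ε : 𝕜) • ContinuousLinearMap.id 𝕜 H) := by
  obtain ⟨hfd, c, hc, E, F, ⟨r, hr⟩, ⟨s, hs⟩, hE, hF, hEk, hFk, ht⟩ := hA.exists_splitting hPN
  set K := LinearMap.ker (A : H →ₗ[𝕜] H) with hK
  have hKz : ∀ k ∈ K, A k = 0 := fun k hk => hk
  have hort : ∀ x, (∀ y, A y = 0 → ⟪x, y⟫ = 0) → ∀ k ∈ K,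
      opForm A (x + k) = opForm A x ∧ ‖x + k‖ ^ 2 = ‖x‖ ^ 2 + ‖k‖ ^ 2 := by
    intro x hx k hk
    have h1 : ⟪A x, k⟫ = 0 := by
      have : ⟪A x, k⟫ = ⟪x, A k⟫ := hA.symm x k
      rw [this, hKz k hk, inner_zero_right]
    refine ⟨by simp [opForm, hKz k hk, inner_add_right, h1], ?_⟩
    rw [pow_two, pow_two, pow_two]
    exact norm_add_sq_eq_norm_sq_add_norm_sq_of_inner_eq_zero _ _ (hx k hk)
  have hEFK : Disjoint (E ⊔ F) K := by
    rw [Submodule.disjoint_def]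
    intro x hx hxk
    obtain ⟨u, hu, w, hw, rfl⟩ := Submodule.mem_sup.1 hx
    rw [← inner_self_eq_zero (𝕜 := 𝕜), inner_add_left, hEk u hu _ (hKz _ hxk),
      hFk w hw _ (hKz _ hxk), add_zero]
  have hEF : Disjoint E F := disjoint_of_definite hc hE hF
  have hc1 : IsCompl (E ⊔ K) F := by
    refine ⟨?_, codisjoint_iff.2 (by rw [sup_right_comm]; exact ht)⟩
    have h := (hEF.symm.disjoint_sup_right_of_disjoint_sup_left (c := K) (by rwa [sup_comm F E]))
    exact h.symm
  have hc2 : IsCompl E (F ⊔ K) := by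
    refine ⟨hEF.disjoint_sup_right_of_disjoint_sup_left hEFK,
      codisjoint_iff.2 (by rw [← sup_assoc]; exact ht)⟩
  have hEK : RelDim (E ⊔ K) P (r + finrank 𝕜 K) := hr.sup (hEFK.mono_left le_sup_left)
  have hFK : RelDim (F ⊔ K) N (s + finrank 𝕜 K) := hs.sup (hEFK.mono_left le_sup_right)
  refine ⟨r, c, hc, ?_, fun ε hε hεc => ?_⟩
  -- The form vanishes on the kernel, which therefore counts as nonnegative.
  · refine HasIndex.of_isCompl hPN hc1 hEK hs (fun x hx => ?_) (fun x hx h0 => ?_)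
    · obtain ⟨u, hu, k, hk, rfl⟩ := Submodule.mem_sup.1 hx
      rw [(hort u (hEk u hu) k hk).1]
      exact le_trans (by positivity) (hE u hu)
    · have := mul_pos hc (sq_norm_pos_of_ne_zero h0)
      linarith [hF x hx]
  -- Subtracting `ε` moves the kernel `K` to the negative side, adding `ε` moves it to the positive
  -- side. On `E` and `F` at least `c - ε` survives and on `K` the shift contributes `ε`, whence the
  -- constant `min (c - ε) ε`.
  · have p1 : ∀ x ∈ E, min (c - ε) ε * ‖x‖ ^ 2
        ≤ opForm (A - (ε : 𝕜) • ContinuousLinearMap.id 𝕜 H) x := by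
      intro x hx
      rw [opForm_sub_smul]
      have := hE x hx
      have h2 : min (c - ε) ε * ‖x‖ ^ 2 ≤ (c - ε) * ‖x‖ ^ 2 := by gcongr; exact min_le_left _ _
      linarith
    have p2 : ∀ x ∈ F ⊔ K, opForm (A - (ε : 𝕜) • ContinuousLinearMap.id 𝕜 H) x
        ≤ -(min (c - ε) ε * ‖x‖ ^ 2) := by
      intro x hx
      rw [opForm_sub_smul]
      obtain ⟨u, hu, k, hk, rfl⟩ := Submodule.mem_sup.1 hx
      rw [(hort u (hFk u hu) k hk).1]
      have := hF u hu
      have h2 : min (c - ε) ε * ‖u + k‖ ^ 2 ≤ ε * ‖u + k‖ ^ 2 := by gcongr; exact min_le_right _ _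
      have h3 : 0 ≤ c * ‖u‖ ^ 2 := by positivity
      linarith
    have p3 : ∀ x ∈ E ⊔ K, min (c - ε) ε * ‖x‖ ^ 2
        ≤ opForm (A + (ε : 𝕜) • ContinuousLinearMap.id 𝕜 H) x := by
      intro x hx
      rw [opForm_add_smul]
      obtain ⟨u, hu, k, hk, rfl⟩ := Submodule.mem_sup.1 hx
      rw [(hort u (hEk u hu) k hk).1]
      have := hE u hu
      have h2 : min (c - ε) ε * ‖u + k‖ ^ 2 ≤ ε * ‖u + k‖ ^ 2 := by gcongr; exact min_le_right _ _
      have h3 : 0 ≤ c * ‖u‖ ^ 2 := by positivity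
      linarith
    have p4 : ∀ x ∈ F, opForm (A + (ε : 𝕜) • ContinuousLinearMap.id 𝕜 H) x
        ≤ -(min (c - ε) ε * ‖x‖ ^ 2) := by
      intro x hx
      rw [opForm_add_smul]
      have := hF x hx
      have h2 : min (c - ε) ε * ‖x‖ ^ 2 ≤ (c - ε) * ‖x‖ ^ 2 := by gcongr; exact min_le_left _ _
      linarith
    have hm : 0 < min (c - ε) ε := lt_min (sub_pos.2 hεc) hε
    refine ⟨HasIndex.of_isCompl hPN hc2 hr hFK (fun x hx => ?_) (fun x hx h0 => ?_),
      HasIndex.of_isCompl hPN hc1 hEK hs (fun x hx => ?_) (fun x hx h0 => ?_),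
      isUnit_of_definite (isSymmetric_sub_smul hA.symm ε) hm p1 p2 hc2.sup_eq_top, ?_⟩
    · exact le_trans (by positivity) (p1 x hx)
    · have := mul_pos hm (sq_norm_pos_of_ne_zero h0)
      linarith [p2 x hx]
    · exact le_trans (by positivity) (p3 x hx)
    · have := mul_pos hm (sq_norm_pos_of_ne_zero h0)
      linarith [p4 x hx]
    · refine isUnit_of_definite ?_ hm p3 p4 hc1.sup_eq_top
      rw [add_smul_eq_sub_neg_smul]
      exact isSymmetric_sub_smul hA.symm _

/-- Adding the orthogonal projection `p` onto the kernel makes `A` definite on the complementary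
spaces `E ⊔ K` and `F`, hence invertible. As `p` has finite rank, the inverse of `A + p` is a
quasi-inverse of `A`. -/
theorem IsDefiniteModFinite.isFredholm {A : H →L[𝕜] H}
    (hA : IsDefiniteModFinite P N A) (hPN : IsCompl P N) : A.IsFredholm := by
  obtain ⟨hfd, c, hc, E, F, -, -, hE, hF, hEk, hFk, ht⟩ := hA.exists_splitting hPN
  set K := LinearMap.ker (A : H →ₗ[𝕜] H) with hK
  have hKz : ∀ k ∈ K, A k = 0 := fun k hk => hk
  let p : H →L[𝕜] H := K.subtypeL ∘L K.orthogonalProjectionOnto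
  have hp0 : ∀ x, (∀ y, A y = 0 → ⟪x, y⟫ = 0) → p x = 0 := by
    intro x hx
    have : K.orthogonalProjectionOnto x = 0 :=
      K.orthogonalProjectionOnto_eq_zero_iff.2 ((Submodule.mem_orthogonal' _ _).2 hx)
    change ((K.orthogonalProjectionOnto x : K) : H) = 0
    rw [this]; rfl
  have hpk : ∀ k ∈ K, p k = k := fun k hk =>
    congrArg Subtype.val (K.orthogonalProjectionOnto_mem_subspace_eq_self ⟨k, hk⟩)
  have hpinner : ∀ x y, ⟪p x, y⟫ = ⟪x, p y⟫ := by
    intro x y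
    have h1 : ⟪p x, y⟫ = inner 𝕜 (K.orthogonalProjectionOnto x) (K.orthogonalProjectionOnto y) :=
      (K.inner_orthogonalProjectionOnto_eq_of_mem_left _ _).symm
    have h2 : ⟪x, p y⟫ = inner 𝕜 (K.orthogonalProjectionOnto x) (K.orthogonalProjectionOnto y) :=
      (K.inner_orthogonalProjectionOnto_eq_of_mem_right _ _).symm
    rw [h1, h2]
  have hsym : ((A + p : H →L[𝕜] H) : H →ₗ[𝕜] H).IsSymmetric := by
    intro x y
    have h1 : ⟪A x, y⟫ = ⟪x, A y⟫ := hA.symm x y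
    simp [inner_add_left, inner_add_right, h1, hpinner]
  have hop : ∀ x, opForm (A + p) x = opForm A x + RCLike.re ⟪p x, x⟫ := by
    intro x; simp [opForm, inner_add_left]
  have hunit : IsUnit (A + p) := by
    refine isUnit_of_definite (c := min c 1) (E := E ⊔ K) (F := F) hsym (lt_min hc one_pos)
      (fun x hx => ?_) (fun x hx => ?_) (by rw [sup_right_comm]; exact ht)
    · obtain ⟨u, hu, k, hk, rfl⟩ := Submodule.mem_sup.1 hx
      have h1 : ⟪A u, k⟫ = 0 := by
        have : ⟪A u, k⟫ = ⟪u, A k⟫ := hA.symm u k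
        rw [this, hKz k hk, inner_zero_right]
      have h2 : ‖u + k‖ ^ 2 = ‖u‖ ^ 2 + ‖k‖ ^ 2 := by
        rw [pow_two, pow_two, pow_two]
        exact norm_add_sq_eq_norm_sq_add_norm_sq_of_inner_eq_zero _ _ (hEk u hu k (hKz k hk))
      have h3 : opForm A (u + k) = opForm A u := by
        simp [opForm, hKz k hk, inner_add_right, h1]
      have h5 : ⟪k, u⟫ = 0 := inner_eq_zero_symm.1 (hEk u hu k (hKz k hk))
      have h4 : RCLike.re ⟪p (u + k), u + k⟫ = ‖k‖ ^ 2 := by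
        rw [map_add, hp0 u (hEk u hu), hpk k hk, zero_add, inner_add_right, h5, zero_add,
          inner_self_eq_norm_sq]
      rw [hop, h3, h4, h2, mul_add]
      have h6 : min c 1 * ‖u‖ ^ 2 ≤ c * ‖u‖ ^ 2 := by gcongr; exact min_le_left _ _
      have h7 : min c 1 * ‖k‖ ^ 2 ≤ 1 * ‖k‖ ^ 2 := by gcongr; exact min_le_right _ _
      linarith [hE u hu]
    · rw [hop, hp0 x (hFk x hx), inner_zero_left, map_zero, add_zero]
      have h6 : min c 1 * ‖x‖ ^ 2 ≤ c * ‖x‖ ^ 2 := by gcongr; exact min_le_left _ _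
      linarith [hF x hx]
  obtain ⟨B, hB⟩ := hunit
  have hfr : LinearMap.HasFiniteRange (p : H →ₗ[𝕜] H) :=
    LinearMap.HasFiniteRange.comp_left (u := (K.orthogonalProjectionOnto : H →ₗ[𝕜] K))
      LinearMap.HasFiniteRange.of_isNoetherian_rng K.subtype
  have hquasi : LinearMap.IsQuasiInverse ((↑B⁻¹ : H →L[𝕜] H) : H →ₗ[𝕜] H)
      ((A + p : H →L[𝕜] H) : H →ₗ[𝕜] H) := by
    have h1 : (↑B⁻¹ : H →L[𝕜] H) * (A + p) = 1 := by rw [← hB]; exact B.inv_mul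
    have h2 : (A + p) * (↑B⁻¹ : H →L[𝕜] H) = 1 := by rw [← hB]; exact B.mul_inv
    have := LinearEquiv.isQuasiInverse (LinearEquiv.ofLinearMap
      ((A + p : H →L[𝕜] H) : H →ₗ[𝕜] H) ((↑B⁻¹ : H →L[𝕜] H) : H →ₗ[𝕜] H)
      (LinearMap.ext fun x => congrArg (fun f : H →L[𝕜] H => f x) h2)
      (LinearMap.ext fun x => congrArg (fun f : H →L[𝕜] H => f x) h1))
    exact this
  refine ContinuousLinearMap.IsFredholm.of_isQuasiInverse (v := (↑B⁻¹ : H →L[𝕜] H)) ?_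
  refine hquasi.congr (LinearMap.FiniteRangeSetoid.equiv_iff_hasFiniteRange.2 (by simp))
    (LinearMap.FiniteRangeSetoid.equiv_iff_hasFiniteRange.2 ?_)
  have : (A : H →ₗ[𝕜] H) - ((A + p : H →L[𝕜] H) : H →ₗ[𝕜] H) = -(p : H →ₗ[𝕜] H) := by
    ext x; simp
  rw [this]
  exact LinearMap.HasFiniteRange.neg hfr

end Operators

end

open scoped Manifold ContDiff
open MeasureTheory

noncomputable section

/-! ### Spectral flow as a difference of indices -/

section SpectralShift

open Module Set Filter Topology

variable {𝕜 : Type*} [RCLike 𝕜] {H : Type*} [NormedAddCommGroup H] [InnerProductSpace 𝕜 H]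
  [CompleteSpace H] {P N : Submodule 𝕜 H}

/-- Propagation of a locally constant property along an interval. -/
theorem Set.Icc_induction_of_locally_iff {a b : ℝ} (hab : a ≤ b) {p : ℝ → Prop}
    (h : ∀ x ∈ Icc a b, ∃ δ > 0, ∀ y ∈ Icc a b, |y - x| < δ → (p y ↔ p x)) (ha : p a) :
    ∀ x ∈ Icc a b, p x := by
  intro x hx
  have key := (isPreconnected_Icc (a := a) (b := b)).induction₂ (fun x y => (p x ↔ p y)) ?_ ?_ ?_
    (left_mem_Icc.2 hab) hx
  · exact key.1 ha
  · intro y hy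
    obtain ⟨δ, hδ, h⟩ := h y hy
    filter_upwards [self_mem_nhdsWithin, mem_nhdsWithin_of_mem_nhds (Metric.ball_mem_nhds y hδ)]
      with z hz hz'
    exact (h z hz (by simpa [Real.dist_eq] using hz')).symm
  · intro x y z _ _ _ h1 h2
    exact h1.trans h2
  · intro x y _ _ h1
    exact h1.symm

theorem eq_zero_of_isUnit {A : H →L[𝕜] H} (h : IsUnit A) {x : H} (hx : A x = 0) : x = 0 :=
  (ContinuousLinearMap.isUnit_iff_bijective.1 h).1 (by rw [hx, map_zero])

theorem eigenspace_eq_ker_sub (A : H →L[𝕜] H) (μ : ℝ) :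
    Module.End.eigenspace (A : H →ₗ[𝕜] H) (μ : 𝕜)
      = LinearMap.ker ((A - (μ : 𝕜) • ContinuousLinearMap.id 𝕜 H : H →L[𝕜] H) : H →ₗ[𝕜] H) := by
  ext x
  simp [sub_eq_zero]

/-- The sum of the eigenspaces with eigenvalues in `[0, μ)`. -/
def eigenspaceSum (A : H →L[𝕜] H) (μ : ℝ) : Submodule 𝕜 H :=
  ⨆ ν : Ico (0 : ℝ) μ, Module.End.eigenspace (A : H →ₗ[𝕜] H) (((ν : ℝ) : 𝕜))

theorem eigenspaceSum_eq_of_forall {A : H →L[𝕜] H} {μ μ' : ℝ} (hμ : μ ≤ μ')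
    (h : ∀ ν ∈ Ico μ μ', Module.End.eigenspace (A : H →ₗ[𝕜] H) ((ν : ℝ) : 𝕜) = ⊥) :
    eigenspaceSum A μ' = eigenspaceSum A μ := by
  refine le_antisymm (iSup_le fun ν => ?_) (iSup_le fun ν => ?_)
  · rcases lt_or_ge ν.1 μ with h1 | h1
    · exact le_iSup (fun ν : Ico (0 : ℝ) μ =>
        Module.End.eigenspace (A : H →ₗ[𝕜] H) (((ν : ℝ) : 𝕜))) ⟨ν, ν.2.1, h1⟩
    · rw [h ν ⟨h1, ν.2.2⟩]; exact bot_le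
  · exact le_iSup (fun ν : Ico (0 : ℝ) μ' =>
      Module.End.eigenspace (A : H →ₗ[𝕜] H) (((ν : ℝ) : 𝕜))) ⟨ν, ν.2.1, ν.2.2.trans_le hμ⟩

theorem eigenspaceSum_eq_sup {A : H →L[𝕜] H} {μ μ' : ℝ} (h0 : 0 ≤ μ) (hμ : μ < μ')
    (h : ∀ ν ∈ Ioo μ μ', Module.End.eigenspace (A : H →ₗ[𝕜] H) ((ν : ℝ) : 𝕜) = ⊥) :
    eigenspaceSum A μ' = eigenspaceSum A μ ⊔ Module.End.eigenspace (A : H →ₗ[𝕜] H) (μ : 𝕜) := by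
  refine le_antisymm (iSup_le fun ν => ?_) (sup_le (iSup_le fun ν => ?_) ?_)
  · rcases lt_trichotomy ν.1 μ with h1 | h1 | h1
    · exact le_trans (le_iSup (fun ν : Ico (0 : ℝ) μ =>
        Module.End.eigenspace (A : H →ₗ[𝕜] H) (((ν : ℝ) : 𝕜))) ⟨ν, ν.2.1, h1⟩) le_sup_left
    · rw [h1]; exact le_sup_right
    · rw [h ν ⟨h1, ν.2.2⟩]; exact bot_le
  · exact le_iSup (fun ν : Ico (0 : ℝ) μ' =>
      Module.End.eigenspace (A : H →ₗ[𝕜] H) (((ν : ℝ) : 𝕜))) ⟨ν, ν.2.1, ν.2.2.trans hμ⟩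
  · exact le_iSup (fun ν : Ico (0 : ℝ) μ' =>
      Module.End.eigenspace (A : H →ₗ[𝕜] H) (((ν : ℝ) : 𝕜))) ⟨μ, h0, hμ⟩

theorem disjoint_eigenspaceSum (A : H →L[𝕜] H) (μ : ℝ) :
    Disjoint (eigenspaceSum A μ) (Module.End.eigenspace (A : H →ₗ[𝕜] H) (μ : 𝕜)) := by
  have h := (Module.End.eigenspaces_iSupIndep (A : H →ₗ[𝕜] H)) (μ : 𝕜)
  refine h.symm.mono_left (iSup_le fun ν => ?_)
  have hne : ((ν : ℝ) : 𝕜) ≠ (μ : 𝕜) := by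
    intro h; exact absurd (RCLike.ofReal_injective h) ν.2.2.ne
  exact le_iSup₂ (f := fun (j : 𝕜) (_ : j ≠ (μ : 𝕜)) =>
    Module.End.eigenspace (A : H →ₗ[𝕜] H) j) _ hne

/-- The index of `A` exceeds the index of `A - a` by the number of eigenvalues in `[0, a]`. -/
theorem hasIndex_of_hasIndex_sub (hPN : IsCompl P N) {A : H →L[𝕜] H} {a : ℝ} (ha : 0 ≤ a)
    (hA : ∀ μ ∈ Icc (0 : ℝ) a,
      IsDefiniteModFinite P N (A - (μ : 𝕜) • ContinuousLinearMap.id 𝕜 H))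
    (hk : ∀ x, (A - (a : 𝕜) • ContinuousLinearMap.id 𝕜 H) x = 0 → x = 0) :
    ∃ r, HasIndex P N (opForm (A - (a : 𝕜) • ContinuousLinearMap.id 𝕜 H)) r ∧
      HasIndex P N (opForm A) (r + eigenvalueCount A a) := by
  have h0A : A - ((0 : ℝ) : 𝕜) • ContinuousLinearMap.id 𝕜 H = A := by simp
  obtain ⟨r₀, -, -, hr₀, -⟩ := (hA 0 (left_mem_Icc.2 ha)).exists_hasIndex_shift hPN
  rw [h0A] at hr₀
  set i₀ := r₀ + finrank 𝕜 (LinearMap.ker (A : H →ₗ[𝕜] H)) with hi₀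
  -- Move `μ` from `0` to `a`. The invariant is that the index of `A - μ` is the index of `A` minus
  -- the number of eigenvalues in the half-open interval `[0, μ)`.
  have main := Set.Icc_induction_of_locally_iff ha
    (p := fun μ => FiniteDimensional 𝕜 (eigenspaceSum A μ) ∧
      HasIndex P N (opForm (A - (μ : 𝕜) • ContinuousLinearMap.id 𝕜 H))
        (i₀ - finrank 𝕜 (eigenspaceSum A μ))) ?_ ?_ a (right_mem_Icc.2 ha)
  · refine ⟨_, main.2, ?_⟩
    -- `eigenvalueCount` includes the endpoint `a` and `eigenspaceSum` does not; they agree because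
    -- `a` is not an eigenvalue.
    have hc : eigenvalueCount A a = finrank 𝕜 (eigenspaceSum A a) := by
      have hsup : (⨆ μ : Set.Icc (0 : ℝ) a,
          Module.End.eigenspace (A : H →ₗ[𝕜] H) (((μ : ℝ) : 𝕜))) = eigenspaceSum A a := by
        refine le_antisymm (iSup_le fun ν => ?_) (iSup_le fun ν => ?_)
        · rcases ν.2.2.lt_or_eq with h1 | h1
          · exact le_iSup (fun ν : Ico (0 : ℝ) a =>
              Module.End.eigenspace (A : H →ₗ[𝕜] H) (((ν : ℝ) : 𝕜))) ⟨ν, ν.2.1, h1⟩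
          · rw [h1, eigenspace_eq_ker_sub, LinearMap.ker_eq_bot'.2 hk]; exact bot_le
        · exact le_iSup (fun ν : Icc (0 : ℝ) a =>
            Module.End.eigenspace (A : H →ₗ[𝕜] H) (((ν : ℝ) : 𝕜))) ⟨ν, ν.2.1, ν.2.2.le⟩
      rw [eigenvalueCount, hsup]
    rw [hc, sub_add_cancel]
    exact hr₀
  · intro μ hμ
    obtain ⟨r, δ, hδ, hr, hshift⟩ := (hA μ hμ).exists_hasIndex_shift hPN
    have hfd := ((hA μ hμ).exists_splitting hPN).1
    rw [← eigenspace_eq_ker_sub] at hr hshift hfd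
    -- Eigenvalues near `μ` are isolated: small nonzero shifts of `A - μ` are invertible.
    have hbot : ∀ ν : ℝ, ν ≠ μ → |ν - μ| < δ →
        Module.End.eigenspace (A : H →ₗ[𝕜] H) ((ν : ℝ) : 𝕜) = ⊥ := by
      intro ν hne hν
      rw [eigenspace_eq_ker_sub, LinearMap.ker_eq_bot']
      intro x hx
      rcases lt_or_gt_of_ne hne with h | h
      · refine eq_zero_of_isUnit (hshift (μ - ν) (by linarith)
          (by rw [abs_lt] at hν; linarith)).2.2.2 ?_
        rw [← hx]; simp [sub_smul]
      · refine eq_zero_of_isUnit (hshift (ν - μ) (by linarith)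
          (by rw [abs_lt] at hν; linarith)).2.2.1 ?_
        rw [← hx]; simp [sub_smul]
    refine ⟨δ, hδ, fun ν hν hνμ => ?_⟩
    have hu := hPN.sup_eq_top
    -- To the left of `μ` nothing changes, since the index of `A - μ` counts its kernel as
    -- nonnegative. To the right the index drops by the dimension of this kernel, which is exactly
    -- what enters `eigenspaceSum`.
    rcases lt_trichotomy ν μ with h | rfl | h
    · have hW : eigenspaceSum A μ = eigenspaceSum A ν :=
        eigenspaceSum_eq_of_forall h.le fun x hx => hbot x hx.2.ne
          (by rw [abs_lt] at hνμ ⊢; constructor <;> linarith [hx.1, hx.2])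
      have hidx := (hshift (μ - ν) (by linarith) (by rw [abs_lt] at hνμ; linarith)).2.1
      have he : A - (μ : 𝕜) • ContinuousLinearMap.id 𝕜 H
          + ((μ - ν : ℝ) : 𝕜) • ContinuousLinearMap.id 𝕜 H
          = A - (ν : 𝕜) • ContinuousLinearMap.id 𝕜 H := by
        push_cast; rw [sub_smul]; abel
      rw [he] at hidx
      rw [hW]
      constructor
      · rintro ⟨h1, h2⟩
        exact ⟨h1, by rw [h2.unique hu hidx]; exact hr⟩
      · rintro ⟨h1, h2⟩
        exact ⟨h1, by rw [h2.unique hu hr]; exact hidx⟩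
    · rfl
    · have hW : eigenspaceSum A ν = eigenspaceSum A μ
          ⊔ Module.End.eigenspace (A : H →ₗ[𝕜] H) (μ : 𝕜) :=
        eigenspaceSum_eq_sup hμ.1 h fun x hx => hbot x hx.1.ne'
          (by rw [abs_lt] at hνμ ⊢; constructor <;> linarith [hx.1, hx.2])
      have hidx := (hshift (ν - μ) (by linarith) (by rw [abs_lt] at hνμ; linarith)).1
      have he : A - (μ : 𝕜) • ContinuousLinearMap.id 𝕜 H
          - ((ν - μ : ℝ) : 𝕜) • ContinuousLinearMap.id 𝕜 H
          = A - (ν : 𝕜) • ContinuousLinearMap.id 𝕜 H := by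
        push_cast; rw [sub_smul]; abel
      rw [he] at hidx
      rw [hW]
      constructor
      · rintro ⟨h1, h2⟩
        have hf1 : FiniteDimensional 𝕜 (eigenspaceSum A μ) :=
          Submodule.finiteDimensional_of_le (le_sup_left (a := eigenspaceSum A μ)
            (b := Module.End.eigenspace (A : H →ₗ[𝕜] H) (μ : 𝕜)))
        refine ⟨hf1, ?_⟩
        rw [Submodule.finrank_sup_of_disjoint (disjoint_eigenspaceSum A μ)] at h2
        have := h2.unique hu hidx
        push_cast at this
        convert hr using 1
        omega
      · rintro ⟨h1, h2⟩
        refine ⟨inferInstance, ?_⟩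
        rw [Submodule.finrank_sup_of_disjoint (disjoint_eigenspaceSum A μ)]
        have := h2.unique hu hr
        convert hidx using 1
        push_cast
        omega
  · have hz : eigenspaceSum A 0 = ⊥ := by
      rw [eigenspaceSum, iSup_eq_bot]
      rintro ⟨ν, h1, h2⟩
      exact absurd h1 (not_le.2 h2)
    rw [hz, h0A]
    exact ⟨inferInstance, by simpa using hr₀⟩

/-- Along a path with a common gap, the change of the index is the change of the eigenvalue
count. -/
theorem exists_hasIndex_sub_eq (hPN : IsCompl P N) {A : ℝ → H →L[𝕜] H} {s s' a : ℝ} (hs : s ≤ s')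
    (hcont : ContinuousOn A (Icc s s')) (ha : 0 ≤ a)
    (hA : ∀ t ∈ Icc s s', ∀ μ ∈ Icc (0 : ℝ) a,
      IsDefiniteModFinite P N (A t - (μ : 𝕜) • ContinuousLinearMap.id 𝕜 H))
    (hk : ∀ t ∈ Icc s s', IsUnit (A t - (a : 𝕜) • ContinuousLinearMap.id 𝕜 H)) :
    ∃ r, ∀ t ∈ Icc s s', HasIndex P N (opForm (A t - (a : 𝕜) • ContinuousLinearMap.id 𝕜 H)) r ∧
      HasIndex P N (opForm (A t)) (r + eigenvalueCount (A t) a) := by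
  obtain ⟨r, hr, -⟩ := hasIndex_of_hasIndex_sub hPN ha (hA s (left_mem_Icc.2 hs))
    (fun x hx => eq_zero_of_isUnit (hk s (left_mem_Icc.2 hs)) hx)
  have main := Set.Icc_induction_of_locally_iff hs
    (p := fun t => HasIndex P N (opForm (A t - (a : 𝕜) • ContinuousLinearMap.id 𝕜 H)) r) ?_ hr
  · refine ⟨r, fun t ht => ⟨main t ht, ?_⟩⟩
    obtain ⟨r', hr', hr''⟩ := hasIndex_of_hasIndex_sub hPN ha (hA t ht)
      (fun x hx => eq_zero_of_isUnit (hk t ht) hx)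
    rwa [hr'.unique hPN.sup_eq_top (main t ht)] at hr''
  · intro t ht
    obtain ⟨r', δ, hδ, hr'⟩ := (hA t ht a (right_mem_Icc.2 ha)).exists_hasIndex_near hPN
      (fun x hx => eq_zero_of_isUnit (hk t ht) hx)
    obtain ⟨η, hη, h⟩ := Metric.continuousWithinAt_iff.1 (hcont t ht) δ hδ
    refine ⟨η, hη, fun y hy hyt => ?_⟩
    have h1 := hr' (A t - (a : 𝕜) • ContinuousLinearMap.id 𝕜 H) (by simpa using hδ)
    have h2 := hr' (A y - (a : 𝕜) • ContinuousLinearMap.id 𝕜 H) (by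
      have := h hy (by rwa [Real.dist_eq])
      rw [dist_eq_norm] at this
      simpa using this)
    have hu := hPN.sup_eq_top
    exact ⟨fun h => by rwa [h.unique hu h2], fun h => by rwa [h.unique hu h1]⟩

/-- On each piece the index of `A t` is a constant plus the eigenvalue count in `[0, a i]`. Every
summand of Phillips' formula is thus a difference of indices, and the sum telescopes. The hypothesis
`hA` covers all admissible cut-offs, since the definition places no upper bound on them. -/
theorem HasOperatorSpectralFlow.eq_index_sub (hPN : IsCompl P N) {A : ℝ → H →L[𝕜] H} {m : ℤ}
    (hcont : ContinuousOn A (Icc 0 1))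
    (hA : ∀ t ∈ Icc (0 : ℝ) 1, ∀ a : ℝ, 0 < a → IsSpectralGap (A t) a → ∀ μ ∈ Icc (0 : ℝ) a,
      IsDefiniteModFinite P N (A t - (μ : 𝕜) • ContinuousLinearMap.id 𝕜 H))
    (h : HasOperatorSpectralFlow A m) :
    m = formIndex P N (opForm (A 1)) - formIndex P N (opForm (A 0)) := by
  obtain ⟨k, s, a, h0, h1, hs, rfl⟩ := h
  have hmono : ∀ j ≤ k, ∀ i ≤ j, s i ≤ s j := by
    intro j
    induction j with
    | zero => intro _ i hi; rw [Nat.le_zero.1 hi]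
    | succ j ih =>
      intro hj i hi
      rcases Nat.le_succ_iff.1 hi with h | h
      · exact (ih (by omega) i h).trans (hs j (by omega)).1
      · rw [h]
  rw [← h0, ← h1, ← Finset.sum_range_sub (fun i => formIndex P N (opForm (A (s i))))]
  refine Finset.sum_congr rfl fun i hi => ?_
  have hi := Finset.mem_range.1 hi
  obtain ⟨hle, hpos, hgap⟩ := hs i hi
  have hsub : Icc (s i) (s (i + 1)) ⊆ Icc 0 1 := by
    refine Icc_subset_Icc ?_ ?_
    · rw [← h0]; exact hmono i hi.le 0 (Nat.zero_le _)
    · rw [← h1]; exact hmono k le_rfl (i + 1) hi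
  obtain ⟨r, hr⟩ := exists_hasIndex_sub_eq hPN hle (hcont.mono hsub) hpos.le
    (fun t ht => hA t (hsub ht) _ hpos (hgap t ht)) (fun t ht => (hgap t ht).1)
  rw [(hr _ (left_mem_Icc.2 hle)).2.formIndex_eq hPN.sup_eq_top,
    (hr _ (right_mem_Icc.2 hle)).2.formIndex_eq hPN.sup_eq_top]
  ring

/-- Existence of a subdivision with admissible cut-offs. -/
theorem exists_hasOperatorSpectralFlow (hPN : IsCompl P N) {A : ℝ → H →L[𝕜] H}
    (hcont : ContinuousOn A (Icc 0 1))
    (hA : ∀ t ∈ Icc (0 : ℝ) 1, ∀ μ ∈ Ioo (-1 : ℝ) 1,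
      IsDefiniteModFinite P N (A t - (μ : 𝕜) • ContinuousLinearMap.id 𝕜 H)) :
    ∃ m, HasOperatorSpectralFlow A m := by
  have hA0 : ∀ t ∈ Icc (0 : ℝ) 1, IsDefiniteModFinite P N (A t) := fun t ht => by
    simpa using hA t ht 0 (by norm_num)
  have hloc : ∀ t : unitInterval, ∃ a > 0, ∃ U : Set unitInterval, IsOpen U ∧ t ∈ U ∧
      ∀ t' ∈ U, IsSpectralGap (A t') a := by
    intro t
    obtain ⟨_, δ, hδ, -, h⟩ := (hA0 t t.2).exists_hasIndex_shift hPN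
    -- At each `t` the shifts `A t ± a` are invertible for small `a`, and this persists for nearby
    -- parameters. Taking `a < 1` keeps `[-a, a]` inside `(-1, 1)`, where the hypothesis gives the
    -- Fredholm property.
    have ha : 0 < min δ 1 / 2 := half_pos (lt_min hδ one_pos)
    have ha1 : min δ 1 / 2 < 1 := by linarith [min_le_right δ 1]
    have haδ : min δ 1 / 2 < δ := by linarith [min_le_left δ 1]
    obtain ⟨-, -, hu1, hu2⟩ := h _ ha haδ
    have hcont' : Continuous fun t : unitInterval => A t := hcont.restrict
    refine ⟨min δ 1 / 2, ha, {t' | IsUnit (A t' - ((min δ 1 / 2 : ℝ) : 𝕜) •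
      ContinuousLinearMap.id 𝕜 H)} ∩ {t' | IsUnit (A t' + ((min δ 1 / 2 : ℝ) : 𝕜) •
      ContinuousLinearMap.id 𝕜 H)}, ?_, ⟨hu1, hu2⟩, ?_⟩
    · exact (Units.isOpen.preimage (hcont'.sub continuous_const)).inter
        (Units.isOpen.preimage (hcont'.add continuous_const))
    · rintro t' ⟨h1, h2⟩
      exact ⟨h1, h2, fun μ hμ => (hA t' t'.2 μ
        ⟨by linarith [hμ.1], by linarith [hμ.2]⟩).isFredholm hPN⟩
  choose a ha U hU htU hgap using hloc
  obtain ⟨t, ht0, htm, ⟨n, hn⟩, hsub⟩ := exists_monotone_Icc_subset_open_cover_unitInterval hU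
    (fun t _ => mem_iUnion.2 ⟨t, htU t⟩)
  choose i hi using hsub
  refine ⟨_, n, fun j => t j, fun j => a (i j), by simp [ht0], by simp [hn n le_rfl],
    fun j _ => ⟨htm (Nat.le_succ j), ha _, fun x hx => ?_⟩, rfl⟩
  have hx01 : x ∈ Icc (0 : ℝ) 1 := ⟨(t j).2.1.trans hx.1, hx.2.trans (t (j + 1)).2.2⟩
  exact hgap (i j) ⟨x, hx01⟩ (hi j ⟨hx.1, hx.2⟩)

/-- The difference of the indices relative to two reference splittings is constant along paths. -/
theorem formIndex_sub_formIndex_eq {P' N' : Submodule 𝕜 H} (hPN : IsCompl P N)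
    (hPN' : IsCompl P' N') {A : ℝ → H →L[𝕜] H} (hcont : ContinuousOn A (Icc 0 1))
    (hA : ∀ t ∈ Icc (0 : ℝ) 1, IsDefiniteModFinite P N (A t))
    (hA' : ∀ t ∈ Icc (0 : ℝ) 1, IsDefiniteModFinite P' N' (A t)) :
    formIndex P N (opForm (A 1)) - formIndex P' N' (opForm (A 1))
      = formIndex P N (opForm (A 0)) - formIndex P' N' (opForm (A 0)) := by
  refine Set.Icc_induction_of_locally_iff zero_le_one
    (p := fun t => formIndex P N (opForm (A t)) - formIndex P' N' (opForm (A t))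
      = formIndex P N (opForm (A 0)) - formIndex P' N' (opForm (A 0))) ?_ rfl 1
      (right_mem_Icc.2 zero_le_one)
  intro t ht
  obtain ⟨δ₁, hδ₁, h₁⟩ := (hA t ht).exists_forall_norm_sub_lt
  obtain ⟨δ₂, hδ₂, h₂⟩ := (hA' t ht).exists_forall_norm_sub_lt
  obtain ⟨_, δ₃, hδ₃, -, h₃⟩ := (hA t ht).exists_hasIndex_shift hPN
  set δ := min (min δ₁ δ₂) δ₃ with hδ
  have hδpos : 0 < δ := lt_min (lt_min hδ₁ hδ₂) hδ₃
  have hle1 : δ ≤ δ₁ := (min_le_left _ _).trans (min_le_left _ _)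
  have hle2 : δ ≤ δ₂ := (min_le_left _ _).trans (min_le_right _ _)
  have hle3 : δ ≤ δ₃ := min_le_right _ _
  -- `A t` may be singular, so its index can jump; `A t - a` is invertible and its indices relative
  -- to both splittings are locally constant. Passing from `A y - a` to `A y` adds the same
  -- eigenvalue count to both, so the count cancels in the difference.
  set a := δ / 2 with ha
  have hapos : 0 < a := half_pos hδpos
  obtain ⟨-, -, hunit, -⟩ := h₃ a hapos (by linarith)
  have hnorm : ∀ (B : H →L[𝕜] H) (μ : ℝ), ‖B - A t‖ < δ / 2 → μ ∈ Icc 0 a →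
      ‖(B - (μ : 𝕜) • ContinuousLinearMap.id 𝕜 H) - A t‖ < δ := by
    intro B μ hB hμ
    have h1 : (B - (μ : 𝕜) • ContinuousLinearMap.id 𝕜 H) - A t
        = (B - A t) - (μ : 𝕜) • ContinuousLinearMap.id 𝕜 H := by abel
    have h2 : ‖(μ : 𝕜) • ContinuousLinearMap.id 𝕜 H‖ ≤ a := by
      rw [norm_smul, RCLike.norm_ofReal, abs_of_nonneg hμ.1]
      calc μ * ‖ContinuousLinearMap.id 𝕜 H‖ ≤ μ * 1 := by
            gcongr
            · exact hμ.1
            · exact ContinuousLinearMap.norm_id_le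
        _ ≤ a := by rw [mul_one]; exact hμ.2
    rw [h1]
    calc _ ≤ ‖B - A t‖ + ‖(μ : 𝕜) • ContinuousLinearMap.id 𝕜 H‖ := norm_sub_le _ _
      _ < δ := by linarith
  obtain ⟨δ₄, hδ₄, h₄⟩ : ∃ δ₄ > 0, ∀ B : H →L[𝕜] H, ‖B - A t‖ < δ₄ →
      IsUnit (B - (a : 𝕜) • ContinuousLinearMap.id 𝕜 H) := by
    have : {B : H →L[𝕜] H | IsUnit (B - (a : 𝕜) • ContinuousLinearMap.id 𝕜 H)} ∈ 𝓝 (A t) :=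
      (Units.isOpen.preimage (continuous_id.sub continuous_const)).mem_nhds hunit
    obtain ⟨δ₄, hδ₄, h⟩ := Metric.mem_nhds_iff.1 this
    exact ⟨δ₄, hδ₄, fun B hB => h (by rwa [Metric.mem_ball, dist_eq_norm])⟩
  have hadm : ∀ B : H →L[𝕜] H, (B : H →ₗ[𝕜] H).IsSymmetric → ‖B - A t‖ < δ / 2 →
      ∀ μ ∈ Icc (0 : ℝ) a,
      IsDefiniteModFinite P N (B - (μ : 𝕜) • ContinuousLinearMap.id 𝕜 H) ∧
      IsDefiniteModFinite P' N' (B - (μ : 𝕜) • ContinuousLinearMap.id 𝕜 H) := fun B hB hBn μ hμ =>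
    ⟨h₁ _ (isSymmetric_sub_smul hB μ) ((hnorm B μ hBn hμ).trans_le hle1),
      h₂ _ (isSymmetric_sub_smul hB μ) ((hnorm B μ hBn hμ).trans_le hle2)⟩
  have hAt := hadm (A t) (hA t ht).symm (by simpa using hδpos) a (right_mem_Icc.2 hapos.le)
  obtain ⟨r, δ₅, hδ₅, h₅⟩ := hAt.1.exists_hasIndex_near hPN
    fun x hx => eq_zero_of_isUnit hunit hx
  obtain ⟨r', δ₆, hδ₆, h₆⟩ := hAt.2.exists_hasIndex_near hPN'
    fun x hx => eq_zero_of_isUnit hunit hx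
  obtain ⟨η, hη, hη'⟩ := Metric.continuousWithinAt_iff.1 (hcont t ht)
    (min (min (δ / 2) δ₄) (min δ₅ δ₆)) (by positivity)
  have hval : ∀ y ∈ Icc (0 : ℝ) 1, |y - t| < η →
      formIndex P N (opForm (A y)) - formIndex P' N' (opForm (A y)) = r - r' := by
    intro y hy hyt
    have hd := hη' hy (by rwa [Real.dist_eq])
    rw [dist_eq_norm, lt_min_iff, lt_min_iff, lt_min_iff] at hd
    obtain ⟨⟨d1, d2⟩, d3, d4⟩ := hd
    have hu := h₄ _ d2
    have hB := hadm (A y) (hA y hy).symm d1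
    obtain ⟨s, hs, hs'⟩ := hasIndex_of_hasIndex_sub hPN hapos.le (fun μ hμ => (hB μ hμ).1)
      fun x hx => eq_zero_of_isUnit hu hx
    obtain ⟨s', hs1, hs1'⟩ := hasIndex_of_hasIndex_sub hPN' hapos.le (fun μ hμ => (hB μ hμ).2)
      fun x hx => eq_zero_of_isUnit hu hx
    have e1 : s = r := hs.unique hPN.sup_eq_top (h₅ _ (by simpa using d3))
    have e2 : s' = r' := hs1.unique hPN'.sup_eq_top (h₆ _ (by simpa using d4))
    rw [hs'.formIndex_eq hPN.sup_eq_top, hs1'.formIndex_eq hPN'.sup_eq_top, e1, e2]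
    ring
  refine ⟨η, hη, fun y hy hyt => ?_⟩
  rw [hval y hy hyt, hval t ht (by simpa using hη)]

end SpectralShift

end

open scoped Manifold ContDiff
open MeasureTheory

noncomputable section

/-! ### Operators close to a reflection on subspaces of finite codimension -/

section Reflection

open Module Set

variable {𝕜 : Type*} [RCLike 𝕜] {H : Type*} [NormedAddCommGroup H] [InnerProductSpace 𝕜 H]
  [CompleteSpace H]

local notation "⟪" x ", " y "⟫" => inner 𝕜 x y

/-- The fixed space of `J`. -/
def fixedSpace (J : H →L[𝕜] H) : Submodule 𝕜 H :=
  LinearMap.ker ((J - ContinuousLinearMap.id 𝕜 H : H →L[𝕜] H) : H →ₗ[𝕜] H)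

/-- The space of vectors reversed by `J`. -/
def antifixedSpace (J : H →L[𝕜] H) : Submodule 𝕜 H :=
  LinearMap.ker ((J + ContinuousLinearMap.id 𝕜 H : H →L[𝕜] H) : H →ₗ[𝕜] H)

theorem mem_fixedSpace {J : H →L[𝕜] H} {x : H} : x ∈ fixedSpace J ↔ J x = x := by
  simp [fixedSpace, sub_eq_zero]

theorem mem_antifixedSpace {J : H →L[𝕜] H} {x : H} : x ∈ antifixedSpace J ↔ J x = -x := by
  simp [antifixedSpace, add_eq_zero_iff_eq_neg]

theorem isCompl_fixedSpace {J : H →L[𝕜] H} (hJ : ∀ x, J (J x) = x) :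
    IsCompl (fixedSpace J) (antifixedSpace J) := by
  constructor
  · rw [Submodule.disjoint_def]
    intro x hx hx'
    rw [mem_fixedSpace] at hx
    rw [mem_antifixedSpace, hx] at hx'
    have h2 : (2 : 𝕜) • x = 0 := by
      rw [two_smul]
      nth_rw 2 [hx']
      exact add_neg_cancel x
    simpa using h2
  · rw [codisjoint_iff, eq_top_iff]
    intro x _
    have h2 : x = (2⁻¹ : 𝕜) • (x + J x) + (2⁻¹ : 𝕜) • (x - J x) := by
      rw [← smul_add, add_add_sub_cancel, ← two_smul 𝕜 x, smul_smul]; norm_num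
    rw [h2]
    refine Submodule.add_mem_sup ?_ ?_
    · rw [mem_fixedSpace, map_smul, map_add, hJ, add_comm]
    · rw [mem_antifixedSpace, map_smul, map_sub, hJ, ← smul_neg, neg_sub]

/-- `A` is symmetric and agrees with `J` up to a form that is arbitrarily small on subspaces of
finite codimension. -/
structure IsReflectionModSmall (J A : H →L[𝕜] H) : Prop where
  symm : (A : H →ₗ[𝕜] H).IsSymmetric
  exists_small : ∀ η > 0, ∃ Y : Submodule 𝕜 H, IsClosed (Y : Set H) ∧
    FiniteDimensional 𝕜 (H ⧸ Y) ∧ ∀ x ∈ Y, ∀ y ∈ Y, ‖⟪A x, y⟫ - ⟪J x, y⟫‖ ≤ η * ‖x‖ * ‖y‖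

omit [CompleteSpace H] in
theorem exists_le_inf_sup {P Y : Submodule 𝕜 H} [FiniteDimensional 𝕜 (H ⧸ Y)] :
    ∃ T : Submodule 𝕜 H, FiniteDimensional 𝕜 T ∧ P ≤ (P ⊓ Y) ⊔ T := by
  have := exists_le_inf_ker_sup P Y.mkQ
  rwa [Submodule.ker_mkQ] at this

omit [CompleteSpace H] in
theorem abs_opForm_sub_re_le {J A : H →L[𝕜] H} {η : ℝ} {x : H}
    (h : ‖⟪A x, x⟫ - ⟪J x, x⟫‖ ≤ η * ‖x‖ * ‖x‖) :
    |opForm A x - RCLike.re ⟪J x, x⟫| ≤ η * ‖x‖ ^ 2 := by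
  rw [opForm, ← map_sub]
  exact (RCLike.abs_re_le_norm _).trans (h.trans_eq (by ring))

omit [CompleteSpace H] in
theorem isClosed_fixedSpace (J : H →L[𝕜] H) : IsClosed (fixedSpace J : Set H) :=
  (J - ContinuousLinearMap.id 𝕜 H).isClosed_ker

omit [CompleteSpace H] in
theorem isClosed_antifixedSpace (J : H →L[𝕜] H) : IsClosed (antifixedSpace J : Set H) :=
  (J + ContinuousLinearMap.id 𝕜 H).isClosed_ker

theorem re_inner_of_mem_fixedSpace {J : H →L[𝕜] H} {x : H} (hx : x ∈ fixedSpace J) :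
    RCLike.re ⟪J x, x⟫ = ‖x‖ ^ 2 := by
  rw [mem_fixedSpace.1 hx, inner_self_eq_norm_sq]

theorem re_inner_of_mem_antifixedSpace {J : H →L[𝕜] H} {x : H} (hx : x ∈ antifixedSpace J) :
    RCLike.re ⟪J x, x⟫ = -‖x‖ ^ 2 := by
  rw [mem_antifixedSpace.1 hx, inner_neg_left, map_neg, inner_self_eq_norm_sq]

/-- On the eigenspaces of `J` the shifted form is `(±1 - μ) ‖x‖²` up to the error. With error at
most `(1 - |μ|) / 2` on a subspace of finite codimension, at least the same amount of definiteness
remains. -/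
theorem IsReflectionModSmall.isDefiniteModFinite {J A : H →L[𝕜] H} (h : IsReflectionModSmall J A)
    {μ : ℝ} (hμ : μ ∈ Ioo (-1 : ℝ) 1) :
    IsDefiniteModFinite (fixedSpace J) (antifixedSpace J)
      (A - (μ : 𝕜) • ContinuousLinearMap.id 𝕜 H) := by
  have hc : 0 < (1 - |μ|) / 2 := half_pos (sub_pos.2 (abs_lt.2 hμ))
  obtain ⟨Y, hYc, hYf, hY⟩ := h.exists_small _ hc
  refine ⟨isSymmetric_sub_smul h.symm μ, (1 - |μ|) / 2, hc, fixedSpace J ⊓ Y,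
    antifixedSpace J ⊓ Y, (isClosed_fixedSpace J).inter hYc, (isClosed_antifixedSpace J).inter hYc,
    inf_le_left, inf_le_left, exists_le_inf_sup, exists_le_inf_sup, ?_, ?_⟩
  · rintro x ⟨hx, hxY⟩
    have h1 := abs_le.1 (abs_opForm_sub_re_le (hY x hxY x hxY))
    rw [re_inner_of_mem_fixedSpace hx] at h1
    rw [opForm_sub_smul]
    have h2 : μ * ‖x‖ ^ 2 ≤ |μ| * ‖x‖ ^ 2 := by gcongr; exact le_abs_self μ
    linarith
  · rintro x ⟨hx, hxY⟩
    have h1 := abs_le.1 (abs_opForm_sub_re_le (hY x hxY x hxY))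
    rw [re_inner_of_mem_antifixedSpace hx] at h1
    rw [opForm_sub_smul]
    have h2 : -μ * ‖x‖ ^ 2 ≤ |μ| * ‖x‖ ^ 2 := by gcongr; exact neg_le_abs μ
    linarith

-- A quasi-inverse is a genuine left inverse on a subspace of finite codimension, where its norm
-- gives the lower bound.
omit [CompleteSpace H] in
open LinearMap.FiniteRangeSetoid in
theorem ContinuousLinearMap.IsFredholm.exists_bounded_below {T : H →L[𝕜] H} (hT : T.IsFredholm) :
    ∃ c > 0, ∃ Z : Submodule 𝕜 H, FiniteDimensional 𝕜 (H ⧸ Z) ∧ ∀ x ∈ Z, c * ‖x‖ ≤ ‖T x‖ := by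
  obtain ⟨v, hv, -⟩ := ContinuousLinearMap.IsFredholm.exists_isQuasiInverse hT
  rw [LinearMap.IsLeftQuasiInverse, Setoid.comm,
    LinearMap.FiniteRangeSetoid.equiv_iff_eqLocus_coFG] at hv
  refine ⟨(‖v‖ + 1)⁻¹, by positivity, _, hv, fun x hx => ?_⟩
  have h1 : v (T x) = x := hx.symm
  rw [inv_mul_le_iff₀ (by positivity)]
  calc ‖x‖ = ‖v (T x)‖ := by rw [h1]
    _ ≤ ‖v‖ * ‖T x‖ := v.le_opNorm _
    _ ≤ _ := by gcongr; linarith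

/-- Let `T = A - 1`. For `x` fixed by `J`, the smallness of `A - J` as a form, tested on the vector
`T x`, yields `‖T x‖² ≤ (c / 2) ‖x‖ ‖T x‖`, whereas the Fredholm property yields `c ‖x‖ ≤ ‖T x‖`.
Both hold under finitely many linear conditions on `x`, so these conditions already force `x = 0`.
-/
theorem IsReflectionModSmall.finiteDimensional_fixedSpace {J A : H →L[𝕜] H}
    (h : IsReflectionModSmall J A)
    (hF : (A - ((1 : ℝ) : 𝕜) • ContinuousLinearMap.id 𝕜 H).IsFredholm) :
    FiniteDimensional 𝕜 (fixedSpace J) := by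
  set T := A - ((1 : ℝ) : 𝕜) • ContinuousLinearMap.id 𝕜 H with hT
  have hTx : ∀ x, T x = A x - x := fun x => by simp [hT]
  obtain ⟨c, hc, Z, hZf, hZ⟩ := hF.exists_bounded_below
  obtain ⟨Y, -, hYf, hY⟩ := h.exists_small _ (half_pos hc)
  let f : H →ₗ[𝕜] (H ⧸ Y) × (H ⧸ Z) × (H ⧸ Y) :=
    Y.mkQ.prod (Z.mkQ.prod (Y.mkQ ∘ₗ (T : H →ₗ[𝕜] H)))
  obtain ⟨S, hS, hle⟩ := exists_le_inf_ker_sup (fixedSpace J) f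
  have hbot : fixedSpace J ⊓ LinearMap.ker f = ⊥ := by
    rw [Submodule.eq_bot_iff]
    rintro x ⟨hx, hxf⟩
    simp only [f, LinearMap.ker_prod, Submodule.ker_mkQ, SetLike.mem_coe, Submodule.mem_inf,
      LinearMap.mem_ker, LinearMap.comp_apply, Submodule.mkQ_apply,
      Submodule.Quotient.mk_eq_zero] at hxf
    obtain ⟨hxY, hxZ, hTY⟩ := hxf
    have h1 : ‖T x‖ * ‖T x‖ ≤ c / 2 * ‖x‖ * ‖T x‖ := by
      have h2 := hY x hxY (T x) hTY
      rw [mem_fixedSpace.1 hx, ← inner_sub_left, ← hTx] at h2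
      have h3 : ‖⟪T x, T x⟫‖ = ‖T x‖ * ‖T x‖ := by
        rw [inner_self_eq_norm_sq_to_K, norm_pow, RCLike.norm_ofReal, abs_norm, pow_two]
      rwa [← h3]
    have h4 := hZ x hxZ
    by_contra h0
    have hx0 : 0 < ‖x‖ := norm_pos_iff.2 h0
    have hTpos : 0 < ‖T x‖ := lt_of_lt_of_le (mul_pos hc hx0) h4
    have h5 := le_of_mul_le_mul_right h1 hTpos
    have := mul_pos hc hx0
    linarith
  rw [hbot, bot_sup_eq] at hle
  exact Submodule.finiteDimensional_of_le hle

/-- Handles cut-offs `a ≥ 1`. Such a cut-off is admissible only if `A - 1` is Fredholm, which makes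
the fixed space of `J` finite dimensional. No positivity is then required, and negativity on the
other eigenspace only improves when `μ ≥ 0` is subtracted. -/
theorem IsReflectionModSmall.isDefiniteModFinite_of_gap {J A : H →L[𝕜] H}
    (h : IsReflectionModSmall J A) {a : ℝ} (ha : 0 < a) (hgap : IsSpectralGap A a) {μ : ℝ}
    (hμ : μ ∈ Icc 0 a) :
    IsDefiniteModFinite (fixedSpace J) (antifixedSpace J)
      (A - (μ : 𝕜) • ContinuousLinearMap.id 𝕜 H) := by
  rcases lt_or_ge a 1 with h1 | h1
  · exact h.isDefiniteModFinite ⟨by linarith [hμ.1], by linarith [hμ.2]⟩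
  · have hfd := h.finiteDimensional_fixedSpace (hgap.2.2 1 ⟨by linarith, h1⟩)
    obtain ⟨Y, hYc, hYf, hY⟩ := h.exists_small (1 / 2) (by norm_num)
    refine ⟨isSymmetric_sub_smul h.symm μ, 1 / 2, by norm_num, ⊥,
      antifixedSpace J ⊓ Y, isClosed_singleton, (isClosed_antifixedSpace J).inter hYc,
      bot_le, inf_le_left, ⟨_, hfd, le_sup_right⟩, exists_le_inf_sup, ?_, ?_⟩
    · intro x hx
      rw [(Submodule.mem_bot 𝕜).1 hx]
      simp [opForm]
    · rintro x ⟨hx, hxY⟩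
      have h1 := abs_le.1 (abs_opForm_sub_re_le (hY x hxY x hxY))
      rw [re_inner_of_mem_antifixedSpace hx] at h1
      rw [opForm_sub_smul]
      have h2 : 0 ≤ μ * ‖x‖ ^ 2 := mul_nonneg hμ.1 (by positivity)
      linarith

/-- The spectral flow of a path of operators that agree with `J` up to small forms exists, and is
the difference of the indices of the endpoints. -/
theorem spectralFlow_eq_index_sub {J : H →L[𝕜] H} (hJ : ∀ x, J (J x) = x) {A : ℝ → H →L[𝕜] H}
    (hcont : ContinuousOn A (Icc 0 1)) (hA : ∀ t ∈ Icc (0 : ℝ) 1, IsReflectionModSmall J (A t)) :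
    (∃ m, HasOperatorSpectralFlow A m) ∧ ∀ m, HasOperatorSpectralFlow A m →
      m = formIndex (fixedSpace J) (antifixedSpace J) (opForm (A 1))
        - formIndex (fixedSpace J) (antifixedSpace J) (opForm (A 0)) :=
  ⟨exists_hasOperatorSpectralFlow (isCompl_fixedSpace hJ) hcont
    fun t ht _ hμ => (hA t ht).isDefiniteModFinite hμ,
    fun _ h => h.eq_index_sub (isCompl_fixedSpace hJ) hcont
      fun t ht _ ha hgap _ hμ => (hA t ht).isDefiniteModFinite_of_gap ha hgap hμ⟩

theorem IsReflectionModSmall.isFredholm {J A : H →L[𝕜] H} (hJ : ∀ x, J (J x) = x)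
    (h : IsReflectionModSmall J A) : A.IsFredholm := by
  have := (h.isDefiniteModFinite (μ := 0) (by norm_num)).isFredholm (isCompl_fixedSpace hJ)
  simpa using this

end Reflection

end

open scoped Manifold ContDiff
open MeasureTheory

noncomputable section

section SobolevOperators

open Set

/-! ### Multiplication operators and gauge transformations on `H¹` -/

/-- Integration by parts for the product of a `C¹` function and a primitive. -/
theorem integral_deriv_smul_add_smul {F : Type*} [NormedAddCommGroup F] [NormedSpace ℝ F]
    [CompleteSpace F] {b b' : ℝ → ℝ} (hb : ∀ x, HasDerivAt b (b' x) x) (hb' : Continuous b')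
    {f : ℝ → F} {r : ℝ} (hf : IntervalIntegrable f volume 0 r) (c : F) :
    ∫ s in (0 : ℝ)..r, (b' s • (c + ∫ u in (0 : ℝ)..s, f u) + b s • f s)
      = b r • (c + ∫ u in (0 : ℝ)..r, f u) - b 0 • c := by
  have hbc : Continuous b := continuous_iff_continuousAt.2 fun x => (hb x).continuousAt
  have hprim : ContinuousOn (fun s => c + ∫ u in (0 : ℝ)..s, f u) (uIcc 0 r) :=
    continuousOn_const.add
      (intervalIntegral.continuousOn_primitive_interval (μ := volume)
        ((intervalIntegrable_iff').1 hf))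
  have hint : IntervalIntegrable (fun s => b' s • (c + ∫ u in (0 : ℝ)..s, f u) + b s • f s)
      volume 0 r :=
    (ContinuousOn.intervalIntegrable (hb'.continuousOn.smul hprim)).add
      (hf.continuousOn_smul hbc.continuousOn)
  have hreal : ∀ (f : ℝ → ℝ) (c : ℝ), IntervalIntegrable f volume 0 r →
      ∫ s in (0 : ℝ)..r, (b' s * (c + ∫ u in (0 : ℝ)..s, f u) + b s * f s)
      = b r * (c + ∫ u in (0 : ℝ)..r, f u) - b 0 * c := by
    intro f c hf
    have hbd : deriv b = b' := funext fun x => (hb x).deriv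
    have h1 : AbsolutelyContinuousOnInterval b 0 r := by
      refine ContDiffOn.absolutelyContinuousOnInterval (ContDiff.contDiffOn ?_)
      rw [contDiff_one_iff_deriv]
      exact ⟨fun x => (hb x).differentiableAt, by rwa [hbd]⟩
    have h2 : AbsolutelyContinuousOnInterval (fun s => c + ∫ u in (0 : ℝ)..s, f u) 0 r :=
      AbsolutelyContinuousOnInterval.add (f := fun _ => c)
        (ContDiffOn.absolutelyContinuousOnInterval contDiff_const.contDiffOn)
        (hf.absolutelyContinuousOnInterval_intervalIntegral left_mem_uIcc)
    have h3 := h1.integral_deriv_mul_eq_sub h2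
    rw [intervalIntegral.integral_same, add_zero] at h3
    rw [← h3]
    refine intervalIntegral.integral_congr_ae ?_
    filter_upwards [hf.ae_hasDerivAt_integral] with x hx hxr
    have h4 := (hx (uIoc_subset_uIcc hxr) 0 left_mem_uIcc).const_add c
    rw [h4.deriv, hbd]
  -- Vector-valued maps are reduced to scalars by testing with continuous functionals.
  refine (SeparatingDual.eq_iff_forall_dual_eq (R := ℝ)).2 fun φ => ?_
  have hφ : ∀ s ∈ uIcc 0 r, φ (∫ u in (0 : ℝ)..s, f u) = ∫ u in (0 : ℝ)..s, φ (f u) := fun s hs =>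
    (φ.intervalIntegral_comp_comm (hf.mono_set (uIcc_subset_uIcc_left hs))).symm
  rw [← φ.intervalIntegral_comp_comm hint, map_sub, map_smul, map_smul, map_add,
    hφ r right_mem_uIcc, smul_eq_mul, smul_eq_mul,
    ← hreal (fun u => φ (f u)) (φ c) ⟨φ.integrable_comp hf.1, φ.integrable_comp hf.2⟩]
  refine intervalIntegral.integral_congr fun s hs => ?_
  simp only [map_add, map_smul, smul_eq_mul]
  rw [hφ s hs]

variable {𝕜 : Type*} [RCLike 𝕜] {n : ℕ}

/-- A bound for the operator norm of a matrix. -/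
def matrixBound (A : Matrix (Fin n) (Fin n) ℝ) : ℝ := ∑ i, ∑ j, |A i j|

theorem continuous_matrixBound :
    Continuous (matrixBound : Matrix (Fin n) (Fin n) ℝ → ℝ) := by
  unfold matrixBound
  fun_prop

theorem norm_le_sum_norm (v : EuclideanSpace 𝕜 (Fin n)) : ‖v‖ ≤ ∑ i, ‖v i‖ := by
  have h : v = ∑ i, EuclideanSpace.single i (v i) := by
    ext j
    simp [Pi.single_apply]
  conv_lhs => rw [h]
  refine (norm_sum_le _ _).trans (Finset.sum_le_sum fun i _ => ?_)
  rw [PiLp.norm_single]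

@[simp] theorem realMatrixApply_apply (A : Matrix (Fin n) (Fin n) ℝ)
    (v : EuclideanSpace 𝕜 (Fin n)) (i : Fin n) :
    realMatrixApply A v i = ∑ j, (A i j : 𝕜) * v j := rfl

theorem norm_realMatrixApply_le (A : Matrix (Fin n) (Fin n) ℝ) (v : EuclideanSpace 𝕜 (Fin n)) :
    ‖realMatrixApply A v‖ ≤ matrixBound A * ‖v‖ := by
  refine (norm_le_sum_norm _).trans ?_
  rw [matrixBound, Finset.sum_mul]
  refine Finset.sum_le_sum fun i _ => ?_
  rw [Finset.sum_mul, realMatrixApply_apply]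
  refine (norm_sum_le _ _).trans (Finset.sum_le_sum fun j _ => ?_)
  rw [norm_mul, RCLike.norm_ofReal]
  gcongr
  exact PiLp.norm_apply_le v j

theorem realMatrixApply_add (A : Matrix (Fin n) (Fin n) ℝ) (v w : EuclideanSpace 𝕜 (Fin n)) :
    realMatrixApply A (v + w) = realMatrixApply A v + realMatrixApply A w := by
  ext i; simp [mul_add, Finset.sum_add_distrib]

theorem realMatrixApply_smul (A : Matrix (Fin n) (Fin n) ℝ) (a : 𝕜)
    (v : EuclideanSpace 𝕜 (Fin n)) : realMatrixApply A (a • v) = a • realMatrixApply A v := by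
  ext i
  simp only [realMatrixApply_apply, PiLp.smul_apply, smul_eq_mul, Finset.mul_sum]
  exact Finset.sum_congr rfl fun j _ => by ring

theorem realMatrixApply_sub_left (A B : Matrix (Fin n) (Fin n) ℝ) (v : EuclideanSpace 𝕜 (Fin n)) :
    realMatrixApply (A - B) v = realMatrixApply A v - realMatrixApply B v := by
  ext i; simp [sub_mul, Finset.sum_sub_distrib]

theorem realMatrixApply_add_left (A B : Matrix (Fin n) (Fin n) ℝ) (v : EuclideanSpace 𝕜 (Fin n)) :
    realMatrixApply (A + B) v = realMatrixApply A v + realMatrixApply B v := by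
  ext i; simp [add_mul, Finset.sum_add_distrib]

theorem realMatrixApply_mul (A B : Matrix (Fin n) (Fin n) ℝ) (v : EuclideanSpace 𝕜 (Fin n)) :
    realMatrixApply (A * B) v = realMatrixApply A (realMatrixApply B v) := by
  ext i
  simp only [realMatrixApply_apply, Matrix.mul_apply, Finset.mul_sum, RCLike.ofReal_sum,
    Finset.sum_mul, RCLike.ofReal_mul]
  rw [Finset.sum_comm]
  exact Finset.sum_congr rfl fun j _ => Finset.sum_congr rfl fun k _ => by ring

@[simp] theorem realMatrixApply_one (v : EuclideanSpace 𝕜 (Fin n)) :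
    realMatrixApply 1 v = v := by
  ext i
  simp only [realMatrixApply_apply, Matrix.one_apply]
  rw [Finset.sum_eq_single i]
  · simp
  · intro j _ h; simp [h.symm]
  · simp

@[simp] theorem realMatrixApply_zero_left (v : EuclideanSpace 𝕜 (Fin n)) :
    realMatrixApply 0 v = 0 := by
  ext i; simp

theorem continuous_realMatrixApply :
    Continuous fun p : Matrix (Fin n) (Fin n) ℝ × EuclideanSpace 𝕜 (Fin n) =>
      realMatrixApply p.1 p.2 := by
  unfold realMatrixApply
  refine (PiLp.continuous_toLp 2 _).comp (continuous_pi fun i => continuous_finsetSum _ fun j _ => ?_)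
  refine (RCLike.continuous_ofReal.comp ?_).mul ?_
  · exact (continuous_apply_apply i j).comp continuous_fst
  · exact (PiLp.continuous_apply 2 _ j).comp continuous_snd

theorem signForm_eq_inner (ε : Fin n → ℝ) (v w : EuclideanSpace 𝕜 (Fin n)) :
    signForm ε v w = inner 𝕜 w (realMatrixApply (Matrix.diagonal ε) v) := by
  rw [signForm, PiLp.inner_apply]
  refine Finset.sum_congr rfl fun i _ => ?_
  rw [realMatrixApply_apply, Finset.sum_eq_single i, RCLike.inner_apply]
  · simp
  · intro j _ h; simp [Matrix.diagonal_apply_ne _ h.symm]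
  · simp

variable (𝕜 n) in
/-- The space `L²([0, 1], 𝕜ⁿ)`. -/
abbrev UnitL2 : Type _ := Lp (EuclideanSpace 𝕜 (Fin n)) 2 unitMeasure

/-- A continuous family of matrices is bounded on `[0, 1]`. -/
theorem exists_matrixBound_le (m : C(ℝ, Matrix (Fin n) (Fin n) ℝ)) :
    ∃ C, 0 ≤ C ∧ ∀ r ∈ Icc (0 : ℝ) 1, matrixBound (m r) ≤ C := by
  obtain ⟨C, hC⟩ := isCompact_Icc.exists_bound_of_continuousOn (s := Icc (0 : ℝ) 1)
    (continuous_matrixBound.comp m.continuous).continuousOn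
  refine ⟨max C 0, le_max_right _ _, fun r hr => ?_⟩
  exact (le_abs_self _).trans ((hC r hr).trans (le_max_left _ _))

theorem ae_unitMeasure_mem : ∀ᵐ r ∂unitMeasure, r ∈ Icc (0 : ℝ) 1 :=
  ae_restrict_mem measurableSet_Icc

theorem memLp_realMatrixApply (m : C(ℝ, Matrix (Fin n) (Fin n) ℝ))
    {f : ℝ → EuclideanSpace 𝕜 (Fin n)} (hf : MemLp f 2 unitMeasure) :
    MemLp (fun r => realMatrixApply (m r) (f r)) 2 unitMeasure := by
  obtain ⟨C, -, hC⟩ := exists_matrixBound_le m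
  have : TopologicalSpace.PseudoMetrizableSpace (Matrix (Fin n) (Fin n) ℝ) :=
    inferInstanceAs (TopologicalSpace.PseudoMetrizableSpace (Fin n → Fin n → ℝ))
  have hm : AEStronglyMeasurable (fun r => (m r, f r)) unitMeasure :=
    m.continuous.aestronglyMeasurable.prodMk hf.aestronglyMeasurable
  have hmeas : AEStronglyMeasurable (fun r => realMatrixApply (m r) (f r)) unitMeasure :=
    continuous_realMatrixApply.comp_aestronglyMeasurable hm
  refine hf.of_le_mul (c := C) hmeas ?_
  filter_upwards [ae_unitMeasure_mem] with r hr
  exact (norm_realMatrixApply_le _ _).trans (by gcongr; exact hC r hr)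

/-- Multiplication by a continuous family of matrices, as a linear map of `L²`. -/
def matrixMulLinear (m : C(ℝ, Matrix (Fin n) (Fin n) ℝ)) : UnitL2 𝕜 n →ₗ[𝕜] UnitL2 𝕜 n where
  toFun f := (memLp_realMatrixApply m (Lp.memLp f)).toLp _
  map_add' f g := by
    ext1
    filter_upwards [(memLp_realMatrixApply m (Lp.memLp (f + g))).coeFn_toLp,
      (memLp_realMatrixApply m (Lp.memLp f)).coeFn_toLp,
      (memLp_realMatrixApply m (Lp.memLp g)).coeFn_toLp, Lp.coeFn_add f g,
      Lp.coeFn_add ((memLp_realMatrixApply m (Lp.memLp f)).toLp _)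
        ((memLp_realMatrixApply m (Lp.memLp g)).toLp _)] with r h1 h2 h3 h4 h5
    rw [h1, h5, Pi.add_apply, h2, h3, h4, Pi.add_apply, realMatrixApply_add]
  map_smul' a f := by
    ext1
    filter_upwards [(memLp_realMatrixApply m (Lp.memLp (a • f))).coeFn_toLp,
      (memLp_realMatrixApply m (Lp.memLp f)).coeFn_toLp, Lp.coeFn_smul a f,
      Lp.coeFn_smul a ((memLp_realMatrixApply m (Lp.memLp f)).toLp _)] with r h1 h2 h4 h5
    rw [h1, RingHom.id_apply, h5, Pi.smul_apply, h2, h4, Pi.smul_apply, realMatrixApply_smul]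

theorem matrixMulLinear_ae (m : C(ℝ, Matrix (Fin n) (Fin n) ℝ)) (f : UnitL2 𝕜 n) :
    ∀ᵐ r ∂unitMeasure, matrixMulLinear m f r = realMatrixApply (m r) (f r) :=
  (memLp_realMatrixApply m (Lp.memLp f)).coeFn_toLp

theorem norm_matrixMulLinear_le (m : C(ℝ, Matrix (Fin n) (Fin n) ℝ)) {C : ℝ}
    (hC : ∀ r ∈ Icc (0 : ℝ) 1, matrixBound (m r) ≤ C) (f : UnitL2 𝕜 n) :
    ‖matrixMulLinear m f‖ ≤ C * ‖f‖ := by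
  refine Lp.norm_le_mul_norm_of_ae_le_mul ?_
  filter_upwards [matrixMulLinear_ae m f, ae_unitMeasure_mem] with r h1 h2
  rw [h1]
  exact (norm_realMatrixApply_le _ _).trans (by gcongr; exact hC r h2)

/-- Multiplication by a continuous family of matrices, as an operator on `L²`. -/
def matrixMul (m : C(ℝ, Matrix (Fin n) (Fin n) ℝ)) : UnitL2 𝕜 n →L[𝕜] UnitL2 𝕜 n :=
  LinearMap.mkContinuous (matrixMulLinear m) (exists_matrixBound_le m).choose
    (norm_matrixMulLinear_le m (exists_matrixBound_le m).choose_spec.2)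

theorem matrixMul_ae (m : C(ℝ, Matrix (Fin n) (Fin n) ℝ)) (f : UnitL2 𝕜 n) :
    ∀ᵐ r ∂unitMeasure, matrixMul m f r = realMatrixApply (m r) (f r) :=
  matrixMulLinear_ae m f

theorem norm_matrixMul_apply_le (m : C(ℝ, Matrix (Fin n) (Fin n) ℝ)) {C : ℝ}
    (hC : ∀ r ∈ Icc (0 : ℝ) 1, matrixBound (m r) ≤ C) (f : UnitL2 𝕜 n) :
    ‖matrixMul m f‖ ≤ C * ‖f‖ :=
  norm_matrixMulLinear_le m hC f

theorem matrixMul_sub (m m' : C(ℝ, Matrix (Fin n) (Fin n) ℝ)) :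
    (matrixMul m - matrixMul m' : UnitL2 𝕜 n →L[𝕜] UnitL2 𝕜 n) = matrixMul (m - m') := by
  ext1 f
  ext1
  filter_upwards [matrixMul_ae m f, matrixMul_ae m' f, matrixMul_ae (m - m') f,
    Lp.coeFn_sub (matrixMul m f) (matrixMul m' f)] with r h1 h2 h3 h4
  rw [sub_apply, h4, Pi.sub_apply, h1, h2, h3, ContinuousMap.sub_apply,
    realMatrixApply_sub_left]

/-! ### Point evaluation -/

theorem SobolevH1.eval_of_mem (V : SobolevH1 𝕜 n) {r : ℝ} (hr : r ∈ Icc (0 : ℝ) 1) :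
    V.eval r = V.fst + ∫ s in (0 : ℝ)..r, V.deriv s := by
  have h : unitMeasure.restrict (Ioc 0 r) = volume.restrict (Ioc 0 r) := by
    rw [Measure.restrict_restrict measurableSet_Ioc,
      inter_eq_self_of_subset_left (Ioc_subset_Icc_self.trans (Icc_subset_Icc_right hr.2))]
  rw [SobolevH1.eval, intervalIntegral.integral_of_le hr.1, intervalIntegral.integral_of_le hr.1, h]

@[simp] theorem SobolevH1.eval_zero_right (V : SobolevH1 𝕜 n) : V.eval 0 = V.fst := by
  simp [SobolevH1.eval]

theorem SobolevH1.intervalIntegrable_volume (V : SobolevH1 𝕜 n) {r s : ℝ}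
    (hr : r ∈ Icc (0 : ℝ) 1) (hs : s ∈ Icc (0 : ℝ) 1) :
    IntervalIntegrable V.deriv volume r s := by
  have h : IntegrableOn V.deriv (Icc 0 1) volume :=
    (Lp.memLp V.deriv).integrable (by norm_num)
  exact (h.mono_set (uIcc_subset_Icc hr hs)).intervalIntegrable

theorem SobolevH1.continuous_eval (V : SobolevH1 𝕜 n) : Continuous V.eval := by
  refine continuous_const.add (intervalIntegral.continuous_primitive (fun a b => ?_) 0)
  exact ((Lp.memLp V.deriv).integrable (by norm_num)).intervalIntegrable

/-- Cauchy–Schwarz: the squared norm of the integral `I` is the inner product of `f` with `I` times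
the indicator of `S`. -/
theorem norm_setIntegral_le_sqrt (f : UnitL2 𝕜 n) {S : Set ℝ} (hS : MeasurableSet S) :
    ‖∫ x in S, f x ∂unitMeasure‖ ≤ Real.sqrt (unitMeasure.real S) * ‖f‖ := by
  set I := ∫ x in S, f x ∂unitMeasure with hI
  have h := L2.inner_indicatorConstLp_eq_inner_setIntegral 𝕜 hS (measure_ne_top unitMeasure S) I f
  have h1 : ‖I‖ ^ 2 ≤ ‖I‖ * Real.sqrt (unitMeasure.real S) * ‖f‖ := by
    have h2 : ‖inner 𝕜 I I‖ = ‖I‖ ^ 2 := by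
      rw [inner_self_eq_norm_sq_to_K, norm_pow, RCLike.norm_ofReal, abs_norm]
    rw [← h2, ← h]
    refine (norm_inner_le_norm _ _).trans ?_
    rw [norm_indicatorConstLp (by norm_num) (by norm_num), Real.sqrt_eq_rpow]
    norm_num
  rcases eq_or_lt_of_le (norm_nonneg I) with h0 | h0
  · rw [← h0]; positivity
  · refine le_of_mul_le_mul_left ?_ h0
    calc ‖I‖ * ‖I‖ = ‖I‖ ^ 2 := (pow_two _).symm
      _ ≤ _ := h1
      _ = _ := by ring

/-- The Hölder estimate of exponent `1 / 2`, which makes a map small once it vanishes on a fine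
grid. -/
theorem SobolevH1.norm_eval_sub_le (V : SobolevH1 𝕜 n) {r s : ℝ} (hrs : r ≤ s) :
    ‖V.eval s - V.eval r‖ ≤ Real.sqrt (s - r) * ‖V.deriv‖ := by
  have h : V.eval s - V.eval r = ∫ x in Ioc r s, V.deriv x ∂unitMeasure := by
    rw [SobolevH1.eval, SobolevH1.eval, add_sub_add_left_eq_sub,
      intervalIntegral.integral_interval_sub_left (V.intervalIntegrable_deriv s)
        (V.intervalIntegrable_deriv r), intervalIntegral.integral_of_le hrs]
  rw [h]
  refine (norm_setIntegral_le_sqrt V.deriv measurableSet_Ioc).trans ?_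
  gcongr
  calc unitMeasure.real (Ioc r s) ≤ volume.real (Ioc r s) :=
        ENNReal.toReal_mono (by simp) (Measure.restrict_apply_le _ _)
    _ = s - r := by simp [hrs]

theorem SobolevH1.norm_fst_le (V : SobolevH1 𝕜 n) : ‖V.fst‖ ≤ ‖V‖ := by
  have := WithLp.prod_norm_sq_eq_of_L2 V
  exact (sq_le_sq₀ (norm_nonneg _) (norm_nonneg _)).1 (by nlinarith [sq_nonneg ‖V.snd‖])

theorem SobolevH1.norm_deriv_le (V : SobolevH1 𝕜 n) : ‖V.deriv‖ ≤ ‖V‖ := by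
  have := WithLp.prod_norm_sq_eq_of_L2 V
  exact (sq_le_sq₀ (norm_nonneg _) (norm_nonneg _)).1
    (by rw [SobolevH1.deriv]; nlinarith [sq_nonneg ‖V.fst‖])

theorem SobolevH1.norm_eval_le (V : SobolevH1 𝕜 n) {r : ℝ} (hr : r ∈ Icc (0 : ℝ) 1) :
    ‖V.eval r‖ ≤ 2 * ‖V‖ := by
  have h1 := V.norm_eval_sub_le hr.1
  rw [sub_zero, SobolevH1.eval_zero_right] at h1
  have h2 : Real.sqrt r * ‖V.deriv‖ ≤ 1 * ‖V‖ := by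
    gcongr
    · exact Real.sqrt_le_one.2 hr.2
    · exact V.norm_deriv_le
  have h3 := norm_add_le (V.eval r - V.fst) V.fst
  rw [sub_add_cancel] at h3
  linarith [V.norm_fst_le]

variable (𝕜 n) in
/-- The weak derivative as an operator. -/
def derivL : SobolevH1 𝕜 n →L[𝕜] UnitL2 𝕜 n :=
  WithLp.sndL 2 𝕜 (EuclideanSpace 𝕜 (Fin n)) (UnitL2 𝕜 n)

/-- Point evaluation as an operator. -/
def evalL (r : ℝ) (hr : r ∈ Icc (0 : ℝ) 1) :
    SobolevH1 𝕜 n →L[𝕜] EuclideanSpace 𝕜 (Fin n) :=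
  LinearMap.mkContinuous
    { toFun := fun V => V.eval r
      map_add' := fun V W => V.eval_add W r
      map_smul' := fun a V => V.eval_smul a r } 2 fun V => V.norm_eval_le hr

@[simp] theorem evalL_apply (r : ℝ) (hr : r ∈ Icc (0 : ℝ) 1) (V : SobolevH1 𝕜 n) :
    evalL r hr V = V.eval r := rfl

theorem SobolevH1.memLp_eval (V : SobolevH1 𝕜 n) : MemLp V.eval 2 unitMeasure := by
  refine MemLp.of_bound V.continuous_eval.aestronglyMeasurable (2 * ‖V‖) ?_
  filter_upwards [ae_unitMeasure_mem] with r hr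
  exact V.norm_eval_le hr

theorem norm_le_of_ae_unit {f : UnitL2 𝕜 n} {C : ℝ} (hC : 0 ≤ C)
    (h : ∀ᵐ r ∂unitMeasure, ‖f r‖ ≤ C) : ‖f‖ ≤ C := by
  have := Lp.norm_le_of_ae_bound hC h
  simpa [measureUnivNNReal, unitMeasure] using this

variable (𝕜 n) in
/-- The inclusion of `H¹` into `L²`. -/
def inclL : SobolevH1 𝕜 n →L[𝕜] UnitL2 𝕜 n :=
  LinearMap.mkContinuous
    { toFun := fun V => V.memLp_eval.toLp V.eval
      map_add' := fun V W => by
        rw [← MemLp.toLp_add]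
        exact MemLp.toLp_congr _ _ (Filter.Eventually.of_forall fun r => V.eval_add W r)
      map_smul' := fun a V => by
        rw [RingHom.id_apply, ← MemLp.toLp_const_smul]
        exact MemLp.toLp_congr _ _ (Filter.Eventually.of_forall fun r => V.eval_smul a r) } 2
    fun V => norm_le_of_ae_unit (by positivity) (by
      filter_upwards [V.memLp_eval.coeFn_toLp, ae_unitMeasure_mem] with r h1 h2
      exact (congrArg norm h1).trans_le (V.norm_eval_le h2))

theorem inclL_ae (V : SobolevH1 𝕜 n) : ∀ᵐ r ∂unitMeasure, inclL 𝕜 n V r = V.eval r :=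
  V.memLp_eval.coeFn_toLp

theorem norm_inclL_le {V : SobolevH1 𝕜 n} {C : ℝ} (hC : 0 ≤ C)
    (h : ∀ r ∈ Icc (0 : ℝ) 1, ‖V.eval r‖ ≤ C) : ‖inclL 𝕜 n V‖ ≤ C := by
  refine norm_le_of_ae_unit hC ?_
  filter_upwards [inclL_ae V, ae_unitMeasure_mem] with r h1 h2
  rw [h1]; exact h r h2

/-! ### Gauge transformations -/

/-- The map `V ↦ a V` for a `C¹` family of matrices `a` with derivative `a'`. -/
def gaugeL (a a' : C(ℝ, Matrix (Fin n) (Fin n) ℝ)) : SobolevH1 𝕜 n →L[𝕜] SobolevH1 𝕜 n :=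
  ((WithLp.prodContinuousLinearEquiv 2 𝕜 (EuclideanSpace 𝕜 (Fin n)) (UnitL2 𝕜 n)).symm :
    _ →L[𝕜] SobolevH1 𝕜 n) ∘L
  ContinuousLinearMap.prod
    ((LinearMap.toContinuousLinearMap
      { toFun := realMatrixApply (a 0)
        map_add' := realMatrixApply_add (a 0)
        map_smul' := realMatrixApply_smul (a 0) } :
      EuclideanSpace 𝕜 (Fin n) →L[𝕜] EuclideanSpace 𝕜 (Fin n)) ∘L
      WithLp.fstL 2 𝕜 (EuclideanSpace 𝕜 (Fin n)) (UnitL2 𝕜 n))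
    (matrixMul a' ∘L inclL 𝕜 n + matrixMul a ∘L derivL 𝕜 n)

theorem gaugeL_fst (a a' : C(ℝ, Matrix (Fin n) (Fin n) ℝ)) (V : SobolevH1 𝕜 n) :
    (gaugeL a a' V).fst = realMatrixApply (a 0) V.fst := rfl

theorem gaugeL_deriv (a a' : C(ℝ, Matrix (Fin n) (Fin n) ℝ)) (V : SobolevH1 𝕜 n) :
    ∀ᵐ r ∂unitMeasure, (gaugeL a a' V).deriv r
      = realMatrixApply (a' r) (V.eval r) + realMatrixApply (a r) (V.deriv r) := by
  have h : (gaugeL a a' V).deriv = matrixMul a' (inclL 𝕜 n V) + matrixMul a V.deriv := rfl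
  rw [h]
  filter_upwards [Lp.coeFn_add (matrixMul a' (inclL 𝕜 n V)) (matrixMul a V.deriv),
    matrixMul_ae a' (inclL 𝕜 n V), matrixMul_ae a V.deriv, inclL_ae V] with r h1 h2 h3 h4
  rw [h1, Pi.add_apply, h2, h3, h4]

/-- `gaugeL` is defined through the initial value `a(0) V(0)` and the derivative `a' V + a V'`.
Integrating the product rule coordinate by coordinate recovers the pointwise product. -/
theorem gaugeL_eval {a a' : C(ℝ, Matrix (Fin n) (Fin n) ℝ)}
    (ha : ∀ r i j, HasDerivAt (fun s => a s i j) (a' r i j) r) (V : SobolevH1 𝕜 n) {r : ℝ}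
    (hr : r ∈ Icc (0 : ℝ) 1) :
    (gaugeL a a' V).eval r = realMatrixApply (a r) (V.eval r) := by
  have h0 : (0 : ℝ) ∈ Icc (0 : ℝ) 1 := left_mem_Icc.2 zero_le_one
  have hsub : uIoc 0 r ⊆ Icc (0 : ℝ) 1 :=
    uIoc_subset_uIcc.trans (uIcc_subset_Icc h0 hr)
  have haij : ∀ i j, Continuous fun s => a s i j := fun i j =>
    (continuous_apply_apply i j).comp a.continuous
  have ha'ij : ∀ i j, Continuous fun s => a' s i j := fun i j =>
    (continuous_apply_apply i j).comp a'.continuous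
  have hVi : ∀ j, IntervalIntegrable (fun s => V.deriv s j) volume 0 r := fun j =>
    ⟨(EuclideanSpace.proj j : EuclideanSpace 𝕜 (Fin n) →L[𝕜] 𝕜).integrable_comp
      (V.intervalIntegrable_volume h0 hr).1,
     (EuclideanSpace.proj j : EuclideanSpace 𝕜 (Fin n) →L[𝕜] 𝕜).integrable_comp
      (V.intervalIntegrable_volume h0 hr).2⟩
  have hcomp : ∀ (W : SobolevH1 𝕜 n) (j : Fin n) {s : ℝ}, s ∈ Icc (0 : ℝ) 1 →
      W.eval s j = W.fst j + ∫ u in (0 : ℝ)..s, W.deriv u j := by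
    intro W j s hs
    rw [W.eval_of_mem hs, PiLp.add_apply]
    congr 1
    exact ((EuclideanSpace.proj j : EuclideanSpace 𝕜 (Fin n) →L[𝕜] 𝕜).intervalIntegral_comp_comm
      (W.intervalIntegrable_volume h0 hs)).symm
  ext i
  rw [hcomp _ i hr, gaugeL_fst, realMatrixApply_apply, realMatrixApply_apply]
  have hae : ∀ᵐ s ∂volume, s ∈ uIoc 0 r → (gaugeL a a' V).deriv s i
      = ∑ j, (a' s i j • (V.fst j + ∫ u in (0 : ℝ)..s, V.deriv u j) + a s i j • V.deriv s j) := by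
    have := (ae_restrict_iff' measurableSet_Icc).1 (gaugeL_deriv a a' V)
    filter_upwards [this] with s hs hsr
    rw [hs (hsub hsr), PiLp.add_apply, realMatrixApply_apply, realMatrixApply_apply,
      ← Finset.sum_add_distrib]
    refine Finset.sum_congr rfl fun j _ => ?_
    rw [hcomp V j (hsub hsr), RCLike.real_smul_eq_coe_mul, RCLike.real_smul_eq_coe_mul]
  rw [intervalIntegral.integral_congr_ae hae, intervalIntegral.integral_finsetSum]
  · rw [← Finset.sum_add_distrib]
    refine Finset.sum_congr rfl fun j _ => ?_
    rw [integral_deriv_smul_add_smul (fun x => ha x i j) (ha'ij i j) (hVi j), hcomp V j hr,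
      RCLike.real_smul_eq_coe_mul, RCLike.real_smul_eq_coe_mul]
    ring
  · intro j _
    refine IntervalIntegrable.add ?_ ((hVi j).continuousOn_smul (haij i j).continuousOn)
    refine ContinuousOn.intervalIntegrable ((ha'ij i j).continuousOn.smul ?_)
    refine (((PiLp.continuous_apply 2 _ j).comp V.continuous_eval).continuousOn).congr fun s hs => ?_
    exact (hcomp V j (uIcc_subset_Icc h0 hr hs)).symm

end SobolevOperators

end

open scoped Manifold ContDiff
open MeasureTheory

noncomputable section

section IndexOperators

open Set Matrix

variable {𝕜 : Type*} [RCLike 𝕜] {n : ℕ}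

/-! ### Elements of `H¹` are determined by their values -/

theorem SobolevH1.ext_deriv {V W : SobolevH1 𝕜 n} (h0 : V.fst = W.fst)
    (h : ∀ᵐ r ∂unitMeasure, V.deriv r = W.deriv r) : V = W := by
  apply (WithLp.prodContinuousLinearEquiv 2 𝕜 (EuclideanSpace 𝕜 (Fin n)) (UnitL2 𝕜 n)).injective
  exact Prod.ext h0 (Lp.ext h)

theorem SobolevH1.eval_sub (V W : SobolevH1 𝕜 n) (r : ℝ) :
    (V - W).eval r = V.eval r - W.eval r := by
  have := (V - W).eval_add W r
  rw [sub_add_cancel] at this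
  rw [this, add_sub_cancel_right]

/-- By Lebesgue differentiation the weak derivative is almost everywhere the derivative of the
values. Identities in `H¹` can therefore be checked pointwise, which is used for all the
isomorphisms constructed later. -/
theorem SobolevH1.eq_zero_of_eval {V : SobolevH1 𝕜 n} (h : ∀ r ∈ Icc (0 : ℝ) 1, V.eval r = 0) :
    V = 0 := by
  have h0 : (0 : ℝ) ∈ Icc (0 : ℝ) 1 := left_mem_Icc.2 zero_le_one
  have h1 : (1 : ℝ) ∈ Icc (0 : ℝ) 1 := right_mem_Icc.2 zero_le_one
  have hfst : V.fst = 0 := by rw [← V.eval_zero_right]; exact h 0 h0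
  refine SobolevH1.ext_deriv hfst ?_
  have hae := (V.intervalIntegrable_volume h0 h1).ae_hasDerivAt_integral
  have hne : ∀ᵐ r ∂(volume : Measure ℝ), r ≠ 0 ∧ r ≠ 1 :=
    Filter.Eventually.and (compl_mem_ae_iff.2 (measure_singleton (0 : ℝ)))
      (compl_mem_ae_iff.2 (measure_singleton (1 : ℝ)))
  have hz : ∀ᵐ r ∂unitMeasure, (0 : SobolevH1 𝕜 n).deriv r = 0 :=
    Lp.coeFn_zero (EuclideanSpace 𝕜 (Fin n)) 2 unitMeasure
  filter_upwards [ae_restrict_of_ae hae, ae_restrict_of_ae hne, ae_unitMeasure_mem, hz]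
    with r hr hr' hr1 hr2
  rw [hr2]
  rw [uIcc_of_le zero_le_one] at hr
  have h3 := hr hr1 0 h0
  have hmem : Ioo (0 : ℝ) 1 ∈ nhds r :=
    Ioo_mem_nhds (lt_of_le_of_ne hr1.1 hr'.1.symm) (lt_of_le_of_ne hr1.2 hr'.2)
  have h4 : (fun x => ∫ s in (0 : ℝ)..x, V.deriv s) =ᶠ[nhds r] fun _ => 0 := by
    filter_upwards [hmem] with x hx
    have := h x (Ioo_subset_Icc_self hx)
    rwa [V.eval_of_mem (Ioo_subset_Icc_self hx), hfst, zero_add] at this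
  exact h3.unique ((hasDerivAt_const r _).congr_of_eventuallyEq h4)

theorem SobolevH1.ext_eval {V W : SobolevH1 𝕜 n}
    (h : ∀ r ∈ Icc (0 : ℝ) 1, V.eval r = W.eval r) : V = W :=
  sub_eq_zero.1 (SobolevH1.eq_zero_of_eval fun r hr => by rw [SobolevH1.eval_sub, h r hr, sub_self])

theorem SobolevH1.inner_eq (V W : SobolevH1 𝕜 n) :
    inner 𝕜 V W = inner 𝕜 V.fst W.fst + inner 𝕜 V.deriv W.deriv :=
  WithLp.prod_inner_apply V W

/-! ### The operators representing the index forms -/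

theorem mem_twistedH1 {z : 𝕜} {V : SobolevH1 𝕜 n} :
    V ∈ twistedH1 𝕜 n z ↔ V.eval 1 = z • V.eval 0 := Iff.rfl

theorem isClosed_twistedH1 (z : 𝕜) : IsClosed (twistedH1 𝕜 n z : Set (SobolevH1 𝕜 n)) :=
  isClosed_eq (evalL 1 (right_mem_Icc.2 zero_le_one)).continuous
    ((evalL 0 (left_mem_Icc.2 zero_le_one)).continuous.const_smul z)

instance (z : 𝕜) : CompleteSpace (twistedH1 𝕜 n z) :=
  (isClosed_twistedH1 z).completeSpace_coe

/-- The operator `V ↦ V' + Γ V`. -/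
def covL (Γ : C(ℝ, Matrix (Fin n) (Fin n) ℝ)) : SobolevH1 𝕜 n →L[𝕜] UnitL2 𝕜 n :=
  derivL 𝕜 n + matrixMul Γ ∘L inclL 𝕜 n

theorem covL_apply (Γ : C(ℝ, Matrix (Fin n) (Fin n) ℝ)) (V : SobolevH1 𝕜 n) :
    covL Γ V = V.deriv + matrixMul Γ (inclL 𝕜 n V) := rfl

theorem covL_ae (Γ : C(ℝ, Matrix (Fin n) (Fin n) ℝ)) (V : SobolevH1 𝕜 n) :
    ∀ᵐ r ∂unitMeasure, covL Γ V r = V.deriv r + realMatrixApply (Γ r) (V.eval r) := by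
  filter_upwards [Lp.coeFn_add V.deriv (matrixMul Γ (inclL 𝕜 n V)),
    matrixMul_ae Γ (inclL 𝕜 n V), inclL_ae V] with r h1 h2 h3
  rw [covL_apply, h1, Pi.add_apply, h2, h3]

/-- The constant family `diag(ε)`. -/
def constDiag (ε : Fin n → ℝ) : C(ℝ, Matrix (Fin n) (Fin n) ℝ) :=
  ContinuousMap.const ℝ (diagonal ε)

@[simp] theorem constDiag_apply (ε : Fin n → ℝ) (r : ℝ) : constDiag ε r = diagonal ε := rfl

/-- The family `diag(ε) R`. -/
def diagMul (ε : Fin n → ℝ) (R : C(ℝ, Matrix (Fin n) (Fin n) ℝ)) :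
    C(ℝ, Matrix (Fin n) (Fin n) ℝ) :=
  ⟨fun r => diagonal ε * R r, by fun_prop⟩

@[simp] theorem diagMul_apply (ε : Fin n → ℝ) (R : C(ℝ, Matrix (Fin n) (Fin n) ℝ)) (r : ℝ) :
    diagMul ε R r = diagonal ε * R r := rfl

/-- The form `∫ G(V' + Γ V, W' + Γ W) + G(R V, W)`. -/
def staticForm (ε : Fin n → ℝ) (Γ R : C(ℝ, Matrix (Fin n) (Fin n) ℝ)) (V W : SobolevH1 𝕜 n) : 𝕜 :=
  inner 𝕜 (covL Γ W) (matrixMul (constDiag ε) (covL Γ V))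
    + inner 𝕜 (inclL 𝕜 n W) (matrixMul (diagMul ε R) (inclL 𝕜 n V))

theorem inner_matrixMul_right (m : C(ℝ, Matrix (Fin n) (Fin n) ℝ)) (f g : UnitL2 𝕜 n) :
    inner 𝕜 g (matrixMul m f) = ∫ r, inner 𝕜 (g r) (realMatrixApply (m r) (f r)) ∂unitMeasure := by
  rw [L2.inner_def]
  refine integral_congr_ae ?_
  filter_upwards [matrixMul_ae m f] with r h
  rw [h]

theorem integrable_inner_matrixMul (m : C(ℝ, Matrix (Fin n) (Fin n) ℝ)) (f g : UnitL2 𝕜 n) :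
    Integrable (fun r => inner 𝕜 (g r) (realMatrixApply (m r) (f r))) unitMeasure := by
  refine (L2.integrable_inner (𝕜 := 𝕜) g (matrixMul m f)).congr ?_
  filter_upwards [matrixMul_ae m f] with r h
  rw [h]

theorem inner_realMatrixApply_of_isSymm {A : Matrix (Fin n) (Fin n) ℝ} (hA : A.IsSymm)
    (v w : EuclideanSpace 𝕜 (Fin n)) :
    inner 𝕜 (realMatrixApply A v) w = inner 𝕜 v (realMatrixApply A w) := by
  simp only [PiLp.inner_apply, RCLike.inner_apply, realMatrixApply_apply, map_sum, map_mul,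
    RCLike.conj_ofReal, Finset.sum_mul, Finset.mul_sum]
  rw [Finset.sum_comm]
  refine Finset.sum_congr rfl fun i _ => Finset.sum_congr rfl fun j _ => ?_
  rw [hA.apply i j]
  ring

theorem inner_matrixMul_of_isSymm {m : C(ℝ, Matrix (Fin n) (Fin n) ℝ)} (hm : ∀ r, (m r).IsSymm)
    (f g : UnitL2 𝕜 n) : inner 𝕜 (matrixMul m f) g = inner 𝕜 f (matrixMul m g) := by
  rw [L2.inner_def, L2.inner_def]
  refine integral_congr_ae ?_
  filter_upwards [matrixMul_ae m f, matrixMul_ae m g] with r h1 h2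
  rw [h1, h2, inner_realMatrixApply_of_isSymm (hm r)]

theorem staticForm_eq_integral (ε : Fin n → ℝ) (Γ R : C(ℝ, Matrix (Fin n) (Fin n) ℝ))
    (V W : SobolevH1 𝕜 n) :
    staticForm ε Γ R V W = ∫ r in (0 : ℝ)..1,
      (signForm ε (V.deriv r + realMatrixApply (Γ r) (V.eval r))
          (W.deriv r + realMatrixApply (Γ r) (W.eval r))
        + signForm ε (realMatrixApply (R r) (V.eval r)) (W.eval r)) := by
  rw [staticForm, inner_matrixMul_right, inner_matrixMul_right,
    ← integral_add (integrable_inner_matrixMul _ _ _) (integrable_inner_matrixMul _ _ _),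
    intervalIntegral.integral_of_le zero_le_one, ← integral_Icc_eq_integral_Ioc]
  refine integral_congr_ae ?_
  filter_upwards [covL_ae Γ V, covL_ae Γ W, inclL_ae V, inclL_ae W] with r h1 h2 h3 h4
  rw [h1, h2, h3, h4, constDiag_apply, diagMul_apply, realMatrixApply_mul, ← signForm_eq_inner,
    ← signForm_eq_inner]

theorem realMatrixApply_smul_left (c : ℝ) (A : Matrix (Fin n) (Fin n) ℝ)
    (v : EuclideanSpace 𝕜 (Fin n)) : realMatrixApply (c • A) v = (c : 𝕜) • realMatrixApply A v := by
  ext i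
  simp only [realMatrixApply_apply, Matrix.smul_apply, PiLp.smul_apply, smul_eq_mul,
    RCLike.ofReal_mul, Finset.mul_sum, mul_assoc]

theorem signForm_add_left (ε : Fin n → ℝ) (u v w : EuclideanSpace 𝕜 (Fin n)) :
    signForm ε (u + v) w = signForm ε u w + signForm ε v w := by
  rw [signForm_eq_inner, realMatrixApply_add, inner_add_right, ← signForm_eq_inner,
    ← signForm_eq_inner]

theorem signForm_add_right (ε : Fin n → ℝ) (u v w : EuclideanSpace 𝕜 (Fin n)) :
    signForm ε w (u + v) = signForm ε w u + signForm ε w v := by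
  rw [signForm_eq_inner, inner_add_left, ← signForm_eq_inner, ← signForm_eq_inner]

theorem signForm_smul_left (ε : Fin n → ℝ) (c : 𝕜) (v w : EuclideanSpace 𝕜 (Fin n)) :
    signForm ε (c • v) w = c * signForm ε v w := by
  rw [signForm_eq_inner, realMatrixApply_smul, inner_smul_right, ← signForm_eq_inner]

theorem signForm_smul_right (ε : Fin n → ℝ) (c : 𝕜) (v w : EuclideanSpace 𝕜 (Fin n)) :
    signForm ε v (c • w) = star c * signForm ε v w := by
  rw [signForm_eq_inner, inner_smul_left, ← signForm_eq_inner]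
  rfl

/-- The family `r ↦ c • m (t r)`. -/
def rescale (c t : ℝ) (m : C(ℝ, Matrix (Fin n) (Fin n) ℝ)) : C(ℝ, Matrix (Fin n) (Fin n) ℝ) :=
  ⟨fun r => c • m (t * r), by fun_prop⟩

@[simp] theorem rescale_apply (c t : ℝ) (m : C(ℝ, Matrix (Fin n) (Fin n) ℝ)) (r : ℝ) :
    rescale c t m r = c • m (t * r) := rfl

/-- The first four terms complete to `G(V' + tΓV, W' + tΓW)`. Every `B_t` is thus of one and the
same shape, with coefficients `tΓ(tr)` and `t²R(tr)`; these vanish at `t = 0` and are the original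
ones at `t = 1`. -/
theorem pathForm_eq_staticForm (ε : Fin n → ℝ) (Γ R : C(ℝ, Matrix (Fin n) (Fin n) ℝ)) (t : ℝ)
    (V W : SobolevH1 𝕜 n) :
    pathForm ε Γ R t V W = staticForm ε (rescale t t Γ) (rescale (t ^ 2) t R) V W := by
  rw [pathForm, staticForm_eq_integral]
  refine intervalIntegral.integral_congr fun r _ => ?_
  simp only [rescale_apply, realMatrixApply_smul_left, signForm_add_left, signForm_add_right,
    signForm_smul_left, signForm_smul_right, RCLike.star_def, RCLike.conj_ofReal, RCLike.ofReal_pow]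
  ring

section Pullback

variable {H E : Type*} [NormedAddCommGroup H] [InnerProductSpace 𝕜 H] [CompleteSpace H]
  [NormedAddCommGroup E] [InnerProductSpace 𝕜 E] [CompleteSpace E]

/-- The operator representing `⟨D W, S D V⟩ + ⟨ι W, Q ι V⟩`. -/
def pullbackOp (D ι : H →L[𝕜] E) (S Q : E →L[𝕜] E) : H →L[𝕜] H :=
  D.adjoint ∘L (S ∘L D) + ι.adjoint ∘L (Q ∘L ι)

theorem inner_pullbackOp (D ι : H →L[𝕜] E) (S Q : E →L[𝕜] E) (V W : H) :
    inner 𝕜 W (pullbackOp D ι S Q V)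
      = inner 𝕜 (D W) (S (D V)) + inner 𝕜 (ι W) (Q (ι V)) := by
  rw [pullbackOp, _root_.add_apply, inner_add_right, ContinuousLinearMap.comp_apply,
    ContinuousLinearMap.adjoint_inner_right, ContinuousLinearMap.comp_apply,
    ContinuousLinearMap.comp_apply, ContinuousLinearMap.adjoint_inner_right,
    ContinuousLinearMap.comp_apply]

theorem continuous_pullbackOp {X : Type*} [TopologicalSpace X] {D : X → H →L[𝕜] E}
    (hD : Continuous D) (ι : H →L[𝕜] E) (S : E →L[𝕜] E) {Q : X → E →L[𝕜] E}
    (hQ : Continuous Q) : Continuous fun x => pullbackOp (D x) ι S (Q x) :=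
  ((ContinuousLinearMap.adjoint.continuous.comp hD).clm_comp
    (continuous_const.clm_comp hD)).add
    (continuous_const.clm_comp (hQ.clm_comp continuous_const))

end Pullback

/-- The operator `V ↦ V' + Γ V` on `{V : V(1) = z V(0)}`. -/
def twistedCovL (z : 𝕜) (Γ : C(ℝ, Matrix (Fin n) (Fin n) ℝ)) : twistedH1 𝕜 n z →L[𝕜] UnitL2 𝕜 n :=
  covL Γ ∘L (twistedH1 𝕜 n z).subtypeL

/-- The inclusion of `{V : V(1) = z V(0)}` into `L²`. -/
def twistedInclL (z : 𝕜) : twistedH1 𝕜 n z →L[𝕜] UnitL2 𝕜 n :=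
  inclL 𝕜 n ∘L (twistedH1 𝕜 n z).subtypeL

/-- The operator representing `staticForm` on `{V : V(1) = z V(0)}`. -/
def indexOp (z : 𝕜) (ε : Fin n → ℝ) (Γ R : C(ℝ, Matrix (Fin n) (Fin n) ℝ)) :
    twistedH1 𝕜 n z →L[𝕜] twistedH1 𝕜 n z :=
  pullbackOp (H := twistedH1 𝕜 n z) (E := UnitL2 𝕜 n) (twistedCovL z Γ) (twistedInclL z)
    (matrixMul (constDiag ε)) (matrixMul (diagMul ε R))

theorem inner_indexOp (z : 𝕜) (ε : Fin n → ℝ) (Γ R : C(ℝ, Matrix (Fin n) (Fin n) ℝ))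
    (V W : twistedH1 𝕜 n z) :
    inner 𝕜 W (indexOp z ε Γ R V) = staticForm ε Γ R (V : SobolevH1 𝕜 n) (W : SobolevH1 𝕜 n) :=
  inner_pullbackOp _ _ _ _ _ _

theorem staticForm_conj {ε : Fin n → ℝ} {Γ R : C(ℝ, Matrix (Fin n) (Fin n) ℝ)}
    (hR : ∀ r, (diagonal ε * R r).IsSymm) (V W : SobolevH1 𝕜 n) :
    starRingEnd 𝕜 (staticForm ε Γ R V W) = staticForm ε Γ R W V := by
  rw [staticForm, map_add, inner_conj_symm, inner_conj_symm, inner_matrixMul_of_isSymm,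
    inner_matrixMul_of_isSymm hR, staticForm]
  exact fun r => isSymm_diagonal ε

theorem indexOp_isSymmetric (z : 𝕜) {ε : Fin n → ℝ} {Γ R : C(ℝ, Matrix (Fin n) (Fin n) ℝ)}
    (hR : ∀ r, (diagonal ε * R r).IsSymm) :
    LinearMap.IsSymmetric (𝕜 := 𝕜) (E := twistedH1 𝕜 n z) (indexOp z ε Γ R).toLinearMap := by
  intro V W
  rw [ContinuousLinearMap.coe_coe, inner_indexOp, ← inner_conj_symm, inner_indexOp,
    staticForm_conj hR]

/-! ### Continuity in the coefficients -/

/-- The operator norm is controlled by the supremum of the matrices over `[0, 1]`, and joint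
continuity is uniform over this compact interval. -/
theorem continuous_matrixMul {X : Type*} [TopologicalSpace X]
    {F : X → C(ℝ, Matrix (Fin n) (Fin n) ℝ)} (hF : Continuous fun p : X × ℝ => F p.1 p.2) :
    Continuous fun x => (matrixMul (F x) : UnitL2 𝕜 n →L[𝕜] UnitL2 𝕜 n) := by
  rw [continuous_iff_continuousAt]
  intro x₀
  rw [ContinuousAt, tendsto_iff_norm_sub_tendsto_zero, Metric.tendsto_nhds]
  intro η hη
  have h : ∀ᶠ x in nhds x₀, ∀ r ∈ Icc (0 : ℝ) 1, matrixBound ((F x - F x₀) r) < η / 2 := by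
    refine isCompact_Icc.eventually_forall_of_forall_eventually fun r _ => ?_
    have hc : Continuous fun p : X × ℝ => matrixBound ((F p.1 - F x₀) p.2) :=
      continuous_matrixBound.comp (hF.sub ((F x₀).continuous.comp continuous_snd))
    refine hc.continuousAt.eventually (gt_mem_nhds ?_)
    simp only [sub_self, ContinuousMap.zero_apply]
    simpa [matrixBound] using hη
  filter_upwards [h] with x hx
  rw [Real.dist_0_eq_abs, abs_norm, matrixMul_sub]
  refine (ContinuousLinearMap.opNorm_le_bound _ (half_pos hη).le fun f => ?_).trans_lt
    (half_lt_self hη)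
  exact norm_matrixMul_apply_le _ (fun r hr => (hx r hr).le) f

theorem continuous_indexOp {X : Type*} [TopologicalSpace X] (z : 𝕜) (ε : Fin n → ℝ)
    {Γ R : X → C(ℝ, Matrix (Fin n) (Fin n) ℝ)} (hΓ : Continuous fun p : X × ℝ => Γ p.1 p.2)
    (hR : Continuous fun p : X × ℝ => R p.1 p.2) :
    Continuous fun x => indexOp z ε (Γ x) (R x) := by
  have h1 : Continuous fun x => twistedCovL z (Γ x) :=
    (continuous_const.add ((continuous_matrixMul hΓ).clm_comp continuous_const)).clm_comp
      continuous_const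
  have h2 : Continuous fun p : X × ℝ => diagMul ε (R p.1) p.2 :=
    continuous_const.matrix_mul hR
  exact continuous_pullbackOp (H := twistedH1 𝕜 n z) (E := UnitL2 𝕜 n) h1 _ _
    (continuous_matrixMul (F := fun x => diagMul ε (R x)) h2)

/-! ### The reflection -/

/-- The map `V ↦ a V` on `{V : V(1) = z V(0)}`, for a `C¹` loop `a`. -/
def twistedGauge (z : 𝕜) (a a' : C(ℝ, Matrix (Fin n) (Fin n) ℝ))
    (ha : ∀ r i j, HasDerivAt (fun s => a s i j) (a' r i j) r) (h1 : a 1 = a 0) :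
    twistedH1 𝕜 n z →L[𝕜] twistedH1 𝕜 n z :=
  (gaugeL a a' ∘L (twistedH1 𝕜 n z).subtypeL).codRestrict (twistedH1 𝕜 n z) fun V => by
    rw [mem_twistedH1, ContinuousLinearMap.comp_apply, Submodule.subtypeL_apply,
      gaugeL_eval ha _ (right_mem_Icc.2 zero_le_one), gaugeL_eval ha _ (left_mem_Icc.2 zero_le_one),
      h1, mem_twistedH1.1 V.2, realMatrixApply_smul]

theorem twistedGauge_eval (z : 𝕜) {a a' : C(ℝ, Matrix (Fin n) (Fin n) ℝ)}
    (ha : ∀ r i j, HasDerivAt (fun s => a s i j) (a' r i j) r) (h1 : a 1 = a 0)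
    (V : twistedH1 𝕜 n z) {r : ℝ} (hr : r ∈ Icc (0 : ℝ) 1) :
    (twistedGauge z a a' ha h1 V : SobolevH1 𝕜 n).eval r
      = realMatrixApply (a r) ((V : SobolevH1 𝕜 n).eval r) :=
  gaugeL_eval ha _ hr

/-- The reflection `V ↦ diag(ε) V`. -/
def reflectionL (z : 𝕜) (ε : Fin n → ℝ) : twistedH1 𝕜 n z →L[𝕜] twistedH1 𝕜 n z :=
  twistedGauge z (constDiag ε) 0 (fun _ _ _ => hasDerivAt_const _ _) rfl

theorem reflectionL_eval (z : 𝕜) (ε : Fin n → ℝ) (V : twistedH1 𝕜 n z) {r : ℝ}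
    (hr : r ∈ Icc (0 : ℝ) 1) :
    (reflectionL z ε V : SobolevH1 𝕜 n).eval r
      = realMatrixApply (diagonal ε) ((V : SobolevH1 𝕜 n).eval r) :=
  twistedGauge_eval z _ _ V hr

theorem diagonal_mul_self {ε : Fin n → ℝ} (hε : ∀ i, ε i = 1 ∨ ε i = -1) :
    diagonal ε * diagonal ε = 1 := by
  rw [diagonal_mul_diagonal, ← diagonal_one]
  congr 1
  ext i
  rcases hε i with h | h <;> simp [h]

theorem reflectionL_reflectionL (z : 𝕜) {ε : Fin n → ℝ} (hε : ∀ i, ε i = 1 ∨ ε i = -1)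
    (V : twistedH1 𝕜 n z) : reflectionL z ε (reflectionL z ε V) = V := by
  refine Subtype.ext (SobolevH1.ext_eval fun r hr => ?_)
  rw [reflectionL_eval z ε _ hr, reflectionL_eval z ε _ hr, ← realMatrixApply_mul,
    diagonal_mul_self hε, realMatrixApply_one]

theorem reflectionL_deriv (z : 𝕜) (ε : Fin n → ℝ) (V : twistedH1 𝕜 n z) :
    (reflectionL z ε V : SobolevH1 𝕜 n).deriv
      = matrixMul (constDiag ε) (V : SobolevH1 𝕜 n).deriv := by
  refine Lp.ext ?_
  filter_upwards [gaugeL_deriv (constDiag ε) 0 (V : SobolevH1 𝕜 n),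
    matrixMul_ae (constDiag ε) (V : SobolevH1 𝕜 n).deriv] with r h1 h2
  rw [h2]
  refine h1.trans ?_
  rw [ContinuousMap.zero_apply, realMatrixApply_zero_left, zero_add]

theorem inner_reflectionL (z : 𝕜) (ε : Fin n → ℝ) (V W : twistedH1 𝕜 n z) :
    inner 𝕜 W (reflectionL z ε V)
      = inner 𝕜 (W : SobolevH1 𝕜 n).fst
          (realMatrixApply (diagonal ε) (V : SobolevH1 𝕜 n).fst)
        + inner 𝕜 (W : SobolevH1 𝕜 n).deriv
          (matrixMul (constDiag ε) (V : SobolevH1 𝕜 n).deriv) := by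
  rw [Submodule.coe_inner, SobolevH1.inner_eq, reflectionL_deriv]
  rfl

end IndexOperators

end

open scoped Manifold ContDiff
open MeasureTheory

noncomputable section

section FlowOfIndexForms

open Set Matrix

variable {𝕜 : Type*} [RCLike 𝕜] {n : ℕ}

/-! ### The operators are reflections up to small forms -/

theorem natCast_div_mem_Icc {m : ℕ} (j : Fin (m + 2)) :
    ((j : ℕ) : ℝ) / (m + 1) ∈ Icc (0 : ℝ) 1 := by
  refine ⟨by positivity, (div_le_one (by positivity)).2 ?_⟩
  have := Nat.lt_succ_iff.1 j.2
  exact_mod_cast this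

/-- The values at the points `j / (m + 1)`. -/
def gridL (z : 𝕜) (m : ℕ) : twistedH1 𝕜 n z →L[𝕜] (Fin (m + 2) → EuclideanSpace 𝕜 (Fin n)) :=
  ContinuousLinearMap.pi fun j =>
    evalL ((j : ℕ) / (m + 1)) (natCast_div_mem_Icc j) ∘L (twistedH1 𝕜 n z).subtypeL

theorem eval_of_gridL_eq_zero {z : 𝕜} {m : ℕ} {V : twistedH1 𝕜 n z} (hV : gridL z m V = 0)
    (j : Fin (m + 2)) : (V : SobolevH1 𝕜 n).eval ((j : ℕ) / (m + 1)) = 0 :=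
  congrFun hV j

theorem fst_of_gridL_eq_zero {z : 𝕜} {m : ℕ} {V : twistedH1 𝕜 n z} (hV : gridL z m V = 0) :
    (V : SobolevH1 𝕜 n).fst = 0 := by
  have := eval_of_gridL_eq_zero hV 0
  rwa [Fin.val_zero, Nat.cast_zero, zero_div, SobolevH1.eval_zero_right] at this

/-- Compare `V(r)` with its zero at the grid point just to the left of `r`, at distance at most `1 /
(m + 1)`. -/
theorem norm_inclL_of_gridL_eq_zero {z : 𝕜} {m : ℕ} {V : twistedH1 𝕜 n z} (hV : gridL z m V = 0) :
    ‖inclL 𝕜 n (V : SobolevH1 𝕜 n)‖ ≤ Real.sqrt (1 / (m + 1)) * ‖V‖ := by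
  have hm : (0 : ℝ) < m + 1 := by positivity
  refine norm_inclL_le (by positivity) fun r hr => ?_
  have hj : ⌊((m : ℝ) + 1) * r⌋₊ < m + 2 := by
    have h1 : ⌊((m : ℝ) + 1) * r⌋₊ ≤ m + 1 := by
      refine Nat.floor_le_of_le ?_
      rw [Nat.cast_add, Nat.cast_one]
      nlinarith [hr.2]
    omega
  have h0 := eval_of_gridL_eq_zero hV ⟨_, hj⟩
  have hle : (⌊((m : ℝ) + 1) * r⌋₊ : ℝ) / (m + 1) ≤ r := by
    rw [div_le_iff₀ hm, mul_comm r]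
    exact Nat.floor_le (mul_nonneg hm.le hr.1)
  have hlt : r - (⌊((m : ℝ) + 1) * r⌋₊ : ℝ) / (m + 1) ≤ 1 / (m + 1) := by
    rw [sub_le_iff_le_add, ← add_div, le_div_iff₀ hm, mul_comm r, add_comm (1 : ℝ)]
    exact (Nat.lt_floor_add_one _).le
  have h1 := (V : SobolevH1 𝕜 n).norm_eval_sub_le hle
  rw [h0, sub_zero] at h1
  refine h1.trans ?_
  gcongr
  exact (V : SobolevH1 𝕜 n).norm_deriv_le

theorem finiteDimensional_quotient_ker {K V W : Type*} [Field K] [AddCommGroup V] [Module K V]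
    [AddCommGroup W] [Module K W] [FiniteDimensional K W] (f : V →ₗ[K] W) :
    FiniteDimensional K (V ⧸ LinearMap.ker f) :=
  Module.Finite.equiv f.quotKerEquivRange.symm

/-- After expansion and cancellation of the leading term, every remaining term contains `v` or `w`
and hence a factor `s`. Terms quadratic in `s` are absorbed using `s ≤ 1`. -/
theorem norm_perturbation_le {E : Type*} [NormedAddCommGroup E] [InnerProductSpace 𝕜 E]
    (S G Q : E →L[𝕜] E) {v v' w w' : E} {s a b : ℝ} (hs0 : 0 ≤ s) (hs : s ≤ 1)
    (ha : 0 ≤ a) (hb : 0 ≤ b) (hv : ‖v‖ ≤ s * a) (hw : ‖w‖ ≤ s * b) (hv' : ‖v'‖ ≤ a)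
    (hw' : ‖w'‖ ≤ b) :
    ‖inner 𝕜 (w' + G w) (S (v' + G v)) + inner 𝕜 w (Q v) - inner 𝕜 w' (S v')‖
      ≤ s * (2 * (‖S‖ * ‖G‖) + ‖S‖ * ‖G‖ ^ 2 + ‖Q‖) * a * b := by
  have e : inner 𝕜 (w' + G w) (S (v' + G v)) + inner 𝕜 w (Q v) - inner 𝕜 w' (S v')
      = inner 𝕜 w' (S (G v)) + inner 𝕜 (G w) (S v') + inner 𝕜 (G w) (S (G v))
        + inner 𝕜 w (Q v) := by
    rw [map_add, inner_add_left, inner_add_right, inner_add_right]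
    ring
  have hGv : ‖G v‖ ≤ ‖G‖ * (s * a) := (G.le_opNorm v).trans (by gcongr)
  have hGw : ‖G w‖ ≤ ‖G‖ * (s * b) := (G.le_opNorm w).trans (by gcongr)
  have hSGv : ‖S (G v)‖ ≤ ‖S‖ * (‖G‖ * (s * a)) := (S.le_opNorm _).trans (by gcongr)
  have hSv : ‖S v'‖ ≤ ‖S‖ * a := (S.le_opNorm _).trans (by gcongr)
  have hQv : ‖Q v‖ ≤ ‖Q‖ * (s * a) := (Q.le_opNorm _).trans (by gcongr)
  have h1 : ‖inner 𝕜 w' (S (G v))‖ ≤ b * (‖S‖ * (‖G‖ * (s * a))) :=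
    (norm_inner_le_norm _ _).trans (by gcongr)
  have h2 : ‖inner 𝕜 (G w) (S v')‖ ≤ ‖G‖ * (s * b) * (‖S‖ * a) :=
    (norm_inner_le_norm _ _).trans (by gcongr)
  have h3 : ‖inner 𝕜 (G w) (S (G v))‖ ≤ ‖G‖ * (1 * b) * (‖S‖ * (‖G‖ * (s * a))) :=
    (norm_inner_le_norm _ _).trans (by gcongr; exact hGw.trans (by gcongr))
  have h4 : ‖inner 𝕜 w (Q v)‖ ≤ 1 * b * (‖Q‖ * (s * a)) :=
    (norm_inner_le_norm _ _).trans (by gcongr; exact hw.trans (by gcongr))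
  rw [e]
  refine (norm_add_le _ _).trans ?_
  refine (add_le_add (norm_add₃_le.trans (add_le_add (add_le_add h1 h2) h3)) h4).trans_eq ?_
  ring

theorem exists_grid_staticForm_le (z : 𝕜) (ε : Fin n → ℝ)
    (Γ R : C(ℝ, Matrix (Fin n) (Fin n) ℝ)) {η : ℝ} (hη : 0 < η) :
    ∃ m : ℕ, ∀ V W : twistedH1 𝕜 n z, gridL z m V = 0 → gridL z m W = 0 →
      ‖staticForm ε Γ R (V : SobolevH1 𝕜 n) (W : SobolevH1 𝕜 n)
        - inner 𝕜 (W : SobolevH1 𝕜 n).deriv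
          (matrixMul (constDiag ε) (V : SobolevH1 𝕜 n).deriv)‖ ≤ η * ‖V‖ * ‖W‖ := by
  set S : UnitL2 𝕜 n →L[𝕜] UnitL2 𝕜 n := matrixMul (constDiag ε) with hS
  set G : UnitL2 𝕜 n →L[𝕜] UnitL2 𝕜 n := matrixMul Γ with hG
  set Q : UnitL2 𝕜 n →L[𝕜] UnitL2 𝕜 n := matrixMul (diagMul ε R) with hQ
  set C := 2 * (‖S‖ * ‖G‖) + ‖S‖ * ‖G‖ ^ 2 + ‖Q‖ with hC
  have hC0 : 0 ≤ C := by positivity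
  -- The mesh is chosen so that its square root times `C` is at most `η`; dividing by `C + 1` rather
  -- than `C` avoids the case `C = 0`.
  obtain ⟨m, hm⟩ := exists_nat_one_div_lt (show 0 < (η / (C + 1)) ^ 2 by positivity)
  have hs : Real.sqrt (1 / (m + 1)) ≤ η / (C + 1) :=
    Real.sqrt_le_iff.2 ⟨by positivity, hm.le⟩
  have hs1 : Real.sqrt (1 / ((m : ℝ) + 1)) ≤ 1 :=
    Real.sqrt_le_one.2 ((div_le_one (by positivity)).2 (by linarith [Nat.cast_nonneg (α := ℝ) m]))
  have hsC : Real.sqrt (1 / (m + 1)) * C ≤ η := by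
    calc Real.sqrt (1 / (m + 1)) * C ≤ η / (C + 1) * (C + 1) := by gcongr; linarith
      _ = η := div_mul_cancel₀ _ (by positivity)
  refine ⟨m, fun V W hV hW => ?_⟩
  rw [staticForm, covL_apply, covL_apply, ← hS, ← hG, ← hQ]
  refine (norm_perturbation_le S G Q (Real.sqrt_nonneg _) hs1 (norm_nonneg V) (norm_nonneg W)
    (norm_inclL_of_gridL_eq_zero hV) (norm_inclL_of_gridL_eq_zero hW)
    (V : SobolevH1 𝕜 n).norm_deriv_le (W : SobolevH1 𝕜 n).norm_deriv_le).trans ?_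
  gcongr

/-- On maps vanishing on a fine grid the lower order terms of the form are small. There also `V(0) =
0`, so the inner product with the reflection reduces to the leading term `∫ G(V', W')`. -/
theorem isReflectionModSmall_indexOp (z : 𝕜) {ε : Fin n → ℝ}
    {Γ R : C(ℝ, Matrix (Fin n) (Fin n) ℝ)} (hR : ∀ r, (diagonal ε * R r).IsSymm) :
    IsReflectionModSmall (𝕜 := 𝕜) (H := twistedH1 𝕜 n z) (reflectionL z ε)
      (indexOp z ε Γ R) := by
  refine ⟨indexOp_isSymmetric z hR, fun η hη => ?_⟩
  obtain ⟨m, hm⟩ := exists_grid_staticForm_le z ε Γ R hη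
  refine ⟨LinearMap.ker (gridL z m).toLinearMap, (gridL z m).isClosed_ker,
    finiteDimensional_quotient_ker _, fun V hV W hW => ?_⟩
  have hV0 : gridL z m V = 0 := hV
  have hW0 : gridL z m W = 0 := hW
  rw [← inner_sub_left, norm_inner_symm, inner_sub_right, inner_indexOp, inner_reflectionL,
    fst_of_gridL_eq_zero hV0, fst_of_gridL_eq_zero hW0, inner_zero_left, zero_add]
  exact hm V W hV0 hW0

/-! ### The spectral flow as a difference of indices -/

/-- The quadratic form of `staticForm` on `{V : V(1) = z V(0)}`. -/
def loopForm (z : 𝕜) (ε : Fin n → ℝ) (Γ R : C(ℝ, Matrix (Fin n) (Fin n) ℝ))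
    (V : twistedH1 𝕜 n z) : ℝ :=
  RCLike.re (staticForm ε Γ R (V : SobolevH1 𝕜 n) (V : SobolevH1 𝕜 n))

/-- The index of `loopForm`, relative to the eigenspaces of `diag(ε)`. -/
def loopIndex (z : 𝕜) (ε : Fin n → ℝ) (Γ R : C(ℝ, Matrix (Fin n) (Fin n) ℝ)) : ℤ :=
  formIndex (fixedSpace (𝕜 := 𝕜) (H := twistedH1 𝕜 n z) (reflectionL z ε))
    (antifixedSpace (𝕜 := 𝕜) (H := twistedH1 𝕜 n z) (reflectionL z ε))
    (loopForm z ε Γ R)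

theorem opForm_indexOp (z : 𝕜) (ε : Fin n → ℝ) (Γ R : C(ℝ, Matrix (Fin n) (Fin n) ℝ)) :
    opForm (𝕜 := 𝕜) (H := twistedH1 𝕜 n z) (indexOp z ε Γ R)
      = loopForm z ε Γ R := by
  funext V
  rw [opForm, loopForm, inner_re_symm, inner_indexOp]

/-- The index exists, so `loopIndex` is never the dummy value of `formIndex`. -/
theorem hasIndex_loopIndex (z : 𝕜) {ε : Fin n → ℝ} (hε : ∀ i, ε i = 1 ∨ ε i = -1)
    {Γ R : C(ℝ, Matrix (Fin n) (Fin n) ℝ)} (hR : ∀ r, (diagonal ε * R r).IsSymm) :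
    HasIndex (fixedSpace (𝕜 := 𝕜) (H := twistedH1 𝕜 n z) (reflectionL z ε))
      (antifixedSpace (𝕜 := 𝕜) (H := twistedH1 𝕜 n z) (reflectionL z ε))
      (loopForm z ε Γ R) (loopIndex z ε Γ R) := by
  have hc := isCompl_fixedSpace (𝕜 := 𝕜) (H := twistedH1 𝕜 n z) (reflectionL_reflectionL z hε)
  have h := (isReflectionModSmall_indexOp z (Γ := Γ) hR).isDefiniteModFinite (μ := 0) (by norm_num)
  rw [RCLike.ofReal_zero, zero_smul, sub_zero] at h
  obtain ⟨r, δ, -, hr, -⟩ := h.exists_hasIndex_shift hc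
  rw [opForm_indexOp] at hr
  rw [loopIndex, hr.formIndex_eq hc.sup_eq_top]
  exact hr

theorem isSymm_diagonal_mul_zero (ε : Fin n → ℝ) (r : ℝ) :
    (diagonal ε * (0 : C(ℝ, Matrix (Fin n) (Fin n) ℝ)) r).IsSymm := by
  rw [ContinuousMap.zero_apply, Matrix.mul_zero]
  exact isSymm_zero

/-- A path of forms whose operators agree with `J` up to small forms has a unique spectral flow. -/
theorem existsUnique_hasSpectralFlow {H : Type*} [NormedAddCommGroup H] [InnerProductSpace 𝕜 H]
    [CompleteSpace H] {J : H →L[𝕜] H} (hJ : ∀ x, J (J x) = x) {A : ℝ → H →L[𝕜] H}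
    (hcont : Continuous A) (hA : ∀ t, IsReflectionModSmall J (A t)) {B : ℝ → H → H → 𝕜}
    (hAB : ∀ t V W, inner 𝕜 W (A t V) = B t V W) :
    (∃! m, HasSpectralFlow B m) ∧ spectralFlow B
      = formIndex (fixedSpace J) (antifixedSpace J) (opForm (A 1))
        - formIndex (fixedSpace J) (antifixedSpace J) (opForm (A 0)) := by
  have hex : ∃ m, HasSpectralFlow B m := by
    obtain ⟨m, hm⟩ := (spectralFlow_eq_index_sub hJ hcont.continuousOn fun t _ => hA t).1
    exact ⟨m, A, hcont.continuousOn, fun t _ => ⟨hAB t, (hA t).symm, (hA t).isFredholm hJ⟩, hm⟩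
  have huniq : ∀ m, HasSpectralFlow B m →
      m = formIndex (fixedSpace J) (antifixedSpace J) (opForm (A 1))
        - formIndex (fixedSpace J) (antifixedSpace J) (opForm (A 0)) := by
    rintro m ⟨A', hA'c, hA', hm⟩
    -- A form determines the operator representing it, so only the subdivision and the cut-offs can
    -- vary.
    have hAA' : ∀ t ∈ Icc (0 : ℝ) 1, A' t = A t := fun t ht => by
      refine ContinuousLinearMap.ext fun V => ext_inner_left 𝕜 fun W => ?_
      rw [(hA' t ht).1, hAB]
    have h := (spectralFlow_eq_index_sub hJ hA'c fun t ht => by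
      rw [hAA' t ht]; exact hA t).2 m hm
    rwa [hAA' 1 (right_mem_Icc.2 zero_le_one), hAA' 0 (left_mem_Icc.2 zero_le_one)] at h
  refine ⟨?_, ?_⟩
  · obtain ⟨m, hm⟩ := hex
    exact ⟨m, hm, fun m' hm' => (huniq m' hm').trans (huniq m hm).symm⟩
  · rw [spectralFlow, dif_pos hex]
    exact huniq _ hex.choose_spec

/-- The reflection is the same for all `t`, so the flow is the index of the full data at `t = 1`
minus that of zero data at `t = 0`. -/
theorem hasSpectralFlow_pathForm (z : 𝕜) {ε : Fin n → ℝ} (hε : ∀ i, ε i = 1 ∨ ε i = -1)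
    {Γ R : C(ℝ, Matrix (Fin n) (Fin n) ℝ)} (hR : ∀ r, (diagonal ε * R r).IsSymm)
    {B : ℝ → twistedH1 𝕜 n z → twistedH1 𝕜 n z → 𝕜}
    (hB : ∀ t V W, B t V W = pathForm ε Γ R t (V : SobolevH1 𝕜 n) (W : SobolevH1 𝕜 n)) :
    (∃! m, HasSpectralFlow B m) ∧ spectralFlow B = loopIndex z ε Γ R - loopIndex z ε 0 0 := by
  have hcont : Continuous fun t : ℝ => indexOp z ε (rescale t t Γ) (rescale (t ^ 2) t R) := by
    refine continuous_indexOp z ε (X := ℝ) (Γ := fun t => rescale t t Γ)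
      (R := fun t => rescale (t ^ 2) t R) ?_ ?_
    · exact continuous_fst.smul (Γ.continuous.comp (continuous_fst.mul continuous_snd))
    · exact (continuous_fst.pow 2).smul (R.continuous.comp (continuous_fst.mul continuous_snd))
  have hsmall : ∀ t : ℝ, IsReflectionModSmall (𝕜 := 𝕜) (H := twistedH1 𝕜 n z) (reflectionL z ε)
      (indexOp z ε (rescale t t Γ) (rescale (t ^ 2) t R)) := by
    refine fun t => isReflectionModSmall_indexOp z fun r => ?_
    rw [rescale_apply, Matrix.mul_smul]
    exact (hR _).smul _
  have h := existsUnique_hasSpectralFlow (𝕜 := 𝕜) (H := twistedH1 𝕜 n z)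
    (reflectionL_reflectionL z hε) hcont hsmall (B := B) fun t V W => by
      rw [inner_indexOp, hB, pathForm_eq_staticForm]
  have h1 : rescale 1 1 Γ = Γ := by ext r i j; simp
  have h2 : rescale (1 ^ 2) 1 R = R := by ext r i j; simp
  have h3 : rescale 0 0 Γ = 0 := by ext r i j; simp
  have h4 : rescale (0 ^ 2) 0 R = 0 := by ext r i j; simp
  rw [h1, h2, h3, h4, opForm_indexOp, opForm_indexOp] at h
  exact h

end FlowOfIndexForms

end

open scoped Manifold ContDiff
open MeasureTheory

noncomputable section

/-! ### Independence of the index from the frame -/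

section GaugeInvariance

open Set Matrix

variable {𝕜 : Type*} [RCLike 𝕜] {n : ℕ}

/-- Definiteness modulo finite dimensional spaces is transported by isomorphisms. -/
theorem IsDefiniteModFinite.map {H : Type*} [NormedAddCommGroup H] [InnerProductSpace 𝕜 H]
    {P N : Submodule 𝕜 H} {A A' : H →L[𝕜] H} (h : IsDefiniteModFinite P N A) (e : H ≃L[𝕜] H)
    (hA' : (A' : H →ₗ[𝕜] H).IsSymmetric) (hq : ∀ x, opForm A' (e x) = opForm A x) :
    IsDefiniteModFinite (P.map (e.toLinearEquiv : H →ₗ[𝕜] H))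
      (N.map (e.toLinearEquiv : H →ₗ[𝕜] H)) A' := by
  obtain ⟨-, c, hc, U, W, hUc, hWc, hUP, hWN, ⟨T, hT, hPT⟩, ⟨T', hT', hNT⟩, hU, hW⟩ := h
  have hclosed : ∀ Z : Submodule 𝕜 H, IsClosed (Z : Set H) →
      IsClosed ((Z.map (e.toLinearEquiv : H →ₗ[𝕜] H) : Submodule 𝕜 H) : Set H) := fun Z hZ =>
    e.toHomeomorph.isClosedMap _ hZ
  -- `e` distorts the norm by at most `‖e‖`, which costs its square in the definiteness constant;
  -- the `1` keeps `k` positive.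
  set k := (‖(e : H →L[𝕜] H)‖ + 1) ^ 2 with hk
  have hk0 : 0 < k := by positivity
  have hnorm : ∀ x, c / k * ‖e x‖ ^ 2 ≤ c * ‖x‖ ^ 2 := fun x => by
    rw [div_mul_eq_mul_div, div_le_iff₀ hk0, mul_assoc]
    gcongr
    calc ‖e x‖ ^ 2 ≤ ((‖(e : H →L[𝕜] H)‖ + 1) * ‖x‖) ^ 2 := by
          gcongr
          refine ((e : H →L[𝕜] H).le_opNorm x).trans ?_
          gcongr
          linarith
      _ = ‖x‖ ^ 2 * k := by rw [hk]; ring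
  refine ⟨hA', c / k, div_pos hc hk0, _, _, hclosed U hUc, hclosed W hWc, Submodule.map_mono hUP,
    Submodule.map_mono hWN, ⟨T.map (e.toLinearEquiv : H →ₗ[𝕜] H), inferInstance, ?_⟩,
    ⟨T'.map (e.toLinearEquiv : H →ₗ[𝕜] H), inferInstance, ?_⟩, ?_, ?_⟩
  · rw [← Submodule.map_sup]; exact Submodule.map_mono hPT
  · rw [← Submodule.map_sup]; exact Submodule.map_mono hNT
  · rintro _ ⟨x, hx, rfl⟩
    have h1 := hU x hx
    rw [← hq x] at h1
    exact (hnorm x).trans h1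
  · rintro _ ⟨x, hx, rfl⟩
    have h1 := hW x hx
    rw [← hq x] at h1
    exact h1.trans (neg_le_neg (hnorm x))

theorem isCompl_map {K V V' : Type*} [Field K] [AddCommGroup V] [Module K V] [AddCommGroup V']
    [Module K V'] (e : V ≃ₗ[K] V') {P N : Submodule K V} (h : IsCompl P N) :
    IsCompl (P.map (e : V →ₗ[K] V')) (N.map (e : V →ₗ[K] V')) :=
  (Submodule.orderIsoMapComap e).isCompl h

/-! ### Adding a large multiple of the identity to the potential -/

/-- The family `R + δ`. -/
def shiftBy (R : C(ℝ, Matrix (Fin n) (Fin n) ℝ)) (δ : ℝ) : C(ℝ, Matrix (Fin n) (Fin n) ℝ) :=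
  ⟨fun r => R r + δ • 1, by fun_prop⟩

@[simp] theorem shiftBy_apply (R : C(ℝ, Matrix (Fin n) (Fin n) ℝ)) (δ r : ℝ) :
    shiftBy R δ r = R r + δ • 1 := rfl

theorem isSymm_diagonal_mul_shiftBy {ε : Fin n → ℝ} {R : C(ℝ, Matrix (Fin n) (Fin n) ℝ)}
    (hR : ∀ r, (diagonal ε * R r).IsSymm) (δ r : ℝ) : (diagonal ε * shiftBy R δ r).IsSymm := by
  rw [shiftBy_apply, Matrix.mul_add, Matrix.mul_smul, Matrix.mul_one]
  exact (hR r).add ((isSymm_diagonal ε).smul δ)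

theorem staticForm_shiftBy (ε : Fin n → ℝ) (Γ R : C(ℝ, Matrix (Fin n) (Fin n) ℝ)) (δ : ℝ)
    (V W : SobolevH1 𝕜 n) :
    staticForm ε Γ (shiftBy R δ) V W = staticForm ε Γ R V W
      + δ * inner 𝕜 (inclL 𝕜 n W) (matrixMul (constDiag ε) (inclL 𝕜 n V)) := by
  have h : matrixMul (diagMul ε (shiftBy R δ)) (inclL 𝕜 n V)
      = matrixMul (diagMul ε R) (inclL 𝕜 n V)
        + (δ : 𝕜) • matrixMul (constDiag ε) (inclL 𝕜 n V) := by
    refine Lp.ext ?_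
    filter_upwards [matrixMul_ae (diagMul ε (shiftBy R δ)) (inclL 𝕜 n V),
      matrixMul_ae (diagMul ε R) (inclL 𝕜 n V), matrixMul_ae (constDiag ε) (inclL 𝕜 n V),
      Lp.coeFn_add (matrixMul (diagMul ε R) (inclL 𝕜 n V))
        ((δ : 𝕜) • matrixMul (constDiag ε) (inclL 𝕜 n V)),
      Lp.coeFn_smul (δ : 𝕜) (matrixMul (constDiag ε) (inclL 𝕜 n V))] with r h1 h2 h3 h4 h5
    rw [h1, h4, Pi.add_apply, h2, h5, Pi.smul_apply, h3, diagMul_apply, diagMul_apply,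
      constDiag_apply, shiftBy_apply, Matrix.mul_add, Matrix.mul_smul, Matrix.mul_one,
      realMatrixApply_add_left, realMatrixApply_smul_left]
  rw [staticForm, h, inner_add_right, inner_smul_right, staticForm, add_assoc]

theorem inclL_injective {V : SobolevH1 𝕜 n} (h : inclL 𝕜 n V = 0) : V = 0 := by
  refine SobolevH1.eq_zero_of_eval ?_
  have hae : V.eval =ᵐ[unitMeasure] fun _ => 0 := by
    filter_upwards [inclL_ae V, Lp.coeFn_zero (EuclideanSpace 𝕜 (Fin n)) 2 unitMeasure]
      with r h1 h2
    rw [← h1, h, h2, Pi.zero_apply]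
  exact Measure.eqOn_Icc_of_ae_eq volume zero_ne_one hae V.continuous_eval.continuousOn
    continuousOn_const

/-- On the `σ`-eigenspace of `S` the leading term gives `‖v'‖²` and the shift gives `δ ‖v‖²`. The
cross terms, at most `2 ‖S‖ ‖G‖ ‖v‖ ‖v'‖`, are absorbed by completing the square, at the price of
`(‖S‖ ‖G‖)² ‖v‖²`. The bound on `δ` pays for this and for the other terms, leaving `‖v‖²`. -/
theorem re_perturbation_ge {E : Type*} [NormedAddCommGroup E] [InnerProductSpace 𝕜 E]
    (S G Q : E →L[𝕜] E) {v v' : E} {σ δ : ℝ} (hσ : σ = 1 ∨ σ = -1)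
    (hv : S v = (σ : 𝕜) • v) (hv' : S v' = (σ : 𝕜) • v')
    (hδ : (‖S‖ * ‖G‖) ^ 2 + (‖S‖ * ‖G‖ ^ 2 + ‖Q‖) + 1 ≤ δ) :
    ‖v‖ ^ 2 ≤ σ * RCLike.re (inner 𝕜 (v' + G v) (S (v' + G v)) + inner 𝕜 v (Q v)
      + δ * inner 𝕜 v (S v)) := by
  have hself : ∀ w : E, σ * RCLike.re (inner 𝕜 w ((σ : 𝕜) • w)) = ‖w‖ ^ 2 := fun w => by
    rw [inner_smul_right, RCLike.re_ofReal_mul, inner_self_eq_norm_sq]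
    rcases hσ with h | h <;> rw [h] <;> ring
  have hbd : ∀ (c : 𝕜) (C : ℝ), ‖c‖ ≤ C → -C ≤ σ * RCLike.re c := fun c C hc => by
    have := abs_le.1 ((RCLike.abs_re_le_norm c).trans hc)
    rcases hσ with h | h <;> rw [h] <;> linarith
  have e : inner 𝕜 (v' + G v) (S (v' + G v))
      = inner 𝕜 v' (S v') + inner 𝕜 v' (S (G v)) + inner 𝕜 (G v) (S v')
        + inner 𝕜 (G v) (S (G v)) := by
    rw [map_add, inner_add_left, inner_add_right, inner_add_right]
    ring
  have hGv : ‖G v‖ ≤ ‖G‖ * ‖v‖ := G.le_opNorm v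
  have hSGv : ‖S (G v)‖ ≤ ‖S‖ * (‖G‖ * ‖v‖) := (S.le_opNorm _).trans (by gcongr)
  have h1 := hbd _ (‖v'‖ * (‖S‖ * (‖G‖ * ‖v‖)))
    ((norm_inner_le_norm (𝕜 := 𝕜) v' (S (G v))).trans (by gcongr))
  have h2 := hbd _ (‖G‖ * ‖v‖ * (‖S‖ * ‖v'‖))
    ((norm_inner_le_norm (𝕜 := 𝕜) (G v) (S v')).trans (by gcongr; exact S.le_opNorm _))
  have h3 := hbd _ (‖G‖ * ‖v‖ * (‖S‖ * (‖G‖ * ‖v‖)))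
    ((norm_inner_le_norm (𝕜 := 𝕜) (G v) (S (G v))).trans (by gcongr))
  have h4 := hbd _ (‖v‖ * (‖Q‖ * ‖v‖))
    ((norm_inner_le_norm (𝕜 := 𝕜) v (Q v)).trans (by gcongr; exact Q.le_opNorm _))
  have h5 : σ * RCLike.re (inner 𝕜 v' (S v')) = ‖v'‖ ^ 2 := by rw [hv', hself]
  have h6 : σ * (δ * RCLike.re (inner 𝕜 v (S v))) = δ * ‖v‖ ^ 2 := by
    rw [hv, mul_left_comm, hself]
  rw [e, map_add, map_add, map_add, map_add, map_add, RCLike.re_ofReal_mul]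
  have h7 : ((‖S‖ * ‖G‖) ^ 2 + (‖S‖ * ‖G‖ ^ 2 + ‖Q‖) + 1) * ‖v‖ ^ 2 ≤ δ * ‖v‖ ^ 2 := by gcongr
  nlinarith [sq_nonneg (‖v'‖ - ‖S‖ * ‖G‖ * ‖v‖)]

/-- Adding a large multiple of `∫ G(V, W)` makes the form nonnegative on `P` and negative on `N`
themselves, so the index is `0`. The lower bound is only in the `L²` norm, which suffices because
the index depends on signs alone. -/
theorem exists_hasIndex_shiftBy (z : 𝕜) (ε : Fin n → ℝ) (Γ R : C(ℝ, Matrix (Fin n) (Fin n) ℝ)) :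
    ∃ δ₀ : ℝ, ∀ δ ≥ δ₀,
      HasIndex (fixedSpace (𝕜 := 𝕜) (H := twistedH1 𝕜 n z) (reflectionL z ε))
        (antifixedSpace (𝕜 := 𝕜) (H := twistedH1 𝕜 n z) (reflectionL z ε))
        (loopForm z ε Γ (shiftBy R δ)) 0 := by
  set S : UnitL2 𝕜 n →L[𝕜] UnitL2 𝕜 n := matrixMul (constDiag ε) with hS
  set G : UnitL2 𝕜 n →L[𝕜] UnitL2 𝕜 n := matrixMul Γ with hG
  set Q : UnitL2 𝕜 n →L[𝕜] UnitL2 𝕜 n := matrixMul (diagMul ε R) with hQ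
  refine ⟨(‖S‖ * ‖G‖) ^ 2 + (‖S‖ * ‖G‖ ^ 2 + ‖Q‖) + 1, fun δ hδ => ?_⟩
  have key : ∀ (σ : ℝ), (σ = 1 ∨ σ = -1) → ∀ V : twistedH1 𝕜 n z,
      reflectionL z ε V = (σ : 𝕜) • V →
      ‖inclL 𝕜 n (V : SobolevH1 𝕜 n)‖ ^ 2 ≤ σ * loopForm z ε Γ (shiftBy R δ) V := by
    intro σ hσ V hV
    rw [loopForm, staticForm_shiftBy, staticForm, covL_apply]
    refine re_perturbation_ge S G Q hσ ?_ ?_ hδ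
    · refine Lp.ext ?_
      have hev : ∀ r ∈ Icc (0 : ℝ) 1, realMatrixApply (diagonal ε) ((V : SobolevH1 𝕜 n).eval r)
          = (σ : 𝕜) • (V : SobolevH1 𝕜 n).eval r := fun r hr => by
        rw [← reflectionL_eval z ε V hr, hV, Submodule.coe_smul, SobolevH1.eval_smul]
      filter_upwards [matrixMul_ae (constDiag ε) (inclL 𝕜 n (V : SobolevH1 𝕜 n)),
        inclL_ae (V : SobolevH1 𝕜 n), ae_unitMeasure_mem,
        Lp.coeFn_smul (σ : 𝕜) (inclL 𝕜 n (V : SobolevH1 𝕜 n))] with r h1 h2 h3 h4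
      rw [hS, h1, h4, Pi.smul_apply, h2, constDiag_apply, hev r h3]
    · rw [hS, ← reflectionL_deriv, hV]
      rfl
  have hpos : ∀ V : twistedH1 𝕜 n z, V ≠ 0 → 0 < ‖inclL 𝕜 n (V : SobolevH1 𝕜 n)‖ ^ 2 :=
    fun V hV => sq_norm_pos_of_ne_zero fun h => hV (Subtype.ext (inclL_injective h))
  refine ⟨⟨_, RelDim.refl _, fun V hV => ?_⟩, ⟨_, by simpa using RelDim.refl _, fun V hV h0 => ?_⟩⟩
  · have h := key 1 (Or.inl rfl) V (by rw [mem_fixedSpace.1 hV, RCLike.ofReal_one, one_smul])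
    rw [one_mul] at h
    exact (sq_nonneg _).trans h
  · have h := key (-1) (Or.inr rfl) V (by
      rw [mem_antifixedSpace.1 hV, RCLike.ofReal_neg, RCLike.ofReal_one, neg_smul, one_smul])
    linarith [hpos V h0]

/-! ### Gauge invariance of the index -/

/-- By `hΓ`, the covariant derivative `V' + Γ V` of `a V` is `a` applied to that of `V` for `Γ'`; by
`hR` the same holds for the potential, and `a` carries one sign form to the other. -/
theorem staticForm_gaugeL {ε ε' : Fin n → ℝ} {a a' Γ R Γ' R' : C(ℝ, Matrix (Fin n) (Fin n) ℝ)}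
    (ha : ∀ r i j, HasDerivAt (fun s => a s i j) (a' r i j) r)
    (horth : ∀ r, (a r)ᵀ * diagonal ε * a r = diagonal ε')
    (hΓ : ∀ r, a r * Γ' r = a' r + Γ r * a r) (hR : ∀ r, a r * R' r = R r * a r)
    (V W : SobolevH1 𝕜 n) :
    staticForm ε Γ R (gaugeL a a' V) (gaugeL a a' W) = staticForm ε' Γ' R' V W := by
  have hsign : ∀ r (v w : EuclideanSpace 𝕜 (Fin n)),
      inner 𝕜 (realMatrixApply (a r) w) (realMatrixApply (diagonal ε) (realMatrixApply (a r) v))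
        = inner 𝕜 w (realMatrixApply (diagonal ε') v) := fun r v w => by
    rw [← horth r, realMatrixApply_mul, realMatrixApply_mul]
    generalize realMatrixApply (diagonal ε) (realMatrixApply (a r) v) = u
    simp only [PiLp.inner_apply, RCLike.inner_apply, realMatrixApply_apply, map_sum, map_mul,
      RCLike.conj_ofReal, Finset.sum_mul, Finset.mul_sum, transpose_apply]
    rw [Finset.sum_comm]
    exact Finset.sum_congr rfl fun i _ => Finset.sum_congr rfl fun j _ => by ring
  have hcov : ∀ V : SobolevH1 𝕜 n, ∀ᵐ r ∂unitMeasure,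
      covL Γ (gaugeL a a' V) r = realMatrixApply (a r) (covL Γ' V r) := fun V => by
    filter_upwards [covL_ae Γ (gaugeL a a' V), covL_ae Γ' V, gaugeL_deriv a a' V,
      ae_unitMeasure_mem] with r h1 h2 h3 hr
    rw [h1, h2, h3, gaugeL_eval ha V hr, realMatrixApply_add, ← realMatrixApply_mul,
      ← realMatrixApply_mul, hΓ r, realMatrixApply_add_left]
    abel
  have hincl : ∀ V : SobolevH1 𝕜 n, ∀ᵐ r ∂unitMeasure,
      inclL 𝕜 n (gaugeL a a' V) r = realMatrixApply (a r) (inclL 𝕜 n V r) := fun V => by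
    filter_upwards [inclL_ae (gaugeL a a' V), inclL_ae V, ae_unitMeasure_mem] with r h1 h2 hr
    rw [h1, h2, gaugeL_eval ha V hr]
  simp only [staticForm, inner_matrixMul_right]
  congr 1
  · refine integral_congr_ae ?_
    filter_upwards [hcov V, hcov W] with r h1 h2
    rw [h1, h2, constDiag_apply, constDiag_apply, hsign]
  · refine integral_congr_ae ?_
    filter_upwards [hincl V, hincl W] with r h1 h2
    rw [h1, h2, diagMul_apply, diagMul_apply, realMatrixApply_mul, ← realMatrixApply_mul (R r),
      ← hR, realMatrixApply_mul (a r), hsign, ← realMatrixApply_mul]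

/-- A `C¹` loop of matrices that intertwines the forms `diag(ε')` and `diag(ε)`. -/
structure IsGaugeLoop (ε ε' : Fin n → ℝ) (a a' : C(ℝ, Matrix (Fin n) (Fin n) ℝ)) : Prop where
  hasDerivAt : ∀ r i j, HasDerivAt (fun s => a s i j) (a' r i j) r
  loop : a 1 = a 0
  orth : ∀ r, (a r)ᵀ * diagonal ε * a r = diagonal ε'

/-- The inverse of a loop of orthogonal matrices, `ε' aᵀ ε`. -/
def gaugeInv (ε ε' : Fin n → ℝ) (a : C(ℝ, Matrix (Fin n) (Fin n) ℝ)) :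
    C(ℝ, Matrix (Fin n) (Fin n) ℝ) :=
  ⟨fun r => diagonal ε' * (a r)ᵀ * diagonal ε,
    (continuous_const.matrix_mul a.continuous.matrix_transpose).matrix_mul continuous_const⟩

theorem gaugeInv_apply (ε ε' : Fin n → ℝ) (a : C(ℝ, Matrix (Fin n) (Fin n) ℝ)) (r : ℝ) :
    gaugeInv ε ε' a r = diagonal ε' * (a r)ᵀ * diagonal ε := rfl

theorem gaugeInv_apply_apply (ε ε' : Fin n → ℝ) (a : C(ℝ, Matrix (Fin n) (Fin n) ℝ)) (r : ℝ)
    (i j : Fin n) : gaugeInv ε ε' a r i j = ε' i * a r j i * ε j := by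
  rw [gaugeInv_apply, mul_diagonal, diagonal_mul, transpose_apply]

variable {ε ε' : Fin n → ℝ} {a a' : C(ℝ, Matrix (Fin n) (Fin n) ℝ)}

theorem IsGaugeLoop.inv_mul (h : IsGaugeLoop ε ε' a a') (hε' : ∀ i, ε' i = 1 ∨ ε' i = -1) (r : ℝ) :
    gaugeInv ε ε' a r * a r = 1 := by
  rw [gaugeInv_apply, Matrix.mul_assoc, Matrix.mul_assoc, ← Matrix.mul_assoc _ _ (a r), h.orth,
    diagonal_mul_self hε']

theorem IsGaugeLoop.mul_inv (h : IsGaugeLoop ε ε' a a') (hε' : ∀ i, ε' i = 1 ∨ ε' i = -1) (r : ℝ) :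
    a r * gaugeInv ε ε' a r = 1 :=
  mul_eq_one_comm.1 (h.inv_mul hε' r)

theorem IsGaugeLoop.hasDerivAt_inv (h : IsGaugeLoop ε ε' a a') (r : ℝ) (i j : Fin n) :
    HasDerivAt (fun s => gaugeInv ε ε' a s i j) (gaugeInv ε ε' a' r i j) r := by
  simp only [gaugeInv_apply_apply]
  exact ((h.hasDerivAt r j i).const_mul _).mul_const _

theorem IsGaugeLoop.loop_inv (h : IsGaugeLoop ε ε' a a') :
    gaugeInv ε ε' a 1 = gaugeInv ε ε' a 0 := by
  rw [gaugeInv_apply, gaugeInv_apply, h.loop]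

/-- The isomorphism `V ↦ a V` of `{V : V(1) = z V(0)}`. -/
def IsGaugeLoop.equiv (h : IsGaugeLoop ε ε' a a') (hε' : ∀ i, ε' i = 1 ∨ ε' i = -1) (z : 𝕜) :
    twistedH1 𝕜 n z ≃L[𝕜] twistedH1 𝕜 n z :=
  ContinuousLinearEquiv.equivOfInverse (twistedGauge z a a' h.hasDerivAt h.loop)
    (twistedGauge z _ (gaugeInv ε ε' a') h.hasDerivAt_inv h.loop_inv)
    (fun V => Subtype.ext (SobolevH1.ext_eval fun r hr => by
      rw [twistedGauge_eval z _ _ _ hr, twistedGauge_eval z _ _ _ hr, ← realMatrixApply_mul,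
        h.inv_mul hε', realMatrixApply_one]))
    (fun V => Subtype.ext (SobolevH1.ext_eval fun r hr => by
      rw [twistedGauge_eval z _ _ _ hr, twistedGauge_eval z _ _ _ hr, ← realMatrixApply_mul,
        h.mul_inv hε', realMatrixApply_one]))

theorem IsGaugeLoop.loopForm_equiv (h : IsGaugeLoop ε ε' a a') (hε' : ∀ i, ε' i = 1 ∨ ε' i = -1)
    (z : 𝕜) {Γ R Γ' R' : C(ℝ, Matrix (Fin n) (Fin n) ℝ)}
    (hΓ : ∀ r, a r * Γ' r = a' r + Γ r * a r) (hR : ∀ r, a r * R' r = R r * a r)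
    (V : twistedH1 𝕜 n z) :
    loopForm z ε Γ R (h.equiv hε' z V) = loopForm z ε' Γ' R' V :=
  congrArg RCLike.re (staticForm_gaugeL h.hasDerivAt h.orth hΓ hR _ _)

/-- Multiplication by `a` transports the right side to an index of the left-hand form, but relative
to the image splitting, which need not be commensurable with the original one. The difference of the
two indices is constant along the path `R + tδ` and vanishes at `t = 1` for large `δ`; hence it
vanishes at `t = 0`. -/
theorem IsGaugeLoop.loopIndex_eq (h : IsGaugeLoop ε ε' a a') (hε : ∀ i, ε i = 1 ∨ ε i = -1)
    (hε' : ∀ i, ε' i = 1 ∨ ε' i = -1) (z : 𝕜) {Γ R Γ' R' : C(ℝ, Matrix (Fin n) (Fin n) ℝ)}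
    (hΓ : ∀ r, a r * Γ' r = a' r + Γ r * a r) (hR : ∀ r, a r * R' r = R r * a r)
    (hRs : ∀ r, (diagonal ε * R r).IsSymm) (hRs' : ∀ r, (diagonal ε' * R' r).IsSymm) :
    loopIndex z ε Γ R = loopIndex z ε' Γ' R' := by
  obtain ⟨δ₁, hδ₁⟩ := exists_hasIndex_shiftBy z ε Γ R
  obtain ⟨δ₂, hδ₂⟩ := exists_hasIndex_shiftBy z ε' Γ' R'
  -- Large enough for the shifted forms of both sets of data to have index `0`.
  set δ := max δ₁ δ₂ with hδ
  have hshift : ∀ c r, a r * shiftBy R' c r = shiftBy R c r * a r := fun c r => by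
    rw [shiftBy_apply, shiftBy_apply, Matrix.mul_add, Matrix.add_mul, hR, Matrix.mul_smul,
      Matrix.smul_mul, Matrix.mul_one, Matrix.one_mul]
  have hc := isCompl_fixedSpace (𝕜 := 𝕜) (H := twistedH1 𝕜 n z) (reflectionL_reflectionL z hε)
  have hc' := isCompl_map (h.equiv hε' z).toLinearEquiv
    (isCompl_fixedSpace (𝕜 := 𝕜) (H := twistedH1 𝕜 n z) (reflectionL_reflectionL z hε'))
  have hcont : Continuous fun t : ℝ => indexOp z ε Γ (shiftBy R (t * δ)) := by
    refine continuous_indexOp z ε (X := ℝ) (Γ := fun _ => Γ) (R := fun t => shiftBy R (t * δ))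
      (Γ.continuous.comp continuous_snd) ?_
    exact (R.continuous.comp continuous_snd).add
      ((continuous_fst.mul continuous_const).smul continuous_const)
  have hdef : ∀ (ε : Fin n → ℝ) (Γ R : C(ℝ, Matrix (Fin n) (Fin n) ℝ)),
      (∀ r, (diagonal ε * R r).IsSymm) → ∀ t : ℝ,
      IsDefiniteModFinite (fixedSpace (𝕜 := 𝕜) (H := twistedH1 𝕜 n z) (reflectionL z ε))
        (antifixedSpace (𝕜 := 𝕜) (H := twistedH1 𝕜 n z) (reflectionL z ε))
        (indexOp z ε Γ (shiftBy R (t * δ))) := fun ε Γ R hRs t => by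
    have h := (isReflectionModSmall_indexOp z (Γ := Γ)
      (isSymm_diagonal_mul_shiftBy hRs (t * δ))).isDefiniteModFinite (μ := 0) (by norm_num)
    rwa [RCLike.ofReal_zero, zero_smul, sub_zero] at h
  have hmap : ∀ t : ℝ, _ := fun t => (hdef ε' Γ' R' hRs' t).map (h.equiv hε' z)
    (indexOp_isSymmetric z (Γ := Γ) (isSymm_diagonal_mul_shiftBy hRs (t * δ))) fun V => by
      rw [opForm_indexOp, opForm_indexOp]
      exact h.loopForm_equiv hε' z hΓ (hshift _) V
  -- Both splittings are admissible along the whole path: the original one directly, the image one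
  -- by transport from the primed data with the same shift.
  have hkey := formIndex_sub_formIndex_eq hc hc' hcont.continuousOn (fun t _ => hdef ε Γ R hRs t)
    fun t _ => hmap t
  have hidx : ∀ c r, HasIndex (fixedSpace (𝕜 := 𝕜) (H := twistedH1 𝕜 n z) (reflectionL z ε'))
      (antifixedSpace (𝕜 := 𝕜) (H := twistedH1 𝕜 n z) (reflectionL z ε'))
      (loopForm z ε' Γ' (shiftBy R' c)) r →
      formIndex _ _ (loopForm z ε Γ (shiftBy R c)) = r := fun c r hr =>
    (hr.map (h.equiv hε' z).toLinearEquiv (q' := loopForm z ε Γ (shiftBy R c))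
      fun V => h.loopForm_equiv hε' z hΓ (hshift c) V).formIndex_eq hc'.sup_eq_top
  have hz : ∀ R : C(ℝ, Matrix (Fin n) (Fin n) ℝ), shiftBy R (0 * δ) = R := fun R => by
    ext r i j; simp
  have hidx0 := hidx (0 * δ) (loopIndex z ε' Γ' R') (by
    rw [hz]; exact hasIndex_loopIndex z hε' hRs')
  have hidx1 := hidx (1 * δ) 0 (hδ₂ _ (by rw [one_mul]; exact le_max_right _ _))
  have hidx1' := (hδ₁ (1 * δ) (by rw [one_mul]; exact le_max_left _ _)).formIndex_eq hc.sup_eq_top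
  simp only [opForm_indexOp] at hkey
  rw [hidx0, hidx1, hidx1', hz] at hkey
  change 0 - 0 = loopIndex z ε Γ R - _ at hkey
  omega

end GaugeInvariance

end

open scoped Manifold ContDiff
open MeasureTheory

noncomputable section

section Gluing

open Set

variable {𝕜 : Type*} [RCLike 𝕜] {n : ℕ}

/-! ### Affine substitutions -/

theorem map_affine_volume {c : ℝ} (hc : c ≠ 0) (d : ℝ) :
    Measure.map (fun x : ℝ => c * x + d) volume = ENNReal.ofReal |c⁻¹| • volume := by
  have h : (fun x : ℝ => c * x + d) = (fun x => x + d) ∘ fun x => c * x := rfl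
  rw [h, ← Measure.map_map (measurable_add_const d) (measurable_const_mul c),
    Real.map_volume_mul_left hc, Measure.map_smul, (measurePreserving_add_right volume d).map_eq]

theorem measurableEmbedding_affine {c : ℝ} (hc : c ≠ 0) (d : ℝ) :
    MeasurableEmbedding fun x : ℝ => c * x + d :=
  (measurableEmbedding_addRight d).comp (measurableEmbedding_mulLeft₀ hc)

theorem map_affine_restrict {c : ℝ} (hc : c ≠ 0) (d : ℝ) (T : Set ℝ) :
    Measure.map (fun x : ℝ => c * x + d) (volume.restrict ((fun x : ℝ => c * x + d) ⁻¹' T))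
      = ENNReal.ofReal |c⁻¹| • volume.restrict T := by
  rw [← (measurableEmbedding_affine hc d).restrict_map, map_affine_volume hc, Measure.restrict_smul]

theorem MeasureTheory.MemLp.comp_affine {F : Type*} [NormedAddCommGroup F] {f : ℝ → F} {T S : Set ℝ}
    {p : ENNReal} (hf : MemLp f p (volume.restrict T)) {c : ℝ} (hc : c ≠ 0) (d : ℝ)
    (hS : ∀ x ∈ S, c * x + d ∈ T) : MemLp (fun x => f (c * x + d)) p (volume.restrict S) := by
  have h : MemLp f p (Measure.map (fun x : ℝ => c * x + d)
      (volume.restrict ((fun x : ℝ => c * x + d) ⁻¹' T))) := by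
    rw [map_affine_restrict hc]
    exact hf.smul_measure ENNReal.ofReal_ne_top
  exact ((measurableEmbedding_affine hc d).memLp_map_measure_iff.1 h).mono_measure
    (Measure.restrict_mono hS le_rfl)

theorem ae_comp_affine {Q : ℝ → Prop} {T S : Set ℝ} (h : ∀ᵐ x ∂volume.restrict T, Q x) {c : ℝ}
    (hc : c ≠ 0) (d : ℝ) (hS : ∀ x ∈ S, c * x + d ∈ T) :
    ∀ᵐ x ∂volume.restrict S, Q (c * x + d) := by
  have h' : ∀ᵐ x ∂Measure.map (fun x : ℝ => c * x + d)
      (volume.restrict ((fun x : ℝ => c * x + d) ⁻¹' T)), Q x := by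
    rw [map_affine_restrict hc]
    exact Measure.ae_smul_measure h _
  exact ae_restrict_of_ae_restrict_of_subset hS ((measurableEmbedding_affine hc d).ae_map_iff.1 h')

/-! ### Construction of `H¹` maps -/

/-- The `H¹` map with value `c` at `0` and derivative `f`. -/
def SobolevH1.ofDeriv (c : EuclideanSpace 𝕜 (Fin n)) (f : ℝ → EuclideanSpace 𝕜 (Fin n))
    (hf : MemLp f 2 unitMeasure) : SobolevH1 𝕜 n :=
  WithLp.toLp 2 (c, hf.toLp f)

section OfDeriv

variable (c : EuclideanSpace 𝕜 (Fin n)) {f : ℝ → EuclideanSpace 𝕜 (Fin n)}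
  (hf : MemLp f 2 unitMeasure)

@[simp] theorem SobolevH1.ofDeriv_fst : (SobolevH1.ofDeriv c f hf).fst = c := rfl

theorem SobolevH1.ofDeriv_deriv :
    ∀ᵐ r ∂unitMeasure, (SobolevH1.ofDeriv c f hf).deriv r = f r :=
  hf.coeFn_toLp

theorem SobolevH1.ofDeriv_eval {r : ℝ} (hr : r ∈ Icc (0 : ℝ) 1) :
    (SobolevH1.ofDeriv c f hf).eval r = c + ∫ s in (0 : ℝ)..r, f s := by
  rw [SobolevH1.eval_of_mem _ hr, SobolevH1.ofDeriv_fst]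
  congr 1
  refine intervalIntegral.integral_congr_ae ?_
  have h := (ae_restrict_iff' measurableSet_Icc).1 (SobolevH1.ofDeriv_deriv c hf)
  filter_upwards [h] with s hs hsr
  rw [uIoc_of_le hr.1] at hsr
  exact hs ⟨hsr.1.le, hsr.2.trans hr.2⟩

end OfDeriv

/-! ### Cutting an interval into `N` pieces -/

variable {N : ℕ}

theorem affine_piece_mem (hN : 0 < N) {j : ℕ} (hj : j < N) {s : ℝ} (hs : s ∈ Icc (0 : ℝ) 1) :
    (N : ℝ)⁻¹ * s + (j : ℝ) / N ∈ Icc (0 : ℝ) 1 := by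
  have hN' : (0 : ℝ) < N := Nat.cast_pos.2 hN
  have hj' : (j : ℝ) + 1 ≤ N := by exact_mod_cast hj
  have h0 := hs.1
  refine ⟨by positivity, ?_⟩
  rw [inv_mul_eq_div, ← add_div, div_le_one hN']
  linarith [hs.2]

theorem exists_piece (hN : 0 < N) {r : ℝ} (hr : r ∈ Icc (0 : ℝ) 1) :
    ∃ j < N, ∃ s ∈ Icc (0 : ℝ) 1, r = (N : ℝ)⁻¹ * s + (j : ℝ) / N := by
  have hN' : (0 : ℝ) < N := Nat.cast_pos.2 hN
  rcases eq_or_lt_of_le hr.2 with h1 | h1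
  · refine ⟨N - 1, by omega, 1, right_mem_Icc.2 zero_le_one, ?_⟩
    rw [h1, Nat.cast_sub hN, Nat.cast_one]
    field_simp
    ring
  · have hr0 : 0 ≤ N * r := mul_nonneg hN'.le hr.1
    refine ⟨⌊N * r⌋₊, (Nat.floor_lt hr0).2 (by nlinarith), N * r - ⌊N * r⌋₊,
      ⟨sub_nonneg.2 (Nat.floor_le hr0), by linarith [Nat.lt_floor_add_one (N * r)]⟩, ?_⟩
    field_simp
    ring

theorem integral_eq_sum_pieces {F : Type*} [NormedAddCommGroup F] [NormedSpace ℝ F]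
    (hN : 0 < N) {f : ℝ → F} (hf : IntervalIntegrable f volume 0 1) :
    ∫ r in (0 : ℝ)..1, f r
      = (N : ℝ)⁻¹ • ∑ j ∈ Finset.range N, ∫ s in (0 : ℝ)..1, f ((N : ℝ)⁻¹ * s + (j : ℝ) / N) := by
  have hN' : (N : ℝ) ≠ 0 := Nat.cast_ne_zero.2 hN.ne'
  have hstep : ∀ j : ℕ, (N : ℝ)⁻¹ • ∫ s in (0 : ℝ)..1, f ((N : ℝ)⁻¹ * s + (j : ℝ) / N)
      = ∫ r in ((j : ℝ) / N)..(((j + 1 : ℕ) : ℝ) / N), f r := fun j => by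
    rw [intervalIntegral.smul_integral_comp_mul_add]
    congr 1 <;> push_cast <;> ring
  rw [Finset.smul_sum, Finset.sum_congr rfl fun j _ => hstep j,
    intervalIntegral.sum_integral_adjacent_intervals (a := fun j : ℕ => (j : ℝ) / N)]
  · simp [hN']
  · intro j hj
    refine hf.mono_set ?_
    have h0 := affine_piece_mem hN hj (left_mem_Icc.2 zero_le_one)
    have h1 := affine_piece_mem hN hj (right_mem_Icc.2 zero_le_one)
    rw [mul_zero, zero_add] at h0
    rw [mul_one, inv_eq_one_div, ← add_div, add_comm (1 : ℝ)] at h1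
    rw [uIcc_of_le (zero_le_one (α := ℝ))]
    refine uIcc_subset_Icc h0 ?_
    rw [Nat.cast_succ]
    exact h1

/-- The rescaled restriction `s ↦ V((s + j) / N)` for `s ∈ [0, 1]`. -/
def pieceH1 (hN : 0 < N) {j : ℕ} (hj : j < N) (V : SobolevH1 𝕜 n) : SobolevH1 𝕜 n :=
  SobolevH1.ofDeriv (V.eval ((j : ℝ) / N))
    (fun s => (N : ℝ)⁻¹ • V.deriv ((N : ℝ)⁻¹ * s + (j : ℝ) / N))
    (((Lp.memLp V.deriv).comp_affine (inv_ne_zero (Nat.cast_ne_zero.2 hN.ne')) _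
      fun _ => affine_piece_mem hN hj).const_smul (N : ℝ)⁻¹)

theorem pieceH1_eval (hN : 0 < N) {j : ℕ} (hj : j < N) (V : SobolevH1 𝕜 n) {s : ℝ}
    (hs : s ∈ Icc (0 : ℝ) 1) :
    (pieceH1 hN hj V).eval s = V.eval ((N : ℝ)⁻¹ * s + (j : ℝ) / N) := by
  have h0 := affine_piece_mem hN hj (left_mem_Icc.2 (zero_le_one (α := ℝ)))
  rw [mul_zero, zero_add] at h0
  have hs' := affine_piece_mem hN hj hs
  rw [pieceH1, SobolevH1.ofDeriv_eval _ _ hs, intervalIntegral.integral_smul,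
    intervalIntegral.smul_integral_comp_mul_add, V.eval_of_mem h0, V.eval_of_mem hs', mul_zero,
    zero_add, add_assoc, intervalIntegral.integral_add_adjacent_intervals
      (V.intervalIntegrable_volume (left_mem_Icc.2 zero_le_one) h0)
      (V.intervalIntegrable_volume h0 hs')]

/-- The derivative of the map glued from `N` maps, in the variable running over `[0, N]`. -/
def glueDeriv (N : ℕ) (W : ℕ → SobolevH1 𝕜 n) (y : ℝ) : EuclideanSpace 𝕜 (Fin n) :=
  -- Half-open intervals keep the pieces from overlapping, and the translation is written as an
  -- affine map to fit `MemLp.comp_affine`.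
  ∑ j ∈ Finset.range N, (Ico (j : ℝ) (j + 1)).indicator (fun y => (W j).deriv (1 * y + -(j : ℝ))) y

theorem glueDeriv_of_mem (W : ℕ → SobolevH1 𝕜 n) {j : ℕ} (hj : j < N) {s : ℝ}
    (hs : s ∈ Ico (0 : ℝ) 1) : glueDeriv N W (s + j) = (W j).deriv s := by
  have hmem : s + j ∈ Ico (j : ℝ) (j + 1) := ⟨by linarith [hs.1], by linarith [hs.2]⟩
  rw [glueDeriv, Finset.sum_eq_single j]
  · rw [indicator_of_mem hmem]
    congr 2
    ring
  · intro i _ hij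
    refine indicator_of_notMem (fun h => hij ?_) _
    have h1 : i < j + 1 := by
      exact_mod_cast h.1.trans_lt (show s + j < (j : ℝ) + 1 by linarith [hs.2])
    have h2 : j < i + 1 := by exact_mod_cast (show (j : ℝ) ≤ s + j by linarith [hs.1]).trans_lt h.2
    omega
  · exact fun h => absurd (Finset.mem_range.2 hj) h

theorem memLp_glueDeriv (W : ℕ → SobolevH1 𝕜 n) : MemLp (glueDeriv N W) 2 volume := by
  refine memLp_finsetSum _ fun j _ => ?_
  rw [memLp_indicator_iff_restrict measurableSet_Ico]
  refine (Lp.memLp (W j).deriv).comp_affine one_ne_zero _ fun y hy => ?_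
  exact ⟨by linarith [hy.1], by linarith [hy.2]⟩

theorem intervalIntegrable_glueDeriv (W : ℕ → SobolevH1 𝕜 n) (a b : ℝ) :
    IntervalIntegrable (glueDeriv N W) volume a b := by
  have h : ∀ s : Set ℝ, volume s ≠ ⊤ → IntegrableOn (glueDeriv N W) s volume := fun s hs => by
    have : IsFiniteMeasure (volume.restrict s) := ⟨by simpa using hs.lt_top⟩
    exact ((memLp_glueDeriv W).restrict s).integrable (by norm_num)
  exact ⟨h _ (by simp), h _ (by simp)⟩

theorem integral_glueDeriv (W : ℕ → SobolevH1 𝕜 n) {j : ℕ} (hj : j < N) {s : ℝ}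
    (hs : s ∈ Icc (0 : ℝ) 1) :
    ∫ y in (j : ℝ)..(s + j), glueDeriv N W y = (W j).eval s - (W j).eval 0 := by
  have h := intervalIntegral.integral_comp_add_right (a := 0) (b := s) (glueDeriv N W) (j : ℝ)
  rw [zero_add] at h
  rw [← h, (W j).eval_of_mem hs, SobolevH1.eval_zero_right, add_sub_cancel_left]
  refine intervalIntegral.integral_congr_ae ?_
  have hne : ∀ᵐ y ∂(volume : Measure ℝ), y ≠ 1 := compl_mem_ae_iff.2 (measure_singleton (1 : ℝ))
  filter_upwards [hne] with y hy hys
  rw [uIoc_of_le hs.1] at hys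
  exact glueDeriv_of_mem W hj ⟨hys.1.le, lt_of_le_of_ne (hys.2.trans hs.2) hy⟩

/-- The map `V` with `V((s + j) / N) = W_j(s)` for `s ∈ [0, 1]`, `j < N`. -/
def glueH1 (hN : 0 < N) (W : ℕ → SobolevH1 𝕜 n) : SobolevH1 𝕜 n :=
  SobolevH1.ofDeriv (W 0).fst (fun r => (N : ℝ) • glueDeriv N W (N * r + 0))
    ((((memLp_glueDeriv W).restrict univ).comp_affine (Nat.cast_ne_zero.2 hN.ne') 0
      fun _ _ => mem_univ _).const_smul (N : ℝ))

/-- The endpoint conditions `W_j(1) = W_{j+1}(0)` ensure that the primitive of the glued derivative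
starts the `j`-th piece at `W_j(0)`. -/
theorem glueH1_eval (hN : 0 < N) {W : ℕ → SobolevH1 𝕜 n}
    (hW : ∀ j, j + 1 < N → (W j).eval 1 = (W (j + 1)).eval 0) {j : ℕ} (hj : j < N) {s : ℝ}
    (hs : s ∈ Icc (0 : ℝ) 1) :
    (glueH1 hN W).eval ((N : ℝ)⁻¹ * s + (j : ℝ) / N) = (W j).eval s := by
  have hN' : (N : ℝ) ≠ 0 := Nat.cast_ne_zero.2 hN.ne'
  have key : ∀ j < N, (W 0).fst + ∫ y in (0 : ℝ)..j, glueDeriv N W y = (W j).eval 0 := by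
    intro j
    induction j with
    | zero => simp
    | succ j ih =>
      intro hj
      have h := integral_glueDeriv W (Nat.lt_of_succ_lt hj) (right_mem_Icc.2 zero_le_one)
      rw [Nat.cast_succ, ← intervalIntegral.integral_add_adjacent_intervals
        (intervalIntegrable_glueDeriv W 0 j) (intervalIntegrable_glueDeriv W j _), ← add_assoc,
        ih (Nat.lt_of_succ_lt hj), add_comm (j : ℝ), h, hW j hj]
      abel
  rw [glueH1, SobolevH1.ofDeriv_eval _ _ (affine_piece_mem hN hj hs),
    intervalIntegral.integral_smul, intervalIntegral.smul_integral_comp_mul_add]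
  have e1 : (N : ℝ) * 0 + 0 = 0 := by ring
  have e2 : (N : ℝ) * ((N : ℝ)⁻¹ * s + (j : ℝ) / N) + 0 = s + j := by field_simp; ring
  rw [e1, e2, ← intervalIntegral.integral_add_adjacent_intervals
    (intervalIntegrable_glueDeriv W 0 j) (intervalIntegrable_glueDeriv W j _), ← add_assoc,
    key j hj, integral_glueDeriv W hj hs]
  abel

theorem glueH1_deriv (hN : 0 < N) (W : ℕ → SobolevH1 𝕜 n) {j : ℕ} (hj : j < N) :
    ∀ᵐ s ∂unitMeasure,
      (glueH1 hN W).deriv ((N : ℝ)⁻¹ * s + (j : ℝ) / N) = (N : ℝ) • (W j).deriv s := by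
  have hN' : (N : ℝ) ≠ 0 := Nat.cast_ne_zero.2 hN.ne'
  have h : ∀ᵐ r ∂unitMeasure, (glueH1 hN W).deriv r = (N : ℝ) • glueDeriv N W (N * r + 0) :=
    SobolevH1.ofDeriv_deriv _ _
  have hne : ∀ᵐ y ∂(volume : Measure ℝ), y ≠ 1 := compl_mem_ae_iff.2 (measure_singleton (1 : ℝ))
  filter_upwards [ae_comp_affine h (inv_ne_zero hN') ((j : ℝ) / N)
    fun _ => affine_piece_mem hN hj, ae_restrict_of_ae hne, ae_unitMeasure_mem] with s h1 h2 h3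
  have e2 : (N : ℝ) * ((N : ℝ)⁻¹ * s + (j : ℝ) / N) + 0 = s + j := by field_simp; ring
  rw [h1, e2, glueDeriv_of_mem W hj ⟨h3.1, lt_of_le_of_ne h3.2 h2⟩]

/-! ### The form on glued maps -/

theorem intervalIntegrable_staticForm_integrand (ε : Fin n → ℝ)
    (Γ R : C(ℝ, Matrix (Fin n) (Fin n) ℝ)) (V W : SobolevH1 𝕜 n) :
    IntervalIntegrable (fun r =>
      signForm ε (V.deriv r + realMatrixApply (Γ r) (V.eval r))
          (W.deriv r + realMatrixApply (Γ r) (W.eval r))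
        + signForm ε (realMatrixApply (R r) (V.eval r)) (W.eval r)) volume 0 1 := by
  rw [intervalIntegrable_iff_integrableOn_Icc_of_le zero_le_one]
  refine ((integrable_inner_matrixMul (constDiag ε) (covL Γ V) (covL Γ W)).add
    (integrable_inner_matrixMul (diagMul ε R) (inclL 𝕜 n V) (inclL 𝕜 n W))).congr ?_
  filter_upwards [covL_ae Γ V, covL_ae Γ W, inclL_ae V, inclL_ae W] with r h1 h2 h3 h4
  rw [Pi.add_apply, h1, h2, h3, h4, constDiag_apply, diagMul_apply, realMatrixApply_mul,
    ← signForm_eq_inner, ← signForm_eq_inner]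

/-- The form of the `N`-fold iterated data on a glued map. -/
theorem staticForm_glueH1 (hN : 0 < N) (ε : Fin n → ℝ) {Γ R : C(ℝ, Matrix (Fin n) (Fin n) ℝ)}
    (hΓ : ∀ r, Γ (r + 1) = Γ r) (hR : ∀ r, R (r + 1) = R r) {W : ℕ → SobolevH1 𝕜 n}
    (hW : ∀ j, j + 1 < N → (W j).eval 1 = (W (j + 1)).eval 0) :
    staticForm ε (rescale N N Γ) (rescale ((N : ℝ) ^ 2) N R) (glueH1 hN W) (glueH1 hN W)
      = N * ∑ j ∈ Finset.range N, staticForm ε Γ R (W j) (W j) := by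
  have hN' : (N : ℝ) ≠ 0 := Nat.cast_ne_zero.2 hN.ne'
  have hNK : (N : 𝕜) ≠ 0 := Nat.cast_ne_zero.2 hN.ne'
  have hper : ∀ m : C(ℝ, Matrix (Fin n) (Fin n) ℝ), (∀ r, m (r + 1) = m r) → ∀ (j : ℕ) (s : ℝ),
      m (N * ((N : ℝ)⁻¹ * s + (j : ℝ) / N)) = m s := fun m hm j s => by
    have e : (N : ℝ) * ((N : ℝ)⁻¹ * s + (j : ℝ) / N) = s + j := by field_simp
    rw [e]
    induction j with
    | zero => simp
    | succ j ih => rw [Nat.cast_succ, ← add_assoc, hm]; exact ih (by field_simp)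
  rw [staticForm_eq_integral, integral_eq_sum_pieces hN
    (intervalIntegrable_staticForm_integrand _ _ _ _ _)]
  -- Each piece contributes `N²` times the form of `W j`: derivatives and `Γ` are scaled by `N`, the
  -- potential by `N²`. The substitution contributes `1 / N`, leaving the factor `N`.
  refine (congrArg _ (Finset.sum_congr rfl fun j hj =>
    (?_ : _ = (N : ℝ) ^ 2 • staticForm ε Γ R (W j) (W j)))).trans ?_
  · rw [staticForm_eq_integral, ← intervalIntegral.integral_smul]
    refine intervalIntegral.integral_congr_ae ?_
    have h := (ae_restrict_iff' measurableSet_Icc).1 (glueH1_deriv hN W (Finset.mem_range.1 hj))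
    filter_upwards [h] with s hs hs1
    rw [uIoc_of_le zero_le_one] at hs1
    have hs2 : s ∈ Icc (0 : ℝ) 1 := ⟨hs1.1.le, hs1.2⟩
    rw [hs hs2, glueH1_eval hN hW (Finset.mem_range.1 hj) hs2, rescale_apply, rescale_apply,
      hper Γ hΓ, hper R hR, realMatrixApply_smul_left, realMatrixApply_smul_left,
      RCLike.real_smul_eq_coe_smul (K := 𝕜) (N : ℝ) ((W j).deriv s), ← smul_add,
      signForm_smul_left, signForm_smul_right, signForm_smul_left, RCLike.real_smul_eq_coe_mul,
      RCLike.star_def, RCLike.conj_ofReal]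
    push_cast
    ring
  · rw [← Finset.smul_sum, smul_smul, RCLike.real_smul_eq_coe_mul]
    congr 1
    push_cast
    field_simp

end Gluing

end

open scoped Manifold ContDiff
open MeasureTheory

noncomputable section

section Iteration

open Set

variable {n N : ℕ}

/-! ### Fourier decomposition of periodic maps -/

theorem sum_pow_mul_conj {ζ : ℂ} (hζ : IsPrimitiveRoot ζ N) (hN : 0 < N) {k l : ℕ} (hk : k < N)
    (hl : l < N) :
    ∑ j ∈ Finset.range N, ζ ^ (j * k) * starRingEnd ℂ (ζ ^ (j * l))
      = if k = l then (N : ℂ) else 0 := by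
  have hnorm : ‖ζ‖ = 1 := hζ.norm'_eq_one hN.ne'
  have hconj : ζ * starRingEnd ℂ ζ = 1 := by
    rw [Complex.mul_conj, Complex.normSq_eq_norm_sq, hnorm]; simp
  set x := ζ ^ k * starRingEnd ℂ (ζ ^ l) with hx
  have hterm : ∀ j, ζ ^ (j * k) * starRingEnd ℂ (ζ ^ (j * l)) = x ^ j := fun j => by
    rw [hx, mul_pow, map_pow, map_pow, ← pow_mul, ← pow_mul, mul_comm k, mul_comm l]
  simp only [hterm]
  have hlx : x * ζ ^ l = ζ ^ k := by
    rw [hx, mul_assoc, map_pow, ← mul_pow, mul_comm (starRingEnd ℂ ζ), hconj, one_pow, mul_one]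
  split_ifs with h
  · have h1 : x = 1 := by
      rw [hx, h, map_pow, ← mul_pow, hconj, one_pow]
    simp [h1]
  · have h1 : x ≠ 1 := fun h1 => by
      rw [h1, one_mul] at hlx
      exact h (hζ.pow_inj hl hk hlx).symm
    have hxN : x ^ N = 1 := by
      rw [hx, mul_pow, ← pow_mul, mul_comm k, pow_mul, hζ.pow_eq_one, one_pow, one_mul, ← map_pow,
        ← pow_mul, mul_comm l, pow_mul, hζ.pow_eq_one, one_pow, map_one]
    have h2 := geom_sum_mul x N
    rw [hxN, sub_self] at h2
    exact (mul_eq_zero.1 h2).resolve_right (sub_ne_zero.2 h1)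

/-- The maps `V_j = ∑ₖ ζ^{jk} U_k`. -/
def fourierSum {E : Type*} [AddCommGroup E] [Module ℂ E] (ζ : ℂ) (N : ℕ) (U : ℕ → E) (j : ℕ) : E :=
  ∑ k ∈ Finset.range N, ζ ^ (j * k) • U k

theorem fourierSum_inversion {E : Type*} [AddCommGroup E] [Module ℂ E] {ζ : ℂ}
    (hζ : IsPrimitiveRoot ζ N) (hN : 0 < N) (U : ℕ → E) {l : ℕ} (hl : l < N) :
    ∑ j ∈ Finset.range N, starRingEnd ℂ (ζ ^ (j * l)) • fourierSum ζ N U j = (N : ℂ) • U l := by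
  simp only [fourierSum, Finset.smul_sum, smul_smul]
  rw [Finset.sum_comm, Finset.sum_eq_single l]
  · rw [← Finset.sum_smul]
    congr 1
    rw [← (sum_pow_mul_conj hζ hN hl hl).trans (if_pos rfl)]
    exact Finset.sum_congr rfl fun j _ => mul_comm _ _
  · intro k hk hkl
    rw [← Finset.sum_smul]
    have := (sum_pow_mul_conj hζ hN (Finset.mem_range.1 hk) hl).trans (if_neg hkl)
    rw [Finset.sum_congr rfl fun j _ => mul_comm _ _, this, zero_smul]
  · exact fun h => absurd (Finset.mem_range.2 hl) h

theorem staticForm_sum_left (ε : Fin n → ℝ) (Γ R : C(ℝ, Matrix (Fin n) (Fin n) ℝ))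
    (a : ℕ → ℂ) (U : ℕ → SobolevH1 ℂ n) (W : SobolevH1 ℂ n) :
    staticForm ε Γ R (∑ k ∈ Finset.range N, a k • U k) W
      = ∑ k ∈ Finset.range N, a k * staticForm ε Γ R (U k) W := by
  simp only [staticForm, map_sum, map_smul, inner_sum, inner_smul_right, mul_add,
    Finset.sum_add_distrib]

theorem staticForm_sum_right (ε : Fin n → ℝ) (Γ R : C(ℝ, Matrix (Fin n) (Fin n) ℝ))
    (a : ℕ → ℂ) (U : ℕ → SobolevH1 ℂ n) (W : SobolevH1 ℂ n) :
    staticForm ε Γ R W (∑ k ∈ Finset.range N, a k • U k)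
      = ∑ k ∈ Finset.range N, starRingEnd ℂ (a k) * staticForm ε Γ R W (U k) := by
  simp only [staticForm, map_sum, map_smul, sum_inner, inner_smul_left, mul_add,
    Finset.sum_add_distrib]

/-- Parseval's identity for `staticForm`. -/
theorem sum_staticForm_fourierSum {ζ : ℂ} (hζ : IsPrimitiveRoot ζ N) (hN : 0 < N) (ε : Fin n → ℝ)
    (Γ R : C(ℝ, Matrix (Fin n) (Fin n) ℝ)) (U : ℕ → SobolevH1 ℂ n) :
    ∑ j ∈ Finset.range N, staticForm ε Γ R (fourierSum ζ N U j) (fourierSum ζ N U j)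
      = N * ∑ k ∈ Finset.range N, staticForm ε Γ R (U k) (U k) := by
  simp only [fourierSum, staticForm_sum_left, staticForm_sum_right, Finset.mul_sum]
  rw [Finset.sum_comm]
  refine Finset.sum_congr rfl fun k hk => ?_
  rw [Finset.sum_comm, Finset.sum_eq_single k]
  · simp only [← mul_assoc]
    rw [← Finset.sum_mul, Finset.sum_congr rfl fun j _ => mul_comm _ _,
      (sum_pow_mul_conj hζ hN (Finset.mem_range.1 hk) (Finset.mem_range.1 hk)).trans (if_pos rfl)]
  · intro l hl hlk
    simp only [← mul_assoc]
    rw [← Finset.sum_mul, Finset.sum_congr rfl fun j _ => mul_comm _ _,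
      (sum_pow_mul_conj hζ hN (Finset.mem_range.1 hl) (Finset.mem_range.1 hk)).trans (if_neg hlk),
      zero_mul]
  · exact fun h => absurd hk h

theorem SobolevH1.eval_sum {𝕜 : Type*} [RCLike 𝕜] {ι : Type*} (s : Finset ι)
    (U : ι → SobolevH1 𝕜 n) {r : ℝ} (hr : r ∈ Icc (0 : ℝ) 1) :
    (∑ k ∈ s, U k).eval r = ∑ k ∈ s, (U k).eval r := by
  simp only [← evalL_apply r hr, map_sum]

theorem fourierSum_eval (ζ : ℂ) (U : ℕ → SobolevH1 ℂ n) (j : ℕ) {r : ℝ}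
    (hr : r ∈ Icc (0 : ℝ) 1) :
    (fourierSum ζ N U j).eval r = fourierSum ζ N (fun k => (U k).eval r) j := by
  simp only [fourierSum, SobolevH1.eval_sum _ _ hr, SobolevH1.eval_smul]

/-- Extension by zero of a family indexed by `Fin N`. -/
def extendFin {ζ : ℂ} (U : ∀ k : Fin N, twistedH1 ℂ n (ζ ^ (k : ℕ))) (k : ℕ) : SobolevH1 ℂ n :=
  if h : k < N then U ⟨k, h⟩ else 0

theorem extendFin_of_lt {ζ : ℂ} (U : ∀ k : Fin N, twistedH1 ℂ n (ζ ^ (k : ℕ))) (k : Fin N) :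
    extendFin U k = U k := dif_pos k.2

theorem extendFin_eval_one {ζ : ℂ} (U : ∀ k : Fin N, twistedH1 ℂ n (ζ ^ (k : ℕ))) {k : ℕ}
    (hk : k < N) : (extendFin U k).eval 1 = ζ ^ k • (extendFin U k).eval 0 := by
  rw [extendFin, dif_pos hk]
  exact (U ⟨k, hk⟩).2

/-- The twisted boundary condition `U_k(1) = ζ^k U_k(0)` turns `ζ^{jk}` into `ζ^{(j+1)k}`, which is
exactly the condition for gluing consecutive pieces. -/
theorem fourierSum_extendFin_eval_one {ζ : ℂ} (U : ∀ k : Fin N, twistedH1 ℂ n (ζ ^ (k : ℕ)))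
    (j : ℕ) : (fourierSum ζ N (extendFin U) j).eval 1
      = (fourierSum ζ N (extendFin U) (j + 1)).eval 0 := by
  rw [fourierSum_eval _ _ _ (right_mem_Icc.2 zero_le_one),
    fourierSum_eval _ _ _ (left_mem_Icc.2 zero_le_one), fourierSum, fourierSum]
  refine Finset.sum_congr rfl fun k hk => ?_
  rw [extendFin_eval_one U (Finset.mem_range.1 hk), smul_smul, add_mul, one_mul, pow_add]

/-- The periodic map with `V((s + j) / N) = ∑ₖ ζ^{jk} U_k(s)`. -/
def unfoldFun (hN : 0 < N) (ζ : ℂ) (U : ∀ k : Fin N, twistedH1 ℂ n (ζ ^ (k : ℕ))) :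
    SobolevH1 ℂ n :=
  glueH1 hN (fourierSum ζ N (extendFin U))

theorem unfoldFun_eval (hN : 0 < N) (ζ : ℂ) (U : ∀ k : Fin N, twistedH1 ℂ n (ζ ^ (k : ℕ)))
    {j : ℕ} (hj : j < N) {s : ℝ} (hs : s ∈ Icc (0 : ℝ) 1) :
    (unfoldFun hN ζ U).eval ((N : ℝ)⁻¹ * s + (j : ℝ) / N)
      = fourierSum ζ N (fun k => (extendFin U k).eval s) j := by
  rw [unfoldFun, glueH1_eval hN (fun j _ => fourierSum_extendFin_eval_one U j) hj hs,
    fourierSum_eval _ _ _ hs]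

theorem SobolevH1.ext_pieces {𝕜 : Type*} [RCLike 𝕜] (hN : 0 < N) {V W : SobolevH1 𝕜 n}
    (h : ∀ j < N, ∀ s ∈ Icc (0 : ℝ) 1, V.eval ((N : ℝ)⁻¹ * s + (j : ℝ) / N)
      = W.eval ((N : ℝ)⁻¹ * s + (j : ℝ) / N)) : V = W := by
  refine SobolevH1.ext_eval fun r hr => ?_
  obtain ⟨j, hj, s, hs, rfl⟩ := exists_piece hN hr
  exact h j hj s hs

/-- The end of the last piece is `∑ₖ ζ^{Nk} U_k(0)`, and `ζ^N = 1` closes the loop. -/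
theorem unfoldFun_mem (hN : 0 < N) {ζ : ℂ} (hζ : ζ ^ N = 1)
    (U : ∀ k : Fin N, twistedH1 ℂ n (ζ ^ (k : ℕ))) : unfoldFun hN ζ U ∈ twistedH1 ℂ n 1 := by
  have hN' : (N : ℝ) ≠ 0 := Nat.cast_ne_zero.2 hN.ne'
  have h1 : (N : ℝ)⁻¹ * 1 + ((N - 1 : ℕ) : ℝ) / N = 1 := by
    rw [Nat.cast_sub hN, Nat.cast_one]; field_simp; ring
  have h0 : (N : ℝ)⁻¹ * 0 + ((0 : ℕ) : ℝ) / N = 0 := by simp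
  have e1 := unfoldFun_eval hN ζ U (Nat.sub_one_lt hN.ne') (right_mem_Icc.2 zero_le_one)
  have e0 := unfoldFun_eval hN ζ U hN (left_mem_Icc.2 zero_le_one)
  rw [h1] at e1
  rw [h0] at e0
  rw [mem_twistedH1, one_smul, e1, e0, fourierSum, fourierSum]
  refine Finset.sum_congr rfl fun k hk => ?_
  rw [extendFin_eval_one U (Finset.mem_range.1 hk), smul_smul, ← pow_add, zero_mul, pow_zero,
    ← Nat.succ_mul, Nat.succ_eq_add_one, Nat.sub_add_cancel hN, pow_mul, hζ, one_pow]

theorem fourierSum_add {E : Type*} [AddCommGroup E] [Module ℂ E] (ζ : ℂ) (U U' : ℕ → E) (j : ℕ) :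
    fourierSum ζ N (fun k => U k + U' k) j = fourierSum ζ N U j + fourierSum ζ N U' j := by
  simp only [fourierSum, smul_add, Finset.sum_add_distrib]

theorem fourierSum_smul {E : Type*} [AddCommGroup E] [Module ℂ E] (ζ c : ℂ) (U : ℕ → E) (j : ℕ) :
    fourierSum ζ N (fun k => c • U k) j = c • fourierSum ζ N U j := by
  simp only [fourierSum, Finset.smul_sum]
  exact Finset.sum_congr rfl fun k _ => smul_comm _ _ _

theorem fourierSum_congr {E : Type*} [AddCommGroup E] [Module ℂ E] (ζ : ℂ) {U U' : ℕ → E}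
    (h : ∀ k < N, U k = U' k) (j : ℕ) : fourierSum ζ N U j = fourierSum ζ N U' j :=
  Finset.sum_congr rfl fun k hk => by rw [h k (Finset.mem_range.1 hk)]

/-- The linear map `U ↦ V` with `V((s + j) / N) = ∑ₖ ζ^{jk} U_k(s)`. -/
def unfoldL (hN : 0 < N) {ζ : ℂ} (hζ : ζ ^ N = 1) :
    (∀ k : Fin N, twistedH1 ℂ n (ζ ^ (k : ℕ))) →ₗ[ℂ] twistedH1 ℂ n 1 where
  toFun U := ⟨unfoldFun hN ζ U, unfoldFun_mem hN hζ U⟩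
  map_add' U U' := by
    refine Subtype.ext (SobolevH1.ext_pieces hN fun j hj s hs => ?_)
    rw [Submodule.coe_add, SobolevH1.eval_add, unfoldFun_eval hN ζ _ hj hs,
      unfoldFun_eval hN ζ _ hj hs, unfoldFun_eval hN ζ _ hj hs, ← fourierSum_add]
    refine fourierSum_congr ζ (fun k hk => ?_) j
    simp only [extendFin, dif_pos hk, ← SobolevH1.eval_add]
    rfl
  map_smul' c U := by
    refine Subtype.ext (SobolevH1.ext_pieces hN fun j hj s hs => ?_)
    rw [RingHom.id_apply, Submodule.coe_smul, SobolevH1.eval_smul, unfoldFun_eval hN ζ _ hj hs,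
      unfoldFun_eval hN ζ _ hj hs, ← fourierSum_smul]
    refine fourierSum_congr ζ (fun k hk => ?_) j
    simp only [extendFin, dif_pos hk, ← SobolevH1.eval_smul]
    rfl

theorem unfoldL_eval (hN : 0 < N) {ζ : ℂ} (hζ : ζ ^ N = 1)
    (U : ∀ k : Fin N, twistedH1 ℂ n (ζ ^ (k : ℕ))) {j : ℕ} (hj : j < N) {s : ℝ}
    (hs : s ∈ Icc (0 : ℝ) 1) :
    (unfoldL hN hζ U : SobolevH1 ℂ n).eval ((N : ℝ)⁻¹ * s + (j : ℝ) / N)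
      = fourierSum ζ N (fun k => (extendFin U k).eval s) j :=
  unfoldFun_eval hN ζ U hj hs

theorem unfoldL_injective (hN : 0 < N) {ζ : ℂ} (hζ : IsPrimitiveRoot ζ N) :
    Function.Injective (unfoldL (n := n) hN hζ.pow_eq_one) := by
  rw [injective_iff_map_eq_zero]
  intro U hU
  funext l
  refine Subtype.ext (SobolevH1.eq_zero_of_eval fun s hs => ?_)
  have h := fourierSum_inversion hζ hN (fun k => (extendFin U k).eval s) l.2
  rw [Finset.sum_eq_zero] at h
  · have hN' : (N : ℂ) ≠ 0 := Nat.cast_ne_zero.2 hN.ne'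
    rw [← extendFin_of_lt U l]
    exact (smul_eq_zero.1 h.symm).resolve_left hN'
  · intro j hj
    rw [← unfoldL_eval hN hζ.pow_eq_one U (Finset.mem_range.1 hj) hs, hU]
    have hz : ((0 : twistedH1 ℂ n 1) : SobolevH1 ℂ n).eval ((N : ℝ)⁻¹ * s + (j : ℝ) / N) = 0 :=
      map_zero (evalL (𝕜 := ℂ) (n := n) _ (affine_piece_mem hN (Finset.mem_range.1 hj) hs))
    rw [hz, smul_zero]

/-- The rescaled restrictions of `V` to the `N` subintervals, extended by zero. -/
def pieces (hN : 0 < N) (V : SobolevH1 ℂ n) (j : ℕ) : SobolevH1 ℂ n :=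
  if h : j < N then pieceH1 hN h V else 0

theorem pieces_eval (hN : 0 < N) (V : SobolevH1 ℂ n) {j : ℕ} (hj : j < N) {s : ℝ}
    (hs : s ∈ Icc (0 : ℝ) 1) :
    (pieces hN V j).eval s = V.eval ((N : ℝ)⁻¹ * s + (j : ℝ) / N) := by
  rw [pieces, dif_pos hj, pieceH1_eval hN hj V hs]

/-- The Fourier coefficients of a periodic map under the translation by `1 / N`. -/
def fourierCoeffH1 (hN : 0 < N) (ζ : ℂ) (V : SobolevH1 ℂ n) (l : ℕ) : SobolevH1 ℂ n :=
  (N : ℂ)⁻¹ • ∑ j ∈ Finset.range N, starRingEnd ℂ (ζ ^ (j * l)) • pieces hN V j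

theorem fourierCoeffH1_eval (hN : 0 < N) (ζ : ℂ) (V : SobolevH1 ℂ n) (l : ℕ) {s : ℝ}
    (hs : s ∈ Icc (0 : ℝ) 1) :
    (fourierCoeffH1 hN ζ V l).eval s = (N : ℂ)⁻¹ • ∑ j ∈ Finset.range N,
      starRingEnd ℂ (ζ ^ (j * l)) • V.eval ((N : ℝ)⁻¹ * s + (j : ℝ) / N) := by
  rw [fourierCoeffH1, SobolevH1.eval_smul, SobolevH1.eval_sum _ _ hs]
  congr 1
  refine Finset.sum_congr rfl fun j hj => ?_
  rw [SobolevH1.eval_smul, pieces_eval hN V (Finset.mem_range.1 hj) hs]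

/-- Passing from `s = 0` to `s = 1` shifts the sum over the pieces by one. The shift produces the
factor `ζ^l`, and periodicity of `V` together with `ζ^N = 1` makes the sum cyclic. -/
theorem fourierCoeffH1_mem (hN : 0 < N) {ζ : ℂ} (hζ : IsPrimitiveRoot ζ N) {V : SobolevH1 ℂ n}
    (hV : V ∈ twistedH1 ℂ n 1) (l : ℕ) : fourierCoeffH1 hN ζ V l ∈ twistedH1 ℂ n (ζ ^ l) := by
  have hN' : (N : ℝ) ≠ 0 := Nat.cast_ne_zero.2 hN.ne'
  have hconj : ζ * starRingEnd ℂ ζ = 1 := by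
    rw [Complex.mul_conj, Complex.normSq_eq_norm_sq, hζ.norm'_eq_one hN.ne']; simp
  set f : ℕ → EuclideanSpace ℂ (Fin n) := fun j =>
    starRingEnd ℂ (ζ ^ (j * l)) • V.eval ((j : ℝ) / N) with hf
  have hfN : f N = f 0 := by
    rw [hf]
    simp only [Nat.cast_zero, zero_div, zero_mul, pow_zero, map_one, pow_mul, hζ.pow_eq_one,
      one_pow]
    rw [div_self hN', mem_twistedH1.1 hV, one_smul]
  have hsum : ∑ j ∈ Finset.range N, f (j + 1) = ∑ j ∈ Finset.range N, f j := by
    have h1 := Finset.sum_range_succ f N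
    rw [Finset.sum_range_succ', hfN] at h1
    exact add_right_cancel h1
  rw [mem_twistedH1, fourierCoeffH1_eval hN ζ V l (right_mem_Icc.2 zero_le_one),
    fourierCoeffH1_eval hN ζ V l (left_mem_Icc.2 zero_le_one), smul_comm]
  congr 1
  have e0 : ∑ j ∈ Finset.range N,
      starRingEnd ℂ (ζ ^ (j * l)) • V.eval ((N : ℝ)⁻¹ * 0 + (j : ℝ) / N)
      = ∑ j ∈ Finset.range N, f j := by
    refine Finset.sum_congr rfl fun j _ => ?_
    rw [mul_zero, zero_add]
  rw [e0, ← hsum, Finset.smul_sum]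
  refine Finset.sum_congr rfl fun j _ => ?_
  have e1 : (N : ℝ)⁻¹ * 1 + (j : ℝ) / N = ((j + 1 : ℕ) : ℝ) / N := by
    push_cast; field_simp; ring
  rw [hf, e1, smul_smul, add_mul, one_mul, pow_add, map_mul, mul_left_comm, map_pow _ _ l,
    ← mul_pow, hconj, one_pow, mul_one]

/-- The Fourier coefficients give a preimage; orthogonality of the characters, now summed over the
frequency, returns the `j`-th piece. -/
theorem unfoldL_surjective (hN : 0 < N) {ζ : ℂ} (hζ : IsPrimitiveRoot ζ N) :
    Function.Surjective (unfoldL (n := n) hN hζ.pow_eq_one) := by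
  intro V
  have hN' : (N : ℂ) ≠ 0 := Nat.cast_ne_zero.2 hN.ne'
  refine ⟨fun l => ⟨fourierCoeffH1 hN ζ V l, fourierCoeffH1_mem hN hζ V.2 l⟩,
    Subtype.ext (SobolevH1.ext_pieces hN fun j hj s hs => ?_)⟩
  rw [unfoldL_eval hN hζ.pow_eq_one _ hj hs, fourierSum_congr ζ (U' := fun k =>
    (fourierCoeffH1 hN ζ (V : SobolevH1 ℂ n) k).eval s) fun k hk => by rw [extendFin, dif_pos hk]]
  simp only [fourierSum, fourierCoeffH1_eval hN ζ _ _ hs, Finset.smul_sum, smul_smul]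
  rw [Finset.sum_comm, Finset.sum_eq_single j]
  · rw [← Finset.sum_smul]
    refine (congrArg (· • _) (?_ : _ = (1 : ℂ))).trans (one_smul _ _)
    have h := (sum_pow_mul_conj hζ hN hj hj).trans (if_pos rfl)
    rw [← inv_mul_cancel₀ hN', ← h, Finset.mul_sum]
    refine Finset.sum_congr rfl fun k _ => ?_
    rw [mul_comm j k]
    ring
  · intro i hi hij
    rw [← Finset.sum_smul]
    refine (congrArg (· • _) (?_ : _ = (0 : ℂ))).trans (zero_smul _ _)
    have h := (sum_pow_mul_conj hζ hN hj (Finset.mem_range.1 hi)).trans (if_neg (Ne.symm hij))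
    rw [← mul_zero ((N : ℂ)⁻¹), ← h, Finset.mul_sum]
    refine Finset.sum_congr rfl fun k _ => ?_
    rw [mul_comm j k, mul_comm i k]
    ring
  · exact fun h => absurd (Finset.mem_range.2 hj) h

/-- The isomorphism of the periodic maps with the sum of the twisted spaces. -/
def unfoldEquiv (hN : 0 < N) {ζ : ℂ} (hζ : IsPrimitiveRoot ζ N) :
    (∀ k : Fin N, twistedH1 ℂ n (ζ ^ (k : ℕ))) ≃ₗ[ℂ] twistedH1 ℂ n 1 :=
  LinearEquiv.ofBijective (unfoldL hN hζ.pow_eq_one)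
    ⟨unfoldL_injective hN hζ, unfoldL_surjective hN hζ⟩

theorem unfoldEquiv_apply (hN : 0 < N) {ζ : ℂ} (hζ : IsPrimitiveRoot ζ N)
    (U : ∀ k : Fin N, twistedH1 ℂ n (ζ ^ (k : ℕ))) :
    unfoldEquiv hN hζ U = unfoldL hN hζ.pow_eq_one U := rfl

theorem realMatrixApply_fourierSum (A : Matrix (Fin n) (Fin n) ℝ) (ζ : ℂ)
    (U : ℕ → EuclideanSpace ℂ (Fin n)) (j : ℕ) :
    realMatrixApply A (fourierSum ζ N U j)
      = fourierSum ζ N (fun k => realMatrixApply A (U k)) j := by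
  let L : EuclideanSpace ℂ (Fin n) →ₗ[ℂ] EuclideanSpace ℂ (Fin n) :=
    { toFun := realMatrixApply A
      map_add' := realMatrixApply_add A
      map_smul' := realMatrixApply_smul A }
  change L (∑ k ∈ Finset.range N, ζ ^ (j * k) • U k) = ∑ k ∈ Finset.range N, ζ ^ (j * k) • L (U k)
  simp only [map_sum, map_smul]

/-! ### The index of iterated data -/

/-- One factor `N` comes from gluing the pieces, the other from Parseval's identity. Mixed terms of
different frequencies cancel. -/
theorem loopForm_unfoldEquiv (hN : 0 < N) {ζ : ℂ} (hζ : IsPrimitiveRoot ζ N) (ε : Fin n → ℝ)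
    {Γ R : C(ℝ, Matrix (Fin n) (Fin n) ℝ)} (hΓ : ∀ r, Γ (r + 1) = Γ r)
    (hR : ∀ r, R (r + 1) = R r) (U : ∀ k : Fin N, twistedH1 ℂ n (ζ ^ (k : ℕ))) :
    loopForm 1 ε (rescale N N Γ) (rescale ((N : ℝ) ^ 2) N R) (unfoldEquiv hN hζ U)
      = (N : ℝ) ^ 2 * ∑ k : Fin N, loopForm (ζ ^ (k : ℕ)) ε Γ R (U k) := by
  have h : staticForm ε (rescale N N Γ) (rescale ((N : ℝ) ^ 2) N R)
      (unfoldEquiv hN hζ U : SobolevH1 ℂ n) (unfoldEquiv hN hζ U : SobolevH1 ℂ n)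
      = (N : ℂ) * (N * ∑ k ∈ Finset.range N, staticForm ε Γ R (extendFin U k) (extendFin U k)) := by
    rw [← sum_staticForm_fourierSum hζ hN]
    exact staticForm_glueH1 hN ε hΓ hR fun j _ => fourierSum_extendFin_eval_one U j
  have hre : ∀ S : ℂ, RCLike.re ((N : ℂ) * (N * S)) = (N : ℝ) ^ 2 * RCLike.re S := fun S => by
    simp [pow_two, mul_assoc]
  rw [loopForm, h, hre, Finset.sum_range, map_sum]
  simp only [loopForm, extendFin_of_lt]

/-- A constant matrix commutes with Fourier sums. Unfolding therefore maps the product of the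
reference splittings onto the reference splitting of the periodic maps, and no correction of the
index arises. -/
theorem unfoldEquiv_reflectionL (hN : 0 < N) {ζ : ℂ} (hζ : IsPrimitiveRoot ζ N) (ε : Fin n → ℝ)
    (U : ∀ k : Fin N, twistedH1 ℂ n (ζ ^ (k : ℕ))) :
    unfoldEquiv hN hζ (fun k => reflectionL _ ε (U k)) = reflectionL 1 ε (unfoldEquiv hN hζ U) := by
  refine Subtype.ext (SobolevH1.ext_pieces hN fun j hj s hs => ?_)
  have h1 := reflectionL_eval 1 ε (unfoldEquiv hN hζ U) (affine_piece_mem hN hj hs)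
  have h2 := unfoldL_eval hN hζ.pow_eq_one U hj hs
  have h3 := unfoldL_eval hN hζ.pow_eq_one (fun k => reflectionL _ ε (U k)) hj hs
  rw [h1, unfoldEquiv_apply, unfoldEquiv_apply, h3, h2, realMatrixApply_fourierSum]
  refine fourierSum_congr ζ (fun k hk => ?_) j
  rw [extendFin, dif_pos hk, extendFin, dif_pos hk, reflectionL_eval _ ε _ hs]

theorem map_pi_fixedSpace {𝕜 ι : Type*} [RCLike 𝕜] [Fintype ι] {W : ι → Type*}
    [∀ i, NormedAddCommGroup (W i)] [∀ i, InnerProductSpace 𝕜 (W i)] [∀ i, CompleteSpace (W i)]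
    {H : Type*} [NormedAddCommGroup H] [InnerProductSpace 𝕜 H] [CompleteSpace H]
    (J : ∀ i, W i →L[𝕜] W i) (J' : H →L[𝕜] H)
    (e : (∀ i, W i) ≃ₗ[𝕜] H) (he : ∀ U, e (fun i => J i (U i)) = J' (e U)) :
    (Submodule.pi univ fun i => fixedSpace (J i)).map (e : (∀ i, W i) →ₗ[𝕜] H) = fixedSpace J' ∧
    (Submodule.pi univ fun i => antifixedSpace (J i)).map (e : (∀ i, W i) →ₗ[𝕜] H)
      = antifixedSpace J' := by
  constructor
  · ext V
    obtain ⟨U, rfl⟩ := e.surjective V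
    rw [mem_fixedSpace, ← he, e.injective.eq_iff, funext_iff, Submodule.mem_map_equiv,
      LinearEquiv.symm_apply_apply, Submodule.mem_pi]
    exact forall_congr' fun k => by simp only [mem_univ, true_imp_iff, mem_fixedSpace]
  · ext V
    obtain ⟨U, rfl⟩ := e.surjective V
    rw [mem_antifixedSpace, ← he, ← map_neg, e.injective.eq_iff, funext_iff,
      Submodule.mem_map_equiv, LinearEquiv.symm_apply_apply, Submodule.mem_pi]
    exact forall_congr' fun k => by
      simp only [mem_univ, true_imp_iff, mem_antifixedSpace, Pi.neg_apply]

/-- The index sees only signs and relative dimensions, so a linear isomorphism respecting the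
reflections suffices. It need not be isometric, and the positive factor `c` is harmless. -/
theorem formIndex_eq_sum {𝕜 ι : Type*} [RCLike 𝕜] [Fintype ι] {W : ι → Type*}
    [∀ i, NormedAddCommGroup (W i)] [∀ i, InnerProductSpace 𝕜 (W i)] [∀ i, CompleteSpace (W i)]
    {H : Type*} [NormedAddCommGroup H] [InnerProductSpace 𝕜 H] [CompleteSpace H]
    {J : ∀ i, W i →L[𝕜] W i} {J' : H →L[𝕜] H} (hJ' : ∀ x, J' (J' x) = x)
    (e : (∀ i, W i) ≃ₗ[𝕜] H) (he : ∀ U, e (fun i => J i (U i)) = J' (e U)) {q : ∀ i, W i → ℝ}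
    {r : ι → ℤ} (h : ∀ i, HasIndex (fixedSpace (J i)) (antifixedSpace (J i)) (q i) (r i))
    (h0 : ∀ i, q i 0 = 0) {q' : H → ℝ} {c : ℝ} (hc : 0 < c)
    (hq : ∀ U, q' (e U) = c * ∑ i, q i (U i)) :
    formIndex (fixedSpace J') (antifixedSpace J') q' = ∑ i, r i := by
  have h1 := ((HasIndex.pi h h0).congr (q' := fun U => q' (e U)) hc hq).map e (q' := q')
    fun _ => rfl
  obtain ⟨hfix, hanti⟩ := map_pi_fixedSpace J J' e he
  rw [hfix, hanti] at h1
  exact h1.formIndex_eq (isCompl_fixedSpace hJ').sup_eq_top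

theorem loopForm_zero_right {𝕜 : Type*} [RCLike 𝕜] (z : 𝕜) (ε : Fin n → ℝ)
    (Γ R : C(ℝ, Matrix (Fin n) (Fin n) ℝ)) : loopForm z ε Γ R 0 = 0 := by
  rw [loopForm, staticForm, Submodule.coe_zero, map_zero, map_zero, map_zero, map_zero,
    inner_zero_left, add_zero, map_zero]

/-- The iteration formula at the level of a single form. With zero data it also settles the initial
point of the path. -/
theorem loopIndex_rescale (hN : 0 < N) {ζ : ℂ} (hζ : IsPrimitiveRoot ζ N) {ε : Fin n → ℝ}
    (hε : ∀ i, ε i = 1 ∨ ε i = -1) {Γ R : C(ℝ, Matrix (Fin n) (Fin n) ℝ)}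
    (hΓ : ∀ r, Γ (r + 1) = Γ r) (hR : ∀ r, R (r + 1) = R r)
    (hRs : ∀ r, (Matrix.diagonal ε * R r).IsSymm) :
    loopIndex (1 : ℂ) ε (rescale N N Γ) (rescale ((N : ℝ) ^ 2) N R)
      = ∑ k ∈ Finset.range N, loopIndex (ζ ^ k) ε Γ R := by
  have hN2 : (0 : ℝ) < (N : ℝ) ^ 2 := by have := Nat.cast_pos (α := ℝ).2 hN; positivity
  have h1 := formIndex_eq_sum (𝕜 := ℂ) (W := fun k : Fin N => twistedH1 ℂ n (ζ ^ (k : ℕ)))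
    (H := twistedH1 ℂ n 1) (J := fun k => reflectionL _ ε) (reflectionL_reflectionL 1 hε)
  have h2 := h1 (unfoldEquiv hN hζ)
  have h3 := h2 (unfoldEquiv_reflectionL hN hζ ε) (q := fun k => loopForm (ζ ^ (k : ℕ)) ε Γ R)
    (r := fun k => loopIndex (ζ ^ (k : ℕ)) ε Γ R)
    (fun k => hasIndex_loopIndex (ζ ^ (k : ℕ)) hε hRs) (fun k => loopForm_zero_right _ _ _ _)
    (q' := loopForm 1 ε (rescale N N Γ) (rescale ((N : ℝ) ^ 2) N R)) (c := (N : ℝ) ^ 2) hN2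
  have h4 := h3 (loopForm_unfoldEquiv hN hζ ε hΓ hR)
  rw [Finset.sum_range]
  exact h4

end Iteration

end

open scoped Manifold ContDiff
open MeasureTheory

noncomputable section

section Complexification

open Set

variable {n : ℕ}

/-! ### Complexification -/

/-- A real linear map of finite sequences that does not increase coefficients is continuous. -/
def coordwiseL {𝕜 𝕜' : Type*} [RCLike 𝕜] [RCLike 𝕜'] (f : 𝕜 →ₗ[ℝ] 𝕜') (hf : ∀ x, ‖f x‖ ≤ ‖x‖) :
    EuclideanSpace 𝕜 (Fin n) →L[ℝ] EuclideanSpace 𝕜' (Fin n) :=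
  LinearMap.mkContinuous
    { toFun := fun v => WithLp.toLp 2 fun i => f (v i)
      map_add' := fun v w => by ext i; simp
      map_smul' := fun a v => by ext i; simp } n fun v => by
    refine (norm_le_sum_norm _).trans ((Finset.sum_le_sum fun i _ =>
      (hf (v i)).trans (PiLp.norm_apply_le v i)).trans_eq ?_)
    simp

@[simp] theorem coordwiseL_apply {𝕜 𝕜' : Type*} [RCLike 𝕜] [RCLike 𝕜'] (f : 𝕜 →ₗ[ℝ] 𝕜')
    (hf : ∀ x, ‖f x‖ ≤ ‖x‖) (v : EuclideanSpace 𝕜 (Fin n)) (i : Fin n) :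
    coordwiseL f hf v i = f (v i) := rfl

section MapH1

variable {𝕜 𝕜' : Type*} [RCLike 𝕜] [RCLike 𝕜']

/-- The action of a real linear map on `H¹` maps. -/
def mapH1 (L : EuclideanSpace 𝕜 (Fin n) →L[ℝ] EuclideanSpace 𝕜' (Fin n)) (V : SobolevH1 𝕜 n) :
    SobolevH1 𝕜' n :=
  SobolevH1.ofDeriv (L V.fst) (fun r => L (V.deriv r)) (L.comp_memLp' (Lp.memLp V.deriv))

theorem mapH1_deriv (L : EuclideanSpace 𝕜 (Fin n) →L[ℝ] EuclideanSpace 𝕜' (Fin n))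
    (V : SobolevH1 𝕜 n) : ∀ᵐ r ∂unitMeasure, (mapH1 L V).deriv r = L (V.deriv r) :=
  SobolevH1.ofDeriv_deriv _ _

theorem mapH1_eval (L : EuclideanSpace 𝕜 (Fin n) →L[ℝ] EuclideanSpace 𝕜' (Fin n))
    (V : SobolevH1 𝕜 n) {r : ℝ} (hr : r ∈ Icc (0 : ℝ) 1) :
    (mapH1 L V).eval r = L (V.eval r) := by
  rw [mapH1, SobolevH1.ofDeriv_eval _ _ hr, V.eval_of_mem hr, map_add,
    L.intervalIntegral_comp_comm (V.intervalIntegrable_volume (left_mem_Icc.2 zero_le_one) hr)]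

theorem mapH1_mem (L : EuclideanSpace 𝕜 (Fin n) →L[ℝ] EuclideanSpace 𝕜' (Fin n))
    {V : SobolevH1 𝕜 n} (hV : V ∈ twistedH1 𝕜 n 1) : mapH1 L V ∈ twistedH1 𝕜' n 1 := by
  rw [mem_twistedH1, one_smul] at hV ⊢
  rw [mapH1_eval L V (right_mem_Icc.2 zero_le_one), mapH1_eval L V (left_mem_Icc.2 zero_le_one), hV]

end MapH1

variable (n) in
/-- The inclusion `ℝⁿ → ℂⁿ`. -/
def complexifyL : EuclideanSpace ℝ (Fin n) →L[ℝ] EuclideanSpace ℂ (Fin n) :=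
  coordwiseL Complex.ofRealCLM fun x => (Complex.norm_real x).le

variable (n) in
/-- The real part `ℂⁿ → ℝⁿ`. -/
def reL : EuclideanSpace ℂ (Fin n) →L[ℝ] EuclideanSpace ℝ (Fin n) :=
  coordwiseL Complex.reCLM fun x => Complex.abs_re_le_norm x

variable (n) in
/-- The imaginary part `ℂⁿ → ℝⁿ`. -/
def imL : EuclideanSpace ℂ (Fin n) →L[ℝ] EuclideanSpace ℝ (Fin n) :=
  coordwiseL Complex.imCLM fun x => Complex.abs_im_le_norm x

@[simp] theorem complexifyL_apply (v : EuclideanSpace ℝ (Fin n)) (i : Fin n) :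
    complexifyL n v i = (v i : ℂ) := rfl

@[simp] theorem reL_apply (v : EuclideanSpace ℂ (Fin n)) (i : Fin n) : reL n v i = (v i).re := rfl

@[simp] theorem imL_apply (v : EuclideanSpace ℂ (Fin n)) (i : Fin n) : imL n v i = (v i).im := rfl

theorem realMatrixApply_complexifyL (A : Matrix (Fin n) (Fin n) ℝ) (v : EuclideanSpace ℝ (Fin n)) :
    realMatrixApply A (complexifyL n v) = complexifyL n (realMatrixApply A v) := by
  ext i; simp

theorem signForm_complexifyL (ε : Fin n → ℝ) (v w : EuclideanSpace ℝ (Fin n)) :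
    signForm ε (complexifyL n v) (complexifyL n w) = ((signForm ε v w : ℝ) : ℂ) := by
  simp [signForm]

theorem staticForm_complexify (ε : Fin n → ℝ) (Γ R : C(ℝ, Matrix (Fin n) (Fin n) ℝ))
    (V W : SobolevH1 ℝ n) :
    staticForm ε Γ R (mapH1 (complexifyL n) V) (mapH1 (complexifyL n) W)
      = ((staticForm ε Γ R V W : ℝ) : ℂ) := by
  rw [staticForm_eq_integral, staticForm_eq_integral, ← intervalIntegral.integral_ofReal]
  refine intervalIntegral.integral_congr_ae ?_
  filter_upwards [(ae_restrict_iff' measurableSet_Icc).1 (mapH1_deriv (complexifyL n) V),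
    (ae_restrict_iff' measurableSet_Icc).1 (mapH1_deriv (complexifyL n) W)] with r h1 h2 hr
  rw [uIoc_of_le zero_le_one] at hr
  have hr' : r ∈ Icc (0 : ℝ) 1 := ⟨hr.1.le, hr.2⟩
  rw [h1 hr', h2 hr', mapH1_eval _ V hr', mapH1_eval _ W hr', realMatrixApply_complexifyL,
    realMatrixApply_complexifyL, realMatrixApply_complexifyL, ← map_add, ← map_add,
    signForm_complexifyL, signForm_complexifyL, Complex.ofReal_add]

/-- The cross terms are `i` times a difference of values on real maps. These values are real, so the
cross terms drop out of the real part. -/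
theorem re_staticForm_add_I_smul (ε : Fin n → ℝ) (Γ R : C(ℝ, Matrix (Fin n) (Fin n) ℝ))
    (V W : SobolevH1 ℝ n) :
    (staticForm ε Γ R (mapH1 (complexifyL n) V + Complex.I • mapH1 (complexifyL n) W)
      (mapH1 (complexifyL n) V + Complex.I • mapH1 (complexifyL n) W)).re
      = staticForm ε Γ R V V + staticForm ε Γ R W W := by
  have h : ∀ X Y : SobolevH1 ℂ n, staticForm ε Γ R (X + Complex.I • Y) (X + Complex.I • Y)
      = staticForm ε Γ R X X + staticForm ε Γ R Y Y
        + Complex.I * (staticForm ε Γ R Y X - staticForm ε Γ R X Y) := fun X Y => by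
    simp only [staticForm, map_add, map_smul, inner_add_left, inner_add_right, inner_smul_left,
      inner_smul_right, Complex.conj_I]
    linear_combination (-(inner ℂ (covL Γ Y) (matrixMul (constDiag ε) (covL Γ Y)))
      - inner ℂ (inclL ℂ n Y) (matrixMul (diagMul ε R) (inclL ℂ n Y))) * Complex.I_mul_I
  rw [h, staticForm_complexify, staticForm_complexify, staticForm_complexify,
    staticForm_complexify]
  simp

/-- The map `(X, Y) ↦ X + iY` on periodic maps. -/
def complexifyPairFun (U : Fin 2 → twistedH1 ℝ n 1) : SobolevH1 ℂ n :=
  mapH1 (complexifyL n) (U 0 : SobolevH1 ℝ n)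
    + Complex.I • mapH1 (complexifyL n) (U 1 : SobolevH1 ℝ n)

theorem complexifyPairFun_eval (U : Fin 2 → twistedH1 ℝ n 1) {r : ℝ} (hr : r ∈ Icc (0 : ℝ) 1) :
    (complexifyPairFun U).eval r = complexifyL n ((U 0 : SobolevH1 ℝ n).eval r)
      + Complex.I • complexifyL n ((U 1 : SobolevH1 ℝ n).eval r) := by
  rw [complexifyPairFun, SobolevH1.eval_add, SobolevH1.eval_smul, mapH1_eval _ _ hr,
    mapH1_eval _ _ hr]

theorem complexifyPairFun_mem (U : Fin 2 → twistedH1 ℝ n 1) :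
    complexifyPairFun U ∈ twistedH1 ℂ n 1 :=
  add_mem (mapH1_mem _ (U 0).2) (Submodule.smul_mem _ _ (mapH1_mem _ (U 1).2))

/-- The isomorphism `(X, Y) ↦ X + iY` of real vector spaces. -/
def complexifyPair : (Fin 2 → twistedH1 ℝ n 1) ≃ₗ[ℝ] twistedH1 ℂ n 1 :=
  LinearEquiv.ofBijective
    { toFun := fun U => ⟨complexifyPairFun U, complexifyPairFun_mem U⟩
      map_add' := fun U U' => by
        refine Subtype.ext (SobolevH1.ext_eval fun r hr => ?_)
        rw [Submodule.coe_add, SobolevH1.eval_add, complexifyPairFun_eval _ hr,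
          complexifyPairFun_eval _ hr, complexifyPairFun_eval _ hr, Pi.add_apply, Pi.add_apply,
          Submodule.coe_add, Submodule.coe_add, SobolevH1.eval_add, SobolevH1.eval_add, map_add,
          map_add, smul_add]
        abel
      map_smul' := fun a U => by
        refine Eq.trans ?_ (algebraMap_smul ℂ a
          (⟨complexifyPairFun U, complexifyPairFun_mem U⟩ : twistedH1 ℂ n 1))
        refine Subtype.ext (SobolevH1.ext_eval fun r hr => ?_)
        rw [Submodule.coe_smul, SobolevH1.eval_smul, complexifyPairFun_eval _ hr,
          complexifyPairFun_eval _ hr, Pi.smul_apply, Pi.smul_apply, Submodule.coe_smul,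
          Submodule.coe_smul, SobolevH1.eval_smul, SobolevH1.eval_smul, map_smul, map_smul,
          smul_add]
        ext i
        simp
        ring }
    ⟨by
      rw [injective_iff_map_eq_zero]
      intro U hU
      have h : ∀ r ∈ Icc (0 : ℝ) 1, ∀ j, (U j : SobolevH1 ℝ n).eval r = 0 := fun r hr j => by
        have h1 := complexifyPairFun_eval U hr
        have h2 : complexifyPairFun U = 0 := congrArg Subtype.val hU
        have h3 : (0 : SobolevH1 ℂ n).eval r = 0 := map_zero (evalL r hr)
        rw [h2, h3] at h1
        ext i
        have h4 := congrArg (fun v : EuclideanSpace ℂ (Fin n) => v i) h1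
        simp only [PiLp.zero_apply, PiLp.add_apply, PiLp.smul_apply, complexifyL_apply,
          smul_eq_mul] at h4
        have hre := congrArg Complex.re h4
        have him := congrArg Complex.im h4
        simp at hre him
        fin_cases j
        · exact hre.symm
        · exact him.symm
      exact funext fun j => Subtype.ext (SobolevH1.eq_zero_of_eval fun r hr => h r hr j),
     fun V => by
      refine ⟨![⟨_, mapH1_mem (reL n) V.2⟩, ⟨_, mapH1_mem (imL n) V.2⟩],
        Subtype.ext (SobolevH1.ext_eval fun r hr => ?_)⟩
      refine (complexifyPairFun_eval _ hr).trans ?_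
      simp only [Matrix.cons_val_zero, Matrix.cons_val_one]
      rw [mapH1_eval _ _ hr, mapH1_eval _ _ hr]
      ext i
      simp only [PiLp.add_apply, PiLp.smul_apply, complexifyL_apply, reL_apply, imL_apply,
        smul_eq_mul]
      rw [mul_comm]
      exact Complex.re_add_im _⟩

theorem coe_complexifyPair (U : Fin 2 → twistedH1 ℝ n 1) :
    (complexifyPair U : SobolevH1 ℂ n) = complexifyPairFun U := rfl

theorem loopForm_complexifyPair (ε : Fin n → ℝ) (Γ R : C(ℝ, Matrix (Fin n) (Fin n) ℝ))
    (U : Fin 2 → twistedH1 ℝ n 1) :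
    loopForm 1 ε Γ R (complexifyPair U) = ∑ i, loopForm 1 ε Γ R (U i) := by
  rw [loopForm, coe_complexifyPair, complexifyPairFun, Fin.sum_univ_two]
  exact re_staticForm_add_I_smul ε Γ R _ _

theorem complexifyPair_reflectionL (ε : Fin n → ℝ) (U : Fin 2 → twistedH1 ℝ n 1) :
    complexifyPair (fun i => reflectionL 1 ε (U i)) = reflectionL 1 ε (complexifyPair U) := by
  refine Subtype.ext (SobolevH1.ext_eval fun r hr => ?_)
  rw [reflectionL_eval 1 ε _ hr, coe_complexifyPair, coe_complexifyPair,
    complexifyPairFun_eval _ hr, complexifyPairFun_eval _ hr, reflectionL_eval 1 ε _ hr,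
    reflectionL_eval 1 ε _ hr, realMatrixApply_add, realMatrixApply_smul,
    realMatrixApply_complexifyL, realMatrixApply_complexifyL]

/-- As a real space `H` is two copies of `W`, so its real index is `2 r`; computed by restriction of
scalars it is `2 r'`. -/
theorem HasIndex.eq_of_complexification {W H : Type*} [NormedAddCommGroup W]
    [InnerProductSpace ℝ W] [CompleteSpace W] [NormedAddCommGroup H] [InnerProductSpace ℂ H]
    [CompleteSpace H] [Module ℝ H] [IsScalarTower ℝ ℂ H] {J : W →L[ℝ] W} {J' : H →L[ℂ] H}
    (hJ' : ∀ x, J' (J' x) = x) (e : (Fin 2 → W) ≃ₗ[ℝ] H)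
    (he : ∀ U, e (fun i => J (U i)) = J' (e U)) {q : W → ℝ} {q' : H → ℝ} {r r' : ℤ}
    (h : HasIndex (fixedSpace J) (antifixedSpace J) q r) (h0 : q 0 = 0)
    (h' : HasIndex (fixedSpace J') (antifixedSpace J') q' r')
    (hq : ∀ U, q' (e U) = ∑ i, q (U i)) : r' = r := by
  have h2 := HasIndex.pi (fun _ : Fin 2 => h) fun _ => h0
  have h3 := (h2.congr one_pos (q' := fun U => q' (e U)) fun U => by rw [hq, one_mul]).map e
    (q' := q') fun _ => rfl
  have hfix : (Submodule.pi univ fun _ : Fin 2 => fixedSpace J).map (e : (Fin 2 → W) →ₗ[ℝ] H)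
      = (fixedSpace J').restrictScalars ℝ := by
    ext V
    obtain ⟨U, rfl⟩ := e.surjective V
    rw [Submodule.restrictScalars_mem, mem_fixedSpace, ← he, e.injective.eq_iff, funext_iff,
      Submodule.mem_map_equiv, LinearEquiv.symm_apply_apply, Submodule.mem_pi]
    exact forall_congr' fun k => by simp only [mem_univ, true_imp_iff, mem_fixedSpace]
  have hanti : (Submodule.pi univ fun _ : Fin 2 => antifixedSpace J).map
      (e : (Fin 2 → W) →ₗ[ℝ] H) = (antifixedSpace J').restrictScalars ℝ := by
    ext V
    obtain ⟨U, rfl⟩ := e.surjective V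
    rw [Submodule.restrictScalars_mem, mem_antifixedSpace, ← he, ← map_neg, e.injective.eq_iff,
      funext_iff, Submodule.mem_map_equiv, LinearEquiv.symm_apply_apply, Submodule.mem_pi]
    exact forall_congr' fun k => by
      simp only [mem_univ, true_imp_iff, mem_antifixedSpace, Pi.neg_apply]
  rw [hfix, hanti] at h3
  have htop : (fixedSpace J').restrictScalars ℝ ⊔ (antifixedSpace J').restrictScalars ℝ = ⊤ := by
    rw [← Submodule.restrictScalars_sup, (isCompl_fixedSpace hJ').sup_eq_top,
      Submodule.restrictScalars_top]
  have h4 := h'.restrictScalars.unique htop h3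
  rw [Fin.sum_univ_two] at h4
  omega

theorem loopIndex_complexify {ε : Fin n → ℝ} (hε : ∀ i, ε i = 1 ∨ ε i = -1)
    {Γ R : C(ℝ, Matrix (Fin n) (Fin n) ℝ)} (hRs : ∀ r, (Matrix.diagonal ε * R r).IsSymm) :
    loopIndex (1 : ℂ) ε Γ R = loopIndex (1 : ℝ) ε Γ R := by
  have h1 := HasIndex.eq_of_complexification (W := twistedH1 ℝ n 1) (H := twistedH1 ℂ n 1)
    (J := reflectionL 1 ε) (reflectionL_reflectionL 1 hε)
  have h2 := h1 complexifyPair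
  have h3 := h2 (complexifyPair_reflectionL ε) (q := loopForm 1 ε Γ R) (q' := loopForm 1 ε Γ R)
    (r := loopIndex 1 ε Γ R) (r' := loopIndex 1 ε Γ R) (hasIndex_loopIndex 1 hε hRs)
    (loopForm_zero_right _ _ _ _) (hasIndex_loopIndex 1 hε hRs)
  exact h3 (loopForm_complexifyPair ε Γ R)

end Complexification

end


open scoped Manifold ContDiff

noncomputable section

/-! ### Levi-Civita connection and curvature of a metric on an open set of a normed space -/

section MetricCalculus

set_option maxSynthPendingDepth 3

variable {E : Type*} [NormedAddCommGroup E] [NormedSpace ℝ E]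

/-- The Koszul expression of a field of bilinear forms on a normed space, for constant fields. -/
def metricKoszul (G : E → E →L[ℝ] E →L[ℝ] ℝ) (y u v : E) : E →L[ℝ] ℝ :=
  (1 / 2 : ℝ) • (fderiv ℝ G y u v + fderiv ℝ G y v u - ((fderiv ℝ G y).flip u).flip v)

/-- The Christoffel symbols of a field of bilinear forms on a normed space. -/
def metricChristoffel (G : E → E →L[ℝ] E →L[ℝ] ℝ) (y u v : E) : E :=
  (G y).inverse (metricKoszul G y u v)

/-- The curvature of a field of bilinear forms on a normed space, for constant fields. -/
def metricCurvature (G : E → E →L[ℝ] E →L[ℝ] ℝ) (y u v w : E) : E :=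
  fderiv ℝ (fun y' => metricChristoffel G y' v w) y u
    - fderiv ℝ (fun y' => metricChristoffel G y' u w) y v
    + metricChristoffel G y u (metricChristoffel G y v w)
    - metricChristoffel G y v (metricChristoffel G y u w)

/-- `G` is a smooth field of nondegenerate symmetric bilinear forms on the open set `U`. -/
structure IsMetricOn (G : E → E →L[ℝ] E →L[ℝ] ℝ) (U : Set E) : Prop where
  isOpen : IsOpen U
  contDiffOn : ContDiffOn ℝ ∞ G U
  symm : ∀ y ∈ U, ∀ u v, G y u v = G y v u
  isInvertible : ∀ y ∈ U, (G y).IsInvertible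

/-- The Christoffel symbols as a bilinear map. -/
def metricChristoffelL (G : E → E →L[ℝ] E →L[ℝ] ℝ) (y : E) : E →L[ℝ] E →L[ℝ] E :=
  (ContinuousLinearMap.compL ℝ E (E →L[ℝ] ℝ) E (G y).inverse).comp
    ((1 / 2 : ℝ) • (fderiv ℝ G y + (fderiv ℝ G y).flip
      - ((ContinuousLinearMap.flipₗᵢ ℝ E E ℝ).toContinuousLinearEquiv :
          (E →L[ℝ] E →L[ℝ] ℝ) →L[ℝ] E →L[ℝ] E →L[ℝ] ℝ).comp (fderiv ℝ G y).flip))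

theorem metricKoszul_apply (G : E → E →L[ℝ] E →L[ℝ] ℝ) (y u v w : E) :
    metricKoszul G y u v w
      = (1 / 2) * (fderiv ℝ G y u v w + fderiv ℝ G y v u w - fderiv ℝ G y w u v) := rfl

theorem metricChristoffelL_apply (G : E → E →L[ℝ] E →L[ℝ] ℝ) (y u v : E) :
    metricChristoffelL G y u v = metricChristoffel G y u v := rfl

theorem two_le_smooth : (2 : WithTop ℕ∞) ≤ ∞ :=
  WithTop.coe_le_coe.2 (le_top : (2 : ℕ∞) ≤ ⊤)

namespace IsMetricOn

variable {G H : E → E →L[ℝ] E →L[ℝ] ℝ} {U U' : Set E} (h : IsMetricOn G U)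
  (h' : IsMetricOn H U')

include h

theorem contDiffAt {y : E} (hy : y ∈ U) : ContDiffAt ℝ ∞ G y :=
  h.contDiffOn.contDiffAt (h.isOpen.mem_nhds hy)

theorem contDiffAt_fderiv {y : E} (hy : y ∈ U) : ContDiffAt ℝ ∞ (fderiv ℝ G) y :=
  (h.contDiffAt hy).fderiv_right (by simp)

theorem hasFDerivAt {y : E} (hy : y ∈ U) : HasFDerivAt G (fderiv ℝ G y) y :=
  ((h.contDiffAt hy).differentiableAt (by simp)).hasFDerivAt

theorem hasFDerivAt_fderiv {y : E} (hy : y ∈ U) :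
    HasFDerivAt (fderiv ℝ G) (fderiv ℝ (fderiv ℝ G) y) y :=
  ((h.contDiffAt_fderiv hy).differentiableAt (by simp)).hasFDerivAt

theorem fderiv_symm {y : E} (hy : y ∈ U) (x u v : E) :
    fderiv ℝ G y x u v = fderiv ℝ G y x v u := by
  have h1 : ∀ u v, HasFDerivAt (fun y => G y u v) (((fderiv ℝ G y).flip u).flip v) y := fun u v =>
    (((h.hasFDerivAt hy).clm_apply (hasFDerivAt_const u y)).clm_apply
      (hasFDerivAt_const v y)).congr_fderiv (by ext; simp)
  have h2 : (fun y => G y u v) =ᶠ[nhds y] fun y => G y v u := by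
    filter_upwards [h.isOpen.mem_nhds hy] with z hz using h.symm z hz u v
  have h3 := ((h1 v u).congr_of_eventuallyEq h2).unique (h1 u v)
  exact (congrArg (fun L : E →L[ℝ] ℝ => L x) h3).symm

theorem fderiv_fderiv_symm {y : E} (hy : y ∈ U) (x z u v : E) :
    fderiv ℝ (fderiv ℝ G) y x z u v = fderiv ℝ (fderiv ℝ G) y x z v u := by
  have h1 : ∀ u v, HasFDerivAt (fun y => fderiv ℝ G y z u v)
      ((((fderiv ℝ (fderiv ℝ G) y).flip z).flip u).flip v) y := fun u v =>
    ((((h.hasFDerivAt_fderiv hy).clm_apply (hasFDerivAt_const z y)).clm_apply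
      (hasFDerivAt_const u y)).clm_apply (hasFDerivAt_const v y)).congr_fderiv (by ext; simp)
  have h2 : (fun y => fderiv ℝ G y z u v) =ᶠ[nhds y] fun y => fderiv ℝ G y z v u := by
    filter_upwards [h.isOpen.mem_nhds hy] with y' hy' using h.fderiv_symm hy' z u v
  have h3 := ((h1 v u).congr_of_eventuallyEq h2).unique (h1 u v)
  exact (congrArg (fun L : E →L[ℝ] ℝ => L x) h3).symm

theorem fderiv_fderiv_comm {y : E} (hy : y ∈ U) (x z : E) :
    fderiv ℝ (fderiv ℝ G) y x z = fderiv ℝ (fderiv ℝ G) y z x :=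
  (h.contDiffAt hy).isSymmSndFDerivAt (by simpa using two_le_smooth) x z

theorem apply_christoffel {y : E} (hy : y ∈ U) (u v w : E) :
    G y (metricChristoffel G y u v) w = metricKoszul G y u v w := by
  rw [metricChristoffel, (h.isInvertible y hy).self_apply_inverse]

theorem eq_of_forall_apply {y : E} (hy : y ∈ U) {u v : E} (huv : ∀ w, G y u w = G y v w) : u = v :=
  (h.isInvertible y hy).injective (ContinuousLinearMap.ext huv)

theorem christoffel_symm {y : E} (hy : y ∈ U) (u v : E) :
    metricChristoffel G y u v = metricChristoffel G y v u := by
  refine h.eq_of_forall_apply hy fun w => ?_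
  rw [h.apply_christoffel hy, h.apply_christoffel hy, metricKoszul_apply, metricKoszul_apply,
    h.fderiv_symm hy w u v]
  ring

theorem fderiv_eq {y : E} (hy : y ∈ U) (u a z : E) :
    fderiv ℝ G y u a z
      = G y (metricChristoffel G y u a) z + G y (metricChristoffel G y u z) a := by
  rw [h.apply_christoffel hy, h.apply_christoffel hy, metricKoszul_apply, metricKoszul_apply,
    h.fderiv_symm hy u z a, h.fderiv_symm hy a u z, h.fderiv_symm hy z u a]
  ring

variable [CompleteSpace E]

theorem contDiffAt_christoffel {y : E} (hy : y ∈ U) (u v : E) :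
    ContDiffAt ℝ ∞ (fun y => metricChristoffel G y u v) y := by
  have h1 : ContDiffAt ℝ ∞ (fun y => (G y).inverse) y := by
    obtain ⟨e, he⟩ := h.isInvertible y hy
    have h2 := contDiffAt_map_inverse (𝕜 := ℝ) (n := ∞) e
    rw [he] at h2
    exact h2.comp y (h.contDiffAt hy)
  refine h1.clm_apply ?_
  have h3 := h.contDiffAt_fderiv hy
  have h4 : ContDiffAt ℝ ∞ (fun y => ((fderiv ℝ G y).flip u).flip v) y := by
    have h5 : ContDiffAt ℝ ∞ (fun y => ((ContinuousLinearMap.flipₗᵢ ℝ E E ℝ)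
      ((ContinuousLinearMap.flipₗᵢ ℝ E E (E →L[ℝ] ℝ)) (fderiv ℝ G y) u)) v) y := by
      refine ContDiffAt.clm_apply ?_ contDiffAt_const
      refine (LinearIsometryEquiv.contDiff
        (ContinuousLinearMap.flipₗᵢ ℝ E E ℝ)).contDiffAt.comp y ?_
      refine ContDiffAt.clm_apply ?_ contDiffAt_const
      exact (LinearIsometryEquiv.contDiff
        (ContinuousLinearMap.flipₗᵢ ℝ E E (E →L[ℝ] ℝ))).contDiffAt.comp y h3
    exact h5
  have h6 : ∀ u v, ContDiffAt ℝ ∞ (fun y => fderiv ℝ G y u v) y := fun u v =>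
    (h3.clm_apply contDiffAt_const).clm_apply contDiffAt_const
  exact (((h6 u v).add (h6 v u)).sub h4).const_smul _

theorem contDiffAt_christoffelL [FiniteDimensional ℝ E] {y : E} (hy : y ∈ U) :
    ContDiffAt ℝ ∞ (metricChristoffelL G) y := by
  have h1 : ContDiffOn ℝ ∞ (metricChristoffelL G) U :=
    contDiffOn_clm_apply.2 fun u => contDiffOn_clm_apply.2 fun v y hy =>
      (h.contDiffAt_christoffel hy u v).contDiffWithinAt
  exact h1.contDiffAt (h.isOpen.mem_nhds hy)

theorem hasFDerivAt_christoffelL [FiniteDimensional ℝ E] {y : E} (hy : y ∈ U) :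
    HasFDerivAt (metricChristoffelL G) (fderiv ℝ (metricChristoffelL G) y) y :=
  ((h.contDiffAt_christoffelL hy).differentiableAt (by simp)).hasFDerivAt

theorem fderiv_christoffel [FiniteDimensional ℝ E] {y : E} (hy : y ∈ U) (u v x : E) :
    fderiv ℝ (fun y => metricChristoffel G y u v) y x
      = fderiv ℝ (metricChristoffelL G) y x u v := by
  have h1 : HasFDerivAt (fun y => metricChristoffelL G y u v) _ y :=
    ((h.hasFDerivAt_christoffelL hy).clm_apply (hasFDerivAt_const u y)).clm_apply
      (hasFDerivAt_const v y)
  have h2 := h1.fderiv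
  simp only [metricChristoffelL_apply] at h2
  rw [h2]
  simp

theorem curvature_eq [FiniteDimensional ℝ E] {y : E} (hy : y ∈ U) (u v w : E) :
    metricCurvature G y u v w
      = fderiv ℝ (metricChristoffelL G) y u v w - fderiv ℝ (metricChristoffelL G) y v u w
        + metricChristoffelL G y u (metricChristoffelL G y v w)
        - metricChristoffelL G y v (metricChristoffelL G y u w) := by
  simp only [metricCurvature, metricChristoffelL_apply, h.fderiv_christoffel hy]

/-- Differentiating the identity `G(∇_u v, z) = koszul` expresses the derivative of the Christoffel
symbols by second derivatives of `G`, without differentiating the inverse of `G`. -/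
theorem apply_fderiv_christoffelL [FiniteDimensional ℝ E] {y : E} (hy : y ∈ U) (x u v z : E) :
    G y (fderiv ℝ (metricChristoffelL G) y x u v) z
      = (1 / 2) * (fderiv ℝ (fderiv ℝ G) y x u v z + fderiv ℝ (fderiv ℝ G) y x v u z
          - fderiv ℝ (fderiv ℝ G) y x z u v) - fderiv ℝ G y x (metricChristoffel G y u v) z := by
  have h1 : HasFDerivAt (fun y => G y (metricChristoffelL G y u v) z) _ y :=
    ((h.hasFDerivAt hy).clm_apply (((h.hasFDerivAt_christoffelL hy).clm_apply
      (hasFDerivAt_const u y)).clm_apply (hasFDerivAt_const v y))).clm_apply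
      (hasFDerivAt_const z y)
  have h2 : ∀ u v w, HasFDerivAt (fun y => fderiv ℝ G y u v w)
      ((((fderiv ℝ (fderiv ℝ G) y).flip u).flip v).flip w) y := fun u v w =>
    ((((h.hasFDerivAt_fderiv hy).clm_apply (hasFDerivAt_const u y)).clm_apply
      (hasFDerivAt_const v y)).clm_apply (hasFDerivAt_const w y)).congr_fderiv (by ext; simp)
  have h3 := (((h2 u v z).add (h2 v u z)).sub (h2 z u v)).const_mul (1 / 2 : ℝ)
  have h4 : (fun y => G y (metricChristoffelL G y u v) z) =ᶠ[nhds y]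
      fun y => (1 / 2) * (fderiv ℝ G y u v z + fderiv ℝ G y v u z - fderiv ℝ G y z u v) := by
    filter_upwards [h.isOpen.mem_nhds hy] with y' hy'
    exact h.apply_christoffel hy' u v z
  have h5 := h1.unique (h3.congr_of_eventuallyEq h4)
  have h6 := congrArg (fun L : E →L[ℝ] ℝ => L x) h5
  simp [metricChristoffelL_apply] at h6
  linarith

/-- The operator `R(c, ·)c` is self-adjoint for `G`. After lowering the index, both sides become the
same expression in second derivatives of `G` and products of Christoffel symbols, by the symmetry of
`G`, of its second derivatives and of the connection. This is what makes the index forms Hermitian.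
-/
theorem curvature_symm [FiniteDimensional ℝ E] {y : E} (hy : y ∈ U) (c a b : E) :
    G y (metricCurvature G y c a c) b = G y (metricCurvature G y c b c) a := by
  rw [h.curvature_eq hy, h.curvature_eq hy]
  simp only [map_add, map_sub, add_apply, sub_apply, h.apply_fderiv_christoffelL hy,
    metricChristoffelL_apply, h.fderiv_eq hy]
  rw [h.christoffel_symm hy a c, h.christoffel_symm hy b c, h.christoffel_symm hy b a,
    h.symm y hy (metricChristoffel G y c b) (metricChristoffel G y c a),
    h.fderiv_fderiv_comm hy a c, h.fderiv_fderiv_comm hy b c, h.fderiv_fderiv_comm hy b a,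
    h.fderiv_fderiv_symm hy c c a b,
    h.fderiv_fderiv_symm hy c b a c, h.fderiv_fderiv_symm hy c a c b]
  ring

end IsMetricOn

/-- The smooth map `f` is a local isometry, on the open set `O`, of the metrics `G` on `U` and `H`
on `U'`. -/
structure IsLocalIsometryOn (f : E → E) (O : Set E) (G H : E → E →L[ℝ] E →L[ℝ] ℝ)
    (U U' : Set E) : Prop where
  left : IsMetricOn G U
  right : IsMetricOn H U'
  isOpen : IsOpen O
  subset : O ⊆ U
  mapsTo : Set.MapsTo f O U'
  contDiffOn : ContDiffOn ℝ ∞ f O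
  surjective : ∀ y ∈ O, Function.Surjective (fderiv ℝ f y)
  isometry : ∀ y ∈ O, ∀ u v, G y u v = H (f y) (fderiv ℝ f y u) (fderiv ℝ f y v)

namespace IsLocalIsometryOn

variable {f : E → E} {O : Set E} {G H : E → E →L[ℝ] E →L[ℝ] ℝ} {U U' : Set E}
  (h : IsLocalIsometryOn f O G H U U')

include h

theorem contDiffAt {y : E} (hy : y ∈ O) : ContDiffAt ℝ ∞ f y :=
  h.contDiffOn.contDiffAt (h.isOpen.mem_nhds hy)

theorem hasFDerivAt {y : E} (hy : y ∈ O) : HasFDerivAt f (fderiv ℝ f y) y :=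
  ((h.contDiffAt hy).differentiableAt (by simp)).hasFDerivAt

theorem contDiffAt_fderiv {y : E} (hy : y ∈ O) : ContDiffAt ℝ ∞ (fderiv ℝ f) y :=
  (h.contDiffAt hy).fderiv_right (by simp)

theorem hasFDerivAt_fderiv {y : E} (hy : y ∈ O) :
    HasFDerivAt (fderiv ℝ f) (fderiv ℝ (fderiv ℝ f) y) y :=
  ((h.contDiffAt_fderiv hy).differentiableAt (by simp)).hasFDerivAt

theorem hasFDerivAt_fderiv_fderiv {y : E} (hy : y ∈ O) :
    HasFDerivAt (fderiv ℝ (fderiv ℝ f)) (fderiv ℝ (fderiv ℝ (fderiv ℝ f)) y) y :=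
  (((h.contDiffAt_fderiv hy).fderiv_right (m := ∞) (by simp)).differentiableAt
    (by simp)).hasFDerivAt

theorem fderiv_fderiv_comm {y : E} (hy : y ∈ O) (u v : E) :
    fderiv ℝ (fderiv ℝ f) y u v = fderiv ℝ (fderiv ℝ f) y v u :=
  (h.contDiffAt hy).isSymmSndFDerivAt (by simpa using two_le_smooth) u v

theorem fderiv_fderiv_fderiv_comm {y : E} (hy : y ∈ O) (u v : E) :
    fderiv ℝ (fderiv ℝ (fderiv ℝ f)) y u v = fderiv ℝ (fderiv ℝ (fderiv ℝ f)) y v u :=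
  (h.contDiffAt_fderiv hy).isSymmSndFDerivAt (by simpa using two_le_smooth) u v

theorem fderiv_metric {y : E} (hy : y ∈ O) (x u v : E) :
    fderiv ℝ G y x u v
      = fderiv ℝ H (f y) (fderiv ℝ f y x) (fderiv ℝ f y u) (fderiv ℝ f y v)
        + H (f y) (fderiv ℝ (fderiv ℝ f) y x u) (fderiv ℝ f y v)
        + H (f y) (fderiv ℝ f y u) (fderiv ℝ (fderiv ℝ f) y x v) := by
  have h1 : HasFDerivAt (fun y => G y u v) _ y :=
    ((h.left.hasFDerivAt (h.subset hy)).clm_apply (hasFDerivAt_const u y)).clm_apply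
      (hasFDerivAt_const v y)
  have h2 : ∀ u, HasFDerivAt (fun y => fderiv ℝ f y u) _ y := fun u =>
    (h.hasFDerivAt_fderiv hy).clm_apply (hasFDerivAt_const u y)
  have h3 : HasFDerivAt (fun y => H (f y) (fderiv ℝ f y u) (fderiv ℝ f y v)) _ y :=
    (((h.right.hasFDerivAt (h.mapsTo hy)).comp y (h.hasFDerivAt hy)).clm_apply (h2 u)).clm_apply
      (h2 v)
  have h4 : (fun y => G y u v) =ᶠ[nhds y]
      fun y => H (f y) (fderiv ℝ f y u) (fderiv ℝ f y v) := by
    filter_upwards [h.isOpen.mem_nhds hy] with z hz using h.isometry z hz u v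
  have h5 := congrArg (fun L : E →L[ℝ] ℝ => L x) (h1.unique (h3.congr_of_eventuallyEq h4))
  simp at h5
  linarith

theorem koszul_eq {y : E} (hy : y ∈ O) (u v w : E) :
    metricKoszul G y u v w
      = metricKoszul H (f y) (fderiv ℝ f y u) (fderiv ℝ f y v) (fderiv ℝ f y w)
        + H (f y) (fderiv ℝ (fderiv ℝ f) y u v) (fderiv ℝ f y w) := by
  have hs := h.right.symm (f y) (h.mapsTo hy)
  rw [metricKoszul_apply, metricKoszul_apply, h.fderiv_metric hy, h.fderiv_metric hy,
    h.fderiv_metric hy, h.fderiv_fderiv_comm hy v u, h.fderiv_fderiv_comm hy w u,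
    h.fderiv_fderiv_comm hy w v, hs (fderiv ℝ f y v) (fderiv ℝ (fderiv ℝ f) y u w),
    hs (fderiv ℝ f y u) (fderiv ℝ (fderiv ℝ f) y v w)]
  ring

/-- The transformation law of the Christoffel symbols. Pairing with vectors in the image of the
differential determines both sides, as the differential is surjective and the target metric
nondegenerate. -/
theorem fderiv_christoffel {y : E} (hy : y ∈ O) (u v : E) :
    fderiv ℝ f y (metricChristoffel G y u v)
      = metricChristoffel H (f y) (fderiv ℝ f y u) (fderiv ℝ f y v)
        + fderiv ℝ (fderiv ℝ f) y u v := by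
  refine h.right.eq_of_forall_apply (h.mapsTo hy) fun w => ?_
  obtain ⟨w, rfl⟩ := h.surjective y hy w
  rw [← h.isometry y hy, h.left.apply_christoffel (h.subset hy), h.koszul_eq hy, map_add,
    add_apply, h.right.apply_christoffel (h.mapsTo hy)]

/-- The transformation law of the Christoffel symbols, differentiated once. -/
theorem fderiv_fderiv_christoffelL [CompleteSpace E] [FiniteDimensional ℝ E] {y : E} (hy : y ∈ O)
    (x u v : E) :
    fderiv ℝ f y (fderiv ℝ (metricChristoffelL G) y x u v)
      = fderiv ℝ (metricChristoffelL H) (f y) (fderiv ℝ f y x) (fderiv ℝ f y u) (fderiv ℝ f y v)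
        + metricChristoffelL H (f y) (fderiv ℝ (fderiv ℝ f) y x u) (fderiv ℝ f y v)
        + metricChristoffelL H (f y) (fderiv ℝ f y u) (fderiv ℝ (fderiv ℝ f) y x v)
        + fderiv ℝ (fderiv ℝ (fderiv ℝ f)) y x u v
        - fderiv ℝ (fderiv ℝ f) y x (metricChristoffelL G y u v) := by
  have h1 : HasFDerivAt (fun y => fderiv ℝ f y (metricChristoffelL G y u v)) _ y :=
    (h.hasFDerivAt_fderiv hy).clm_apply
      (((h.left.hasFDerivAt_christoffelL (h.subset hy)).clm_apply (hasFDerivAt_const u y)).clm_apply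
        (hasFDerivAt_const v y))
  have h2 : ∀ u, HasFDerivAt (fun y => fderiv ℝ f y u) _ y := fun u =>
    (h.hasFDerivAt_fderiv hy).clm_apply (hasFDerivAt_const u y)
  have h3 : HasFDerivAt (fun y => metricChristoffelL H (f y) (fderiv ℝ f y u) (fderiv ℝ f y v)) _
      y :=
    (((h.right.hasFDerivAt_christoffelL (h.mapsTo hy)).comp y (h.hasFDerivAt hy)).clm_apply
      (h2 u)).clm_apply (h2 v)
  have h4 : HasFDerivAt (fun y => fderiv ℝ (fderiv ℝ f) y u v) _ y :=
    ((h.hasFDerivAt_fderiv_fderiv hy).clm_apply (hasFDerivAt_const u y)).clm_apply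
      (hasFDerivAt_const v y)
  have h5 : (fun y => fderiv ℝ f y (metricChristoffelL G y u v)) =ᶠ[nhds y]
      fun y => metricChristoffelL H (f y) (fderiv ℝ f y u) (fderiv ℝ f y v)
        + fderiv ℝ (fderiv ℝ f) y u v := by
    filter_upwards [h.isOpen.mem_nhds hy] with z hz using h.fderiv_christoffel hz u v
  have h6 := congrArg (fun L : E →L[ℝ] E => L x)
    (h1.unique ((h3.add h4).congr_of_eventuallyEq h5))
  simp at h6
  rw [eq_sub_iff_add_eq, h6]
  abel

/-- In the antisymmetrization the third derivatives of `f` cancel because they are symmetric, and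
the terms with second derivatives of `f` cancel against the quadratic Christoffel terms. -/
theorem fderiv_curvature [CompleteSpace E] [FiniteDimensional ℝ E] {y : E} (hy : y ∈ O)
    (u v w : E) :
    fderiv ℝ f y (metricCurvature G y u v w)
      = metricCurvature H (f y) (fderiv ℝ f y u) (fderiv ℝ f y v) (fderiv ℝ f y w) := by
  have h1 : ∀ u v, fderiv ℝ f y (metricChristoffelL G y u v)
      = metricChristoffelL H (f y) (fderiv ℝ f y u) (fderiv ℝ f y v)
        + fderiv ℝ (fderiv ℝ f) y u v := h.fderiv_christoffel hy
  rw [h.left.curvature_eq (h.subset hy), h.right.curvature_eq (h.mapsTo hy)]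
  simp only [map_add, map_sub, h.fderiv_fderiv_christoffelL hy, h1]
  rw [h.fderiv_fderiv_comm hy v u, h.fderiv_fderiv_fderiv_comm hy v u]
  abel

/-- Written as a derivative, this says that the covariant derivative along a curve commutes with the
differential of a local isometry: the second derivative of `f` is the inhomogeneous term in the law
for the Christoffel symbols. -/
theorem hasDerivAt_fderiv {c v : ℝ → E} {c' v' : E} {t : ℝ} (ht : c t ∈ O)
    (hc : HasDerivAt c c' t) (hv : HasDerivAt v v' t) :
    HasDerivAt (fun s => fderiv ℝ f (c s) (v s))
      (fderiv ℝ f (c t) (v' + metricChristoffel G (c t) c' (v t))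
        - metricChristoffel H (f (c t)) (fderiv ℝ f (c t) c') (fderiv ℝ f (c t) (v t))) t := by
  refine (((h.hasFDerivAt_fderiv ht).comp_hasDerivAt t hc).clm_apply hv).congr_deriv ?_
  rw [map_add, h.fderiv_christoffel ht]
  simp only [Function.comp_apply]
  abel

end IsLocalIsometryOn

end MetricCalculus

end


open scoped Manifold ContDiff

noncomputable section

/-! ### Chart independence of curvature and covariant derivative -/

section ChartGeometry

set_option maxSynthPendingDepth 3

variable {n : ℕ} {M : Type*} [TopologicalSpace M] [ChartedSpace (EuclideanSpace ℝ (Fin n)) M]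
  [IsManifold (𝓡 n) ∞ M]

theorem isManifold_one_of_smooth (n : ℕ) (M : Type*) [TopologicalSpace M]
    [ChartedSpace (EuclideanSpace ℝ (Fin n)) M] [IsManifold (𝓡 n) ∞ M] : IsManifold (𝓡 n) 1 M :=
  IsManifold.of_le (n := ∞) (by simp)

theorem chartDiff_chartSymmDiff {p : M} {y : EuclideanSpace ℝ (Fin n)}
    (hy : y ∈ (extChartAt (𝓡 n) p).target) (a : EuclideanSpace ℝ (Fin n)) :
    chartDiff p ((extChartAt (𝓡 n) p).symm y) (chartSymmDiff p y a) = a := by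
  have := isManifold_one_of_smooth n M
  have h1 := mfderiv_extChartAt_comp_mfderivWithin_extChartAt_symm (I := 𝓡 n) hy
  rw [ModelWithCorners.range_eq_univ, mfderivWithin_univ] at h1
  exact congrArg (fun L : EuclideanSpace ℝ (Fin n) →L[ℝ] EuclideanSpace ℝ (Fin n) => L a) h1

theorem chartSymmDiff_chartDiff {p : M} {y : EuclideanSpace ℝ (Fin n)}
    (hy : y ∈ (extChartAt (𝓡 n) p).target)
    (a : TangentSpace (𝓡 n) ((extChartAt (𝓡 n) p).symm y)) :
    chartSymmDiff p y (chartDiff p ((extChartAt (𝓡 n) p).symm y) a) = a := by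
  have := isManifold_one_of_smooth n M
  have h1 := mfderivWithin_extChartAt_symm_comp_mfderiv_extChartAt (I := 𝓡 n) hy
  rw [ModelWithCorners.range_eq_univ, mfderivWithin_univ] at h1
  exact congrArg (fun L : EuclideanSpace ℝ (Fin n) →L[ℝ] EuclideanSpace ℝ (Fin n) => L a) h1

omit [IsManifold (𝓡 n) ∞ M] in
theorem exists_extChartAt_symm_eq {p x : M} (hx : x ∈ (extChartAt (𝓡 n) p).source) :
    ∃ y ∈ (extChartAt (𝓡 n) p).target, x = (extChartAt (𝓡 n) p).symm y :=
  ⟨_, (extChartAt (𝓡 n) p).map_source hx, ((extChartAt (𝓡 n) p).left_inv hx).symm⟩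

theorem chartDiff_bijective {p x : M} (hx : x ∈ (extChartAt (𝓡 n) p).source) :
    Function.Bijective (chartDiff (n := n) p x) := by
  obtain ⟨y, hy, rfl⟩ := exists_extChartAt_symm_eq hx
  exact Function.bijective_iff_has_inverse.2
    ⟨chartSymmDiff p y, chartSymmDiff_chartDiff hy, chartDiff_chartSymmDiff hy⟩

theorem chartDiff_self_inverse (x : M) (a : EuclideanSpace ℝ (Fin n)) :
    chartDiff x x ((chartDiff x x).inverse a) = a := by
  have := isManifold_one_of_smooth n M
  have h : (chartDiff x x).IsInvertible :=
    isInvertible_mfderiv_extChartAt (mem_extChartAt_source (I := 𝓡 n) x)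
  exact h.self_apply_inverse a

namespace SemiRiemannianMetric

variable (g : SemiRiemannianMetric n M)

theorem inChart_apply (p : M) (y a b : EuclideanSpace ℝ (Fin n)) :
    g.inChart p y a b
      = g.form ((extChartAt (𝓡 n) p).symm y) (chartSymmDiff p y a) (chartSymmDiff p y b) := rfl

theorem inChart_chartDiff {p x : M} (hx : x ∈ (extChartAt (𝓡 n) p).source)
    (a b : TangentSpace (𝓡 n) x) :
    g.inChart p (extChartAt (𝓡 n) p x) (chartDiff p x a) (chartDiff p x b) = g.form x a b := by
  obtain ⟨y, hy, rfl⟩ := exists_extChartAt_symm_eq hx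
  rw [(extChartAt (𝓡 n) p).right_inv hy, inChart_apply, chartSymmDiff_chartDiff hy,
    chartSymmDiff_chartDiff hy]

theorem contMDiffAt_chartSymmDiff {p : M} {y : EuclideanSpace ℝ (Fin n)}
    (hy : y ∈ (extChartAt (𝓡 n) p).target) (a : EuclideanSpace ℝ (Fin n)) :
    ContMDiffAt 𝓘(ℝ, EuclideanSpace ℝ (Fin n)) (𝓡 n).tangent ∞
      (fun y => (⟨(extChartAt (𝓡 n) p).symm y, chartSymmDiff p y a⟩ :
        TangentBundle (𝓡 n) M)) y := by
  have hopen : IsOpen (extChartAt (𝓡 n) p).target := isOpen_extChartAt_target p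
  have h1 : ContMDiffOn 𝓘(ℝ, EuclideanSpace ℝ (Fin n)) (𝓡 n) ∞ (extChartAt (𝓡 n) p).symm
      (extChartAt (𝓡 n) p).target := contMDiffOn_extChartAt_symm p
  have h2 := h1.contMDiffOn_tangentMapWithin (m := ∞) (by simp) hopen.uniqueMDiffOn
  have h3 : ContMDiffAt 𝓘(ℝ, EuclideanSpace ℝ (Fin n)) 𝓘(ℝ, EuclideanSpace ℝ (Fin n)).tangent ∞
      (fun y => (⟨y, a⟩ : TangentBundle 𝓘(ℝ, EuclideanSpace ℝ (Fin n))
        (EuclideanSpace ℝ (Fin n)))) y :=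
    Bundle.contMDiffAt_totalSpace.2 ⟨contMDiffAt_id, by simpa using contMDiffAt_const⟩
  have h4 := (h2 ⟨y, a⟩ hy).contMDiffAt
    ((hopen.preimage (FiberBundle.continuous_proj _ _)).mem_nhds hy)
  refine (h4.comp y h3).congr_of_eventuallyEq ?_
  filter_upwards [hopen.mem_nhds hy] with z hz
  simp only [Function.comp, tangentMapWithin, chartSymmDiff]
  rw [mfderivWithin_of_isOpen hopen hz]
  rfl

theorem isMetricOn_inChart (p : M) :
    IsMetricOn (g.inChart p) (extChartAt (𝓡 n) p).target where
  isOpen := isOpen_extChartAt_target p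
  contDiffOn := by
    refine contDiffOn_clm_apply.2 fun a => contDiffOn_clm_apply.2 fun b y hy => ?_
    have h1 := (g.contMDiff ((extChartAt (𝓡 n) p).symm y)).comp y
      ((contMDiffOn_extChartAt_symm p).contMDiffAt ((isOpen_extChartAt_target p).mem_nhds hy))
    have h2 := ContMDiffAt.clm_bundle_apply₂ (F₁ := EuclideanSpace ℝ (Fin n))
      (F₂ := EuclideanSpace ℝ (Fin n)) (F₃ := ℝ) (E₃ := fun _ : M => ℝ) h1
      (contMDiffAt_chartSymmDiff hy a) (contMDiffAt_chartSymmDiff hy b)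
    have h3 := (Bundle.contMDiffAt_totalSpace.1 h2).2
    exact h3.contDiffAt.contDiffWithinAt
  symm y _ a b := g.symm _ _ _
  isInvertible y hy := by
    -- Nondegeneracy gives injectivity; equality of the dimensions of the space and its dual gives
    -- the rest.
    have hinj : Function.Injective (g.inChart p y) := by
      refine (injective_iff_map_eq_zero _).2 fun a ha => ?_
      rw [← chartDiff_chartSymmDiff hy a, g.nondegenerate _ (chartSymmDiff p y a) fun w => ?_,
        map_zero]
      rw [← chartSymmDiff_chartDiff hy w, ← inChart_apply, ha]
      rfl
    have hfr : Module.finrank ℝ (EuclideanSpace ℝ (Fin n))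
        = Module.finrank ℝ (EuclideanSpace ℝ (Fin n) →L[ℝ] ℝ) := by
      rw [← (LinearMap.toContinuousLinearMap (𝕜 := ℝ) (E := EuclideanSpace ℝ (Fin n))
        (F' := ℝ)).finrank_eq]
      exact (Subspace.dual_finrank_eq (K := ℝ) (V := EuclideanSpace ℝ (Fin n))).symm
    refine ⟨(LinearEquiv.ofBijective (g.inChart p y : EuclideanSpace ℝ (Fin n) →ₗ[ℝ] _)
      ⟨hinj, (LinearMap.injective_iff_surjective_of_finrank_eq_finrank hfr).1
        hinj⟩).toContinuousLinearEquiv, ?_⟩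
    ext a b
    rfl

theorem fderiv_transition {p q : M} {y : EuclideanSpace ℝ (Fin n)}
    (hy : y ∈ (extChartAt (𝓡 n) p).target)
    (hq : (extChartAt (𝓡 n) p).symm y ∈ (extChartAt (𝓡 n) q).source)
    (a : EuclideanSpace ℝ (Fin n)) :
    fderiv ℝ (extChartAt (𝓡 n) q ∘ (extChartAt (𝓡 n) p).symm) y a
      = chartDiff q ((extChartAt (𝓡 n) p).symm y) (chartSymmDiff p y a) := by
  have := isManifold_one_of_smooth n M
  have h1 : MDifferentiableAt (𝓡 n) 𝓘(ℝ, EuclideanSpace ℝ (Fin n)) (extChartAt (𝓡 n) q)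
      ((extChartAt (𝓡 n) p).symm y) :=
    mdifferentiableAt_extChartAt (by rwa [extChartAt_source] at hq)
  have h2 : MDifferentiableAt 𝓘(ℝ, EuclideanSpace ℝ (Fin n)) (𝓡 n) (extChartAt (𝓡 n) p).symm y :=
    (mdifferentiableOn_extChartAt_symm y hy).mdifferentiableAt
      ((isOpen_extChartAt_target p).mem_nhds hy)
  rw [← mfderiv_eq_fderiv, mfderiv_comp y h1 h2]
  rfl

/-- All coordinate metrics come from one metric on `M`, so transition maps are local isometries and
the covariance results for such maps apply. -/
theorem isLocalIsometryOn_transition (p q : M) :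
    IsLocalIsometryOn (extChartAt (𝓡 n) q ∘ (extChartAt (𝓡 n) p).symm)
      ((extChartAt (𝓡 n) p).target ∩ (extChartAt (𝓡 n) p).symm ⁻¹' (extChartAt (𝓡 n) q).source)
      (g.inChart p) (g.inChart q) (extChartAt (𝓡 n) p).target (extChartAt (𝓡 n) q).target where
  left := g.isMetricOn_inChart p
  right := g.isMetricOn_inChart q
  isOpen := (continuousOn_extChartAt_symm p).isOpen_inter_preimage (isOpen_extChartAt_target p)
    (isOpen_extChartAt_source q)
  subset := Set.inter_subset_left
  mapsTo y hy := (extChartAt (𝓡 n) q).map_source hy.2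
  contDiffOn y hy := by
    have h1 := (contMDiffOn_extChartAt_symm (n := ∞) p).contMDiffAt
      ((isOpen_extChartAt_target (I := 𝓡 n) p).mem_nhds hy.1)
    have h2 : ContMDiffAt (𝓡 n) 𝓘(ℝ, EuclideanSpace ℝ (Fin n)) ∞ (extChartAt (𝓡 n) q)
        ((extChartAt (𝓡 n) p).symm y) :=
      contMDiffAt_extChartAt' (by simpa using hy.2)
    exact (h2.comp y h1).contDiffAt.contDiffWithinAt
  surjective y hy a := by
    obtain ⟨b, hb⟩ := (chartDiff_bijective hy.2).2 a
    refine ⟨chartDiff p _ b, ?_⟩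
    rw [fderiv_transition hy.1 hy.2, chartSymmDiff_chartDiff hy.1, hb]
  isometry y hy a b := by
    rw [fderiv_transition hy.1 hy.2, fderiv_transition hy.1 hy.2, Function.comp_apply,
      g.inChart_chartDiff hy.2]
    rfl

omit [IsManifold (𝓡 n) ∞ M] in
theorem mem_transition {p q x : M} (hp : x ∈ (extChartAt (𝓡 n) p).source)
    (hq : x ∈ (extChartAt (𝓡 n) q).source) :
    extChartAt (𝓡 n) p x ∈ (extChartAt (𝓡 n) p).target ∩
      (extChartAt (𝓡 n) p).symm ⁻¹' (extChartAt (𝓡 n) q).source :=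
  ⟨(extChartAt (𝓡 n) p).map_source hp, by
    rwa [Set.mem_preimage, (extChartAt (𝓡 n) p).left_inv hp]⟩

theorem fderiv_transition_chartDiff {p q x : M} (hp : x ∈ (extChartAt (𝓡 n) p).source)
    (hq : x ∈ (extChartAt (𝓡 n) q).source) (a : TangentSpace (𝓡 n) x) :
    fderiv ℝ (extChartAt (𝓡 n) q ∘ (extChartAt (𝓡 n) p).symm) (extChartAt (𝓡 n) p x)
      (chartDiff p x a) = chartDiff q x a := by
  obtain ⟨y, hy, rfl⟩ := exists_extChartAt_symm_eq hp
  rw [(extChartAt (𝓡 n) p).right_inv hy, fderiv_transition hy hq, chartSymmDiff_chartDiff hy]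

/-- `curvature` at `x` is defined in the chart around `x`, which moves with the point. Computing it
in any fixed chart around `p` is what makes continuity along a curve accessible. -/
theorem chartDiff_curvature {p x : M} (hx : x ∈ (extChartAt (𝓡 n) p).source)
    (u v w : TangentSpace (𝓡 n) x) :
    chartDiff p x (g.curvature x u v w)
      = metricCurvature (g.inChart p) (extChartAt (𝓡 n) p x) (chartDiff p x u) (chartDiff p x v)
          (chartDiff p x w) := by
  have hxx : x ∈ (extChartAt (𝓡 n) x).source := mem_extChartAt_source x
  rw [← fderiv_transition_chartDiff hxx hx, curvature, chartDiff_self_inverse]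
  have h1 := (g.isLocalIsometryOn_transition x p).fderiv_curvature (mem_transition hxx hx)
    (chartDiff x x u) (chartDiff x x v) (chartDiff x x w)
  rw [fderiv_transition_chartDiff hxx hx, fderiv_transition_chartDiff hxx hx,
    fderiv_transition_chartDiff hxx hx, Function.comp_apply,
    (extChartAt (𝓡 n) x).left_inv hxx] at h1
  exact h1

theorem form_curvature_symm (x : M) (c a b : TangentSpace (𝓡 n) x) :
    g.form x (g.curvature x c a c) b = g.form x (g.curvature x c b c) a := by
  have hx : x ∈ (extChartAt (𝓡 n) x).source := mem_extChartAt_source x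
  rw [← g.inChart_chartDiff hx, ← g.inChart_chartDiff hx, g.chartDiff_curvature hx,
    g.chartDiff_curvature hx]
  exact (g.isMetricOn_inChart x).curvature_symm ((extChartAt (𝓡 n) x).map_source hx) _ _ _

section Curves

variable {γ : ℝ → M} {V : ∀ t, TangentSpace (𝓡 n) (γ t)} {p : M} {t : ℝ}

theorem contDiffAt_extChartAt_curve (hγ : ContMDiff 𝓘(ℝ, ℝ) (𝓡 n) ∞ γ)
    (ht : γ t ∈ (extChartAt (𝓡 n) p).source) :
    ContDiffAt ℝ ∞ (fun s => extChartAt (𝓡 n) p (γ s)) t := by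
  have h2 : ContMDiffAt (𝓡 n) 𝓘(ℝ, EuclideanSpace ℝ (Fin n)) ∞ (extChartAt (𝓡 n) p) (γ t) :=
    contMDiffAt_extChartAt' (by simpa using ht)
  exact (h2.comp t (hγ t)).contDiffAt

theorem contMDiff_of_field
    (hV : ContMDiff 𝓘(ℝ, ℝ) (𝓡 n).tangent ∞ (fun t => (⟨γ t, V t⟩ : TangentBundle (𝓡 n) M))) :
    ContMDiff 𝓘(ℝ, ℝ) (𝓡 n) ∞ γ := fun t => (Bundle.contMDiffAt_totalSpace.1 (hV t)).1

omit [IsManifold (𝓡 n) ∞ M] in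
theorem eventually_mem_source (hγ : ContMDiff 𝓘(ℝ, ℝ) (𝓡 n) ∞ γ)
    (ht : γ t ∈ (extChartAt (𝓡 n) p).source) :
    ∀ᶠ s in nhds t, γ s ∈ (extChartAt (𝓡 n) p).source :=
  hγ.continuous.continuousAt.eventually_mem ((isOpen_extChartAt_source p).mem_nhds ht)

theorem contDiffAt_chartDiff_field
    (hV : ContMDiff 𝓘(ℝ, ℝ) (𝓡 n).tangent ∞ (fun t => (⟨γ t, V t⟩ : TangentBundle (𝓡 n) M)))
    (ht : γ t ∈ (extChartAt (𝓡 n) p).source) :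
    ContDiffAt ℝ ∞ (fun s => chartDiff p (γ s) (V s)) t := by
  have hopen : IsOpen (extChartAt (𝓡 n) p).source := isOpen_extChartAt_source p
  have h1 : ContMDiffOn (𝓡 n) 𝓘(ℝ, EuclideanSpace ℝ (Fin n)) ∞ (extChartAt (𝓡 n) p)
      (extChartAt (𝓡 n) p).source := by
    rw [extChartAt_source]
    exact contMDiffOn_extChartAt
  have h2 := h1.contMDiffOn_tangentMapWithin (m := ∞) (by simp) hopen.uniqueMDiffOn
  have h4 := (h2 ⟨γ t, V t⟩ ht).contMDiffAt
    ((hopen.preimage (FiberBundle.continuous_proj _ _)).mem_nhds ht)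
  have h5 := (contMDiff_snd_tangentBundle_modelSpace (EuclideanSpace ℝ (Fin n))
    𝓘(ℝ, EuclideanSpace ℝ (Fin n)) (n := ∞)).contMDiffAt.comp t (h4.comp t (hV t))
  refine (h5.congr_of_eventuallyEq ?_).contDiffAt
  filter_upwards [eventually_mem_source (contMDiff_of_field hV) ht] with s hs
  simp only [Function.comp, tangentMapWithin, chartDiff]
  rw [mfderivWithin_of_isOpen hopen hs]
  rfl

theorem deriv_extChartAt_curve (hγ : ContMDiff 𝓘(ℝ, ℝ) (𝓡 n) ∞ γ)
    (ht : γ t ∈ (extChartAt (𝓡 n) p).source) :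
    deriv (fun s => extChartAt (𝓡 n) p (γ s)) t = chartDiff p (γ t) (curveVelocity γ t) := by
  have := isManifold_one_of_smooth n M
  have h1 : MDifferentiableAt (𝓡 n) 𝓘(ℝ, EuclideanSpace ℝ (Fin n)) (extChartAt (𝓡 n) p) (γ t) :=
    mdifferentiableAt_extChartAt (by rwa [extChartAt_source] at ht)
  have h2 := mfderiv_comp t h1 ((hγ t).mdifferentiableAt (by simp))
  rw [← fderiv_apply_one_eq_deriv, ← mfderiv_eq_fderiv]
  exact congrArg (fun L : ℝ →L[ℝ] EuclideanSpace ℝ (Fin n) => L 1) h2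

/-- The definition uses the chart around `γ t`. Since transition maps are local isometries, every
chart containing `γ t` gives the same vector, and a single chart can serve for all nearby times. -/
theorem chartDiff_covDerivAlong
    (hV : ContMDiff 𝓘(ℝ, ℝ) (𝓡 n).tangent ∞ (fun t => (⟨γ t, V t⟩ : TangentBundle (𝓡 n) M)))
    (ht : γ t ∈ (extChartAt (𝓡 n) p).source) :
    chartDiff p (γ t) (g.covDerivAlong γ V t)
      = deriv (fun s => chartDiff p (γ s) (V s)) t
        + metricChristoffel (g.inChart p) (extChartAt (𝓡 n) p (γ t))
            (chartDiff p (γ t) (curveVelocity γ t)) (chartDiff p (γ t) (V t)) := by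
  have hγ := contMDiff_of_field hV
  have htt : γ t ∈ (extChartAt (𝓡 n) (γ t)).source := mem_extChartAt_source _
  have hi := g.isLocalIsometryOn_transition (γ t) p
  have hm := mem_transition htt ht
  have h1 := ((contDiffAt_extChartAt_curve hγ htt).differentiableAt (by simp)).hasDerivAt
  have h2 := ((contDiffAt_chartDiff_field hV htt).differentiableAt (by simp)).hasDerivAt
  have h3 := hi.hasDerivAt_fderiv hm h1 h2
  have h4 : (fun s => chartDiff p (γ s) (V s)) =ᶠ[nhds t] fun s =>
      fderiv ℝ (extChartAt (𝓡 n) p ∘ (extChartAt (𝓡 n) (γ t)).symm)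
        (extChartAt (𝓡 n) (γ t) (γ s)) (chartDiff (γ t) (γ s) (V s)) := by
    filter_upwards [eventually_mem_source hγ htt, eventually_mem_source hγ ht] with s hs hs'
    exact (fderiv_transition_chartDiff hs hs' _).symm
  have h5 := (h3.congr_of_eventuallyEq h4).deriv
  rw [deriv_extChartAt_curve hγ htt] at h5
  rw [fderiv_transition_chartDiff htt ht, fderiv_transition_chartDiff htt ht, Function.comp_apply,
    (extChartAt (𝓡 n) (γ t)).left_inv htt] at h5
  rw [h5, sub_add_cancel, ← fderiv_transition_chartDiff htt ht (g.covDerivAlong γ V t),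
    covDerivAlong, chartDiff_self_inverse, deriv_extChartAt_curve hγ htt]
  rfl

end Curves

end SemiRiemannianMetric

end ChartGeometry

end


open scoped Manifold ContDiff

noncomputable section

/-! ### Coefficient matrices of a frame and their behaviour under change of frame -/

section Frames

set_option maxSynthPendingDepth 3

theorem ContDiffAt.deriv_smooth {F : Type*} [NormedAddCommGroup F] [NormedSpace ℝ F] {f : ℝ → F}
    {t : ℝ} (h : ContDiffAt ℝ ∞ f t) : ContDiffAt ℝ ∞ (deriv f) t := by
  have h1 : ContDiffAt ℝ ∞ (fderiv ℝ f) t := h.fderiv_right (by simp)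
  exact (h1.clm_apply (contDiffAt_const (c := (1 : ℝ)))).congr_of_eventuallyEq
    (Filter.Eventually.of_forall fun s => fderiv_apply_one_eq_deriv.symm)

/-- The expansion of a vector in an orthonormal basis of a symmetric bilinear form. -/
theorem eq_sum_smul_of_orthonormal {n : ℕ} {B : EuclideanSpace ℝ (Fin n) →L[ℝ]
    EuclideanSpace ℝ (Fin n) →L[ℝ] ℝ} {ε : Fin n → ℝ} (hε : ∀ i, ε i = 1 ∨ ε i = -1)
    {e : Fin n → EuclideanSpace ℝ (Fin n)} (he : ∀ i j, B (e i) (e j) = if i = j then ε i else 0)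
    (b : EuclideanSpace ℝ (Fin n)) : b = ∑ k, (ε k * B b (e k)) • e k := by
  have hε2 : ∀ i, ε i * ε i = 1 := fun i => by rcases hε i with h | h <;> rw [h] <;> norm_num
  have hB : ∀ (c : Fin n → ℝ) j, B (∑ k, c k • e k) (e j) = c j * ε j := fun c j => by
    simp [he]
  have hli : LinearIndependent ℝ e := by
    refine Fintype.linearIndependent_iff.2 fun c hc j => ?_
    have h1 := hB c j
    rw [hc, map_zero, zero_apply] at h1
    calc c j = c j * ε j * ε j := by rw [mul_assoc, hε2, mul_one]
      _ = 0 := by rw [← h1, zero_mul]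
  have hspan := hli.span_eq_top_of_card_eq_finrank' (by simp)
  obtain ⟨c, rfl⟩ := (Submodule.mem_span_range_iff_exists_fun ℝ).1
    (hspan ▸ Submodule.mem_top : b ∈ Submodule.span ℝ (Set.range e))
  refine Finset.sum_congr rfl fun k _ => ?_
  rw [hB, mul_comm (c k), ← mul_assoc, hε2, one_mul]

theorem IsMetricOn.curvature_smul_sum {E : Type*} [NormedAddCommGroup E] [NormedSpace ℝ E]
    [CompleteSpace E] [FiniteDimensional ℝ E] {G : E → E →L[ℝ] E →L[ℝ] ℝ} {U : Set E}
    (h : IsMetricOn G U) {y : E} (hy : y ∈ U) {ι : Type*} (s : Finset ι) (r : ℝ) (u : E) (a : ι → ℝ)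
    (v : ι → E) :
    metricCurvature G y (r • u) (∑ k ∈ s, a k • v k) (r • u)
      = ∑ k ∈ s, (r ^ 2 * a k) • metricCurvature G y u (v k) u := by
  simp only [h.curvature_eq hy, map_sum, map_smul, sum_apply, smul_apply, smul_add, smul_sub,
    Finset.sum_add_distrib, Finset.sum_sub_distrib, Finset.smul_sum, smul_smul]
  congr 1
  · congr 1
    · congr 1 <;> exact Finset.sum_congr rfl fun k _ => by congr 1; ring
    · exact Finset.sum_congr rfl fun k _ => by congr 1; ring
  · exact Finset.sum_congr rfl fun k _ => by congr 1; ring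

theorem IsMetricOn.christoffel_smul_sum {E : Type*} [NormedAddCommGroup E] [NormedSpace ℝ E]
    (G : E → E →L[ℝ] E →L[ℝ] ℝ) {y : E} {ι : Type*} (s : Finset ι) (r : ℝ) (u : E) (a : ι → ℝ)
    (v : ι → E) :
    metricChristoffel G y (r • u) (∑ k ∈ s, a k • v k)
      = ∑ k ∈ s, (r * a k) • metricChristoffel G y u (v k) := by
  simp only [← metricChristoffelL_apply, map_sum, map_smul, smul_apply, smul_smul, mul_comm r]

variable {n : ℕ} {M : Type*} [TopologicalSpace M] [ChartedSpace (EuclideanSpace ℝ (Fin n)) M]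
  [IsManifold (𝓡 n) ∞ M]

namespace SemiRiemannianMetric.PeriodicFrame

variable {g : SemiRiemannianMetric n M} {γ : ℝ → M} (T : g.PeriodicFrame γ)

/-- The coordinates of a frame vector in the chart around `p`. -/
def chartVec (p : M) (i : Fin n) (s : ℝ) : EuclideanSpace ℝ (Fin n) :=
  chartDiff p (γ s) (T.vec i s)

/-- The covariant derivative of a frame vector in the chart around `p`. -/
def chartCov (p : M) (j : Fin n) (t : ℝ) : EuclideanSpace ℝ (Fin n) :=
  deriv (T.chartVec p j) t + metricChristoffel (g.inChart p) (extChartAt (𝓡 n) p (γ t))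
    (deriv (fun s => extChartAt (𝓡 n) p (γ s)) t) (T.chartVec p j t)

theorem chartVec_add_one (p : M) (i : Fin n) (s : ℝ) :
    T.chartVec p i (s + 1) = T.chartVec p i s :=
  congrArg (fun X : TangentBundle (𝓡 n) M => chartDiff p X.proj X.snd) (T.periodic i s)

theorem sign_mul_sign (i : Fin n) : T.sign i * T.sign i = 1 := by
  rcases T.sign_eq i with h | h <;> rw [h] <;> norm_num

variable {T} {p : M} {t : ℝ}

theorem contDiffAt_chartVec (ht : γ t ∈ (extChartAt (𝓡 n) p).source) (i : Fin n) :
    ContDiffAt ℝ ∞ (T.chartVec p i) t := contDiffAt_chartDiff_field (T.contMDiff i) ht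

theorem inChart_chartVec (ht : γ t ∈ (extChartAt (𝓡 n) p).source) (i j : Fin n) :
    g.inChart p (extChartAt (𝓡 n) p (γ t)) (T.chartVec p i t) (T.chartVec p j t)
      = if i = j then T.sign i else 0 := by
  rw [chartVec, chartVec, g.inChart_chartDiff ht, T.orthonormal]

theorem coord_eq (ht : γ t ∈ (extChartAt (𝓡 n) p).source) (w : TangentSpace (𝓡 n) (γ t))
    (i : Fin n) :
    T.coord t w i = T.sign i * g.inChart p (extChartAt (𝓡 n) p (γ t)) (chartDiff p (γ t) w)
      (T.chartVec p i t) := by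
  rw [chartVec, g.inChart_chartDiff ht, coord]

theorem eq_sum_chartVec (ht : γ t ∈ (extChartAt (𝓡 n) p).source) (b : EuclideanSpace ℝ (Fin n)) :
    b = ∑ k, (T.sign k * g.inChart p (extChartAt (𝓡 n) p (γ t)) b (T.chartVec p k t)) •
      T.chartVec p k t :=
  eq_sum_smul_of_orthonormal T.sign_eq (inChart_chartVec ht) b

theorem christoffelMatrix_apply (hγ : ContMDiff 𝓘(ℝ, ℝ) (𝓡 n) ∞ γ)
    (ht : γ t ∈ (extChartAt (𝓡 n) p).source) (i j : Fin n) :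
    T.christoffelMatrix t i j = T.sign i * g.inChart p (extChartAt (𝓡 n) p (γ t))
      (T.chartCov p j t) (T.chartVec p i t) := by
  rw [christoffelMatrix, Matrix.of_apply, coord_eq ht, g.chartDiff_covDerivAlong (T.contMDiff j) ht,
    chartCov, deriv_extChartAt_curve hγ ht]
  rfl

theorem curvatureMatrix_apply (hγ : ContMDiff 𝓘(ℝ, ℝ) (𝓡 n) ∞ γ)
    (ht : γ t ∈ (extChartAt (𝓡 n) p).source) (i j : Fin n) :
    T.curvatureMatrix t i j = T.sign i * g.inChart p (extChartAt (𝓡 n) p (γ t))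
      (metricCurvature (g.inChart p) (extChartAt (𝓡 n) p (γ t))
        (deriv (fun s => extChartAt (𝓡 n) p (γ s)) t) (T.chartVec p j t)
        (deriv (fun s => extChartAt (𝓡 n) p (γ s)) t)) (T.chartVec p i t) := by
  rw [curvatureMatrix, Matrix.of_apply, coord_eq ht, g.chartDiff_curvature ht,
    deriv_extChartAt_curve hγ ht]
  rfl

/-- The sign in `coord` cancels the factor `diag(ε)`, leaving `g(R(γ', T_j)γ', T_i)`, which is
symmetric in `i` and `j`. -/
theorem isSymm_curvatureMatrix (T : g.PeriodicFrame γ) (t : ℝ) :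
    (Matrix.diagonal T.sign * T.curvatureMatrix t).IsSymm := by
  ext i j
  rw [Matrix.transpose_apply, Matrix.diagonal_mul, Matrix.diagonal_mul, curvatureMatrix,
    Matrix.of_apply, Matrix.of_apply, coord, coord, ← mul_assoc, ← mul_assoc, sign_mul_sign,
    sign_mul_sign, one_mul, one_mul, g.form_curvature_symm]

section Continuity

variable (hγ : ContMDiff 𝓘(ℝ, ℝ) (𝓡 n) ∞ γ)

include hγ

/-- Near `t` every entry is computed in the single chart around `γ t`, where metric, Christoffel
symbols, curve and frame are smooth. -/
theorem continuous_christoffelMatrix (T : g.PeriodicFrame γ) : Continuous T.christoffelMatrix := by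
  refine continuous_matrix fun i j => continuous_iff_continuousAt.2 fun t => ?_
  have ht : γ t ∈ (extChartAt (𝓡 n) (γ t)).source := mem_extChartAt_source _
  have hm := g.isMetricOn_inChart (γ t)
  have hc := contDiffAt_extChartAt_curve hγ ht
  have h1 : ContinuousAt (fun s => T.sign i * g.inChart (γ t) (extChartAt (𝓡 n) (γ t) (γ s))
      (deriv (T.chartVec (γ t) j) s + metricChristoffelL (g.inChart (γ t))
        (extChartAt (𝓡 n) (γ t) (γ s)) (deriv (fun s => extChartAt (𝓡 n) (γ t) (γ s)) s)
        (T.chartVec (γ t) j s)) (T.chartVec (γ t) i s)) t := by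
    have hy := (extChartAt (𝓡 n) (γ t)).map_source ht
    have hG := (hm.contDiffAt hy).continuousAt.comp (f := fun s => extChartAt (𝓡 n) (γ t) (γ s))
      hc.continuousAt
    have hL := (hm.contDiffAt_christoffelL hy).continuousAt.comp
      (f := fun s => extChartAt (𝓡 n) (γ t) (γ s)) hc.continuousAt
    have hv := fun i => (contDiffAt_chartVec (T := T) ht i)
    exact continuousAt_const.mul ((hG.clm_apply ((hv j).deriv_smooth.continuousAt.add
      ((hL.clm_apply hc.deriv_smooth.continuousAt).clm_apply (hv j).continuousAt))).clm_apply
      (hv i).continuousAt)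
  refine h1.congr ?_
  filter_upwards [eventually_mem_source hγ ht] with s hs
  exact (christoffelMatrix_apply hγ hs i j).symm

theorem continuous_curvatureMatrix (T : g.PeriodicFrame γ) : Continuous T.curvatureMatrix := by
  refine continuous_matrix fun i j => continuous_iff_continuousAt.2 fun t => ?_
  have ht : γ t ∈ (extChartAt (𝓡 n) (γ t)).source := mem_extChartAt_source _
  have hm := g.isMetricOn_inChart (γ t)
  have hc := contDiffAt_extChartAt_curve hγ ht
  have hy := (extChartAt (𝓡 n) (γ t)).map_source ht
  have hG := (hm.contDiffAt hy).continuousAt.comp (f := fun s => extChartAt (𝓡 n) (γ t) (γ s))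
    hc.continuousAt
  have hL := (hm.contDiffAt_christoffelL hy).continuousAt.comp
    (f := fun s => extChartAt (𝓡 n) (γ t) (γ s)) hc.continuousAt
  have hL' := ((hm.contDiffAt_christoffelL hy).fderiv_right (m := ∞) (by simp)).continuousAt.comp
    (f := fun s => extChartAt (𝓡 n) (γ t) (γ s)) hc.continuousAt
  have hv := fun i => (contDiffAt_chartVec (T := T) ht i).continuousAt
  have hc' := hc.deriv_smooth.continuousAt
  have h1 := (continuousAt_const (y := T.sign i)).mul ((hG.clm_apply
    ((((((hL'.clm_apply hc').clm_apply (hv j)).clm_apply hc').sub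
      (((hL'.clm_apply (hv j)).clm_apply hc').clm_apply hc')).add
      ((hL.clm_apply hc').clm_apply ((hL.clm_apply (hv j)).clm_apply hc'))).sub
      ((hL.clm_apply (hv j)).clm_apply ((hL.clm_apply hc').clm_apply hc')))).clm_apply (hv i))
  refine h1.congr ?_
  filter_upwards [eventually_mem_source hγ ht] with s hs
  rw [curvatureMatrix_apply hγ hs, hm.curvature_eq ((extChartAt (𝓡 n) (γ t)).map_source hs)]
  rfl

variable (hp : ∀ t, γ (t + 1) = γ t)

include hp

theorem christoffelMatrix_add_one (T : g.PeriodicFrame γ) (t : ℝ) :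
    T.christoffelMatrix (t + 1) = T.christoffelMatrix t := by
  ext i j
  have ht : γ t ∈ (extChartAt (𝓡 n) (γ t)).source := mem_extChartAt_source _
  have ht' : γ (t + 1) ∈ (extChartAt (𝓡 n) (γ t)).source := by rwa [hp]
  rw [christoffelMatrix_apply hγ ht', christoffelMatrix_apply hγ ht, chartCov, chartCov,
    ← deriv_comp_add_const, ← deriv_comp_add_const]
  simp only [hp, chartVec_add_one]

theorem curvatureMatrix_add_one (T : g.PeriodicFrame γ) (t : ℝ) :
    T.curvatureMatrix (t + 1) = T.curvatureMatrix t := by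
  ext i j
  have ht : γ t ∈ (extChartAt (𝓡 n) (γ t)).source := mem_extChartAt_source _
  have ht' : γ (t + 1) ∈ (extChartAt (𝓡 n) (γ t)).source := by rwa [hp]
  rw [curvatureMatrix_apply hγ ht', curvatureMatrix_apply hγ ht, ← deriv_comp_add_const]
  simp only [hp, chartVec_add_one]

end Continuity

section FrameChange

variable {N : ℕ}

/-- The matrix expressing a frame along an iterate of `γ` in a frame along `γ`. -/
def frameChange (T : g.PeriodicFrame γ) (T' : g.PeriodicFrame (iterateCurve γ N)) (t : ℝ) :
    Matrix (Fin n) (Fin n) ℝ :=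
  Matrix.of fun i j => T.coord (N * t) (T'.vec j t) i

variable {T' : g.PeriodicFrame (iterateCurve γ N)}

theorem frameChange_apply (ht : γ (N * t) ∈ (extChartAt (𝓡 n) p).source) (i j : Fin n) :
    T.frameChange T' t i j = T.sign i * g.inChart p (extChartAt (𝓡 n) p (γ (N * t)))
      (T'.chartVec p j t) (T.chartVec p i (N * t)) :=
  coord_eq (T := T) ht _ _

theorem chartVec_eq_sum (ht : γ (N * t) ∈ (extChartAt (𝓡 n) p).source) (j : Fin n) :
    T'.chartVec p j t = ∑ k, T.frameChange T' t k j • T.chartVec p k (N * t) := by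
  simp only [frameChange_apply ht]
  exact eq_sum_chartVec ht _

theorem frameChange_orth (T : g.PeriodicFrame γ) (T' : g.PeriodicFrame (iterateCurve γ N)) (t : ℝ) :
    (T.frameChange T' t).transpose * Matrix.diagonal T.sign * T.frameChange T' t
      = Matrix.diagonal T'.sign := by
  have ht : γ (N * t) ∈ (extChartAt (𝓡 n) (γ (N * t))).source := mem_extChartAt_source _
  have ht' : iterateCurve γ N t ∈ (extChartAt (𝓡 n) (γ (N * t))).source := ht
  ext i j
  rw [Matrix.mul_apply, Matrix.diagonal_apply, ← inChart_chartVec ht' i j,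
    chartVec_eq_sum (T := T) ht i]
  have h1 : extChartAt (𝓡 n) (γ (N * t)) (iterateCurve γ N t)
      = extChartAt (𝓡 n) (γ (N * t)) (γ (N * t)) := rfl
  simp only [map_sum, map_smul, sum_apply, smul_apply, smul_eq_mul, Matrix.mul_diagonal,
    Matrix.transpose_apply, h1]
  refine Finset.sum_congr rfl fun k _ => ?_
  rw [frameChange_apply (i := k) (j := j) ht,
    (g.isMetricOn_inChart _).symm _ ((extChartAt (𝓡 n) _).map_source ht)
      (T.chartVec (γ (N * t)) k (N * t)), mul_assoc, ← mul_assoc (T.sign k), sign_mul_sign, one_mul]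

section Smooth

variable (hγ : ContMDiff 𝓘(ℝ, ℝ) (𝓡 n) ∞ γ)

include hγ

theorem contDiff_frameChange (T : g.PeriodicFrame γ) (T' : g.PeriodicFrame (iterateCurve γ N))
    (i j : Fin n) : ContDiff ℝ ∞ fun s => T.frameChange T' s i j := by
  refine contDiff_iff_contDiffAt.2 fun t => ?_
  have ht : γ (N * t) ∈ (extChartAt (𝓡 n) (γ (N * t))).source := mem_extChartAt_source _
  have ht' : iterateCurve γ N t ∈ (extChartAt (𝓡 n) (γ (N * t))).source := ht
  have hm := g.isMetricOn_inChart (γ (N * t))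
  have hN : ContDiffAt ℝ ∞ (fun s : ℝ => N * s) t := contDiffAt_const.mul contDiffAt_id
  have hc := (contDiffAt_extChartAt_curve hγ ht).comp t hN
  have hG := (hm.contDiffAt ((extChartAt (𝓡 n) _).map_source ht)).comp t hc
  have h1 := contDiffAt_const (c := T.sign i) |>.mul ((hG.clm_apply
    (contDiffAt_chartVec (T := T') ht' j)).clm_apply
    ((contDiffAt_chartVec (T := T) ht i).comp t hN))
  refine h1.congr_of_eventuallyEq ?_
  have hev := (hN.continuousAt.eventually (eventually_mem_source hγ ht))
  filter_upwards [hev] with s hs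
  exact frameChange_apply hs i j

theorem deriv_iterate (ht : γ (N * t) ∈ (extChartAt (𝓡 n) p).source) :
    deriv (fun s => extChartAt (𝓡 n) p (iterateCurve γ N s)) t
      = (N : ℝ) • deriv (fun s => extChartAt (𝓡 n) p (γ s)) (N * t) := by
  have h1 : HasDerivAt (fun s : ℝ => N * s) (N : ℝ) t := by
    simpa using (hasDerivAt_id t).const_mul (N : ℝ)
  exact (((contDiffAt_extChartAt_curve hγ ht).differentiableAt (by simp)).hasDerivAt.scomp t
    h1).deriv

/-- The product rule for `T'_j(t) = ∑ₖ a_{kj}(t) T_k(N t)`, with a factor `N` from the speed of the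
iterate. -/
theorem chartCov_iterate (ht : γ (N * t) ∈ (extChartAt (𝓡 n) p).source) (j : Fin n) :
    T'.chartCov p j t = ∑ k, (deriv (fun s => T.frameChange T' s k j) t • T.chartVec p k (N * t)
      + (N * T.frameChange T' t k j) • T.chartCov p k (N * t)) := by
  have h1 : HasDerivAt (fun s : ℝ => N * s) (N : ℝ) t := by
    simpa using (hasDerivAt_id t).const_mul (N : ℝ)
  have h2 : ∀ k, HasDerivAt (fun s => T.frameChange T' s k j • T.chartVec p k (N * s))
      (T.frameChange T' t k j • (N : ℝ) • deriv (T.chartVec p k) (N * t)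
        + deriv (fun s => T.frameChange T' s k j) t • T.chartVec p k (N * t)) t :=
    fun k => ((contDiff_frameChange hγ T T' k j).contDiffAt.differentiableAt
      (by simp)).hasDerivAt.smul
        (((contDiffAt_chartVec (T := T) ht k).differentiableAt (by simp)).hasDerivAt.scomp t h1)
  have h3 := HasDerivAt.fun_sum fun k (_ : k ∈ Finset.univ) => h2 k
  have h4 : T'.chartVec p j =ᶠ[nhds t]
      fun s => ∑ k, T.frameChange T' s k j • T.chartVec p k (N * s) := by
    filter_upwards [h1.continuousAt.eventually (eventually_mem_source hγ ht)] with s hs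
    exact chartVec_eq_sum hs j
  rw [chartCov, (h3.congr_of_eventuallyEq h4).deriv, deriv_iterate hγ ht,
    chartVec_eq_sum (T := T) ht, IsMetricOn.christoffel_smul_sum, ← Finset.sum_add_distrib]
  refine Finset.sum_congr rfl fun k _ => ?_
  rw [chartCov, smul_add, smul_smul, mul_comm (T.frameChange T' t k j) (N : ℝ)]
  have h5 : extChartAt (𝓡 n) p (iterateCurve γ N t) = extChartAt (𝓡 n) p (γ (N * t)) := rfl
  rw [h5]
  abel

/-- The law `a Γ' = a' + N Γ(N t) a`: the covariant derivative of a vector of `T'` is expanded both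
in `T'` and, by the product rule, in `T`. It is the hypothesis on `Γ` in the gauge invariance of the
index. -/
theorem frameChange_mul_christoffelMatrix (T : g.PeriodicFrame γ)
    (T' : g.PeriodicFrame (iterateCurve γ N)) (hγ' : ContMDiff 𝓘(ℝ, ℝ) (𝓡 n) ∞ (iterateCurve γ N))
    (t : ℝ) :
    T.frameChange T' t * T'.christoffelMatrix t
      = (Matrix.of fun i j => deriv (fun s => T.frameChange T' s i j) t)
        + (N : ℝ) • T.christoffelMatrix (N * t) * T.frameChange T' t := by
  have ht : γ (N * t) ∈ (extChartAt (𝓡 n) (γ (N * t))).source := mem_extChartAt_source _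
  have ht' : iterateCurve γ N t ∈ (extChartAt (𝓡 n) (γ (N * t))).source := ht
  ext i j
  have h1 := congrArg (fun x => T.sign i * g.inChart (γ (N * t))
      (extChartAt (𝓡 n) (γ (N * t)) (γ (N * t))) x (T.chartVec (γ (N * t)) i (N * t)))
    ((eq_sum_chartVec (T := T') ht' (T'.chartCov (γ (N * t)) j t)).symm.trans
      (chartCov_iterate (T := T) hγ ht j))
  simp only [map_sum, map_add, map_smul, sum_apply, add_apply, smul_apply, smul_eq_mul,
    inChart_chartVec ht, Finset.mul_sum, Finset.sum_add_distrib, mul_add, mul_ite, mul_zero,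
    Finset.sum_ite_eq', Finset.mem_univ, if_true] at h1
  rw [Matrix.mul_apply, Matrix.add_apply, Matrix.of_apply, Matrix.mul_apply]
  refine Eq.trans (Finset.sum_congr rfl fun k _ => ?_) (h1.trans ?_)
  · rw [christoffelMatrix_apply hγ' ht', frameChange_apply ht]
    ring
  · refine congrArg₂ (· + ·) ?_ (Finset.sum_congr rfl fun k _ => ?_)
    · rw [mul_left_comm, sign_mul_sign, mul_one]
    · rw [Matrix.smul_apply, christoffelMatrix_apply hγ ht, smul_eq_mul]
      ring

/-- The factor `N²` arises because the velocity enters the curvature term twice and the iterate runs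
`N` times as fast. -/
theorem frameChange_mul_curvatureMatrix (T : g.PeriodicFrame γ)
    (T' : g.PeriodicFrame (iterateCurve γ N)) (hγ' : ContMDiff 𝓘(ℝ, ℝ) (𝓡 n) ∞ (iterateCurve γ N))
    (t : ℝ) :
    T.frameChange T' t * T'.curvatureMatrix t
      = (N : ℝ) ^ 2 • T.curvatureMatrix (N * t) * T.frameChange T' t := by
  have ht : γ (N * t) ∈ (extChartAt (𝓡 n) (γ (N * t))).source := mem_extChartAt_source _
  have ht' : iterateCurve γ N t ∈ (extChartAt (𝓡 n) (γ (N * t))).source := ht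
  ext i j
  set p := γ (N * t) with hp
  set y := extChartAt (𝓡 n) p p with hy
  set u := deriv (fun s => extChartAt (𝓡 n) p (γ s)) (N * t) with hu
  have h0 := (g.isMetricOn_inChart p).curvature_smul_sum ((extChartAt (𝓡 n) _).map_source ht)
    Finset.univ (N : ℝ) u (fun k => T.frameChange T' t k j) (fun k => T.chartVec p k (N * t))
  have h1 := congrArg (fun x => T.sign i * g.inChart p y x (T.chartVec p i (N * t)))
    ((eq_sum_chartVec (T := T') ht' (metricCurvature (g.inChart p) y ((N : ℝ) • u)
      (∑ k, T.frameChange T' t k j • T.chartVec p k (N * t)) ((N : ℝ) • u))).symm.trans h0)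
  simp only [map_sum, map_smul, sum_apply, smul_apply, smul_eq_mul, Finset.mul_sum] at h1
  rw [Matrix.mul_apply, Matrix.mul_apply]
  refine Eq.trans (Finset.sum_congr rfl fun k _ => ?_)
    (h1.trans (Finset.sum_congr rfl fun k _ => ?_))
  · rw [curvatureMatrix_apply hγ' ht', frameChange_apply ht, deriv_iterate hγ ht,
      ← chartVec_eq_sum ht]
    exact (fun a b c d => by ring : ∀ a b c d : ℝ, a * b * (c * d) = a * (c * d * b)) _ _ _ _
  · rw [Matrix.smul_apply, curvatureMatrix_apply hγ ht, smul_eq_mul]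
    ring

end Smooth

/-- Over the unit interval the frame `T'` runs through one period and `T` through `N` periods. -/
theorem frameChange_loop (hp : ∀ t, γ (t + 1) = γ t) (T : g.PeriodicFrame γ)
    (T' : g.PeriodicFrame (iterateCurve γ N)) : T.frameChange T' 1 = T.frameChange T' 0 := by
  ext i j
  have h0 : γ (N * 0) ∈ (extChartAt (𝓡 n) (γ (N * 0))).source := mem_extChartAt_source _
  have h2 : (N : ℝ) * 1 = N * 0 + N * 1 := by ring
  have h3 : γ (N * 1) = γ (N * 0) := by
    rw [h2]
    exact Function.Periodic.nat_mul hp N _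
  have h4 : T.chartVec (γ (N * 0)) i (N * 1) = T.chartVec (γ (N * 0)) i (N * 0) := by
    rw [h2]
    exact Function.Periodic.nat_mul (T.chartVec_add_one (γ (N * 0)) i) N _
  have h5 := T'.chartVec_add_one (γ (N * 0)) j 0
  rw [zero_add] at h5
  have h1 : γ (N * 1) ∈ (extChartAt (𝓡 n) (γ (N * 0))).source := by rwa [h3]
  rw [frameChange_apply h1, frameChange_apply h0, h3, h4, h5]

end FrameChange

end SemiRiemannianMetric.PeriodicFrame

end Frames

end


open scoped Manifold ContDiff

noncomputable section

/-! ### The iteration formula for closed geodesics -/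

namespace SemiRiemannianMetric.PeriodicFrame

variable {n : ℕ} {M : Type*} [TopologicalSpace M] [ChartedSpace (EuclideanSpace ℝ (Fin n)) M]
  [IsManifold (𝓡 n) ∞ M] {g : SemiRiemannianMetric n M} {γ : ℝ → M}

/-- The Christoffel matrix of a frame as a continuous map. -/
def christoffelMap (hγ : ContMDiff 𝓘(ℝ, ℝ) (𝓡 n) ∞ γ) (T : g.PeriodicFrame γ) :
    C(ℝ, Matrix (Fin n) (Fin n) ℝ) := ⟨T.christoffelMatrix, continuous_christoffelMatrix hγ T⟩

/-- The curvature matrix of a frame as a continuous map. -/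
def curvatureMap (hγ : ContMDiff 𝓘(ℝ, ℝ) (𝓡 n) ∞ γ) (T : g.PeriodicFrame γ) :
    C(ℝ, Matrix (Fin n) (Fin n) ℝ) := ⟨T.curvatureMatrix, continuous_curvatureMatrix hγ T⟩

theorem hasSpectralFlow_indexForm {𝕜 : Type*} [RCLike 𝕜] (hγ : ContMDiff 𝓘(ℝ, ℝ) (𝓡 n) ∞ γ)
    (T : g.PeriodicFrame γ) (z : 𝕜) :
    (∃! m, HasSpectralFlow (T.indexForm z) m) ∧ spectralFlow (T.indexForm z)
      = loopIndex z T.sign (christoffelMap hγ T) (curvatureMap hγ T)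
        - loopIndex z T.sign 0 0 :=
  hasSpectralFlow_pathForm z T.sign_eq (isSymm_curvatureMatrix T) fun _ _ _ => rfl

variable {N : ℕ} {T : g.PeriodicFrame γ} {T' : g.PeriodicFrame (iterateCurve γ N)}

omit [IsManifold (𝓡 n) ∞ M] in
theorem contMDiff_iterateCurve (hγ : ContMDiff 𝓘(ℝ, ℝ) (𝓡 n) ∞ γ) (N : ℕ) :
    ContMDiff 𝓘(ℝ, ℝ) (𝓡 n) ∞ (iterateCurve γ N) :=
  hγ.comp (contDiff_const.mul contDiff_id).contMDiff

/-- The matrices expressing `T'` in `T` form a gauge loop from the data of `T'` to the `N`-fold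
rescaled data of `T`. No relation between the two frames is required. -/
theorem loopIndex_iterate (hγ : ContMDiff 𝓘(ℝ, ℝ) (𝓡 n) ∞ γ) (hp : ∀ t, γ (t + 1) = γ t)
    (T : g.PeriodicFrame γ) (T' : g.PeriodicFrame (iterateCurve γ N)) :
    loopIndex (1 : ℂ) T.sign (rescale N N (christoffelMap hγ T))
        (rescale ((N : ℝ) ^ 2) N (curvatureMap hγ T))
      = loopIndex (1 : ℂ) T'.sign (christoffelMap (contMDiff_iterateCurve hγ N) T')
          (curvatureMap (contMDiff_iterateCurve hγ N) T') := by
  have hd := contDiff_frameChange hγ T T'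
  have ha : Continuous (T.frameChange T') := continuous_matrix fun i j => (hd i j).continuous
  have ha' : Continuous fun r => (Matrix.of fun i j => deriv (fun s => T.frameChange T' s i j) r :
      Matrix (Fin n) (Fin n) ℝ) :=
    continuous_matrix fun i j => (hd i j).continuous_deriv (by simp)
  have hg : IsGaugeLoop T.sign T'.sign ⟨T.frameChange T', ha⟩ ⟨_, ha'⟩ :=
    { hasDerivAt := fun r i j => ((hd i j).differentiable (by simp) r).hasDerivAt
      loop := frameChange_loop hp T T'
      orth := frameChange_orth T T' }
  refine hg.loopIndex_eq T.sign_eq T'.sign_eq 1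
    (frameChange_mul_christoffelMatrix hγ T T' (contMDiff_iterateCurve hγ N))
    (frameChange_mul_curvatureMatrix hγ T T' (contMDiff_iterateCurve hγ N)) (fun r => ?_)
    (isSymm_curvatureMatrix T')
  have h1 := (isSymm_curvatureMatrix T (N * r)).smul ((N : ℝ) ^ 2)
  rwa [← Matrix.mul_smul] at h1

/-- At `t = 0` only the signs of the frames remain, possibly in different order. The constant loop
equal to the change of frame at time `0` matches them and keeps the zero data. -/
theorem loopIndex_zero_iterate (T : g.PeriodicFrame γ) (T' : g.PeriodicFrame (iterateCurve γ N)) :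
    loopIndex (1 : ℂ) T.sign 0 0 = loopIndex (1 : ℂ) T'.sign 0 0 := by
  have hg : IsGaugeLoop T.sign T'.sign (ContinuousMap.const ℝ (T.frameChange T' 0)) 0 :=
    { hasDerivAt := fun r i j => hasDerivAt_const r _
      loop := rfl
      orth := fun r => frameChange_orth T T' 0 }
  exact hg.loopIndex_eq T.sign_eq T'.sign_eq 1 (fun r => by simp) (fun r => by simp)
    (isSymm_diagonal_mul_zero _) (isSymm_diagonal_mul_zero _)

end SemiRiemannianMetric.PeriodicFrame

end

open SemiRiemannianMetric PeriodicFrame in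
theorem theorem5p3 {n : ℕ} {M : Type*} [TopologicalSpace M]
    [ChartedSpace (EuclideanSpace ℝ (Fin n)) M] [IsManifold (𝓡 n) ∞ M]
    (g : SemiRiemannianMetric n M) (γ : ℝ → M) (hγ : g.IsClosedGeodesic γ)
    (T : g.PeriodicFrame γ) (N : ℕ) (hN : 1 ≤ N)
    (T' : g.PeriodicFrame (iterateCurve γ N)) :
    (∃! m : ℤ, HasSpectralFlow (T'.indexForm (1 : ℝ)) m) ∧
    (∀ z : Circle, ∃! m : ℤ, HasSpectralFlow (T.indexForm (z : ℂ)) m) ∧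
    T'.geodesicSpectralFlow =
      ∑ k ∈ Finset.range N, T.spectralFlowFunction (Circle.exp (2 * Real.pi / N) ^ k) := by
  have hs := contMDiff_iterateCurve hγ.contMDiff N
  refine ⟨(hasSpectralFlow_indexForm hs T' 1).1,
    fun z => (hasSpectralFlow_indexForm hγ.contMDiff T (z : ℂ)).1, ?_⟩
  have hζ := Complex.isPrimitiveRoot_exp N (by lia)
  have hz : ((Circle.exp (2 * Real.pi / N) : Circle) : ℂ)
      = Complex.exp (2 * Real.pi * Complex.I / N) := by
    rw [Circle.coe_exp]
    push_cast
    ring_nf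
  -- The iteration formula for the initial point of the path, where all coefficients vanish.
  have h0 := loopIndex_rescale hN hζ T.sign_eq (Γ := 0) (R := 0) (fun _ => rfl) (fun _ => rfl)
    (isSymm_diagonal_mul_zero _)
  have hr : ∀ c t : ℝ, rescale c t (0 : C(ℝ, Matrix (Fin n) (Fin n) ℝ)) = 0 := fun c t => by
    ext1 r
    rw [rescale_apply]
    exact smul_zero c
  rw [hr, hr] at h0
  -- Both endpoint indices pass from real to complex maps and from the frame `T'` to `T`, and then
  -- decompose over the roots of unity. Subtracting term by term leaves the spectral flows on the
  -- twisted spaces.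
  rw [geodesicSpectralFlow, (hasSpectralFlow_indexForm hs T' 1).2,
    ← loopIndex_complexify T'.sign_eq (isSymm_curvatureMatrix T'),
    ← loopIndex_complexify T'.sign_eq (isSymm_diagonal_mul_zero _),
    ← loopIndex_iterate hγ.contMDiff hγ.periodic T T', ← loopIndex_zero_iterate T T', h0,
    loopIndex_rescale hN hζ T.sign_eq (christoffelMatrix_add_one hγ.contMDiff hγ.periodic T)
      (curvatureMatrix_add_one hγ.contMDiff hγ.periodic T) (isSymm_curvatureMatrix T),
    ← Finset.sum_sub_distrib]
  refine Finset.sum_congr rfl fun k _ => ?_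
  rw [spectralFlowFunction, (hasSpectralFlow_indexForm hγ.contMDiff T _).2, Circle.coe_pow, hz]
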